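/- Let $d\in\mathbb N$, $T>0$, let $U\subset\mathbb R^d$ be compact and convex, and let $\mu_0$ be a compactly supported probability measure on $\mathbb R^d$. Let $\mathscr P_2(\mathbb R^d)$ be the set of probability measures with finite second moment $M_2(\mu)=\int|x|^2\mu(dx)$, with the Wasserstein distance $W_2$. Assume: * $b:[0,T]\times\mathbb R^d\times\mathscr P_2(\mathbb R^d)\to\mathbb R^d$ is measurable in $t$ and, for some constants $M,L$, $|b(t,x,\mu)|\le M\bigl(1+|x|+\int|y|\,\mu(dy)\bigr)$ and $|b(t,x,\mu)-b(t,y,\nu)|\le L\bigl(|x-y|+W_2(\mu,\nu)\bigr)$; * $f:[0,T]\times\mathbb R^d\times\mathscr P_2(\mathbb R^d)\to\mathbb R$ is measurable in $t$ with $f(\cdot,0,\delta_0)\in L^1(0,T)$, $g:\mathbb R^d\times\mathscr P_2(\mathbb R^d)\to\mathbb R$, and for $h=f(t,\cdot,\cdot)$, $t\in[0,T]$, and $h=g$, with a constant $M$ independent of $t$, $$|h(x,\mu)-h(x',\mu')|\le M\bigl[1+|x|+|x'|+M_2(\mu)+M_2(\mu')\bigr]\bigl(|x-x'|+W_2(\mu,\mu')\bigr);$$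 * $\psi$ is $C^1$ on $U$ and $\lambda$-convex for some $\lambda>0$: $\psi(\alpha')\ge\psi(\alpha)+\nabla\psi(\alpha)\cdot(\alpha'-\alpha)+\lambda|\alpha'-\alpha|^2$ for all $\alpha,\alpha'\in U$. For $\varepsilon\ge0$ and a control, i.e. a Borel map $u:[0,T]\times\mathbb R^d\to U$, a trajectory is a weak solution $\mu\in C([0,T];(\mathscr P_2(\mathbb R^d),W_2))$ of $$\partial_t\mu_t+\operatorname{div}\bigl[(b(t,x,\mu_t)+u(t,x))\mu_t\bigr]=\varepsilon\Delta\mu_t,\qquad \mu|_{t=0}=\mu_0, \qquad (E_{\varepsilon,u})$$ and its cost is $$J(\mu,u)=\int_0^T\!\!\int_{\mathbb R^d}\bigl(f(t,x,\mu_t)+\psi(u(t,x))\bigr)\mu_t(dx)\,dt+\int_{\mathbb R^d} g(x,\mu_T)\,\mu_T(dx).$$ For $\varepsilon>0$, problem $(\mathcal P_\varepsilon)$ is to minimize $J(\mu,u)$ over all controls $u$ and all solutions $\mu$ of $(E_{\varepsilon,u})$. For $\varepsilon\to0^+$ (the whole family or a sequence) let $(\mu^\varepsilon,u^\varepsilon)$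 be optimal pairs of $(\mathcal P_\varepsilon)$ with $u^\varepsilon\in L^\infty((0,T);\mathrm{Lip}(\mathbb R^d,U))$, let $u\in L^\infty((0,T);\mathrm{Lip}(\mathbb R^d,U))$ be such that $u^\varepsilon\rightharpoonup u$ weakly in $L^2((0,T);W^{1,p}_{\rm loc}(\mathbb R^d))$ for every $1<p<\infty$, and let $\mu$ be a solution of $(E_{0,u})$. Then: 1. For every control $w$ that is continuous in $x$ for a.e. $t$, $\displaystyle\lim_{\varepsilon\to0}J(\mu^\varepsilon,w)=J(\mu,w)$. 2. For every control $w\in L^\infty((0,T);\mathrm{Lip}(\mathbb R^d,U))$, if $\mu^{w,\varepsilon}$ solves $(E_{\varepsilon,w})$ and $\mu^w$ solves $(E_{0,w})$, then $\displaystyle\lim_{\varepsilon\to0}J(\mu^{w,\varepsilon},w)=J(\mu^w,w)$. 3. $\displaystyle J(\mu,u)\le\liminf_{\varepsilon\to0}J(\mu^\varepsilon,u^\varepsilon)$. -/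

import Mathlib

open MeasureTheory Filter Topology Set
open scoped ENNReal NNReal ContDiff InnerProductSpace

noncomputable section

namespace VanishingViscosity

/-- The space `ℝ^d` with its Euclidean norm. -/
abbrev E (d : ℕ) := EuclideanSpace ℝ (Fin d)

/-- Borel probability measures on `ℝ^d` with finite second moment. -/
structure P2 (d : ℕ) where
  /-- the underlying measure -/
  toMeasure : Measure (E d)
  isProb : IsProbabilityMeasure toMeasure
  integrable_sq : Integrable (fun x => ‖x‖ ^ 2) toMeasure

/-- The first moment `∫ |x| dμ`. -/
def P2.M1 {d : ℕ} (μ : P2 d) : ℝ := ∫ x, ‖x‖ ∂μ.toMeasure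

/-- The second moment `M₂(μ) = ∫ |x|² dμ`. -/
def P2.M2 {d : ℕ} (μ : P2 d) : ℝ := ∫ x, ‖x‖ ^ 2 ∂μ.toMeasure

/-- The Dirac mass at the origin. -/
def P2.diracZero (d : ℕ) : P2 d where
  toMeasure := Measure.dirac 0
  isProb := Measure.dirac.isProbabilityMeasure
  integrable_sq := integrable_dirac (by simp)

/-- Transport plans between `μ` and `ν`. -/
def Plans {d : ℕ} (μ ν : P2 d) : Set (Measure (E d × E d)) :=
  {γ | γ.map Prod.fst = μ.toMeasure ∧ γ.map Prod.snd = ν.toMeasure}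

/-- The quadratic Wasserstein distance
`W₂(μ, ν) = (inf_γ ∫ |x - y|² dγ)^{1/2}`; the infimum is finite on `P2`. -/
def W2 {d : ℕ} (μ ν : P2 d) : ℝ :=
  Real.sqrt (⨅ γ ∈ Plans μ ν, ∫⁻ z, ‖z.1 - z.2‖ₑ ^ 2 ∂γ).toReal

/-- `μ ∈ C([0,T]; P₂(ℝ^d))`, where `P₂(ℝ^d)` carries the distance `W₂`. -/
def IsW2Continuous {d : ℕ} (T : ℝ) (μ : ℝ → P2 d) : Prop :=
  ∀ t ∈ Icc 0 T, Tendsto (fun s => W2 (μ s) (μ t)) (𝓝[Icc 0 T] t) (𝓝 0)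

/-- Test functions `φ ∈ C_c^∞([0,T) × ℝ^d)`: restrictions of smooth functions with compact
support in `(-∞,T) × ℝ^d`. -/
def IsTestFunction {d : ℕ} (T : ℝ) (φ : ℝ → E d → ℝ) : Prop :=
  ContDiff ℝ ∞ (fun z : ℝ × E d => φ z.1 z.2) ∧
  HasCompactSupport (fun z : ℝ × E d => φ z.1 z.2) ∧
  tsupport (fun z : ℝ × E d => φ z.1 z.2) ⊆ Iio T ×ˢ univ

/-- `μ ∈ C([0,T]; P₂)` is a weak solution of
`∂_t μ_t + div[(b(t,x,μ_t) + u(t,x)) μ_t] = ε Δ μ_t`, `μ|_{t=0} = μ₀`.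
For `ε = 0` this is the continuity equation. -/
def IsWeakSolution {d : ℕ} (T : ℝ) (b : ℝ → E d → P2 d → E d) (μ₀ : P2 d)
    (ε : ℝ) (u : ℝ → E d → E d) (μ : ℝ → P2 d) : Prop :=
  IsW2Continuous T μ ∧
  ∀ φ : ℝ → E d → ℝ, IsTestFunction T φ →
    ∫ t in (0 : ℝ)..T, ∫ x,
      (deriv (fun s => φ s x) t + ⟪b t x (μ t) + u t x, gradient (φ t) x⟫_ℝ
        + ε * Laplacian.laplacian (φ t) x) ∂(μ t).toMeasure
      = - ∫ x, φ 0 x ∂μ₀.toMeasure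

/-- The cost
`J(μ,u) = ∫₀ᵀ ∫ (f(t,x,μ_t) + ψ(u(t,x))) μ_t(dx) dt + ∫ g(x,μ_T) μ_T(dx)`. -/
def J {d : ℕ} (T : ℝ) (f : ℝ → E d → P2 d → ℝ) (g : E d → P2 d → ℝ) (ψ : E d → ℝ)
    (μ : ℝ → P2 d) (u : ℝ → E d → E d) : ℝ :=
  (∫ t in (0 : ℝ)..T, ∫ x, (f t x (μ t) + ψ (u t x)) ∂(μ t).toMeasure)
    + ∫ x, g x (μ T) ∂(μ T).toMeasure

/-- Admissible controls: measurable maps with values in `U`. Since `U` is compact, they belong to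
`L^∞((0,T); L¹(ℝ^d, U; dμ_t))` for every curve `μ` of probability measures, and every element of
that space has such a representative. -/
def IsControl {d : ℕ} (T : ℝ) (U : Set (E d)) (u : ℝ → E d → E d) : Prop :=
  Measurable (fun z : ℝ × E d => u z.1 z.2) ∧ ∀ t ∈ Icc 0 T, ∀ x, u t x ∈ U

/-- Controls in `L^∞((0,T); Lip(ℝ^d, U))`. -/
def IsLipControl {d : ℕ} (T : ℝ) (U : Set (E d)) (u : ℝ → E d → E d) : Prop :=
  IsControl T U u ∧ ∃ C : ℝ≥0, ∀ᵐ t ∂volume.restrict (Icc 0 T), LipschitzWith C (u t)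

/-- `(μ,u)` is an optimal pair: `u` is admissible, `μ` is a trajectory of the equation with
viscosity `ε` and control `u`, and the cost is minimal among all such pairs. -/
def IsOptimalPair {d : ℕ} (T : ℝ) (U : Set (E d)) (b : ℝ → E d → P2 d → E d)
    (f : ℝ → E d → P2 d → ℝ) (g : E d → P2 d → ℝ) (ψ : E d → ℝ) (μ₀ : P2 d)
    (ε : ℝ) (μ : ℝ → P2 d) (u : ℝ → E d → E d) : Prop :=
  IsControl T U u ∧ IsWeakSolution T b μ₀ ε u μ ∧
  ∀ (ν : ℝ → P2 d) (w : ℝ → E d → E d), IsControl T U w → IsWeakSolution T b μ₀ ε w ν →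
    J T f g ψ μ u ≤ J T f g ψ ν w

/-- Assumptions on the velocity field: measurable in time, of linear growth, and Lipschitz
(hence continuous) in `(x,μ)` for `|·| × W₂`. -/
structure AssumptionB {d : ℕ} (T : ℝ) (b : ℝ → E d → P2 d → E d) : Prop where
  measurable : ∀ x μ, AEStronglyMeasurable (fun t => b t x μ) (volume.restrict (Icc 0 T))
  growth : ∃ M : ℝ, ∀ t ∈ Icc 0 T, ∀ x μ, ‖b t x μ‖ ≤ M * (1 + ‖x‖ + μ.M1)
  lipschitz : ∃ L : ℝ, ∀ t ∈ Icc 0 T, ∀ x y μ ν,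
    ‖b t x μ - b t y ν‖ ≤ L * (‖x - y‖ + W2 μ ν)

/-- Assumptions on the running cost `f` and the final cost `g`. -/
structure AssumptionFG {d : ℕ} (T : ℝ) (f : ℝ → E d → P2 d → ℝ) (g : E d → P2 d → ℝ) :
    Prop where
  measurable : ∀ x μ, AEStronglyMeasurable (fun t => f t x μ) (volume.restrict (Icc 0 T))
  integrable : IntegrableOn (fun t => f t 0 (P2.diracZero d)) (Icc 0 T)
  locLipschitz : ∃ M : ℝ,
    (∀ t ∈ Icc 0 T, ∀ x x' μ μ', |f t x μ - f t x' μ'|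
      ≤ M * (1 + ‖x‖ + ‖x'‖ + μ.M2 + μ'.M2) * (‖x - x'‖ + W2 μ μ')) ∧
    (∀ x x' μ μ', |g x μ - g x' μ'|
      ≤ M * (1 + ‖x‖ + ‖x'‖ + μ.M2 + μ'.M2) * (‖x - x'‖ + W2 μ μ'))

/-- The control cost is `C¹` on `U`, with gradient `ψ'` relative to `U`, and `lam`-convex on `U`. -/
def AssumptionPsi {d : ℕ} (U : Set (E d)) (ψ : E d → ℝ) (lam : ℝ) : Prop :=
  ∃ ψ' : E d → E d, ContinuousOn ψ' U ∧ (∀ α ∈ U, HasGradientWithinAt ψ (ψ' α) U α) ∧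
    ∀ α ∈ U, ∀ α' ∈ U, ψ α + ⟪ψ' α, α' - α⟫_ℝ + lam * ‖α' - α‖ ^ 2 ≤ ψ α'

/-- Measurable fields on `(0,T) × B_r` in `L²((0,T); L^q(B_r; ℝ^d))`. -/
def IsDualField {d : ℕ} (T r q : ℝ) (φ : ℝ → E d → E d) : Prop :=
  Measurable (fun z : ℝ × E d => φ z.1 z.2) ∧
  ∫⁻ t in Icc 0 T, (∫⁻ x in Metric.ball 0 r, ‖φ t x‖ₑ ^ q) ^ (2 / q) < ⊤

/-- Weak convergence `u^ε ⇀ u` in `L²((0,T); W^{1,p}_loc(ℝ^d; ℝ^d))` along the filter `l`, for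
controls that are Lipschitz in space: on every ball, the maps and all their directional derivatives
(which exist almost everywhere and are the weak derivatives) converge weakly in `L²((0,T); L^p)`,
that is, when tested against `L²((0,T); L^q)`, `1/p + 1/q = 1`. By the Riesz and Hahn-Banach
theorems these tests exhaust the dual of `L²((0,T); W^{1,p}(B_r))`. -/
def WeaklyConverges {d : ℕ} (T p : ℝ) (l : Filter ℝ) (uε : ℝ → ℝ → E d → E d)
    (u : ℝ → E d → E d) : Prop :=
  ∀ r > 0, ∀ q : ℝ, p.HolderConjugate q → ∀ φ : ℝ → E d → E d, IsDualField T r q φ →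
    Tendsto (fun ε => ∫ t in (0 : ℝ)..T, ∫ x in Metric.ball 0 r, ⟪φ t x, uε ε t x⟫_ℝ) l
      (𝓝 (∫ t in (0 : ℝ)..T, ∫ x in Metric.ball 0 r, ⟪φ t x, u t x⟫_ℝ)) ∧
    ∀ v : E d,
      Tendsto (fun ε => ∫ t in (0 : ℝ)..T, ∫ x in Metric.ball 0 r,
          ⟪φ t x, fderiv ℝ (uε ε t) x v⟫_ℝ) l
        (𝓝 (∫ t in (0 : ℝ)..T, ∫ x in Metric.ball 0 r, ⟪φ t x, fderiv ℝ (u t) x v⟫_ℝ))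

end VanishingViscosity

end

open VanishingViscosity

/-! Everything rests on one fact: viscous trajectories whose Lipschitz controls converge weakly to a
Lipschitz control `u` converge in `W2`, at every time, to the solution of the inviscid equation
driven by `u`. It is proved along a subsequence of an arbitrary sequence of viscosities, which
suffices because the limit is unique.

Compactness. Freezing the law inside `b` makes a trajectory a solution of a linear equation with a
Borel velocity of linear growth. Grönwall bounds second moments and then, after truncation, fourth
moments, uniformly for `|ε| ≤ 1` (`exists_uniform_moment`), and characteristic functions are
Lipschitz in time uniformly in `ε`. A diagonal extraction gives narrow limits at all times, and the
fourth moments upgrade them to `W2` limits (`tendsto_W2_of_tendsto_prob`,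
`exists_subseq_tendsto_W2`).

Identification. The delicate term is the integral of `⟪Θ, u^ε⟫` against `μ^ε`: a weakly convergent
factor meets moving laws that may have no density, and the Lipschitz constants of `u^ε` need not be
bounded in `ε`. Weak convergence of the gradients and Banach–Steinhaus bound their pairings with the
unit ball of `L^∞((0,T); L^q)`, where `q = (d+2)/(d+1)` is conjugate to `p = d+2 > d`
(`exists_pairing_bound`). A Lipschitz field is, up to a constant, its gradient convolved with
`y/|y|^d` truncated near the origin, minus its convolution with a continuous kernel carried by an
annulus. Convolving the truncated kernel with a probability measure keeps its `L^q` norm, which is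
small with the truncation radius, so the gradient part is uniformly negligible. The annulus kernel
convolved with `μ^ε` converges strongly and can be paired with a weakly convergent control. So `u^ε`
may be replaced by `u` (`tendsto_integral_inner_sub`), and the limit solves the inviscid equation
(`isWeakSolution_of_tendsto`).

Uniqueness. A mollified Euler scheme pushes `μ₀` close to any solution of the inviscid linear
equation. Running the schemes of two velocity fields from the same starting points couples their
solutions, which bounds `W2` by the time integral of the distance between the fields
(`W2_le_integral`). Since `b` is Lipschitz in the measure, Grönwall closes the argument
(`IsWeakSolution.unique`).

Conclusion. For a fixed control continuous in space the cost is continuous along this convergence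
(`tendsto_J`), which gives the first two claims, the second with a constant sequence of controls.
For the third, convexity bounds the cost of `u^ε` below by that of `u` plus a term linear in `u^ε -
u` (`J_add_le`), and this term vanishes by the replacement principle with `Θ = ∇ψ(u)`. -/

namespace VanishingViscosity

-- Moments, transport plans and the Wasserstein distance

attribute [instance] P2.isProb

variable {d : ℕ}

theorem P2.ext_measure {μ ν : P2 d} (h : μ.toMeasure = ν.toMeasure) : μ = ν := by
  cases μ; cases ν; simp_all

/-- An element of `P2` as a bundled probability measure. -/
def P2.prob (μ : P2 d) : ProbabilityMeasure (E d) := ⟨μ.toMeasure, μ.isProb⟩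

@[simp] theorem P2.coe_prob (μ : P2 d) : (μ.prob : Measure (E d)) = μ.toMeasure := rfl

theorem P2.M2_nonneg (μ : P2 d) : 0 ≤ μ.M2 := integral_nonneg fun _ => by positivity

theorem P2.M1_nonneg (μ : P2 d) : 0 ≤ μ.M1 := integral_nonneg fun _ => by positivity

theorem P2.integrable_norm (μ : P2 d) : Integrable (fun x => ‖x‖) μ.toMeasure := by
  refine ((integrable_const (1 : ℝ)).add μ.integrable_sq).mono' (by fun_prop) ?_
  refine .of_forall fun x => ?_
  simp only [norm_norm, Pi.add_apply]
  nlinarith [sq_nonneg (‖x‖ - 1), norm_nonneg x]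

theorem P2.M1_le (μ : P2 d) : μ.M1 ≤ 1 + μ.M2 := by
  have h : ∫ x, ‖x‖ ∂μ.toMeasure ≤ ∫ x, (1 + ‖x‖ ^ 2) ∂μ.toMeasure := by
    refine integral_mono μ.integrable_norm ((integrable_const (1 : ℝ)).add μ.integrable_sq) ?_
    intro x
    simp only
    nlinarith [sq_nonneg (‖x‖ - 1), norm_nonneg x]
  rw [integral_add (integrable_const _) μ.integrable_sq] at h
  simpa [P2.M1, P2.M2] using h

theorem P2.integrable_of_growth (μ : P2 d) {F : Type*} [NormedAddCommGroup F] {φ : E d → F} {C : ℝ}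
    (hm : AEStronglyMeasurable φ μ.toMeasure) (h : ∀ x, ‖φ x‖ ≤ C * (1 + ‖x‖ ^ 2)) :
    Integrable φ μ.toMeasure :=
  (((integrable_const (1 : ℝ)).add μ.integrable_sq).const_mul C).mono' hm (.of_forall h)

theorem P2.norm_integral_le_of_growth (μ : P2 d) {F : Type*} [NormedAddCommGroup F]
    [NormedSpace ℝ F] {φ : E d → F} {C : ℝ}
    (h : ∀ x, ‖φ x‖ ≤ C * (1 + ‖x‖ ^ 2)) : ‖∫ x, φ x ∂μ.toMeasure‖ ≤ C * (1 + μ.M2) := by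
  refine (norm_integral_le_of_norm_le (((integrable_const (1 : ℝ)).add μ.integrable_sq).const_mul C)
    (.of_forall h)).trans_eq ?_
  rw [integral_const_mul, Pi.add_def, integral_add (integrable_const _) μ.integrable_sq]
  simp [P2.M2]

theorem W2_nonneg (μ ν : P2 d) : 0 ≤ W2 μ ν := Real.sqrt_nonneg _

theorem isProbabilityMeasure_of_mem_plans {μ ν : P2 d} {γ : Measure (E d × E d)}
    (h : γ ∈ Plans μ ν) : IsProbabilityMeasure γ := by
  constructor
  have := congrArg (fun m => m univ) h.1
  simpa [Measure.map_apply measurable_fst MeasurableSet.univ] using this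

theorem prod_mem_plans (μ ν : P2 d) : μ.toMeasure.prod ν.toMeasure ∈ Plans μ ν := by
  constructor
  · simp
  · simp

theorem integrable_fst_of_mem_plans {μ ν : P2 d} {γ : Measure (E d × E d)} (h : γ ∈ Plans μ ν)
    {F : Type*} [NormedAddCommGroup F] {φ : E d → F} (hφ : Integrable φ μ.toMeasure) :
    Integrable (fun z => φ z.1) γ := by
  rw [← h.1] at hφ
  exact hφ.comp_measurable measurable_fst

theorem integrable_snd_of_mem_plans {μ ν : P2 d} {γ : Measure (E d × E d)} (h : γ ∈ Plans μ ν)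
    {F : Type*} [NormedAddCommGroup F] {φ : E d → F} (hφ : Integrable φ ν.toMeasure) :
    Integrable (fun z => φ z.2) γ := by
  rw [← h.2] at hφ
  exact hφ.comp_measurable measurable_snd

theorem integral_fst_of_mem_plans {μ ν : P2 d} {γ : Measure (E d × E d)} (h : γ ∈ Plans μ ν)
    {φ : E d → ℝ} (hφ : Integrable φ μ.toMeasure) :
    ∫ z, φ z.1 ∂γ = ∫ x, φ x ∂μ.toMeasure := by
  rw [← h.1] at hφ ⊢
  rw [integral_map measurable_fst.aemeasurable hφ.aestronglyMeasurable]

theorem integral_snd_of_mem_plans {μ ν : P2 d} {γ : Measure (E d × E d)} (h : γ ∈ Plans μ ν)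
    {φ : E d → ℝ} (hφ : Integrable φ ν.toMeasure) :
    ∫ z, φ z.2 ∂γ = ∫ x, φ x ∂ν.toMeasure := by
  rw [← h.2] at hφ ⊢
  rw [integral_map measurable_snd.aemeasurable hφ.aestronglyMeasurable]

theorem integrable_sub_sq_of_mem_plans {μ ν : P2 d} {γ : Measure (E d × E d)}
    (h : γ ∈ Plans μ ν) : Integrable (fun z : E d × E d => ‖z.1 - z.2‖ ^ 2) γ := by
  refine (((integrable_fst_of_mem_plans h μ.integrable_sq).add
    (integrable_snd_of_mem_plans h ν.integrable_sq)).const_mul 2).mono' (by fun_prop) ?_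
  refine .of_forall fun z => ?_
  have := norm_sub_le z.1 z.2
  simp only [norm_pow, norm_norm, Pi.add_apply]
  nlinarith [sq_nonneg (‖z.1‖ - ‖z.2‖), norm_nonneg (z.1 - z.2)]

theorem lintegral_sub_sq_of_mem_plans {μ ν : P2 d} {γ : Measure (E d × E d)}
    (h : γ ∈ Plans μ ν) : ∫⁻ z, ‖z.1 - z.2‖ₑ ^ 2 ∂γ = ENNReal.ofReal (∫ z, ‖z.1 - z.2‖ ^ 2 ∂γ) := by
  rw [ofReal_integral_eq_lintegral_ofReal (integrable_sub_sq_of_mem_plans h)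
    (.of_forall fun _ => by positivity)]
  refine lintegral_congr fun z => ?_
  rw [ENNReal.ofReal_pow (norm_nonneg _), ofReal_norm]

theorem W2_sq_le_of_mem_plans {μ ν : P2 d} {γ : Measure (E d × E d)} (h : γ ∈ Plans μ ν) :
    W2 μ ν ^ 2 ≤ ∫ z, ‖z.1 - z.2‖ ^ 2 ∂γ := by
  rw [W2, Real.sq_sqrt ENNReal.toReal_nonneg]
  refine ENNReal.toReal_le_of_le_ofReal (integral_nonneg fun _ => by positivity) ?_
  rw [← lintegral_sub_sq_of_mem_plans h]
  exact iInf₂_le γ h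

/-- Optimal plans are never needed: a plan that beats a given `c` above the distance suffices. The
product plan makes the infimum finite, so that `toReal` loses nothing. -/
theorem exists_plan_of_W2_lt {μ ν : P2 d} {c : ℝ} (hc : W2 μ ν < c) :
    ∃ γ ∈ Plans μ ν, ∫ z, ‖z.1 - z.2‖ ^ 2 ∂γ < c ^ 2 := by
  have hc0 : 0 < c := (W2_nonneg μ ν).trans_lt hc
  set I := ⨅ γ ∈ Plans μ ν, ∫⁻ z, ‖z.1 - z.2‖ₑ ^ 2 ∂γ with hI
  have hfin : I ≠ ⊤ := by
    refine ne_top_of_le_ne_top ?_ (iInf₂_le _ (prod_mem_plans μ ν))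
    rw [lintegral_sub_sq_of_mem_plans (prod_mem_plans μ ν)]
    exact ENNReal.ofReal_ne_top
  have h1 : I.toReal < c ^ 2 := by
    rw [W2, ← hI, Real.sqrt_lt' hc0] at hc
    exact hc
  have h2 : I < ENNReal.ofReal (c ^ 2) := (ENNReal.lt_ofReal_iff_toReal_lt hfin).2 h1
  rw [hI] at h2
  simp only [iInf_lt_iff] at h2
  obtain ⟨γ, hγ, hlt⟩ := h2
  refine ⟨γ, hγ, ?_⟩
  rw [lintegral_sub_sq_of_mem_plans hγ] at hlt
  exact (ENNReal.ofReal_lt_ofReal_iff (by positivity)).1 hlt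

theorem W2_diracZero_le (μ : P2 d) : W2 μ (P2.diracZero d) ≤ Real.sqrt μ.M2 := by
  refine Real.le_sqrt_of_sq_le ?_
  refine (W2_sq_le_of_mem_plans (prod_mem_plans μ (P2.diracZero d))).trans_eq ?_
  have : Integrable (fun z : E d × E d => ‖z.1 - z.2‖ ^ 2)
      (μ.toMeasure.prod (P2.diracZero d).toMeasure) :=
    integrable_sub_sq_of_mem_plans (prod_mem_plans μ (P2.diracZero d))
  rw [integral_prod _ this]
  simp [P2.diracZero, P2.M2]

/-- Integrate `|x|² ≤ 2|y|² + 2|x - y|²` against a plan of cost below `(W2 + 1)²`; the `1` pays for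
not having an optimal plan. -/
theorem M2_le_of_W2 (μ ν : P2 d) : μ.M2 ≤ 2 * ν.M2 + 2 * (W2 μ ν + 1) ^ 2 := by
  obtain ⟨γ, hγ, hlt⟩ := exists_plan_of_W2_lt (lt_add_one (W2 μ ν))
  have h1 := integral_fst_of_mem_plans hγ μ.integrable_sq
  have h2 := integral_snd_of_mem_plans hγ ν.integrable_sq
  have i2 := (integrable_snd_of_mem_plans hγ ν.integrable_sq)
  have i3 := integrable_sub_sq_of_mem_plans hγ
  have : ∫ z, ‖z.1‖ ^ 2 ∂γ ≤ ∫ z, (2 * ‖z.2‖ ^ 2 + 2 * ‖z.1 - z.2‖ ^ 2) ∂γ := by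
    refine integral_mono (integrable_fst_of_mem_plans hγ μ.integrable_sq)
      ((i2.const_mul 2).add (i3.const_mul 2)) fun z => ?_
    have := norm_le_insert' z.1 z.2
    simp only
    nlinarith [sq_nonneg (‖z.2‖ - ‖z.1 - z.2‖), norm_nonneg z.1, norm_nonneg z.2,
      norm_nonneg (z.1 - z.2)]
  rw [integral_add (i2.const_mul 2) (i3.const_mul 2), integral_const_mul, integral_const_mul, h1,
    h2] at this
  simp only [P2.M2]
  linarith

/-- Locally Lipschitz functions whose Lipschitz constant grows linearly. -/
def LocLip {F : Type*} [NormedAddCommGroup F] (C : ℝ) (φ : E d → F) : Prop :=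
  ∀ x y, ‖φ x - φ y‖ ≤ C * (1 + ‖x‖ + ‖y‖) * ‖x - y‖

theorem LocLip.nonneg_const {F : Type*} [NormedAddCommGroup F] {C : ℝ} {φ : E d → F}
    (h : LocLip C φ) : LocLip (max C 0) φ := fun x y => (h x y).trans (by gcongr; exact le_max_left _ _)

theorem LocLip.continuous {F : Type*} [NormedAddCommGroup F] {C : ℝ} {φ : E d → F}
    (h : LocLip C φ) : Continuous φ := by
  rw [continuous_iff_continuousAt]
  intro x
  rw [ContinuousAt, tendsto_iff_norm_sub_tendsto_zero]
  have : Tendsto (fun y => C * (1 + ‖y‖ + ‖x‖) * ‖y - x‖) (𝓝 x) (𝓝 (C * (1 + ‖x‖ + ‖x‖) * ‖x - x‖)) := by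
    have : Continuous (fun y => C * (1 + ‖y‖ + ‖x‖) * ‖y - x‖) := by fun_prop
    exact this.tendsto x
  simp only [sub_self, norm_zero, mul_zero] at this
  exact squeeze_zero (fun _ => norm_nonneg _) (fun y => h y x) this

theorem LocLip.growth {F : Type*} [NormedAddCommGroup F] {C : ℝ} {φ : E d → F}
    (h : LocLip C φ) (x : E d) : ‖φ x‖ ≤ (‖φ 0‖ + 2 * max C 0) * (1 + ‖x‖ ^ 2) := by
  have h1 := h.nonneg_const x 0
  have h2 := norm_le_insert' (φ x) (φ 0)
  simp only [norm_zero, sub_zero, add_zero] at h1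
  have hC : 0 ≤ max C 0 := le_max_right _ _
  have h3 : (1 + ‖x‖) * ‖x‖ ≤ 2 * (1 + ‖x‖ ^ 2) := by
    nlinarith [sq_nonneg (‖x‖ - 1), norm_nonneg x]
  nlinarith [mul_le_mul_of_nonneg_left h3 hC, norm_nonneg (φ 0), sq_nonneg ‖x‖,
    mul_nonneg (norm_nonneg (φ 0)) (sq_nonneg ‖x‖)]

theorem LocLip.integrable {F : Type*} [NormedAddCommGroup F] {C : ℝ} {φ : E d → F}
    (h : LocLip C φ) (μ : P2 d) : Integrable φ μ.toMeasure :=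
  μ.integrable_of_growth h.continuous.aestronglyMeasurable h.growth

/-- Integrate `φ x - φ y` against a plan of cost below `c²` and apply Young's inequality with
weights tuned so that the outcome is the Cauchy–Schwarz bound `S * c`; then let `c` decrease to
`W2`. The `3` comes from `(1 + |x| + |y|)² ≤ 3 (1 + |x|² + |y|²)`. -/
theorem LocLip.abs_integral_sub_le {C : ℝ} (hC : 0 ≤ C) {φ : E d → ℝ} (h : LocLip C φ) (μ ν : P2 d) :
    |∫ x, φ x ∂μ.toMeasure - ∫ x, φ x ∂ν.toMeasure|
      ≤ C * Real.sqrt (3 * (1 + μ.M2 + ν.M2)) * W2 μ ν := by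
  have key : ∀ c, W2 μ ν < c → |∫ x, φ x ∂μ.toMeasure - ∫ x, φ x ∂ν.toMeasure|
      ≤ C * Real.sqrt (3 * (1 + μ.M2 + ν.M2)) * c := by
    intro c hc
    have hc0 : 0 < c := (W2_nonneg μ ν).trans_lt hc
    obtain ⟨γ, hγ, hlt⟩ := exists_plan_of_W2_lt hc
    have := isProbabilityMeasure_of_mem_plans hγ
    have hμ := integrable_fst_of_mem_plans hγ (h.integrable μ)
    have hν := integrable_snd_of_mem_plans hγ (h.integrable ν)
    rw [← integral_fst_of_mem_plans hγ (h.integrable μ),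
      ← integral_snd_of_mem_plans hγ (h.integrable ν), ← integral_sub hμ hν]
    have i1 := integrable_fst_of_mem_plans hγ μ.integrable_sq
    have i2 := integrable_snd_of_mem_plans hγ ν.integrable_sq
    have i3 := integrable_sub_sq_of_mem_plans hγ
    set S := Real.sqrt (3 * (1 + μ.M2 + ν.M2)) with hS
    have hS2 : S ^ 2 = 3 * (1 + μ.M2 + ν.M2) :=
      Real.sq_sqrt (by have := μ.M2_nonneg; have := ν.M2_nonneg; positivity)
    have hSpos : 0 < S := Real.sqrt_pos.2 (by have := μ.M2_nonneg; have := ν.M2_nonneg; positivity)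
    have i12 : Integrable (fun z : E d × E d => 1 + ‖z.1‖ ^ 2) γ := (integrable_const (1 : ℝ)).add i1
    have iA : Integrable (fun z : E d × E d => 3 * (1 + ‖z.1‖ ^ 2 + ‖z.2‖ ^ 2)) γ :=
      (i12.add i2).const_mul 3
    have hA : ∫ z, 3 * (1 + ‖z.1‖ ^ 2 + ‖z.2‖ ^ 2) ∂γ = S ^ 2 := by
      rw [integral_const_mul, integral_add i12 i2,
        integral_add (integrable_const (1 : ℝ)) i1, integral_fst_of_mem_plans hγ μ.integrable_sq,
        integral_snd_of_mem_plans hγ ν.integrable_sq, hS2]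
      simp [P2.M2]
    have iB : Integrable (fun z : E d × E d => C * ((c / (2 * S)) * (3 * (1 + ‖z.1‖ ^ 2 + ‖z.2‖ ^ 2))
        + (S / (2 * c)) * ‖z.1 - z.2‖ ^ 2)) γ :=
      ((iA.const_mul _).add (i3.const_mul _)).const_mul C
    calc |∫ z, φ z.1 - φ z.2 ∂γ|
        ≤ ∫ z, C * ((c / (2 * S)) * (3 * (1 + ‖z.1‖ ^ 2 + ‖z.2‖ ^ 2))
        + (S / (2 * c)) * ‖z.1 - z.2‖ ^ 2) ∂γ := by
          refine norm_integral_le_of_norm_le iB (.of_forall fun z => (h z.1 z.2).trans ?_)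
          rw [mul_assoc]
          refine mul_le_mul_of_nonneg_left ?_ hC
          set a := 1 + ‖z.1‖ + ‖z.2‖
          set r := ‖z.1 - z.2‖
          have h1 : a ^ 2 ≤ 3 * (1 + ‖z.1‖ ^ 2 + ‖z.2‖ ^ 2) := by
            nlinarith [sq_nonneg (‖z.1‖ - 1), sq_nonneg (‖z.2‖ - 1), sq_nonneg (‖z.1‖ - ‖z.2‖)]
          have h2 : a * r ≤ c / (2 * S) * a ^ 2 + S / (2 * c) * r ^ 2 := by
            have : c / (2 * S) * a ^ 2 + S / (2 * c) * r ^ 2 - a * r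
                = (c * a - S * r) ^ 2 / (2 * S * c) := by
              field_simp; ring
            have h3 : 0 ≤ (c * a - S * r) ^ 2 / (2 * S * c) := by positivity
            linarith
          have h4 : c / (2 * S) * a ^ 2 ≤ c / (2 * S) * (3 * (1 + ‖z.1‖ ^ 2 + ‖z.2‖ ^ 2)) := by
            gcongr
          linarith
      _ = C * ((c / (2 * S)) * S ^ 2 + (S / (2 * c)) * ∫ z, ‖z.1 - z.2‖ ^ 2 ∂γ) := by
          rw [integral_const_mul, integral_add (iA.const_mul _) (i3.const_mul _),
            integral_const_mul (c / (2 * S)), integral_const_mul (S / (2 * c)), hA]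
      _ ≤ C * ((c / (2 * S)) * S ^ 2 + (S / (2 * c)) * c ^ 2) := by gcongr
      _ = C * S * c := by field_simp; ring
  have hcont : Tendsto (fun c => C * Real.sqrt (3 * (1 + μ.M2 + ν.M2)) * c) (𝓝[>] (W2 μ ν))
      (𝓝 (C * Real.sqrt (3 * (1 + μ.M2 + ν.M2)) * W2 μ ν)) :=
    ((continuous_const.mul continuous_id).tendsto _).mono_left nhdsWithin_le_nhds
  exact ge_of_tendsto hcont (eventually_mem_nhdsWithin.mono fun c hc => key c hc)

theorem locLip_of_lipschitzWith {F : Type*} [NormedAddCommGroup F] {K : ℝ≥0} {φ : E d → F}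
    (h : LipschitzWith K φ) : LocLip (d := d) K φ := fun x y => by
  have := h.dist_le_mul x y
  rw [dist_eq_norm, dist_eq_norm] at this
  refine this.trans ?_
  have h1 : (K : ℝ) * 1 ≤ K * (1 + ‖x‖ + ‖y‖) := by
    gcongr; linarith [norm_nonneg x, norm_nonneg y]
  nlinarith [mul_le_mul_of_nonneg_right h1 (norm_nonneg (x - y))]

section W2Limits

variable {ι : Type*} {l : Filter ι} {μs : ι → P2 d} {μ : P2 d}

theorem eventually_M2_le (h : Tendsto (fun i => W2 (μs i) μ) l (𝓝 0)) :
    ∀ᶠ i in l, (μs i).M2 ≤ 2 * μ.M2 + 8 := by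
  filter_upwards [h.eventually (gt_mem_nhds (zero_lt_one' ℝ))] with i hi
  have := M2_le_of_W2 (μs i) μ
  have := W2_nonneg (μs i) μ
  nlinarith

theorem LocLip.tendsto_integral {C : ℝ} {φ : E d → ℝ} (hφ : LocLip C φ)
    (h : Tendsto (fun i => W2 (μs i) μ) l (𝓝 0)) :
    Tendsto (fun i => ∫ x, φ x ∂(μs i).toMeasure) l (𝓝 (∫ x, φ x ∂μ.toMeasure)) := by
  rw [tendsto_iff_norm_sub_tendsto_zero]
  have h0 : Tendsto (fun i => max C 0 * Real.sqrt (3 * (1 + (2 * μ.M2 + 8) + μ.M2)) * W2 (μs i) μ)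
      l (𝓝 0) := by simpa using h.const_mul (max C 0 * Real.sqrt (3 * (1 + (2 * μ.M2 + 8) + μ.M2)))
  refine squeeze_zero' (.of_forall fun _ => norm_nonneg _) ?_ h0
  filter_upwards [eventually_M2_le h] with i hi
  refine (hφ.nonneg_const.abs_integral_sub_le (le_max_right _ _) (μs i) μ).trans ?_
  have := W2_nonneg (μs i) μ
  gcongr

/-- Narrow convergence may be tested on bounded Lipschitz functions, whose integrals are controlled
by `W2`. -/
theorem tendsto_prob_of_tendsto_W2 [l.IsCountablyGenerated]
    (h : Tendsto (fun i => W2 (μs i) μ) l (𝓝 0)) :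
    Tendsto (fun i => (μs i).prob) l (𝓝 μ.prob) := by
  rw [tendsto_iff_forall_lipschitz_integral_tendsto]
  rintro φ - ⟨K, hK⟩
  exact (locLip_of_lipschitzWith hK).tendsto_integral h

theorem locLip_norm_sq : LocLip (d := d) 1 (fun x : E d => ‖x‖ ^ 2) := fun x y => by
  have h1 := abs_norm_sub_norm_le x y
  rw [Real.norm_eq_abs, sq_sub_sq, abs_mul, abs_of_nonneg (by positivity)]
  have : (‖x‖ + ‖y‖) * |‖x‖ - ‖y‖| ≤ (‖x‖ + ‖y‖) * ‖x - y‖ := by gcongr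
  nlinarith [norm_nonneg (x - y)]

theorem tendsto_M2 (h : Tendsto (fun i => W2 (μs i) μ) l (𝓝 0)) :
    Tendsto (fun i => (μs i).M2) l (𝓝 μ.M2) := locLip_norm_sq.tendsto_integral h

end W2Limits

end VanishingViscosity

/-! ### Explicit couplings: from narrow convergence to convergence in `W2` -/

namespace VanishingViscosity

variable {d : ℕ}

/-- Here `p` and `q` are the masses that two measures give to a cell. The weight `min p q / (p * q)`
gives the product of the two restrictions total mass `min p q`, with marginals below the
restrictions. When a mass is zero, the conventions of `ℝ≥0∞` still give the right value. -/
theorem min_div_mul_le_one {p q : ℝ≥0∞} (hp : p ≠ ⊤) (hq : q ≠ ⊤) : min p q / (p * q) * q ≤ 1 := by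
  rcases eq_or_ne q 0 with rfl | hq0
  · simp
  rcases eq_or_ne p 0 with rfl | hp0
  · simp
  rw [div_eq_mul_inv, ENNReal.mul_inv (.inl hp0) (.inl hp), mul_assoc, mul_assoc,
    ENNReal.inv_mul_cancel hq0 hq, mul_one, ← div_eq_mul_inv]
  exact ENNReal.div_le_of_le_mul (by simp)

theorem min_div_mul_mul {p q : ℝ≥0∞} (hp : p ≠ ⊤) (hq : q ≠ ⊤) :
    min p q / (p * q) * q * p = min p q := by
  rcases eq_or_ne q 0 with rfl | hq0
  · simp
  rcases eq_or_ne p 0 with rfl | hp0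
  · simp
  rw [mul_assoc, mul_comm q p]
  exact ENNReal.div_mul_cancel (mul_ne_zero hp0 hq0) (ENNReal.mul_ne_top hp hq)

/-- The residual of a measure after removing the part which is matched cell by cell. -/
theorem lintegral_residual {ι : Type*} [Fintype ι] (a : ι → Measure (E d)) (c : ι → ℝ≥0∞)
    (f : E d → ℝ≥0∞) :
    ∫⁻ x, f x ∂(∑ i, (1 - c i) • a i) = ∑ i, (1 - c i) * ∫⁻ x, f x ∂(a i) := by
  rw [lintegral_finsetSum_measure]
  simp [lintegral_smul_measure]

theorem sum_withDensity_partition {ι : Type*} [Fintype ι] {χ : ι → E d → ℝ≥0∞}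
    (hm : ∀ i, Measurable (χ i)) (hsum : ∀ x, ∑ i, χ i x = 1) (μ : Measure (E d)) :
    ∑ i, μ.withDensity (χ i) = μ := by
  ext s hs
  simp only [Measure.coe_finsetSum, Finset.sum_apply, withDensity_apply _ hs]
  rw [← lintegral_finsetSum _ fun i _ => hm i]
  simp [hsum]

/-- Two measures whose masses are close on the cells of a fine partition of unity of a large ball
are coupled at small quadratic cost. -/
theorem exists_plan_of_partition {ι : Type*} [Fintype ι] (χ : Option ι → E d → ℝ≥0∞)
    (hm : ∀ i, Measurable (χ i)) (hsum : ∀ x, ∑ i, χ i x = 1) (c : ι → E d) (δ R : ℝ≥0∞)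
    (hδ : ∀ i x, χ (some i) x ≠ 0 → ‖x - c i‖ₑ ≤ δ) (hR : ∀ i x, χ (some i) x ≠ 0 → ‖x‖ₑ ≤ R)
    (μ ν : P2 d) :
    ∃ γ ∈ Plans μ ν, ∫⁻ z, ‖z.1 - z.2‖ₑ ^ 2 ∂γ ≤ (2 * δ) ^ 2
      + 4 * (∫⁻ x, ‖x‖ₑ ^ 2 * χ none x ∂μ.toMeasure + ∫⁻ x, ‖x‖ₑ ^ 2 * χ none x ∂ν.toMeasure)
      + 2 * (R ^ 2 * ∑ i, ((∫⁻ x, χ (some i) x ∂μ.toMeasure - ∫⁻ x, χ (some i) x ∂ν.toMeasure)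
        + (∫⁻ x, χ (some i) x ∂ν.toMeasure - ∫⁻ x, χ (some i) x ∂μ.toMeasure))) := by
  set a : Option ι → Measure (E d) := fun i => μ.toMeasure.withDensity (χ i) with ha
  set b : Option ι → Measure (E d) := fun i => ν.toMeasure.withDensity (χ i) with hb
  set p : Option ι → ℝ≥0∞ := fun i => ∫⁻ x, χ i x ∂μ.toMeasure with hp
  set q : Option ι → ℝ≥0∞ := fun i => ∫⁻ x, χ i x ∂ν.toMeasure with hq
  have hχ1 : ∀ i x, χ i x ≤ 1 := fun i x => by
    rw [← hsum x]
    exact Finset.single_le_sum (f := fun i => χ i x) (fun _ _ => zero_le) (Finset.mem_univ i)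
  have pfin : ∀ i, p i ≠ ⊤ := fun i => ne_top_of_le_ne_top ENNReal.one_ne_top
    ((lintegral_mono (hχ1 i)).trans_eq (by simp))
  have qfin : ∀ i, q i ≠ ⊤ := fun i => ne_top_of_le_ne_top ENNReal.one_ne_top
    ((lintegral_mono (hχ1 i)).trans_eq (by simp))
  have ha1 : ∀ i, a i univ = p i := fun i => by simp [ha, hp]
  have hb1 : ∀ i, b i univ = q i := fun i => by simp [hb, hq]
  have : ∀ i, IsFiniteMeasure (a i) := fun i => ⟨by rw [ha1]; exact (pfin i).lt_top⟩
  have : ∀ i, IsFiniteMeasure (b i) := fun i => ⟨by rw [hb1]; exact (qfin i).lt_top⟩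
  have psum : ∑ i, p i = 1 := by
    rw [← lintegral_finsetSum _ fun i _ => hm i]; simp [hsum]
  have qsum : ∑ i, q i = 1 := by
    rw [← lintegral_finsetSum _ fun i _ => hm i]; simp [hsum]
  -- Inside each cell the common mass `min (p i) (q i)` is matched by a multiple of the product
  -- measure; `α` and `β` below collect what is left of `μ` and `ν`.
  set r : Option ι → ℝ≥0∞ := fun i => min (p i) (q i) / (p i * q i) with hr
  have rq : ∀ i, r i * q i ≤ 1 := fun i => min_div_mul_le_one (pfin i) (qfin i)
  have rp : ∀ i, r i * p i ≤ 1 := fun i => by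
    simp only [hr]; rw [min_comm, mul_comm (p i)]; exact min_div_mul_le_one (qfin i) (pfin i)
  have rqp : ∀ i, r i * q i * p i = min (p i) (q i) := fun i => min_div_mul_mul (pfin i) (qfin i)
  have rpq : ∀ i, r i * p i * q i = min (p i) (q i) := fun i => by
    rw [mul_assoc, mul_comm (p i), ← mul_assoc, rqp]
  have mfin : ∀ i, min (p i) (q i) ≠ ⊤ := fun i => ne_top_of_le_ne_top (pfin i) (min_le_left _ _)
  set α : Measure (E d) := ∑ i, (1 - r i * q i) • a i with hα
  set β : Measure (E d) := ∑ i, (1 - r i * p i) • b i with hβ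
  have hpm : ∀ i, (1 - r i * q i) * p i = p i - q i := fun i => by
    rw [ENNReal.sub_mul fun _ _ => pfin i, one_mul, rqp]
    rcases le_total (p i) (q i) with h | h
    · simp [h, min_eq_left, tsub_eq_zero_of_le]
    · simp [h, min_eq_right, tsub_eq_zero_of_le]
  have hqm : ∀ i, (1 - r i * p i) * q i = q i - p i := fun i => by
    rw [ENNReal.sub_mul fun _ _ => qfin i, one_mul, rpq]
    rcases le_total (p i) (q i) with h | h
    · simp [h, min_eq_left, tsub_eq_zero_of_le]
    · simp [h, min_eq_right, tsub_eq_zero_of_le]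
  have hα1 : α univ = ∑ i, (p i - q i) := by
    simp only [hα, Measure.coe_finsetSum, Finset.sum_apply, Measure.smul_apply, smul_eq_mul, ha1, hpm]
  have hβ1 : β univ = ∑ i, (q i - p i) := by
    simp only [hβ, Measure.coe_finsetSum, Finset.sum_apply, Measure.smul_apply, smul_eq_mul, hb1, hqm]
  have hαβ : α univ = β univ := by
    have e1 : ∑ i, (p i - q i) + ∑ i, min (p i) (q i) = 1 := by
      rw [← Finset.sum_add_distrib, ← psum]
      refine Finset.sum_congr rfl fun i _ => ?_
      rcases le_total (p i) (q i) with h | h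
      · simp [h, tsub_eq_zero_of_le, tsub_add_cancel_of_le]
      · simp [h, tsub_eq_zero_of_le, tsub_add_cancel_of_le]
    have e2 : ∑ i, (q i - p i) + ∑ i, min (p i) (q i) = 1 := by
      rw [← Finset.sum_add_distrib, ← qsum]
      refine Finset.sum_congr rfl fun i _ => ?_
      rcases le_total (p i) (q i) with h | h
      · simp [h, tsub_eq_zero_of_le, tsub_add_cancel_of_le]
      · simp [h, tsub_eq_zero_of_le, tsub_add_cancel_of_le]
    have hfin : ∑ i, min (p i) (q i) ≠ ⊤ := ENNReal.sum_ne_top.2 fun i _ => mfin i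
    rw [hα1, hβ1]
    exact (ENNReal.add_left_inj hfin).1 (e1.trans e2.symm)
  have hαfin : α univ ≠ ⊤ := by
    rw [hα1]; exact ENNReal.sum_ne_top.2 fun i _ => ENNReal.sub_ne_top (pfin i)
  have : IsFiniteMeasure α := ⟨hαfin.lt_top⟩
  have : IsFiniteMeasure β := ⟨by rw [← hαβ]; exact hαfin.lt_top⟩
  -- If there is no residual mass the inverse is infinite, but then the residual measures vanish and
  -- the identity still holds.
  have hinv : ∀ m : Measure (E d), m univ = α univ → ((α univ)⁻¹ * α univ) • m = m := fun m h => by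
    rcases eq_or_ne (α univ) 0 with h0 | h0
    · rw [h0, Measure.measure_univ_eq_zero] at h
      simp [h]
    · rw [ENNReal.inv_mul_cancel h0 hαfin, one_smul]
  set γ : Measure (E d × E d) := (∑ i, r i • (a i).prod (b i)) + (α univ)⁻¹ • α.prod β with hγ
  have hfst : ∀ i, (r i • (a i).prod (b i)).map Prod.fst = (r i * q i) • a i := fun i => by
    rw [Measure.map_smul, Measure.map_fst_prod, hb1, smul_smul]
  have hsnd : ∀ i, (r i • (a i).prod (b i)).map Prod.snd = (r i * p i) • b i := fun i => by
    rw [Measure.map_smul, Measure.map_snd_prod, ha1, smul_smul]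
  have hfst' : ((α univ)⁻¹ • α.prod β).map Prod.fst = α := by
    rw [Measure.map_smul, Measure.map_fst_prod, smul_smul, ← hαβ, hinv α rfl]
  have hsnd' : ((α univ)⁻¹ • α.prod β).map Prod.snd = β := by
    rw [Measure.map_smul, Measure.map_snd_prod, smul_smul, hinv β hαβ.symm]
  have split : ∀ (x : ℝ≥0∞) (m : Measure (E d)), x ≤ 1 → x • m + (1 - x) • m = m := fun x m hx => by
    rw [← add_smul, add_tsub_cancel_of_le hx, one_smul]
  refine ⟨γ, ⟨?_, ?_⟩, ?_⟩
  · rw [hγ, Measure.map_add _ _ measurable_fst, hfst', Measure.map_finset_sum measurable_fst.aemeasurable]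
    simp only [hfst]
    rw [hα, ← Finset.sum_add_distrib]
    simp only [split _ _ (rq _)]
    exact sum_withDensity_partition hm hsum _
  · rw [hγ, Measure.map_add _ _ measurable_snd, hsnd', Measure.map_finset_sum measurable_snd.aemeasurable]
    simp only [hsnd]
    rw [hβ, ← Finset.sum_add_distrib]
    simp only [split _ _ (rp _)]
    exact sum_withDensity_partition hm hsum _
  have hN : Measurable (fun x : E d => ‖x‖ₑ ^ 2) := by fun_prop
  have quad : ∀ m : Measure (E d × E d), ∫⁻ z, ‖z.1 - z.2‖ₑ ^ 2 ∂m
      ≤ 2 * (∫⁻ x, ‖x‖ₑ ^ 2 ∂(m.map Prod.fst) + ∫⁻ x, ‖x‖ₑ ^ 2 ∂(m.map Prod.snd)) := fun m => by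
    rw [lintegral_map hN measurable_fst, lintegral_map hN measurable_snd,
      ← lintegral_add_left (by fun_prop), ← lintegral_const_mul _ (by fun_prop)]
    refine lintegral_mono fun z => ?_
    have h1 : ‖z.1 - z.2‖ₑ ^ 2 ≤ (‖z.1‖ₑ + ‖z.2‖ₑ) ^ 2 := by gcongr; exact enorm_sub_le
    refine h1.trans ?_
    have := ENNReal.rpow_add_le_mul_rpow_add_rpow ‖z.1‖ₑ ‖z.2‖ₑ (p := 2) (by norm_num)
    norm_num at this
    exact this
  have ha2 : ∀ i, ∫⁻ x, ‖x‖ₑ ^ 2 ∂(a i) = ∫⁻ x, ‖x‖ₑ ^ 2 * χ i x ∂μ.toMeasure := fun i => by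
    rw [ha, lintegral_withDensity_eq_lintegral_mul _ (hm i) hN]
    simp [mul_comm]
  have hb2 : ∀ i, ∫⁻ x, ‖x‖ₑ ^ 2 ∂(b i) = ∫⁻ x, ‖x‖ₑ ^ 2 * χ i x ∂ν.toMeasure := fun i => by
    rw [hb, lintegral_withDensity_eq_lintegral_mul _ (hm i) hN]
    simp [mul_comm]
  have aein : ∀ (m : P2 d) (i : ι), ∀ᵐ x ∂(m.toMeasure.withDensity (χ (some i))),
      χ (some i) x ≠ 0 := fun m i => by
    rw [ae_withDensity_iff (hm _)]
    exact .of_forall fun x hx => hx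
  have cell : ∀ (m : P2 d) (i : ι), ∫⁻ x, ‖x‖ₑ ^ 2 ∂(m.toMeasure.withDensity (χ (some i)))
      ≤ R ^ 2 * ∫⁻ x, χ (some i) x ∂m.toMeasure := fun m i => by
    calc ∫⁻ x, ‖x‖ₑ ^ 2 ∂(m.toMeasure.withDensity (χ (some i)))
        ≤ ∫⁻ x, R ^ 2 ∂(m.toMeasure.withDensity (χ (some i))) := by
          refine lintegral_mono_ae ?_
          filter_upwards [aein m i] with x hx
          gcongr
          exact hR i x hx
      _ = _ := by simp
  have costcell : ∀ i, ∫⁻ z, ‖z.1 - z.2‖ₑ ^ 2 ∂(r (some i) • (a (some i)).prod (b (some i)))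
      ≤ (2 * δ) ^ 2 * p (some i) := fun i => by
    rw [lintegral_smul_measure, smul_eq_mul]
    have : ∫⁻ z, ‖z.1 - z.2‖ₑ ^ 2 ∂((a (some i)).prod (b (some i)))
        ≤ (2 * δ) ^ 2 * (p (some i) * q (some i)) := by
      calc _ ≤ ∫⁻ z, (2 * δ) ^ 2 ∂((a (some i)).prod (b (some i))) := by
            refine lintegral_mono_ae ?_
            have h1 : ∀ᵐ z ∂((a (some i)).prod (b (some i))), χ (some i) z.1 ≠ 0 :=
              Measure.quasiMeasurePreserving_fst.ae (aein μ i)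
            have h2 : ∀ᵐ z ∂((a (some i)).prod (b (some i))), χ (some i) z.2 ≠ 0 :=
              Measure.quasiMeasurePreserving_snd.ae (aein ν i)
            filter_upwards [h1, h2] with z h1 h2
            gcongr
            have : z.1 - z.2 = (z.1 - c i) - (z.2 - c i) := by abel
            rw [this, two_mul]
            exact enorm_sub_le.trans (add_le_add (hδ i _ h1) (hδ i _ h2))
        _ = _ := by
            rw [lintegral_const, ← univ_prod_univ, Measure.prod_prod, ha1, hb1]
    calc _ ≤ r (some i) * ((2 * δ) ^ 2 * (p (some i) * q (some i))) := by gcongr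
      _ = (2 * δ) ^ 2 * ((r (some i) * p (some i)) * q (some i)) := by ring
      _ ≤ _ := by rw [rpq]; gcongr; exact min_le_left _ _
  -- Matched mass in a small cell travels at most `2 * δ`; in the outer cell `none` the cost is
  -- bounded by the second moments carried there.
  have cost1 : ∫⁻ z, ‖z.1 - z.2‖ₑ ^ 2 ∂(∑ i, r i • (a i).prod (b i)) ≤ (2 * δ) ^ 2
      + 2 * (∫⁻ x, ‖x‖ₑ ^ 2 * χ none x ∂μ.toMeasure + ∫⁻ x, ‖x‖ₑ ^ 2 * χ none x ∂ν.toMeasure) := by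
    rw [lintegral_finsetSum_measure, Fintype.sum_option, add_comm]
    gcongr
    · calc _ ≤ ∑ i, (2 * δ) ^ 2 * p (some i) := Finset.sum_le_sum fun i _ => costcell i
        _ ≤ (2 * δ) ^ 2 * 1 := by
          rw [← Finset.mul_sum]
          gcongr
          rw [← psum, Fintype.sum_option]
          exact le_add_self
        _ = _ := mul_one _
    · refine (quad _).trans ?_
      rw [hfst, hsnd, lintegral_smul_measure, lintegral_smul_measure, ha2, hb2]
      gcongr
      · exact mul_le_of_le_one_left' (rq none)
      · exact mul_le_of_le_one_left' (rp none)
  -- The residuals are coupled blindly through `|x - y|² ≤ 2 (|x|² + |y|²)`. In the inner cells this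
  -- costs `R²` times the mass discrepancy, which is what narrow convergence makes small.
  have cost2 : ∫⁻ z, ‖z.1 - z.2‖ₑ ^ 2 ∂((α univ)⁻¹ • α.prod β) ≤
      2 * (∫⁻ x, ‖x‖ₑ ^ 2 * χ none x ∂μ.toMeasure + ∫⁻ x, ‖x‖ₑ ^ 2 * χ none x ∂ν.toMeasure)
      + 2 * (R ^ 2 * ∑ i, ((p (some i) - q (some i)) + (q (some i) - p (some i)))) := by
    refine (quad _).trans ?_
    rw [hfst', hsnd', hα, hβ, lintegral_residual, lintegral_residual, Fintype.sum_option,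
      Fintype.sum_option, ← mul_add]
    refine mul_le_mul_right ?_ 2
    have e1 : ∑ i, (1 - r (some i) * q (some i)) * ∫⁻ x, ‖x‖ₑ ^ 2 ∂(a (some i))
        ≤ R ^ 2 * ∑ i, (p (some i) - q (some i)) := by
      rw [Finset.mul_sum]
      refine Finset.sum_le_sum fun i _ => ?_
      rw [← hpm, mul_left_comm]
      gcongr
      exact cell μ i
    have e2 : ∑ i, (1 - r (some i) * p (some i)) * ∫⁻ x, ‖x‖ₑ ^ 2 ∂(b (some i))
        ≤ R ^ 2 * ∑ i, (q (some i) - p (some i)) := by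
      rw [Finset.mul_sum]
      refine Finset.sum_le_sum fun i _ => ?_
      rw [← hqm, mul_left_comm]
      gcongr
      exact cell ν i
    have e3 : (1 - r none * q none) * ∫⁻ x, ‖x‖ₑ ^ 2 ∂(a none)
        ≤ ∫⁻ x, ‖x‖ₑ ^ 2 * χ none x ∂μ.toMeasure := by
      rw [ha2]; exact mul_le_of_le_one_left' tsub_le_self
    have e4 : (1 - r none * p none) * ∫⁻ x, ‖x‖ₑ ^ 2 ∂(b none)
        ≤ ∫⁻ x, ‖x‖ₑ ^ 2 * χ none x ∂ν.toMeasure := by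
      rw [hb2]; exact mul_le_of_le_one_left' tsub_le_self
    rw [Finset.sum_add_distrib, mul_add]
    calc _ ≤ _ := add_le_add (add_le_add e3 e1) (add_le_add e4 e2)
      _ = _ := by ring
  rw [hγ, lintegral_add_measure]
  calc _ ≤ _ := add_le_add cost1 cost2
    _ = _ := by ring

theorem W2_lt_of_plan {μ ν : P2 d} {γ : Measure (E d × E d)} (h : γ ∈ Plans μ ν) {η : ℝ}
    (hη : 0 < η) (hγ : ∫⁻ z, ‖z.1 - z.2‖ₑ ^ 2 ∂γ < ENNReal.ofReal (η ^ 2)) : W2 μ ν < η := by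
  rw [lintegral_sub_sq_of_mem_plans h, ENNReal.ofReal_lt_ofReal_iff (by positivity)] at hγ
  exact lt_of_pow_lt_pow_left₀ 2 hη.le ((W2_sq_le_of_mem_plans h).trans_lt hγ)

/-- A continuous partition of unity, subordinate to a finite family of `δ`-balls and the
complement of a large ball. -/
theorem exists_partition (d : ℕ) {δ R : ℝ} (hδ : 0 < δ) :
    ∃ (t : Finset (E d)) (χ : Option t → BoundedContinuousFunction (E d) ℝ≥0),
      (∀ x, ∑ i, χ i x = 1) ∧ (∀ i x, χ (some i) x ≠ 0 → ‖x - i‖ ≤ δ) ∧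
      (∀ i x, χ (some i) x ≠ 0 → ‖x‖ ≤ R + δ) ∧ (∀ x, χ none x ≠ 0 → R ≤ ‖x‖) := by
  obtain ⟨s, hs, hsf, hcov⟩ := (isCompact_closedBall (0 : E d) R).finite_cover_balls hδ
  obtain ⟨t, rfl⟩ := hsf.exists_finset_coe
  -- Unnormalized tents: one for each ball of the finite cover, and the excess of the norm over `R`
  -- for the outer cell. Their sum is positive everywhere, so they can be normalized.
  set h : Option t → E d → ℝ := fun i x => i.elim (max 0 (‖x‖ - R)) fun c => max 0 (δ - ‖x - c‖)
    with hh
  have hc : ∀ i, Continuous (h i) := by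
    rintro (_ | c)
    · simp only [hh, Option.elim]; fun_prop
    · simp only [hh, Option.elim]; fun_prop
  have hnn : ∀ i x, 0 ≤ h i x := by
    rintro (_ | c) x
    · exact le_max_left _ _
    · exact le_max_left _ _
  have hpos : ∀ x, 0 < ∑ i, h i x := fun x => by
    rcases le_or_gt ‖x‖ R with hx | hx
    · have hx' : x ∈ Metric.closedBall (0 : E d) R := by simpa using hx
      obtain ⟨c, hct, hxc⟩ := mem_iUnion₂.1 (hcov hx')
      refine Finset.sum_pos' (fun i _ => hnn i x) ⟨some ⟨c, hct⟩, Finset.mem_univ _, ?_⟩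
      rw [Metric.mem_ball, dist_eq_norm] at hxc
      exact lt_max_of_lt_right (by simpa using hxc)
    · exact Finset.sum_pos' (fun i _ => hnn i x) ⟨none, Finset.mem_univ _,
        lt_max_of_lt_right (by linarith)⟩
  have hle : ∀ i x, h i x ≤ ∑ i, h i x := fun i x =>
    Finset.single_le_sum (f := fun i => h i x) (fun i _ => hnn i x) (Finset.mem_univ i)
  have hdiv : ∀ i x, h i x / ∑ i, h i x ≤ 1 := fun i x => (div_le_one (hpos x)).2 (hle i x)
  set χ : Option t → BoundedContinuousFunction (E d) ℝ≥0 := fun i =>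
    BoundedContinuousFunction.mkOfBound ⟨fun x => (h i x / ∑ i, h i x).toNNReal, by
      refine continuous_real_toNNReal.comp ?_
      exact (hc i).div (continuous_finsetSum _ fun i _ => hc i) fun x => (hpos x).ne'⟩ 1 (by
      intro x y
      simp only [ContinuousMap.coe_mk]
      rw [NNReal.dist_eq, abs_le]
      have h1 : ∀ x, (((h i x / ∑ i, h i x).toNNReal : ℝ≥0) : ℝ) ≤ 1 := fun x => by
        exact_mod_cast Real.toNNReal_le_one.2 (hdiv i x)
      have h2 : ∀ x, 0 ≤ (((h i x / ∑ i, h i x).toNNReal : ℝ≥0) : ℝ) := fun x => NNReal.coe_nonneg _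
      constructor <;> linarith [h1 x, h1 y, h2 x, h2 y]) with hχ
  have hne : ∀ i x, χ i x ≠ 0 → 0 < h i x := fun i x hx => by
    by_contra hcon
    have h0 : h i x = 0 := le_antisymm (not_lt.1 hcon) (hnn i x)
    apply hx
    simp [hχ, h0]
  refine ⟨t, χ, fun x => ?_, fun i x hx => ?_, fun i x hx => ?_, fun x hx => ?_⟩
  · simp only [hχ, BoundedContinuousFunction.mkOfBound_coe, ContinuousMap.coe_mk]
    rw [← Real.toNNReal_sum_of_nonneg fun i _ => div_nonneg (hnn i x) (hpos x).le,
      ← Finset.sum_div, div_self (hpos x).ne', Real.toNNReal_one]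
  · have := hne _ _ hx
    simp only [hh, Option.elim, lt_max_iff, lt_self_iff_false, false_or] at this
    linarith
  · have := hne _ _ hx
    simp only [hh, Option.elim, lt_max_iff, lt_self_iff_false, false_or] at this
    have h1 : ‖(i : E d)‖ ≤ R := by simpa using hs i.2
    have := norm_le_insert' x i
    linarith
  · have := hne _ _ hx
    simp only [hh, Option.elim, lt_max_iff, lt_self_iff_false, false_or] at this
    linarith

/-- Narrow convergence together with a bound on the fourth moments implies convergence in `W2`. -/
theorem tendsto_W2_of_tendsto_prob {ι : Type*} {l : Filter ι} {μs : ι → P2 d} {μ : P2 d} {K : ℝ≥0}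
    (h : Tendsto (fun i => (μs i).prob) l (𝓝 μ.prob))
    (hK : ∀ i, ∫⁻ x, ‖x‖ₑ ^ 4 ∂(μs i).toMeasure ≤ K) (hKμ : ∫⁻ x, ‖x‖ₑ ^ 4 ∂μ.toMeasure ≤ K) :
    Tendsto (fun i => W2 (μs i) μ) l (𝓝 0) := by
  rw [Metric.tendsto_nhds]
  intro η hη
  obtain ⟨δ, hδ, hδη⟩ : ∃ δ : ℝ, 0 < δ ∧ (2 * δ) ^ 2 < η ^ 2 / 4 := ⟨η / 8, by positivity, by
    nlinarith⟩
  -- The two outer second moments are at most `K / R²` each, because `|x|² ≤ |x|⁴ / R²` there, and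
  -- enter with factor 4. Any constant from 32 on would do in place of 33. Each of the three error
  -- terms receives `η² / 4`.
  obtain ⟨R, hR, hRη⟩ : ∃ R : ℝ, 0 < R ∧ 8 * (K / R ^ 2) < η ^ 2 / 4 := by
    refine ⟨Real.sqrt (33 * K / η ^ 2 + 1), by positivity, ?_⟩
    rw [Real.sq_sqrt (by positivity), ← mul_div_assoc, div_lt_iff₀ (by positivity)]
    have : η ^ 2 / 4 * (33 * K / η ^ 2 + 1) = 33 / 4 * K + η ^ 2 / 4 := by field_simp
    rw [this]
    nlinarith [K.2, sq_pos_of_pos hη]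
  obtain ⟨t, χ, hsum, hχδ, hχR, hχn⟩ := exists_partition d (R := R) hδ
  have hdist : ∀ i, dist (W2 (μs i) μ) 0 = W2 (μs i) μ := fun i => by
    rw [Real.dist_eq, sub_zero, abs_of_nonneg (W2_nonneg _ _)]
  simp only [hdist]
  have hplan : ∀ i, _ := fun i => exists_plan_of_partition (fun j x => (χ j x : ℝ≥0∞))
    (fun j => by fun_prop) (fun x => by exact_mod_cast congrArg ((↑) : ℝ≥0 → ℝ≥0∞) (hsum x))
    (fun c : t => (c : E d)) (ENNReal.ofReal δ) (ENNReal.ofReal (R + δ))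
    (fun c x hx => by
      rw [← ofReal_norm]
      exact ENNReal.ofReal_le_ofReal (hχδ c x (by simpa using hx)))
    (fun c x hx => by
      rw [← ofReal_norm]
      exact ENNReal.ofReal_le_ofReal (hχR c x (by simpa using hx))) (μs i) μ
  have hrest : ∀ m : P2 d, ∫⁻ x, ‖x‖ₑ ^ 4 ∂m.toMeasure ≤ K →
      ∫⁻ x, ‖x‖ₑ ^ 2 * (χ none x : ℝ≥0∞) ∂m.toMeasure ≤ ENNReal.ofReal (K / R ^ 2) := by
    intro m hm
    calc _ ≤ ∫⁻ x, ENNReal.ofReal (1 / R ^ 2) * ‖x‖ₑ ^ 4 ∂m.toMeasure := by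
          refine lintegral_mono fun x => ?_
          by_cases hx : χ none x = 0
          · simp [hx]
          · have h1 : χ none x ≤ 1 := by
              rw [← hsum x]
              exact Finset.single_le_sum (f := fun i => χ i x) (fun _ _ => zero_le)
                (Finset.mem_univ _)
            have h2 : R ≤ ‖x‖ := hχn x hx
            calc ‖x‖ₑ ^ 2 * (χ none x : ℝ≥0∞) ≤ ‖x‖ₑ ^ 2 * 1 := by gcongr; exact_mod_cast h1
              _ = ENNReal.ofReal (‖x‖ ^ 2) := by
                rw [mul_one, ENNReal.ofReal_pow (norm_nonneg _), ofReal_norm]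
              _ ≤ ENNReal.ofReal (1 / R ^ 2 * ‖x‖ ^ 4) := by
                refine ENNReal.ofReal_le_ofReal ?_
                rw [div_mul_eq_mul_div, one_mul, le_div_iff₀ (by positivity)]
                have : R ^ 2 ≤ ‖x‖ ^ 2 := by gcongr
                nlinarith [sq_nonneg ‖x‖]
              _ = _ := by
                rw [ENNReal.ofReal_mul (by positivity), ENNReal.ofReal_pow (norm_nonneg _),
                  ofReal_norm]
      _ = ENNReal.ofReal (1 / R ^ 2) * ∫⁻ x, ‖x‖ₑ ^ 4 ∂m.toMeasure := by
          rw [lintegral_const_mul _ (by fun_prop)]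
      _ ≤ ENNReal.ofReal (1 / R ^ 2) * K := by gcongr
      _ = _ := by
          rw [← ENNReal.ofReal_coe_nnreal, ← ENNReal.ofReal_mul (by positivity)]
          congr 1; ring
  have hconv : Tendsto (fun i => 2 * (ENNReal.ofReal (R + δ) ^ 2 * ∑ c : t,
      ((∫⁻ x, χ (some c) x ∂(μs i).toMeasure - ∫⁻ x, χ (some c) x ∂μ.toMeasure)
      + (∫⁻ x, χ (some c) x ∂μ.toMeasure - ∫⁻ x, χ (some c) x ∂(μs i).toMeasure)))) l (𝓝 0) := by
    have hz : (0 : ℝ≥0∞) = 2 * (ENNReal.ofReal (R + δ) ^ 2 * ∑ c : t,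
      ((∫⁻ x, χ (some c) x ∂μ.toMeasure - ∫⁻ x, χ (some c) x ∂μ.toMeasure)
      + (∫⁻ x, χ (some c) x ∂μ.toMeasure - ∫⁻ x, χ (some c) x ∂μ.toMeasure))) := by simp
    rw [hz]
    refine ENNReal.Tendsto.const_mul ?_ (.inr (by simp))
    refine ENNReal.Tendsto.const_mul ?_ (.inr (by simp))
    refine tendsto_finsetSum _ fun c _ => ?_
    have hc := ProbabilityMeasure.tendsto_iff_forall_lintegral_tendsto.1 h (χ (some c))
    have hfin : ∫⁻ x, χ (some c) x ∂μ.toMeasure ≠ ⊤ :=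
      (BoundedContinuousFunction.lintegral_lt_top_of_nnreal μ.toMeasure (χ (some c))).ne
    exact (ENNReal.Tendsto.sub hc tendsto_const_nhds (.inr hfin)).add
      (ENNReal.Tendsto.sub tendsto_const_nhds hc (.inl hfin))
  have hη4 : (0 : ℝ≥0∞) < ENNReal.ofReal (η ^ 2 / 4) := ENNReal.ofReal_pos.2 (by positivity)
  filter_upwards [hconv.eventually (gt_mem_nhds hη4)] with i hi
  obtain ⟨γ, hγ, hcost⟩ := hplan i
  refine W2_lt_of_plan hγ hη (hcost.trans_lt ?_)
  calc _ < ENNReal.ofReal (η ^ 2 / 4) + ENNReal.ofReal (η ^ 2 / 4) + ENNReal.ofReal (η ^ 2 / 4) := by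
        refine (fun hA => ENNReal.add_lt_add_of_le_of_lt (ne_top_of_le_ne_top
          (ENNReal.add_ne_top.2 ⟨ENNReal.ofReal_ne_top, ENNReal.ofReal_ne_top⟩) hA) hA hi)
          (add_le_add ?_ ?_)
        · rw [← ENNReal.ofReal_ofNat, ← ENNReal.ofReal_mul (by positivity),
            ← ENNReal.ofReal_pow (by positivity)]
          exact ENNReal.ofReal_le_ofReal hδη.le
        · calc _ ≤ 4 * (ENNReal.ofReal (K / R ^ 2) + ENNReal.ofReal (K / R ^ 2)) := by
                gcongr
                · exact hrest _ (hK i)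
                · exact hrest _ hKμ
            _ = ENNReal.ofReal (8 * (K / R ^ 2)) := by
                rw [← ENNReal.ofReal_add (by positivity) (by positivity), ← ENNReal.ofReal_ofNat,
                  ← ENNReal.ofReal_mul (by positivity)]
                congr 1; ring
            _ ≤ _ := ENNReal.ofReal_le_ofReal hRη.le
    _ ≤ ENNReal.ofReal (η ^ 2) := by
        rw [← ENNReal.ofReal_add (by positivity) (by positivity),
          ← ENNReal.ofReal_add (by positivity) (by positivity)]
        exact ENNReal.ofReal_le_ofReal (by nlinarith [sq_nonneg η])

end VanishingViscosity

namespace VanishingViscosity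

variable {d : ℕ}

/-! ### Measurability along curves of measures -/

section Measurability

open ProbabilityTheory

/-- Closed sets form a generating π-system, and their indicators are limits of bounded continuous
functions, whose integrals depend continuously on the parameter. -/
theorem measurable_toMeasure_of_continuous {X : Type*} [TopologicalSpace X] [MeasurableSpace X]
    [OpensMeasurableSpace X] {m : X → ProbabilityMeasure (E d)} (hm : Continuous m) :
    Measurable (fun t => (m t : Measure (E d))) := by
  refine .measure_of_isPiSystem_of_isProbabilityMeasure (S := {s : Set (E d) | IsClosed s})
    (by rw [← borel_eq_generateFrom_isClosed]; exact BorelSpace.measurable_eq)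
    isPiSystem_isClosed fun F hF => ?_
  refine measurable_of_tendsto_metrizable (f := fun n t => ∫⁻ x, hF.apprSeq n x ∂(m t : Measure (E d)))
    (fun n => ?_) ?_
  · refine Continuous.measurable ?_
    rw [continuous_iff_continuousAt]
    intro t
    exact ProbabilityMeasure.tendsto_iff_forall_lintegral_tendsto.1 (hm.tendsto t) _
  · rw [tendsto_pi_nhds]
    exact fun t => HasOuterApproxClosed.tendsto_lintegral_apprSeq hF _

/-- A continuous curve in `P2` as a Markov kernel. -/
theorem exists_kernel {T : ℝ} (hT : 0 ≤ T) {μ : ℝ → P2 d} (hμ : IsW2Continuous T μ) :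
    ∃ κ : Kernel ℝ (E d), IsMarkovKernel κ ∧ ∀ t ∈ Icc 0 T, κ t = (μ t).toMeasure := by
  have hc : ContinuousOn (fun t => (μ t).prob) (Icc 0 T) := fun t ht =>
    tendsto_prob_of_tendsto_W2 (hμ t ht)
  have hc' : Continuous (fun t => (μ (projIcc 0 T hT t)).prob) :=
    hc.comp_continuous (continuous_subtype_val.comp continuous_projIcc) fun t => (projIcc 0 T hT t).2
  -- Outside `[0,T]` the curve is frozen at its endpoint values, so that the kernel is defined for
  -- all times.
  refine ⟨⟨fun t => (μ (projIcc 0 T hT t)).toMeasure, measurable_toMeasure_of_continuous hc'⟩,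
    ⟨fun t => (μ _).isProb⟩, fun t ht => ?_⟩
  change (μ (projIcc 0 T hT t)).toMeasure = _
  simp [projIcc_of_mem hT ht]

/-- Joint continuity in the space and measure variables, along sequences. -/
def SeqContinuous {F : Type*} [TopologicalSpace F] (h : E d → P2 d → F) : Prop :=
  ∀ (x : E d) (μ : P2 d) (xs : ℕ → E d) (μs : ℕ → P2 d), Tendsto xs atTop (𝓝 x) →
    Tendsto (fun n => W2 (μs n) μ) atTop (𝓝 0) →
    Tendsto (fun n => h (xs n) (μs n)) atTop (𝓝 (h x μ))

theorem W2_self (μ : P2 d) : W2 μ μ = 0 := by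
  have hγ : μ.toMeasure.map (fun x => (x, x)) ∈ Plans μ μ := by
    constructor
    · rw [Measure.map_map measurable_fst (by fun_prop)]; exact Measure.map_id
    · rw [Measure.map_map measurable_snd (by fun_prop)]; exact Measure.map_id
  have h := W2_sq_le_of_mem_plans hγ
  rw [integral_map (by fun_prop) (by fun_prop)] at h
  simp only [sub_self, norm_zero, ne_eq, OfNat.ofNat_ne_zero, not_false_eq_true, zero_pow,
    integral_zero] at h
  have := W2_nonneg μ μ
  nlinarith

theorem SeqContinuous.continuous {F : Type*} [TopologicalSpace F] {h : E d → P2 d → F}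
    (hh : SeqContinuous h) (μ : P2 d) : Continuous (fun x => h x μ) := by
  rw [continuous_iff_seqContinuous]
  intro xs x hx
  exact hh x μ xs (fun _ => μ) hx (by simp [W2_self])

/-- Rounding is downwards, so the rounded time stays in `[0,T]` although `T` need not be a grid
point. -/
theorem exists_floor_grid {T t : ℝ} (ht : t ∈ Icc 0 T) (n : ℕ) :
    (⌊(n + 1) * t⌋₊ : ℝ) / (n + 1) ∈ Icc 0 T := by
  have h0 := ht.1
  refine ⟨by positivity, ?_⟩
  rw [div_le_iff₀ (by positivity)]
  have := Nat.floor_le (a := (n + 1) * t) (by positivity)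
  nlinarith [ht.2]

theorem tendsto_floor_grid {t : ℝ} (ht : 0 ≤ t) :
    Tendsto (fun n : ℕ => (⌊((n : ℝ) + 1) * t⌋₊ : ℝ) / (n + 1)) atTop (𝓝 t) := by
  have h1 := (tendsto_nat_floor_mul_div_atTop (R := ℝ) ht).comp
    (tendsto_natCast_atTop_atTop.comp (tendsto_add_atTop_nat 1))
  refine h1.congr fun n => ?_
  simp [mul_comm]

theorem IsW2Continuous.tendsto_grid {T : ℝ} {μ : ℝ → P2 d} (hμ : IsW2Continuous T μ) {t : ℝ}
    (ht : t ∈ Icc 0 T) :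
    Tendsto (fun n : ℕ => W2 (μ ((⌊((n : ℝ) + 1) * t⌋₊ : ℝ) / (n + 1))) (μ t)) atTop (𝓝 0) :=
  (hμ t ht).comp (tendsto_nhdsWithin_iff.2
    ⟨tendsto_floor_grid ht.1, .of_forall fun n => exists_floor_grid ht n⟩)

/-- Evaluating a Carathéodory function along a continuous curve of measures. -/
theorem exists_measurable_rep {F : Type*} [NormedAddCommGroup F] {T : ℝ}
    {h : ℝ → E d → P2 d → F} {μ : ℝ → P2 d} (hμ : IsW2Continuous T μ)
    (hm : ∀ x ν, AEStronglyMeasurable (fun t => h t x ν) (volume.restrict (Icc 0 T)))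
    (hc : ∀ t ∈ Icc 0 T, SeqContinuous (h t)) :
    ∃ H : ℝ → E d → F, StronglyMeasurable (Function.uncurry H) ∧ (∀ t, Continuous (H t)) ∧
      ∀ᵐ t ∂volume.restrict (Icc 0 T), ∀ x, H t x = h t x (μ t) := by
  -- For fixed `x`, freeze the measure argument at the last grid time: on each grid interval
  -- measurability is the hypothesis, and refining the grid recovers `h t x (μ t)` by continuity in
  -- the measure.
  have hmx : ∀ x, AEStronglyMeasurable (fun t => h t x (μ t)) (volume.restrict (Icc 0 T)) := by
    intro x
    refine aestronglyMeasurable_of_tendsto_ae atTop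
      (f := fun (n : ℕ) t => h t x (μ ((⌊((n : ℝ) + 1) * t⌋₊ : ℝ) / (n + 1)))) (fun n => ?_) ?_
    · have hcov : (⋃ j : ℕ, (fun t : ℝ => ⌊((n : ℝ) + 1) * t⌋₊) ⁻¹' {j}) = univ := by
        ext; simp
      have hmeas : ∀ j : ℕ, MeasurableSet ((fun t : ℝ => ⌊((n : ℝ) + 1) * t⌋₊) ⁻¹' {j}) := fun j =>
        (Nat.measurable_floor.comp (measurable_const.mul measurable_id)) (measurableSet_singleton j)
      rw [← Measure.restrict_univ (μ := volume.restrict (Icc 0 T)), ← hcov,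
        aestronglyMeasurable_iUnion_iff]
      intro j
      refine ((hm x (μ ((j : ℝ) / (n + 1)))).restrict).congr ?_
      filter_upwards [ae_restrict_mem (hmeas j)] with t ht
      have : ⌊((n : ℝ) + 1) * t⌋₊ = j := ht
      simp only [this]
    · filter_upwards [ae_restrict_mem measurableSet_Icc] with t ht
      exact hc t ht x (μ t) (fun _ => x) _ tendsto_const_nhds (hμ.tendsto_grid ht)
  set D : ℕ → E d := TopologicalSpace.denseSeq (E d)
  have hae : ∀ᵐ t ∂volume.restrict (Icc 0 T), t ∈ Icc 0 T ∧
      ∀ j, (hmx (D j)).mk _ t = h t (D j) (μ t) := by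
    filter_upwards [ae_restrict_mem measurableSet_Icc,
      ae_all_iff.2 fun j => (hmx (D j)).ae_eq_mk] with t ht hj
    exact ⟨ht, fun j => (hj j).symm⟩
  -- The null set on which the Borel version fails depends on `x`, so only countably many points are
  -- treated at once. On the remaining times `G`, continuity in `x` transfers measurability from the
  -- dense sequence to every point.
  obtain ⟨G, hG, hGm, hGsub⟩ := hae.exists_measurable_mem
  set H : ℝ → E d → F := fun t x => G.indicator (fun t => h t x (μ t)) t with hH
  have hHc : ∀ t, Continuous (H t) := fun t => by
    by_cases ht : t ∈ G
    · simp only [hH, indicator_of_mem ht]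
      exact (hc t (hGsub t ht).1).continuous (μ t)
    · simp only [hH, indicator_of_notMem ht]
      exact continuous_const
  have hHD : ∀ j, StronglyMeasurable (fun t => H t (D j)) := fun j => by
    have heq : (fun t => H t (D j)) = G.indicator ((hmx (D j)).mk _) := by
      funext t
      by_cases ht : t ∈ G
      · simp only [hH, indicator_of_mem ht]
        exact ((hGsub t ht).2 j).symm
      · simp only [hH, indicator_of_notMem ht]
    rw [heq]
    exact (hmx (D j)).stronglyMeasurable_mk.indicator hGm
  refine ⟨H, ?_, hHc, ?_⟩
  · have : StronglyMeasurable (Function.uncurry fun x t => H t x) := by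
      refine stronglyMeasurable_uncurry_of_continuous_of_stronglyMeasurable hHc fun x => ?_
      obtain ⟨xs, hxs, hlim⟩ := mem_closure_iff_seq_limit.1
        ((TopologicalSpace.denseRange_denseSeq (E d)).closure_range ▸ mem_univ x)
      choose j hj using hxs
      refine stronglyMeasurable_of_tendsto atTop (fun n => hHD (j n)) ?_
      rw [tendsto_pi_nhds]
      intro t
      have : ∀ n, D (j n) = xs n := hj
      simp only [this]
      exact ((hHc t).tendsto x).comp hlim
    exact this.comp_measurable measurable_swap
  · filter_upwards [hG] with t ht x
    simp only [hH, indicator_of_mem ht]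

theorem aestronglyMeasurable_integral_curve {F : Type*} [NormedAddCommGroup F] [NormedSpace ℝ F]
    {T : ℝ} (hT : 0 ≤ T) {μ : ℝ → P2 d} (hμ : IsW2Continuous T μ) {h H : ℝ → E d → F}
    (hH : StronglyMeasurable (Function.uncurry H))
    (hae : ∀ᵐ t ∂volume.restrict (Icc 0 T), ∀ x, H t x = h t x) :
    AEStronglyMeasurable (fun t => ∫ x, h t x ∂(μ t).toMeasure) (volume.restrict (Icc 0 T)) := by
  obtain ⟨κ, hκ, hκμ⟩ := exists_kernel hT hμ
  refine ⟨_, StronglyMeasurable.integral_kernel_prod_right (κ := κ) hH, ?_⟩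
  filter_upwards [hae, ae_restrict_mem measurableSet_Icc] with t h1 h2
  rw [hκμ t h2]
  simp only [h1]

end Measurability

/-! ### Grönwall's inequality -/

theorem restrict_Icc_eq_Ioc (a b : ℝ) :
    (volume : Measure ℝ).restrict (Icc a b) = volume.restrict (Ioc a b) :=
  Measure.restrict_congr_set Ioc_ae_eq_Icc.symm

/-- Grönwall's inequality in integral form. -/
theorem gronwall_integral {T a C : ℝ} {y : ℝ → ℝ} (ha : 0 ≤ a) (hC : 0 ≤ C)
    (h_int : IntervalIntegrable y volume 0 T) {K : ℝ} (hK : ∀ t ∈ Icc 0 T, y t ≤ K)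
    (h : ∀ t ∈ Icc 0 T, y t ≤ a + C * ∫ s in (0 : ℝ)..t, y s) :
    ∀ t ∈ Icc 0 T, y t ≤ a * Real.exp (C * t) := by
  -- Reinserting the bound into the hypothesis improves the crude bound `K` to a Taylor remainder at
  -- each round; continuity of `y` is not needed.
  have key : ∀ n : ℕ, ∀ t ∈ Icc 0 T, y t ≤ a * Real.exp (C * t)
      + max K 0 * (C * t) ^ n / n.factorial := by
    intro n
    induction n with
    | zero =>
      intro t ht
      have := hK t ht
      have h1 := le_max_left K 0
      have h2 : 0 ≤ a * Real.exp (C * t) := by positivity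
      simp only [pow_zero, mul_one, Nat.factorial_zero, Nat.cast_one, div_one]
      linarith
    | succ n ih =>
      intro t ht
      have ht0 := ht.1
      have hi : IntervalIntegrable y volume 0 t := h_int.mono_set (by
        rw [uIcc_of_le ht0, uIcc_of_le (ht0.trans ht.2)]; exact Icc_subset_Icc_right ht.2)
      have hd : ∀ s : ℝ, HasDerivAt (fun s => a / C * Real.exp (C * s)
          + max K 0 / C * (C * s) ^ (n + 1) / (n + 1).factorial)
          (a / C * (Real.exp (C * s) * C) + max K 0 / C * ((n + 1 : ℕ) * (C * s) ^ n * C)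
            / (n + 1).factorial) s := fun s => by
        have h1 : HasDerivAt (fun s => C * s) C s := by simpa using (hasDerivAt_id s).const_mul C
        exact (h1.exp.const_mul _).add (((h1.pow (n + 1)).const_mul _).div_const _)
      -- The primitive used below divides by `C`, so `C = 0` is settled first.
      rcases hC.eq_or_lt with rfl | hCpos
      · have := h t ht
        simp only [zero_mul, add_zero] at this
        simpa using this
      have hcont : Continuous (fun s => a * Real.exp (C * s)
          + max K 0 * (C * s) ^ n / n.factorial) := by fun_prop
      have hfac : ((n + 1).factorial : ℝ) = (n + 1) * n.factorial := by
        rw [Nat.factorial_succ]; push_cast; ring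
      have hnf : (n.factorial : ℝ) ≠ 0 := by positivity
      have hint2 : ∫ s in (0 : ℝ)..t, (a * Real.exp (C * s) + max K 0 * (C * s) ^ n / n.factorial)
          = (a / C * Real.exp (C * t) + max K 0 / C * (C * t) ^ (n + 1) / (n + 1).factorial)
            - (a / C * Real.exp (C * 0) + max K 0 / C * (C * 0) ^ (n + 1) / (n + 1).factorial) := by
        refine intervalIntegral.integral_eq_sub_of_hasDerivAt (fun s _ => (hd s).congr_deriv ?_)
          (hcont.intervalIntegrable _ _)
        rw [hfac]
        push_cast
        field_simp
      have hmono : ∫ s in (0 : ℝ)..t, y s ≤ ∫ s in (0 : ℝ)..t, (a * Real.exp (C * s)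
          + max K 0 * (C * s) ^ n / n.factorial) :=
        intervalIntegral.integral_mono_on ht0 hi (hcont.intervalIntegrable _ _) fun s hs =>
          ih s ⟨hs.1, hs.2.trans ht.2⟩
      calc y t ≤ a + C * ∫ s in (0 : ℝ)..t, y s := h t ht
        _ ≤ a + C * _ := add_le_add_right (mul_le_mul_of_nonneg_left hmono hC) _
        _ = _ := by
          rw [hint2]
          simp only [mul_zero, Real.exp_zero, ne_eq, Nat.add_eq_zero_iff, one_ne_zero, and_false,
            not_false_eq_true, zero_pow, zero_div, add_zero, mul_one]
          field_simp
          ring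
  intro t ht
  have hlim : Tendsto (fun n : ℕ => a * Real.exp (C * t) + max K 0 * (C * t) ^ n / n.factorial)
      atTop (𝓝 (a * Real.exp (C * t) + 0)) := by
    refine tendsto_const_nhds.add ?_
    simpa [mul_div_assoc] using (FloorSemiring.tendsto_pow_div_factorial_atTop (C * t)).const_mul (max K 0)
  rw [add_zero] at hlim
  exact ge_of_tendsto hlim (.of_forall fun n => key n t ht)

end VanishingViscosity

/-! ### From the weak formulation to an identity at each time -/

namespace VanishingViscosity

variable {d : ℕ}

/-- A smooth decreasing cutoff on `[0, ∞)`, equal to `1` up to time `s` and to `0` after `s + 1/m`. -/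
noncomputable def timeCutoff (s m t : ℝ) : ℝ := Real.smoothTransition (t + 2) * (1 - Real.smoothTransition (m * (t - s)))

theorem contDiff_timeCutoff (s m : ℝ) : ContDiff ℝ ∞ (timeCutoff s m) := by
  unfold timeCutoff
  have h : ContDiff ℝ ∞ Real.smoothTransition := Real.smoothTransition.contDiff
  exact (h.comp (by fun_prop)).mul (contDiff_const.sub (h.comp (by fun_prop)))

theorem timeCutoff_eq_zero {s m t : ℝ} (hm : 0 < m) (ht : t ∉ Icc (-2) (s + 1 / m)) :
    timeCutoff s m t = 0 := by
  rw [mem_Icc, not_and_or, not_le, not_le] at ht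
  rcases ht with ht | ht
  · simp [timeCutoff, Real.smoothTransition.zero_of_nonpos (show t + 2 ≤ 0 by linarith)]
  · have : 1 ≤ m * (t - s) := by
      have : m * (1 / m) ≤ m * (t - s) := by gcongr; linarith
      rwa [mul_one_div_cancel hm.ne'] at this
    simp [timeCutoff, Real.smoothTransition.one_of_one_le this]

theorem tsupport_timeCutoff_subset {s m : ℝ} (hm : 0 < m) :
    tsupport (timeCutoff s m) ⊆ Icc (-2) (s + 1 / m) :=
  closure_minimal (fun t ht => by
    by_contra h
    exact ht (timeCutoff_eq_zero hm h)) isClosed_Icc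

/-- The first factor of the cutoff is there only to make the support compact; it equals `1` in a
neighbourhood of `[0, ∞)`. -/
theorem timeCutoff_eqOn {s m t : ℝ} (ht : -1 ≤ t) :
    timeCutoff s m t = 1 - Real.smoothTransition (m * (t - s)) := by
  simp [timeCutoff, Real.smoothTransition.one_of_one_le (show 1 ≤ t + 2 by linarith)]

theorem deriv_timeCutoff_nonpos {s m t : ℝ} (hm : 0 < m) (ht : 0 ≤ t) :
    deriv (timeCutoff s m) t ≤ 0 := by
  have h : timeCutoff s m =ᶠ[𝓝 t] fun t => 1 - Real.smoothTransition (m * (t - s)) := by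
    filter_upwards [lt_mem_nhds (show -1 < t by linarith)] with r hr
    exact timeCutoff_eqOn hr.le
  rw [h.deriv_eq]
  refine Antitone.deriv_nonpos fun a b hab => ?_
  have := Real.smoothTransition.monotone (show m * (a - s) ≤ m * (b - s) by gcongr)
  linarith

theorem deriv_timeCutoff_eq_zero {s m t : ℝ} (hm : 0 < m) (ht : 0 ≤ t)
    (h : t ∉ Icc s (s + 1 / m)) : deriv (timeCutoff s m) t = 0 := by
  rw [mem_Icc, not_and_or, not_le, not_le] at h
  rcases h with h | h
  · have : timeCutoff s m =ᶠ[𝓝 t] fun _ => 1 := by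
      filter_upwards [lt_mem_nhds (show -1 < t by linarith), gt_mem_nhds h] with r hr hr'
      rw [timeCutoff_eqOn hr.le, Real.smoothTransition.zero_of_nonpos, sub_zero]
      nlinarith
    rw [this.deriv_eq, deriv_const]
  · have : timeCutoff s m =ᶠ[𝓝 t] fun _ => 0 := by
      filter_upwards [lt_mem_nhds h] with r hr
      exact timeCutoff_eq_zero hm fun hr' => absurd hr'.2 (not_le.2 hr)
    rw [this.deriv_eq, deriv_const]

/-- A continuous function whose distributional derivative is integrable is its primitive. -/
theorem eq_add_integral_of_weak_deriv {T : ℝ} {F G : ℝ → ℝ} {F₀ : ℝ}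
    (hF : ContinuousOn F (Icc 0 T)) (hG : IntervalIntegrable G volume 0 T)
    (h : ∀ χ : ℝ → ℝ, ContDiff ℝ ∞ χ → HasCompactSupport χ → tsupport χ ⊆ Iio T →
      ∫ t in (0 : ℝ)..T, (deriv χ t * F t + χ t * G t) = -(χ 0 * F₀)) {t : ℝ} (ht : t ∈ Icc 0 T)
      (hT : 0 < T) :
    F t = F₀ + ∫ s in (0 : ℝ)..t, G s := by
  -- Test with a cutoff that drops from 1 to 0 on `[s, s + 1/(n+1)]`: its derivative tends to minus
  -- the Dirac mass at `s`, and the cutoff itself to the indicator of the times up to `s`.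
  have main : ∀ s ∈ Ico 0 T, F s = F₀ + ∫ r in (0 : ℝ)..s, G r := by
    intro s hs
    have hFi : IntervalIntegrable F volume 0 T := hF.intervalIntegrable_of_Icc hT.le
    have hdc : ∀ n : ℕ, Continuous (deriv (timeCutoff s (n + 1))) := fun n =>
      (contDiff_timeCutoff s _).continuous_deriv (by simp)
    have hcc : ∀ n : ℕ, Continuous (timeCutoff s (n + 1)) := fun n =>
      (contDiff_timeCutoff s _).continuous
    have hval : ∀ n : ℕ, timeCutoff s (n + 1) 0 = 1 := fun n => by
      rw [timeCutoff_eqOn (by norm_num), Real.smoothTransition.zero_of_nonpos, sub_zero]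
      have := hs.1
      have : 0 ≤ ((n : ℝ) + 1) * s := by positivity
      linarith
    have hsmall : ∀ᶠ n : ℕ in atTop, s + 1 / ((n : ℝ) + 1) < T := by
      have : Tendsto (fun n : ℕ => s + 1 / ((n : ℝ) + 1)) atTop (𝓝 (s + 0)) :=
        tendsto_const_nhds.add tendsto_one_div_add_atTop_nhds_zero_nat
      rw [add_zero] at this
      exact this.eventually (gt_mem_nhds hs.2)
    have hlim1 : Tendsto (fun n : ℕ => ∫ t in (0 : ℝ)..T, timeCutoff s (n + 1) t * G t) atTop
        (𝓝 (∫ t in (0 : ℝ)..T, (Iic s).indicator (fun t => G t) t)) := by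
      refine intervalIntegral.tendsto_integral_filter_of_dominated_convergence (fun t => ‖G t‖)
        (.of_forall fun n => ?_) (.of_forall fun n => .of_forall fun t ht => ?_) hG.norm
        (.of_forall fun t ht => ?_)
      · exact (hcc n).aestronglyMeasurable.mul hG.def'.aestronglyMeasurable
      · rw [uIoc_of_le hT.le] at ht
        rw [norm_mul, timeCutoff_eqOn (by linarith [ht.1])]
        refine mul_le_of_le_one_left (norm_nonneg _) ?_
        rw [Real.norm_eq_abs, abs_le]
        constructor <;> linarith [Real.smoothTransition.le_one (((n : ℝ) + 1) * (t - s)),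
          Real.smoothTransition.nonneg (((n : ℝ) + 1) * (t - s))]
      · rw [uIoc_of_le hT.le] at ht
        rcases le_or_gt t s with hts | hts
        · rw [indicator_of_mem (show t ∈ Iic s from hts)]
          refine tendsto_const_nhds.congr fun n => ?_
          rw [timeCutoff_eqOn (by linarith [ht.1]), Real.smoothTransition.zero_of_nonpos,
            sub_zero, one_mul]
          exact mul_nonpos_of_nonneg_of_nonpos (by positivity) (by linarith)
        · rw [indicator_of_notMem (show t ∉ Iic s from not_le.2 hts)]
          refine tendsto_const_nhds.congr' ?_
          have : Tendsto (fun n : ℕ => s + 1 / ((n : ℝ) + 1)) atTop (𝓝 (s + 0)) :=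
            tendsto_const_nhds.add tendsto_one_div_add_atTop_nhds_zero_nat
          rw [add_zero] at this
          filter_upwards [this.eventually (gt_mem_nhds hts)] with n hn
          rw [timeCutoff_eq_zero (by positivity) fun h => absurd h.2 (not_le.2 hn), zero_mul]
    have hind : ∫ t in (0 : ℝ)..T, (Iic s).indicator (fun t => G t) t = ∫ r in (0 : ℝ)..s, G r := by
      rw [intervalIntegral.integral_of_le hT.le, intervalIntegral.integral_of_le hs.1,
        integral_indicator measurableSet_Iic, Measure.restrict_restrict measurableSet_Iic]
      congr 2
      ext r
      simp only [mem_inter_iff, mem_Iic, mem_Ioc]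
      exact ⟨fun h => ⟨h.2.1, h.1⟩, fun h => ⟨h.2, h.1, h.2.trans hs.2.le⟩⟩
    have hlim2 : Tendsto (fun n : ℕ => ∫ t in (0 : ℝ)..T, deriv (timeCutoff s (n + 1)) t * F t) atTop
        (𝓝 (-F s)) := by
      rw [Metric.tendsto_atTop']
      intro η hη
      have hcs := hF s ⟨hs.1, hs.2.le⟩
      rw [Metric.continuousWithinAt_iff] at hcs
      obtain ⟨δ, hδ, hFδ⟩ := hcs (η / 2) (by positivity)
      obtain ⟨N, hN⟩ := (hsmall.and (tendsto_one_div_add_atTop_nhds_zero_nat.eventually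
        (gt_mem_nhds hδ))).exists_forall_of_atTop
      refine ⟨N, fun n hn => ?_⟩
      obtain ⟨h1, h2⟩ := hN n hn.le
      have hm : (0 : ℝ) < n + 1 := by positivity
      have hder : ∫ t in (0 : ℝ)..T, deriv (timeCutoff s (n + 1)) t = -1 := by
        rw [intervalIntegral.integral_deriv_eq_sub
          (fun t _ => ((contDiff_timeCutoff s _).differentiable (by simp)).differentiableAt)
          ((hdc n).intervalIntegrable _ _), hval,
          timeCutoff_eq_zero hm fun h => absurd h.2 (not_le.2 h1)]
        ring
      have e1 : (∫ t in (0 : ℝ)..T, deriv (timeCutoff s (n + 1)) t * F t) - -F s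
          = ∫ t in (0 : ℝ)..T, deriv (timeCutoff s (n + 1)) t * (F t - F s) := by
        simp only [mul_sub]
        rw [intervalIntegral.integral_sub (hFi.continuousOn_mul (hdc n).continuousOn)
          (((hdc n).intervalIntegrable _ _).mul_const _), intervalIntegral.integral_mul_const, hder]
        ring
      rw [Real.dist_eq]
      rw [e1]
      -- The derivative has one sign and total integral `-1`, so its absolute value integrates to 1
      -- whatever the slope.
      have e2 : ‖∫ t in (0 : ℝ)..T, deriv (timeCutoff s (n + 1)) t * (F t - F s)‖
          ≤ ∫ t in (0 : ℝ)..T, -deriv (timeCutoff s (n + 1)) t * (η / 2) := by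
        refine intervalIntegral.norm_integral_le_of_norm_le hT.le (.of_forall fun t ht => ?_)
          (((hdc n).neg.intervalIntegrable _ _).mul_const _)
        by_cases hts : t ∈ Icc s (s + 1 / ((n : ℝ) + 1))
        · rw [norm_mul, Real.norm_eq_abs, abs_of_nonpos (deriv_timeCutoff_nonpos hm ht.1.le)]
          refine mul_le_mul_of_nonneg_left ?_
            (neg_nonneg.2 (deriv_timeCutoff_nonpos hm ht.1.le))
          refine (hFδ ⟨ht.1.le, ht.2⟩ ?_).le
          rw [Real.dist_eq, abs_of_nonneg (by linarith [hts.1])]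
          linarith [hts.2]
        · rw [deriv_timeCutoff_eq_zero hm ht.1.le hts]
          simp
      rw [intervalIntegral.integral_mul_const, intervalIntegral.integral_neg, hder] at e2
      rw [Real.norm_eq_abs] at e2
      linarith
    have hlim3 : Tendsto (fun n : ℕ => ∫ t in (0 : ℝ)..T, (deriv (timeCutoff s (n + 1)) t * F t
        + timeCutoff s (n + 1) t * G t)) atTop (𝓝 (-F s + ∫ r in (0 : ℝ)..s, G r)) := by
      rw [← hind]
      refine (hlim2.add hlim1).congr fun n => ?_
      rw [intervalIntegral.integral_add (hFi.continuousOn_mul (hdc n).continuousOn)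
        (hG.continuousOn_mul (hcc n).continuousOn)]
    have hconst : ∀ᶠ n : ℕ in atTop, ∫ t in (0 : ℝ)..T, (deriv (timeCutoff s (n + 1)) t * F t
        + timeCutoff s (n + 1) t * G t) = -F₀ := by
      filter_upwards [hsmall] with n hn
      have hm : (0 : ℝ) < n + 1 := by positivity
      have hsub := tsupport_timeCutoff_subset (s := s) hm
      rw [h _ (contDiff_timeCutoff s _) (isCompact_Icc.of_isClosed_subset (isClosed_tsupport _) hsub)
        (hsub.trans fun r hr => hr.2.trans_lt hn), hval, one_mul]
    have := tendsto_nhds_unique (tendsto_const_nhds.congr' (hconst.mono fun n hn => hn.symm)) hlim3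
    linarith
  -- At the final time the cutoff has no room before `T`; both sides are continuous there.
  rcases ht.2.lt_or_eq with htT | rfl
  · exact main t ⟨ht.1, htT⟩
  · have hc : ContinuousOn (fun s => F₀ + ∫ r in (0 : ℝ)..s, G r) (Icc 0 t) := by
      refine continuousOn_const.add ?_
      have := intervalIntegral.continuousOn_primitive_interval' hG left_mem_uIcc
      rwa [uIcc_of_le hT.le] at this
    have h1 := (hF t ht).mono_left (nhdsWithin_mono _ Ico_subset_Icc_self)
    have h2 := (hc t ht).mono_left (nhdsWithin_mono _ Ico_subset_Icc_self)
    have hne : (𝓝[Ico 0 t] t).NeBot := by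
      rw [← mem_closure_iff_nhdsWithin_neBot, closure_Ico hT.ne]; exact ht
    exact tendsto_nhds_unique h1 (h2.congr' (by
      filter_upwards [self_mem_nhdsWithin] with s hs
      exact (main s hs).symm))

end VanishingViscosity

namespace VanishingViscosity

variable {d : ℕ}

/-! ### Gradients, Laplacians and cutoffs in space -/

section Calculus

theorem two_le_contDiff_top : (2 : ℕ∞ω) ≤ (∞ : ℕ∞ω) := by
  exact WithTop.coe_le_coe.2 le_top

theorem inner_gradient_eq (φ : E d → ℝ) (x v : E d) : ⟪v, gradient φ x⟫_ℝ = fderiv ℝ φ x v := by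
  rw [real_inner_comm, gradient, InnerProductSpace.toDual_symm_apply]

theorem laplacian_eq_sum (φ : E d → ℝ) (x : E d) :
    Laplacian.laplacian φ x = ∑ i, iteratedFDeriv ℝ 2 φ x
      ![EuclideanSpace.basisFun (Fin d) ℝ i, EuclideanSpace.basisFun (Fin d) ℝ i] :=
  congrFun (InnerProductSpace.laplacian_eq_iteratedFDeriv_orthonormalBasis φ
    (EuclideanSpace.basisFun (Fin d) ℝ)) x

theorem abs_laplacian_le (φ : E d → ℝ) (x : E d) :
    |Laplacian.laplacian φ x| ≤ d * ‖iteratedFDeriv ℝ 2 φ x‖ := by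
  rw [laplacian_eq_sum]
  calc _ ≤ ∑ _i : Fin d, ‖iteratedFDeriv ℝ 2 φ x‖ := by
        refine (Finset.abs_sum_le_sum_abs _ _).trans (Finset.sum_le_sum fun i _ => ?_)
        refine ((iteratedFDeriv ℝ 2 φ x).le_opNorm _).trans_eq ?_
        simp [Fin.prod_univ_two]
    _ = d * ‖iteratedFDeriv ℝ 2 φ x‖ := by simp

theorem continuous_laplacian {φ : E d → ℝ} (hφ : ContDiff ℝ ∞ φ) :
    Continuous (fun x => Laplacian.laplacian φ x) := by
  simp only [laplacian_eq_sum]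
  refine continuous_finsetSum _ fun i _ => ?_
  have h : Continuous (iteratedFDeriv ℝ 2 φ) := hφ.continuous_iteratedFDeriv two_le_contDiff_top
  fun_prop

/-- Smooth cutoffs at scale `n + 1`. -/
theorem exists_spaceCutoff (d : ℕ) : ∃ (C : ℝ) (η : ℕ → E d → ℝ), 0 ≤ C ∧ ∀ n,
    ContDiff ℝ ∞ (η n) ∧ HasCompactSupport (η n) ∧ (∀ x, 0 ≤ η n x ∧ η n x ≤ 1) ∧
    (∀ x, ‖x‖ ≤ n + 1 → η n x = 1) ∧ (∀ x, ‖fderiv ℝ (η n) x‖ * (1 + ‖x‖) ≤ C) ∧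
    (∀ x, ‖iteratedFDeriv ℝ 2 (η n) x‖ * (1 + ‖x‖) ^ 2 ≤ C) := by
  let f : ContDiffBump (0 : E d) := ⟨1, 2, one_pos, one_lt_two⟩
  have hf : ContDiff ℝ ∞ f := f.contDiff
  have hbd : ∀ k : ℕ, ∃ K : ℝ, ∀ x, ‖iteratedFDeriv ℝ k f x‖ ≤ K := fun k => by
    have hc : Continuous (iteratedFDeriv ℝ k f) :=
      hf.continuous_iteratedFDeriv (by exact_mod_cast le_top)
    exact hc.bounded_above_of_compact_support (f.hasCompactSupport.iteratedFDeriv k)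
  obtain ⟨K₁, hK₁⟩ := hbd 1
  obtain ⟨K₂, hK₂⟩ := hbd 2
  have hK₁0 : 0 ≤ K₁ := (norm_nonneg _).trans (hK₁ 0)
  have hK₂0 : 0 ≤ K₂ := (norm_nonneg _).trans (hK₂ 0)
  let L : ℕ → E d →L[ℝ] E d := fun n => ((n : ℝ) + 1)⁻¹ • ContinuousLinearMap.id ℝ (E d)
  have hL : ∀ n, ‖L n‖ ≤ ((n : ℝ) + 1)⁻¹ := fun n => by
    refine ContinuousLinearMap.opNorm_le_bound _ (by positivity) fun x => ?_
    simp only [L, smul_apply, ContinuousLinearMap.id_apply, norm_smul]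
    rw [Real.norm_of_nonneg (by positivity)]
  have hLn : ∀ n x, ‖L n x‖ = ((n : ℝ) + 1)⁻¹ * ‖x‖ := fun n x => by
    simp only [L, smul_apply, ContinuousLinearMap.id_apply, norm_smul]
    rw [Real.norm_of_nonneg (by positivity)]
  have hD : ∀ (n k : ℕ) x, ‖iteratedFDeriv ℝ k (fun x => f (L n x)) x‖
      ≤ ‖iteratedFDeriv ℝ k f (L n x)‖ * (((n : ℝ) + 1)⁻¹) ^ k := fun n k x => by
    have := (L n).iteratedFDeriv_comp_right (f := f) hf x (i := k) (by exact_mod_cast le_top)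
    change ‖iteratedFDeriv ℝ k (f ∘ L n) x‖ ≤ _
    rw [this]
    refine (ContinuousMultilinearMap.norm_compContinuousLinearMap_le _ _).trans ?_
    gcongr
    simp only [Finset.prod_const, Finset.card_univ, Fintype.card_fin]
    gcongr
    exact hL n
  have hz : ∀ (n k : ℕ) x, 2 * ((n : ℝ) + 1) < ‖x‖ → iteratedFDeriv ℝ k f (L n x) = 0 := by
    intro n k x hx
    have : L n x ∉ tsupport f := by
      rw [f.tsupport_eq, Metric.mem_closedBall, dist_zero_right, hLn, not_le]
      change 2 < _
      rw [inv_mul_eq_div, lt_div_iff₀ (by positivity)]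
      exact hx
    exact Function.notMem_support.1 fun h => this (support_iteratedFDeriv_subset k h)
  -- All cutoffs are dilations of one bump. Where a derivative survives, `1 + ‖x‖ ≤ 3 (n + 1)`,
  -- which cancels the factor `(n + 1)⁻ᵏ` produced by the dilation.
  have hfin : ∀ (k : ℕ) (K : ℝ), (∀ x, ‖iteratedFDeriv ℝ k f x‖ ≤ K) → 0 ≤ K → ∀ (n : ℕ) x,
      ‖iteratedFDeriv ℝ k (fun x => f (L n x)) x‖ * (1 + ‖x‖) ^ k ≤ K * 3 ^ k := by
    intro k K hK hK0 n x
    rcases le_or_gt ‖x‖ (2 * ((n : ℝ) + 1)) with hx | hx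
    · have hn : (0 : ℝ) ≤ n := by positivity
      calc _ ≤ (K * (((n : ℝ) + 1)⁻¹) ^ k) * (3 * ((n : ℝ) + 1)) ^ k := by
            gcongr
            · exact (hD n k x).trans (by gcongr; exact hK _)
            · linarith
        _ = K * 3 ^ k := by
            rw [mul_pow, mul_assoc, mul_comm ((3 : ℝ) ^ k), ← mul_assoc (_ ^ k), ← mul_pow,
              inv_mul_cancel₀ (by positivity), one_pow, one_mul]
    · have h1 : ‖iteratedFDeriv ℝ k (fun x => f (L n x)) x‖ ≤ 0 := by
        refine (hD n k x).trans_eq ?_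
        rw [hz n k x hx]; simp
      have h2 : ‖iteratedFDeriv ℝ k (fun x => f (L n x)) x‖ = 0 := le_antisymm h1 (norm_nonneg _)
      rw [h2, zero_mul]
      positivity
  refine ⟨max (K₁ * 3) (K₂ * 3 ^ 2), fun n x => f (L n x), by positivity, fun n => ⟨?_, ?_, ?_, ?_, ?_,
    fun x => ?_⟩⟩
  · exact hf.comp (L n).contDiff
  · refine HasCompactSupport.of_support_subset_isCompact
      (isCompact_closedBall (0 : E d) (2 * ((n : ℝ) + 1))) fun x hx => ?_
    rw [Metric.mem_closedBall, dist_zero_right]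
    by_contra hcon
    have := hz n 0 x (not_le.1 hcon)
    apply hx
    have h0 : ‖iteratedFDeriv ℝ 0 f (L n x)‖ = 0 := by rw [this, norm_zero]
    rwa [norm_iteratedFDeriv_zero, norm_eq_zero] at h0
  · exact fun x => ⟨f.nonneg, f.le_one⟩
  · intro x hx
    refine f.one_of_mem_closedBall ?_
    rw [Metric.mem_closedBall, dist_zero_right, hLn, inv_mul_eq_div]
    exact (div_le_one (by positivity)).2 hx
  · intro x
    have := hfin 1 K₁ hK₁ hK₁0 n x
    rw [norm_iteratedFDeriv_one, pow_one, pow_one] at this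
    exact this.trans (le_max_left _ _)
  · exact (hfin 2 K₂ hK₂ hK₂0 n x).trans (le_max_right _ _)

end Calculus

/-- Weak solutions of the linear equation `∂_t μ + div (v μ) = ε Δ μ`, for a Borel velocity field of
linear growth. -/
structure IsLinearSolution (T : ℝ) (μ₀ : P2 d) (ε : ℝ) (v : ℝ → E d → E d) (μ : ℝ → P2 d) : Prop where
  cont : IsW2Continuous T μ
  meas : Measurable (Function.uncurry v)
  growth : ∃ C : ℝ, ∀ t x, ‖v t x‖ ≤ C * (1 + ‖x‖)
  eq : ∀ φ : ℝ → E d → ℝ, IsTestFunction T φ →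
    ∫ t in (0 : ℝ)..T, ∫ x,
      (deriv (fun s => φ s x) t + ⟪v t x, gradient (φ t) x⟫_ℝ
        + ε * Laplacian.laplacian (φ t) x) ∂(μ t).toMeasure
      = - ∫ x, φ 0 x ∂μ₀.toMeasure

theorem IsW2Continuous.continuousOn_M2 {T : ℝ} {μ : ℝ → P2 d} (h : IsW2Continuous T μ) :
    ContinuousOn (fun t => (μ t).M2) (Icc 0 T) := fun t ht => tendsto_M2 (h t ht)

theorem IsW2Continuous.exists_M2_le {T : ℝ} {μ : ℝ → P2 d} (h : IsW2Continuous T μ) :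
    ∃ C, 0 ≤ C ∧ ∀ t ∈ Icc 0 T, (μ t).M2 ≤ C := by
  obtain ⟨C, hC⟩ := isCompact_Icc.exists_bound_of_continuousOn h.continuousOn_M2
  exact ⟨max C 0, le_max_right _ _, fun t ht => ((le_abs_self _).trans (hC t ht)).trans (le_max_left _ _)⟩

/-- The generator of the linear equation, applied to a function and integrated. -/
noncomputable def generator (ε : ℝ) (v : ℝ → E d → E d) (φ : E d → ℝ) (t : ℝ) (x : E d) : ℝ :=
  fderiv ℝ φ x (v t x) + ε * Laplacian.laplacian φ x

theorem measurable_generator {ε : ℝ} {v : ℝ → E d → E d} (hv : Measurable (Function.uncurry v))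
    {φ : E d → ℝ} (hφ : ContDiff ℝ ∞ φ) : Measurable (Function.uncurry (generator ε v φ)) := by
  have h1 : Continuous (fun z : E d × E d => fderiv ℝ φ z.1 z.2) := by
    have := hφ.continuous_fderiv (by simp)
    fun_prop
  have h2 : Measurable (fun z : ℝ × E d => fderiv ℝ φ z.2 (v z.1 z.2)) :=
    h1.measurable.comp (measurable_snd.prodMk hv)
  exact h2.add (((continuous_laplacian hφ).measurable.comp measurable_snd).const_mul ε)

/-- Linear growth of both the gradient and the velocity yields quadratic growth, the most that
elements of `P2` integrate. The second-order hypothesis carries the factor `|ε|`, so that it is void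
in the inviscid case. -/
theorem norm_generator_le {ε : ℝ} {v : ℝ → E d → E d} {C B : ℝ} (hC : ∀ t x, ‖v t x‖ ≤ C * (1 + ‖x‖))
    {φ : E d → ℝ} (hB : 0 ≤ B) (h1 : ∀ x, ‖fderiv ℝ φ x‖ ≤ B * (1 + ‖x‖))
    (h2 : ∀ x, |ε| * ‖iteratedFDeriv ℝ 2 φ x‖ ≤ B) (t : ℝ) (x : E d) :
    ‖generator ε v φ t x‖ ≤ (2 * B * C + d * B) * (1 + ‖x‖ ^ 2) := by
  have hC0 : 0 ≤ C := by
    have := (norm_nonneg _).trans (hC 0 0)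
    simpa using this
  have e1 : ‖fderiv ℝ φ x (v t x)‖ ≤ B * (1 + ‖x‖) * (C * (1 + ‖x‖)) :=
    ((fderiv ℝ φ x).le_opNorm _).trans (mul_le_mul (h1 x) (hC t x) (norm_nonneg _) (by positivity))
  have e2 : ‖ε * Laplacian.laplacian φ x‖ ≤ d * B := by
    rw [norm_mul, Real.norm_eq_abs, Real.norm_eq_abs]
    calc _ ≤ |ε| * (d * ‖iteratedFDeriv ℝ 2 φ x‖) := by gcongr; exact abs_laplacian_le φ x
      _ = d * (|ε| * ‖iteratedFDeriv ℝ 2 φ x‖) := by ring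
      _ ≤ _ := by gcongr; exact h2 x
  have e3 : (1 + ‖x‖) * (1 + ‖x‖) ≤ 2 * (1 + ‖x‖ ^ 2) := by nlinarith [sq_nonneg (‖x‖ - 1)]
  calc _ ≤ B * (1 + ‖x‖) * (C * (1 + ‖x‖)) + d * B := (norm_add_le _ _).trans (add_le_add e1 e2)
    _ = B * C * ((1 + ‖x‖) * (1 + ‖x‖)) + d * B * 1 := by ring
    _ ≤ B * C * (2 * (1 + ‖x‖ ^ 2)) + d * B * (1 + ‖x‖ ^ 2) := by
      gcongr
      nlinarith [sq_nonneg ‖x‖]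
    _ = _ := by ring

namespace IsLinearSolution

variable {T ε : ℝ} {μ₀ : P2 d} {v : ℝ → E d → E d} {μ : ℝ → P2 d}

theorem intervalIntegrable_generator (hT : 0 < T) (h : IsLinearSolution T μ₀ ε v μ) {φ : E d → ℝ}
    (hφ : ContDiff ℝ ∞ φ) {B : ℝ} (hB : 0 ≤ B) (h1 : ∀ x, ‖fderiv ℝ φ x‖ ≤ B * (1 + ‖x‖))
    (h2 : ∀ x, |ε| * ‖iteratedFDeriv ℝ 2 φ x‖ ≤ B) :
    IntervalIntegrable (fun t => ∫ x, generator ε v φ t x ∂(μ t).toMeasure) volume 0 T := by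
  obtain ⟨C, hC⟩ := h.growth
  obtain ⟨K, hK0, hK⟩ := h.cont.exists_M2_le
  rw [intervalIntegrable_iff_integrableOn_Ioc_of_le hT.le, IntegrableOn, ← restrict_Icc_eq_Ioc]
  refine Integrable.of_bound (aestronglyMeasurable_integral_curve hT.le h.cont
      (measurable_generator h.meas hφ).stronglyMeasurable (.of_forall fun t x => rfl))
      ((2 * B * C + d * B) * (1 + K)) ?_
  filter_upwards [ae_restrict_mem measurableSet_Icc] with t ht
  refine ((μ t).norm_integral_le_of_growth (norm_generator_le hC hB h1 h2 t)).trans ?_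
  have hC0 : 0 ≤ C := by simpa using (norm_nonneg _).trans (hC 0 0)
  gcongr
  exact hK t ht

/-- Products `χ t * φ x` are test functions, and the weak formulation then says that the
distributional time derivative of the integral of `φ` is the integral of the generator. -/
theorem integral_eq_of_compactSupport (hT : 0 < T) (h : IsLinearSolution T μ₀ ε v μ) {φ : E d → ℝ}
    (hφ : ContDiff ℝ ∞ φ) (hcs : HasCompactSupport φ) {t : ℝ} (ht : t ∈ Icc 0 T) :
    ∫ x, φ x ∂(μ t).toMeasure = ∫ x, φ x ∂μ₀.toMeasure
      + ∫ s in (0 : ℝ)..t, ∫ x, generator ε v φ s x ∂(μ s).toMeasure := by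
  obtain ⟨C, hC⟩ := h.growth
  have hbd : ∀ k : ℕ, ∃ K : ℝ, ∀ x, ‖iteratedFDeriv ℝ k φ x‖ ≤ K := fun k => by
    have hc : Continuous (iteratedFDeriv ℝ k φ) :=
      hφ.continuous_iteratedFDeriv (by exact_mod_cast le_top)
    exact hc.bounded_above_of_compact_support (hcs.iteratedFDeriv k)
  obtain ⟨K₁, hK₁⟩ := hbd 1
  obtain ⟨K₂, hK₂⟩ := hbd 2
  simp only [norm_iteratedFDeriv_one] at hK₁
  have hK₁0 : 0 ≤ K₁ := (norm_nonneg _).trans (hK₁ 0)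
  have hK₂0 : 0 ≤ K₂ := (norm_nonneg _).trans (hK₂ 0)
  have hlip : LipschitzWith ⟨K₁, hK₁0⟩ φ :=
    lipschitzWith_of_nnnorm_fderiv_le (hφ.differentiable (by simp)) fun x => hK₁ x
  have hB : 0 ≤ K₁ + |ε| * K₂ := by positivity
  have hB1 : ∀ x, ‖fderiv ℝ φ x‖ ≤ (K₁ + |ε| * K₂) * (1 + ‖x‖) := fun x => by
    have : 0 ≤ |ε| * K₂ := by positivity
    nlinarith [hK₁ x, norm_nonneg x, mul_nonneg hB (norm_nonneg x)]
  have hB2 : ∀ x, |ε| * ‖iteratedFDeriv ℝ 2 φ x‖ ≤ K₁ + |ε| * K₂ := fun x => by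
    have : |ε| * ‖iteratedFDeriv ℝ 2 φ x‖ ≤ |ε| * K₂ := by gcongr; exact hK₂ x
    linarith
  refine eq_add_integral_of_weak_deriv (T := T) (F := fun t => ∫ x, φ x ∂(μ t).toMeasure)
    (F₀ := ∫ x, φ x ∂μ₀.toMeasure) (fun s hs => ?_)
    (h.intervalIntegrable_generator hT hφ hB hB1 hB2) (fun χ hχ hχc hχT => ?_) ht hT
  · exact (locLip_of_lipschitzWith hlip).tendsto_integral (h.cont s hs)
  have htest : IsTestFunction T (fun t x => χ t * φ x) := by
    refine ⟨?_, ?_, ?_⟩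
    · exact (hχ.comp contDiff_fst).mul (hφ.comp contDiff_snd)
    · refine HasCompactSupport.of_support_subset_isCompact (hχc.prod hcs) fun z hz => ?_
      simp only [Function.mem_support, ne_eq, mul_eq_zero, not_or] at hz
      exact ⟨subset_tsupport _ hz.1, subset_tsupport _ hz.2⟩
    · refine (closure_minimal (t := tsupport χ ×ˢ (univ : Set (E d))) (fun z hz => ?_)
        ((isClosed_tsupport χ).prod isClosed_univ)).trans (prod_mono hχT le_rfl)
      simp only [Function.mem_support, ne_eq, mul_eq_zero, not_or] at hz
      exact ⟨subset_tsupport _ hz.1, mem_univ _⟩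
  have heq := h.eq _ htest
  rw [integral_const_mul] at heq
  rw [← heq]
  refine intervalIntegral.integral_congr fun s _ => ?_
  have hi1 : Integrable φ (μ s).toMeasure := (locLip_of_lipschitzWith hlip).integrable _
  have hi2 : Integrable (generator ε v φ s) (μ s).toMeasure :=
    (μ s).integrable_of_growth ((measurable_generator h.meas hφ).comp
      (measurable_const.prodMk measurable_id)).aestronglyMeasurable (norm_generator_le hC hB hB1 hB2 s)
  rw [← integral_const_mul, ← integral_const_mul, ← integral_add (hi1.const_mul _) (hi2.const_mul _)]
  refine integral_congr_ae (.of_forall fun x => ?_)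
  simp only [generator]
  have e1 : deriv (fun s => χ s * φ x) s = deriv χ s * φ x :=
    deriv_mul_const (hχ.differentiable (by simp)).differentiableAt _
  have e2 : fderiv ℝ (fun x => χ s * φ x) x = χ s • fderiv ℝ φ x :=
    fderiv_const_mul (hφ.differentiable (by simp)).differentiableAt _
  have e3 : Laplacian.laplacian (fun x => χ s * φ x) x = χ s * Laplacian.laplacian φ x :=
    InnerProductSpace.laplacian_smul (χ s) ((hφ.of_le two_le_contDiff_top).contDiffAt)
  rw [e1, inner_gradient_eq, e2, e3]
  simp only [smul_apply, smul_eq_mul]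
  ring

/-- The weak formulation extends to smooth functions of quadratic growth. -/
theorem integral_eq (hT : 0 < T) (h : IsLinearSolution T μ₀ ε v μ) {φ : E d → ℝ}
    (hφ : ContDiff ℝ ∞ φ) {B : ℝ} (h0 : ∀ x, |φ x| ≤ B * (1 + ‖x‖ ^ 2))
    (h1 : ∀ x, ‖fderiv ℝ φ x‖ ≤ B * (1 + ‖x‖))
    (h2 : ∀ x, |ε| * ‖iteratedFDeriv ℝ 2 φ x‖ ≤ B) {t : ℝ} (ht : t ∈ Icc 0 T) :
    ∫ x, φ x ∂(μ t).toMeasure = ∫ x, φ x ∂μ₀.toMeasure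
      + ∫ s in (0 : ℝ)..t, ∫ x, generator ε v φ s x ∂(μ s).toMeasure := by
  obtain ⟨C, hC⟩ := h.growth
  obtain ⟨A, η, hA, hη⟩ := exists_spaceCutoff d
  obtain ⟨K, hK0, hK⟩ := h.cont.exists_M2_le
  have hB : 0 ≤ B := by simpa using (abs_nonneg _).trans (h0 0)
  have hC0 : 0 ≤ C := by simpa using (norm_nonneg _).trans (hC 0 0)
  have hηs : ∀ n, ContDiff ℝ ∞ (η n) := fun n => (hη n).1
  have hprod : ∀ n, ContDiff ℝ ∞ (fun x => η n x * φ x) := fun n => (hηs n).mul hφ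
  have hle : ∀ n x, ‖η n x * φ x‖ ≤ B * (1 + ‖x‖ ^ 2) := fun n x => by
    rw [norm_mul, Real.norm_eq_abs, abs_of_nonneg ((hη n).2.2.1 x).1]
    exact (mul_le_of_le_one_left (norm_nonneg _) ((hη n).2.2.1 x).2).trans (h0 x)
  -- By the Leibniz rule, since the first and second derivatives of the cutoffs decay like `(1 +
  -- ‖x‖)⁻¹` and `(1 + ‖x‖)⁻²`, the truncated functions satisfy the same kind of bounds as `φ`,
  -- uniformly in the truncation. This permits dominated convergence.
  set B' := B + B * A + |ε| * (3 * (B * A)) with hB'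
  have hB'0 : 0 ≤ B' := by positivity
  have hquot : ∀ n x, ‖fderiv ℝ (η n) x‖ * |φ x| ≤ B * A * (1 + ‖x‖) := fun n x => by
    calc _ ≤ ‖fderiv ℝ (η n) x‖ * (B * (1 + ‖x‖) ^ 2) := by
          gcongr
          exact (h0 x).trans (by gcongr; nlinarith [norm_nonneg x])
      _ = B * (‖fderiv ℝ (η n) x‖ * (1 + ‖x‖)) * (1 + ‖x‖) := by ring
      _ ≤ _ := by gcongr; exact (hη n).2.2.2.2.1 x
  have hd1 : ∀ n x, ‖fderiv ℝ (fun x => η n x * φ x) x‖ ≤ B' * (1 + ‖x‖) := fun n x => by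
    have : fderiv ℝ (fun x => η n x * φ x) x = η n x • fderiv ℝ φ x + φ x • fderiv ℝ (η n) x :=
      fderiv_mul ((hηs n).differentiable (by simp)).differentiableAt
        (hφ.differentiable (by simp)).differentiableAt
    rw [this]
    calc _ ≤ ‖fderiv ℝ φ x‖ + ‖fderiv ℝ (η n) x‖ * |φ x| := by
          refine (norm_add_le _ _).trans (add_le_add ?_ ?_)
          · rw [norm_smul, Real.norm_eq_abs, abs_of_nonneg ((hη n).2.2.1 x).1]
            exact mul_le_of_le_one_left (norm_nonneg _) ((hη n).2.2.1 x).2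
          · rw [norm_smul, Real.norm_eq_abs, mul_comm]
      _ ≤ B * (1 + ‖x‖) + B * A * (1 + ‖x‖) := add_le_add (h1 x) (hquot n x)
      _ ≤ B' * (1 + ‖x‖) := by
        rw [← add_mul, hB']
        refine mul_le_mul_of_nonneg_right ?_ (by positivity)
        have : 0 ≤ |ε| * (3 * (B * A)) := by positivity
        linarith
  have hd2 : ∀ n x, |ε| * ‖iteratedFDeriv ℝ 2 (fun x => η n x * φ x) x‖ ≤ B' := fun n x => by
    have hL := norm_iteratedFDeriv_mul_le (𝕜 := ℝ) (N := ∞) (hηs n) hφ x (n := 2) two_le_contDiff_top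
    simp only [Finset.sum_range_succ, Finset.range_zero, Finset.sum_empty, Nat.choose_zero_right,
      Nat.cast_one, norm_iteratedFDeriv_zero, zero_add, Nat.choose_one_right, Nat.cast_ofNat,
      Nat.choose_self, one_mul, Nat.sub_zero, norm_iteratedFDeriv_one, Real.norm_eq_abs] at hL
    have f1 : ‖iteratedFDeriv ℝ (2 - 1) φ x‖ = ‖fderiv ℝ φ x‖ := norm_iteratedFDeriv_one φ
    have f2 : ‖iteratedFDeriv ℝ (2 - 2) φ x‖ = |φ x| := norm_iteratedFDeriv_zero
    rw [f1, f2] at hL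
    have e1 : |η n x| * ‖iteratedFDeriv ℝ 2 φ x‖ ≤ ‖iteratedFDeriv ℝ 2 φ x‖ := by
      rw [abs_of_nonneg ((hη n).2.2.1 x).1]
      exact mul_le_of_le_one_left (norm_nonneg _) ((hη n).2.2.1 x).2
    have e2 : ‖fderiv ℝ (η n) x‖ * ‖fderiv ℝ φ x‖ ≤ B * A := by
      calc _ ≤ ‖fderiv ℝ (η n) x‖ * (B * (1 + ‖x‖)) := by gcongr; exact h1 x
        _ = B * (‖fderiv ℝ (η n) x‖ * (1 + ‖x‖)) := by ring
        _ ≤ _ := by gcongr; exact (hη n).2.2.2.2.1 x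
    have e3 : ‖iteratedFDeriv ℝ 2 (η n) x‖ * |φ x| ≤ B * A := by
      calc _ ≤ ‖iteratedFDeriv ℝ 2 (η n) x‖ * (B * (1 + ‖x‖) ^ 2) := by
            gcongr
            exact (h0 x).trans (by gcongr; nlinarith [norm_nonneg x])
        _ = B * (‖iteratedFDeriv ℝ 2 (η n) x‖ * (1 + ‖x‖) ^ 2) := by ring
        _ ≤ _ := by gcongr; exact (hη n).2.2.2.2.2 x
    calc _ ≤ |ε| * (‖iteratedFDeriv ℝ 2 φ x‖ + 3 * (B * A)) := by
          refine mul_le_mul_of_nonneg_left (hL.trans ?_) (abs_nonneg _)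
          linarith
      _ = |ε| * ‖iteratedFDeriv ℝ 2 φ x‖ + |ε| * (3 * (B * A)) := by ring
      _ ≤ B' := by
        rw [hB']
        have : 0 ≤ B * A := by positivity
        linarith [h2 x]
  have hev : ∀ x, ∀ᶠ n : ℕ in atTop, (fun y => η n y * φ y) =ᶠ[𝓝 x] φ := fun x => by
    filter_upwards [eventually_ge_atTop ⌈‖x‖⌉₊] with n hn
    have hxn : ‖x‖ < n + 1 := (Nat.ceil_le.1 hn).trans_lt (lt_add_one _)
    filter_upwards [continuous_norm.continuousAt.eventually_lt_const hxn] with y hy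
    rw [(hη n).2.2.2.1 y hy.le, one_mul]
  have hlimF : ∀ m : P2 d, Tendsto (fun n => ∫ x, η n x * φ x ∂m.toMeasure) atTop
      (𝓝 (∫ x, φ x ∂m.toMeasure)) := fun m => by
    refine tendsto_integral_of_dominated_convergence (fun x => B * (1 + ‖x‖ ^ 2))
      (fun n => (hprod n).continuous.aestronglyMeasurable)
      (((integrable_const (1 : ℝ)).add m.integrable_sq).const_mul B)
      (fun n => .of_forall (hle n)) (.of_forall fun x => ?_)
    exact tendsto_const_nhds.congr' ((hev x).mono fun n hn => hn.self_of_nhds.symm)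
  have hlimG : ∀ s, Tendsto (fun n => ∫ x, generator ε v (fun x => η n x * φ x) s x ∂(μ s).toMeasure)
      atTop (𝓝 (∫ x, generator ε v φ s x ∂(μ s).toMeasure)) := fun s => by
    refine tendsto_integral_of_dominated_convergence
      (fun x => (2 * B' * C + d * B') * (1 + ‖x‖ ^ 2))
      (fun n => ((measurable_generator h.meas (hprod n)).comp
        (measurable_const.prodMk measurable_id)).aestronglyMeasurable)
      (((integrable_const (1 : ℝ)).add (μ s).integrable_sq).const_mul _)
      (fun n => .of_forall (norm_generator_le hC hB'0 (hd1 n) (hd2 n) s)) (.of_forall fun x => ?_)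
    refine tendsto_const_nhds.congr' ((hev x).mono fun n hn => ?_)
    simp only [generator]
    rw [hn.fderiv_eq, (InnerProductSpace.laplacian_congr_nhds hn).self_of_nhds]
  have hlimI : Tendsto (fun n => ∫ s in (0 : ℝ)..t, ∫ x, generator ε v (fun x => η n x * φ x) s x
      ∂(μ s).toMeasure) atTop (𝓝 (∫ s in (0 : ℝ)..t, ∫ x, generator ε v φ s x ∂(μ s).toMeasure)) := by
    refine intervalIntegral.tendsto_integral_filter_of_dominated_convergence
      (fun _ => (2 * B' * C + d * B') * (1 + K)) (.of_forall fun n => ?_)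
      (.of_forall fun n => .of_forall fun s hs => ?_) intervalIntegrable_const
      (.of_forall fun s _ => hlimG s)
    · refine ((h.intervalIntegrable_generator hT (hprod n) hB'0 (hd1 n) (hd2 n)).mono_set
        ?_).def'.aestronglyMeasurable
      rw [uIcc_of_le ht.1, uIcc_of_le hT.le]
      exact Icc_subset_Icc_right ht.2
    · rw [uIoc_of_le ht.1] at hs
      refine ((μ s).norm_integral_le_of_growth (norm_generator_le hC hB'0 (hd1 n) (hd2 n) s)).trans ?_
      gcongr
      exact hK s ⟨hs.1.le, hs.2.trans ht.2⟩
  refine tendsto_nhds_unique (hlimF (μ t)) (((hlimF μ₀).add hlimI).congr fun n => ?_)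
  exact (h.integral_eq_of_compactSupport hT (hprod n) ((hη n).2.1.mul_right) ht).symm

end IsLinearSolution

end VanishingViscosity

namespace VanishingViscosity

variable {d : ℕ}

/-! ### Radial functions and growth of moments -/

section Radial

variable {p p' p'' : ℝ → ℝ}

theorem hasFDerivAt_radial (hp : ∀ s, 0 ≤ s → HasDerivAt p (p' s) s) (x : E d) :
    HasFDerivAt (fun x : E d => p (‖x‖ ^ 2)) ((2 * p' (‖x‖ ^ 2)) • innerSL ℝ x) x := by
  have h1 : HasFDerivAt (fun x : E d => ‖x‖ ^ 2) (2 • (innerSL ℝ x)) x :=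
    (hasStrictFDerivAt_norm_sq x).hasFDerivAt
  have := (hp (‖x‖ ^ 2) (by positivity)).comp_hasFDerivAt x h1
  refine this.congr_fderiv ?_
  ext v
  simp
  ring

theorem norm_fderiv_radial_le (hp : ∀ s, 0 ≤ s → HasDerivAt p (p' s) s) (x : E d) :
    ‖fderiv ℝ (fun x : E d => p (‖x‖ ^ 2)) x‖ ≤ 2 * |p' (‖x‖ ^ 2)| * ‖x‖ := by
  rw [(hasFDerivAt_radial hp x).fderiv, norm_smul, innerSL_apply_norm]
  simp [abs_mul]

/-- The Hessian is `2 p' Id + 4 p'' x ⊗ x`, evaluated at `‖x‖²`. -/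
theorem norm_iteratedFDeriv_two_radial_le (hp : ∀ s, 0 ≤ s → HasDerivAt p (p' s) s)
    (hp' : ∀ s, 0 ≤ s → HasDerivAt p' (p'' s) s) (x : E d) :
    ‖iteratedFDeriv ℝ 2 (fun x : E d => p (‖x‖ ^ 2)) x‖
      ≤ 2 * |p' (‖x‖ ^ 2)| + 4 * (|p'' (‖x‖ ^ 2)| * ‖x‖ ^ 2) := by
  have e : fderiv ℝ (fun x : E d => p (‖x‖ ^ 2)) = fun x => (2 * p' (‖x‖ ^ 2)) • innerSL ℝ x :=
    funext fun x => (hasFDerivAt_radial hp x).fderiv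
  rw [← norm_iteratedFDeriv_fderiv (n := 1), norm_iteratedFDeriv_one, e]
  have h1 : HasFDerivAt (fun x : E d => (2 * p' (‖x‖ ^ 2)) • innerSL ℝ x) _ x :=
    ((hasFDerivAt_radial hp' x).const_mul 2).smul
      ((innerSL ℝ : E d →L[ℝ] E d →L[ℝ] ℝ).hasFDerivAt (x := x))
  rw [h1.fderiv]
  refine ContinuousLinearMap.opNorm_le_bound _ (by positivity) fun v => ?_
  simp only [add_apply, smul_apply, ContinuousLinearMap.smulRight_apply]
  refine (norm_add_le _ _).trans ?_
  rw [norm_smul, norm_smul, innerSL_apply_norm, innerSL_apply_norm, add_mul]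
  refine add_le_add ?_ ?_
  · simp [abs_mul]
  · simp only [smul_eq_mul, norm_mul, Real.norm_eq_abs, abs_two, innerSL_apply_apply]
    have := abs_real_inner_le_norm x v
    calc 2 * (2 * |p'' (‖x‖ ^ 2)| * |⟪x, v⟫_ℝ|) * ‖x‖
        ≤ 2 * (2 * |p'' (‖x‖ ^ 2)| * (‖x‖ * ‖v‖)) * ‖x‖ := by gcongr
      _ = _ := by ring

end Radial

theorem P2.M1_sq_le (μ : P2 d) : μ.M1 ^ 2 ≤ μ.M2 := by
  have h : 0 ≤ ∫ x, (‖x‖ - μ.M1) ^ 2 ∂μ.toMeasure := integral_nonneg fun _ => by positivity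
  have e : ∀ x : E d, (‖x‖ - μ.M1) ^ 2 = ‖x‖ ^ 2 + (-(2 * μ.M1) * ‖x‖ + μ.M1 ^ 2) := fun x => by ring
  simp only [e] at h
  have hi : Integrable (fun x : E d => -(2 * μ.M1) * ‖x‖ + μ.M1 ^ 2) μ.toMeasure :=
    (μ.integrable_norm.const_mul _).add (integrable_const _)
  rw [integral_add μ.integrable_sq hi,
    integral_add (μ.integrable_norm.const_mul _) (integrable_const _), integral_const_mul] at h
  simp only [integral_const, probReal_univ, one_smul] at h
  have : ∫ x, ‖x‖ ∂μ.toMeasure = μ.M1 := rfl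
  rw [this] at h
  have : ∫ x, ‖x‖ ^ 2 ∂μ.toMeasure = μ.M2 := rfl
  nlinarith

section Moments

variable {T ε : ℝ} {μ₀ : P2 d} {v : ℝ → E d → E d} {μ : ℝ → P2 d}

/-- If the generator is controlled by the function itself, so is the moment. -/
theorem IsLinearSolution.moment_le (hT : 0 < T) (h : IsLinearSolution T μ₀ ε v μ) {φ : E d → ℝ}
    (hφ : ContDiff ℝ ∞ φ) {B : ℝ} (h0 : ∀ x, |φ x| ≤ B * (1 + ‖x‖ ^ 2))
    (h1 : ∀ x, ‖fderiv ℝ φ x‖ ≤ B * (1 + ‖x‖))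
    (h2 : ∀ x, |ε| * ‖iteratedFDeriv ℝ 2 φ x‖ ≤ B) (hpos : ∀ x, 0 ≤ φ x)
    {D : ℝ} (hD : 0 ≤ D) (hgen : ∀ t ∈ Icc 0 T, ∫ x, generator ε v φ t x ∂(μ t).toMeasure
      ≤ D * (1 + ∫ x, φ x ∂(μ t).toMeasure)) {t : ℝ} (ht : t ∈ Icc 0 T) :
    1 + ∫ x, φ x ∂(μ t).toMeasure ≤ (1 + ∫ x, φ x ∂μ₀.toMeasure) * Real.exp (D * T) := by
  have hB : 0 ≤ B := by simpa using (abs_nonneg _).trans (h0 0)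
  obtain ⟨K, hK0, hK⟩ := h.cont.exists_M2_le
  have hGi := h.intervalIntegrable_generator hT hφ hB h1 h2
  have hform : ∀ s ∈ Icc 0 T, 1 + ∫ x, φ x ∂(μ s).toMeasure = 1 + ∫ x, φ x ∂μ₀.toMeasure
      + ∫ r in (0 : ℝ)..s, ∫ x, generator ε v φ r x ∂(μ r).toMeasure := fun s hs => by
    rw [h.integral_eq hT hφ h0 h1 h2 hs, add_assoc]
  have hcont : ContinuousOn (fun s => 1 + ∫ x, φ x ∂(μ s).toMeasure) (Icc 0 T) := by
    have hc := intervalIntegral.continuousOn_primitive_interval' hGi left_mem_uIcc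
    rw [uIcc_of_le hT.le] at hc
    exact (continuousOn_const.add hc).congr hform
  have hyi : IntervalIntegrable (fun s => 1 + ∫ x, φ x ∂(μ s).toMeasure) volume 0 T :=
    hcont.intervalIntegrable_of_Icc hT.le
  have hnn : 0 ≤ ∫ x, φ x ∂μ₀.toMeasure := integral_nonneg hpos
  have := gronwall_integral (a := 1 + ∫ x, φ x ∂μ₀.toMeasure) (C := D)
    (y := fun s => 1 + ∫ x, φ x ∂(μ s).toMeasure) (T := T) (by positivity) hD hyi
    (K := 1 + B * (1 + K)) (fun s hs => ?_) (fun s hs => ?_) t ht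
  · refine this.trans ?_
    gcongr
    exact ht.2
  · have h3 := (μ s).norm_integral_le_of_growth (φ := φ) h0
    have h4 : B * (1 + (μ s).M2) ≤ B * (1 + K) := by gcongr; exact hK s hs
    have := le_abs_self (∫ x, φ x ∂(μ s).toMeasure)
    rw [Real.norm_eq_abs] at h3
    linarith
  · have hsub : uIcc 0 s ⊆ uIcc 0 T := by
      rw [uIcc_of_le hs.1, uIcc_of_le hT.le]; exact Icc_subset_Icc_right hs.2
    rw [hform s hs, ← intervalIntegral.integral_const_mul]
    refine add_le_add_right ?_ _
    refine intervalIntegral.integral_mono_on hs.1 (hGi.mono_set hsub)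
      ((hyi.mono_set hsub).const_mul D) fun r hr => hgen r ⟨hr.1, hr.2.trans hs.2⟩

theorem generator_le_of_bounds {φ : E d → ℝ} (hε : |ε| ≤ 1) (t : ℝ) (x : E d) {V P Q : ℝ}
    (hv : ‖v t x‖ ≤ V) (h1 : ‖fderiv ℝ φ x‖ ≤ P) (h2 : ‖iteratedFDeriv ℝ 2 φ x‖ ≤ Q) :
    generator ε v φ t x ≤ P * V + d * Q := by
  have hP : 0 ≤ P := (norm_nonneg _).trans h1
  have e1 : fderiv ℝ φ x (v t x) ≤ P * V :=
    (le_abs_self _).trans (((fderiv ℝ φ x).le_opNorm _).trans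
      (mul_le_mul h1 hv (norm_nonneg _) hP))
  have e2 : ε * Laplacian.laplacian φ x ≤ d * Q := by
    refine (le_abs_self _).trans ?_
    rw [abs_mul]
    calc _ ≤ 1 * (d * Q) := by
          gcongr
          exact (abs_laplacian_le φ x).trans (by gcongr)
      _ = _ := one_mul _
  exact add_le_add e1 e2

/-- The generator applied to `‖x‖²` is at most `2 ‖x‖ ‖v‖` plus a multiple of the dimension. The
nonlocal term in the growth of `v` is absorbed through `M1² ≤ M2`, and Grönwall applies with a rate
free of `ε`. -/
theorem IsLinearSolution.M2_le (hT : 0 < T) (h : IsLinearSolution T μ₀ ε v μ) (hε : |ε| ≤ 1)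
    {a : ℝ} (ha : 0 ≤ a) (hv : ∀ t ∈ Icc 0 T, ∀ x, ‖v t x‖ ≤ a * (1 + ‖x‖ + (μ t).M1)) {t : ℝ}
    (ht : t ∈ Icc 0 T) : 1 + (μ t).M2 ≤ (1 + μ₀.M2) * Real.exp ((8 * a + 2 * d) * T) := by
  obtain ⟨C, hC⟩ := h.growth
  have hp : ∀ s : ℝ, 0 ≤ s → HasDerivAt (fun s : ℝ => s) ((fun _ => 1) s) s := fun s _ => hasDerivAt_id s
  have hp' : ∀ s : ℝ, 0 ≤ s → HasDerivAt (fun _ : ℝ => (1 : ℝ)) ((fun _ => 0) s) s := fun s _ =>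
    hasDerivAt_const s 1
  have hφ : ContDiff ℝ ∞ (fun x : E d => ‖x‖ ^ 2) := contDiff_norm_sq ℝ
  have b1 : ∀ x : E d, ‖fderiv ℝ (fun x : E d => ‖x‖ ^ 2) x‖ ≤ 2 * ‖x‖ := fun x => by
    simpa using norm_fderiv_radial_le hp x
  have b2 : ∀ x : E d, ‖iteratedFDeriv ℝ 2 (fun x : E d => ‖x‖ ^ 2) x‖ ≤ 2 := fun x => by
    simpa using norm_iteratedFDeriv_two_radial_le hp hp' x
  have c0 : ∀ x : E d, |‖x‖ ^ 2| ≤ 2 * (1 + ‖x‖ ^ 2) := fun x => by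
    rw [abs_of_nonneg (by positivity)]; nlinarith [sq_nonneg ‖x‖]
  have c1 : ∀ x : E d, ‖fderiv ℝ (fun x : E d => ‖x‖ ^ 2) x‖ ≤ 2 * (1 + ‖x‖) := fun x =>
    (b1 x).trans (by linarith)
  have c2 : ∀ x : E d, |ε| * ‖iteratedFDeriv ℝ 2 (fun x : E d => ‖x‖ ^ 2) x‖ ≤ 2 := fun x => by
    calc _ ≤ 1 * (2 : ℝ) := by gcongr; exact b2 x
      _ = 2 := one_mul _
  refine h.moment_le hT hφ c0 c1 c2 (fun x => by positivity) (by positivity) (fun s hs => ?_) ht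
  set m := (μ s).M1
  have hm : 0 ≤ m := (μ s).M1_nonneg
  have i1 : Integrable (fun x : E d => (2 * a * (1 + m ^ 2) + 2 * d) + 6 * a * ‖x‖ ^ 2)
      (μ s).toMeasure := (integrable_const _).add ((μ s).integrable_sq.const_mul _)
  calc _ ≤ ∫ x, ((2 * a * (1 + m ^ 2) + 2 * d) + 6 * a * ‖x‖ ^ 2) ∂(μ s).toMeasure := by
        refine integral_mono ?_ i1 fun x => ?_
        · exact (μ s).integrable_of_growth ((measurable_generator h.meas hφ).comp
            (measurable_const.prodMk measurable_id)).aestronglyMeasurable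
            (norm_generator_le hC (by norm_num) c1 c2 s)
        · refine (generator_le_of_bounds hε s x (hv s hs x) (b1 x) (b2 x)).trans ?_
          have : ‖x‖ * (1 + ‖x‖ + m) ≤ 1 + m ^ 2 + 3 * ‖x‖ ^ 2 := by
            nlinarith [sq_nonneg (‖x‖ - 1), sq_nonneg (‖x‖ - m), sq_nonneg ‖x‖, sq_nonneg m]
          have := mul_le_mul_of_nonneg_left this ha
          nlinarith
    _ = (2 * a * (1 + m ^ 2) + 2 * d) + 6 * a * (μ s).M2 := by
        rw [integral_add (integrable_const _) ((μ s).integrable_sq.const_mul _), integral_const_mul]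
        simp [P2.M2]
    _ ≤ (8 * a + 2 * d) * (1 + (μ s).M2) := by
        have h3 := mul_le_mul_of_nonneg_left (μ s).M1_sq_le ha
        have h4 := (μ s).M2_nonneg
        have h5 : 0 ≤ (d : ℝ) * (μ s).M2 := by positivity
        have h6 : a * (μ s).M1 ^ 2 = a * m ^ 2 := rfl
        nlinarith

/-- A function of quadratic growth approximating `s ^ 2`. -/
noncomputable def quarticApprox (N s : ℝ) : ℝ := N * s ^ 2 / (N + s)

theorem quarticApprox_facts {N : ℝ} (hN : 1 ≤ N) :
    (∀ s, 0 ≤ s → HasDerivAt (quarticApprox N) (N * s * (s + 2 * N) / (N + s) ^ 2) s) ∧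
    (∀ s, 0 ≤ s → HasDerivAt (fun s => N * s * (s + 2 * N) / (N + s) ^ 2)
      (2 * N ^ 3 / (N + s) ^ 3) s) := by
  refine ⟨fun s hs => ?_, fun s hs => ?_⟩
  · have hne : N + s ≠ 0 := by positivity
    have h1 : HasDerivAt (fun s => N * s ^ 2) (N * (2 * s)) s := by
      simpa using (hasDerivAt_pow 2 s).const_mul N
    have h2 : HasDerivAt (fun s => N + s) 1 s := by simpa using (hasDerivAt_id s).const_add N
    refine (h1.div h2 hne).congr_deriv ?_
    field_simp
    ring
  · have hne : N + s ≠ 0 := by positivity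
    have h1 : HasDerivAt (fun s => N * s * (s + 2 * N)) (N * (s + 2 * N) + N * s) s := by
      have ha : HasDerivAt (fun s => N * s) N s := by simpa using (hasDerivAt_id s).const_mul N
      have hb : HasDerivAt (fun s => s + 2 * N) 1 s := by
        simpa using (hasDerivAt_id s).add_const (2 * N)
      exact (ha.mul hb).congr_deriv (by simp)
    have h2 : HasDerivAt (fun s => (N + s) ^ 2) (2 * (N + s)) s := by
      exact (((hasDerivAt_id s).const_add N).pow 2).congr_deriv (by simp)
    refine (h1.div h2 (by positivity)).congr_deriv ?_
    field_simp
    ring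

/-- With `r = N / (N + s)`, which lies in `[0,1]`, the function is `r s²`, its derivative is `r s (1
+ r)` and `s` times its second derivative is `2 r³ s`. The bounds involving `N` make it admissible
in the weak formulation; those involving the function itself do not see `N` and feed Grönwall. -/
theorem quarticApprox_bounds {N s : ℝ} (hN : 1 ≤ N) (hs : 0 ≤ s) :
    0 ≤ quarticApprox N s ∧ quarticApprox N s ≤ N * s ∧ quarticApprox N s ≤ s ^ 2 ∧
    0 ≤ N * s * (s + 2 * N) / (N + s) ^ 2 ∧
    N * s * (s + 2 * N) / (N + s) ^ 2 ≤ 2 * N ∧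
    N * s * (s + 2 * N) / (N + s) ^ 2 * s ≤ 2 * quarticApprox N s ∧
    N * s * (s + 2 * N) / (N + s) ^ 2 ≤ 2 * (1 + quarticApprox N s) ∧
    0 ≤ 2 * N ^ 3 / (N + s) ^ 3 ∧ 2 * N ^ 3 / (N + s) ^ 3 * s ≤ 2 * N ∧
    2 * N ^ 3 / (N + s) ^ 3 * s ≤ 2 * (1 + quarticApprox N s) := by
  have hpos : 0 < N + s := by positivity
  have hN0 : 0 < N := by linarith
  set r := N / (N + s) with hr
  have hr0 : 0 ≤ r := by positivity
  have hr1 : r ≤ 1 := (div_le_one hpos).2 (by linarith)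
  have eq1 : quarticApprox N s = r * s ^ 2 := by rw [hr, quarticApprox]; ring
  have eq2 : N * s * (s + 2 * N) / (N + s) ^ 2 = r * s * (1 + r) := by
    rw [hr]; field_simp; ring
  have eq3 : 2 * N ^ 3 / (N + s) ^ 3 * s = 2 * (r ^ 2 * (r * s)) := by
    rw [hr]; field_simp
  have hrs : r * s ≤ N := by
    rw [hr, div_mul_eq_mul_div, div_le_iff₀ hpos]; nlinarith
  have hrs0 : 0 ≤ r * s := by positivity
  have hrs1 : r * s ≤ 1 + r * s ^ 2 := by
    nlinarith [mul_nonneg hr0 (sq_nonneg (s - 1)), mul_nonneg hr0 (sq_nonneg s)]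
  have hr2 : r ^ 2 ≤ 1 := pow_le_one₀ hr0 hr1
  have h3 : r ^ 2 * (r * s) ≤ r * s := mul_le_of_le_one_left hrs0 hr2
  rw [eq3, eq2, eq1]
  refine ⟨by positivity, ?_, ?_, by positivity, ?_, ?_, ?_, by positivity, ?_, ?_⟩
  · nlinarith
  · nlinarith [sq_nonneg s]
  · nlinarith
  · nlinarith [mul_nonneg hr0 (sq_nonneg s), mul_nonneg (mul_nonneg hr0 (sq_nonneg s)) (sub_nonneg.2 hr1)]
  · nlinarith
  · linarith
  · linarith

theorem contDiff_quarticApprox {N : ℝ} (hN : 1 ≤ N) :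
    ContDiff ℝ ∞ (fun x : E d => quarticApprox N (‖x‖ ^ 2)) := by
  unfold quarticApprox
  have h : ContDiff ℝ ∞ (fun x : E d => ‖x‖ ^ 2) := contDiff_norm_sq ℝ
  exact (contDiff_const.mul (h.pow 2)).div (contDiff_const.add h) fun x => by positivity

/-- The fourth power is not admissible before its integrability is known. Its truncation has
quadratic growth and obeys the differential inequality of the fourth moment with a rate independent
of `N`. -/
theorem IsLinearSolution.quarticApprox_le (hT : 0 < T) (h : IsLinearSolution T μ₀ ε v μ)
    (hε : |ε| ≤ 1) {A : ℝ} (hA : 0 ≤ A) (hv : ∀ t ∈ Icc 0 T, ∀ x, ‖v t x‖ ≤ A * (1 + ‖x‖))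
    {N : ℝ} (hN : 1 ≤ N) {t : ℝ} (ht : t ∈ Icc 0 T) :
    1 + ∫ x, quarticApprox N (‖x‖ ^ 2) ∂(μ t).toMeasure
      ≤ (1 + ∫ x, quarticApprox N (‖x‖ ^ 2) ∂μ₀.toMeasure) * Real.exp ((12 * A + 12 * d) * T) := by
  obtain ⟨C, hC⟩ := h.growth
  obtain ⟨hp, hp'⟩ := quarticApprox_facts hN
  have hφ := contDiff_quarticApprox (d := d) hN
  have hq := fun x : E d => quarticApprox_bounds hN (sq_nonneg ‖x‖)
  have b1 := fun x : E d => norm_fderiv_radial_le (p := quarticApprox N) hp x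
  have b2 := fun x : E d => norm_iteratedFDeriv_two_radial_le (p := quarticApprox N) hp hp' x
  have a1 := fun x : E d => abs_of_nonneg (hq x).2.2.2.1
  have a2 := fun x : E d => abs_of_nonneg (hq x).2.2.2.2.2.2.2.1
  simp only [a1] at b1
  simp only [a1, a2] at b2
  have c0 : ∀ x : E d, |quarticApprox N (‖x‖ ^ 2)| ≤ 12 * N * (1 + ‖x‖ ^ 2) := fun x => by
    rw [abs_of_nonneg (hq x).1]
    have := (hq x).2.1
    nlinarith [sq_nonneg ‖x‖, mul_nonneg (zero_le_one.trans hN) (sq_nonneg ‖x‖)]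
  have c1 : ∀ x : E d, ‖fderiv ℝ (fun x : E d => quarticApprox N (‖x‖ ^ 2)) x‖
      ≤ 12 * N * (1 + ‖x‖) := fun x => by
    refine (b1 x).trans ?_
    have := mul_le_mul_of_nonneg_right (hq x).2.2.2.2.1 (norm_nonneg x)
    nlinarith [norm_nonneg x, mul_nonneg (zero_le_one.trans hN) (norm_nonneg x)]
  have c2 : ∀ x : E d, |ε| * ‖iteratedFDeriv ℝ 2 (fun x : E d => quarticApprox N (‖x‖ ^ 2)) x‖
      ≤ 12 * N := fun x => by
    calc _ ≤ 1 * (12 * N) := by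
          gcongr
          refine (b2 x).trans ?_
          have h1 := (hq x).2.2.2.2.1
          have h2 := (hq x).2.2.2.2.2.2.2.2.1
          linarith
      _ = _ := one_mul _
  have hqi : ∀ m : P2 d, Integrable (fun x => quarticApprox N (‖x‖ ^ 2)) m.toMeasure := fun m =>
    m.integrable_of_growth hφ.continuous.aestronglyMeasurable c0
  refine h.moment_le hT hφ c0 c1 c2 (fun x => (hq x).1) (by positivity) (fun s hs => ?_) ht
  have hi : Integrable (fun x : E d => (12 * A + 12 * d) * (1 + quarticApprox N (‖x‖ ^ 2)))
      (μ s).toMeasure := ((integrable_const _).add (hqi _)).const_mul _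
  calc _ ≤ ∫ x, (12 * A + 12 * d) * (1 + quarticApprox N (‖x‖ ^ 2)) ∂(μ s).toMeasure := by
        refine integral_mono ?_ hi fun x => ?_
        · exact (μ s).integrable_of_growth ((measurable_generator h.meas hφ).comp
            (measurable_const.prodMk measurable_id)).aestronglyMeasurable
            (norm_generator_le hC (by positivity) c1 c2 s)
        · refine (generator_le_of_bounds hε s x (hv s hs x) (b1 x) (b2 x)).trans ?_
          obtain ⟨q0, -, -, q1, -, q2, q3, q4, -, q5⟩ := hq x
          set q := quarticApprox N (‖x‖ ^ 2)
          set P := N * ‖x‖ ^ 2 * (‖x‖ ^ 2 + 2 * N) / (N + ‖x‖ ^ 2) ^ 2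
          set Q := 2 * N ^ 3 / (N + ‖x‖ ^ 2) ^ 3
          have e1 : P * (‖x‖ * (1 + ‖x‖)) ≤ 6 * (1 + q) := by
            have : ‖x‖ * (1 + ‖x‖) ≤ 1 + 2 * ‖x‖ ^ 2 := by nlinarith [sq_nonneg (‖x‖ - 1)]
            have := mul_le_mul_of_nonneg_left this q1
            nlinarith
          have e2 := mul_le_mul_of_nonneg_left e1 hA
          have e3 : 2 * P + 4 * (Q * ‖x‖ ^ 2) ≤ 12 * (1 + q) := by linarith
          have e4 := mul_le_mul_of_nonneg_left e3 (Nat.cast_nonneg (α := ℝ) d)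
          nlinarith
    _ = _ := by
        rw [integral_const_mul, integral_add (integrable_const _) (hqi _)]
        simp

end Moments

end VanishingViscosity

namespace VanishingViscosity

variable {d : ℕ}

/-! ### Moment bounds uniform in the viscosity -/

section UniformMoments

variable {T : ℝ} {μ₀ : P2 d}

theorem tendsto_quarticApprox (s : ℝ) :
    Tendsto (fun n : ℕ => quarticApprox (n + 1) s) atTop (𝓝 (s ^ 2)) := by
  have h1 : Tendsto (fun n : ℕ => ((n : ℝ) + 1)) atTop atTop :=
    tendsto_atTop_add_const_right _ _ tendsto_natCast_atTop_atTop
  have h2 : Tendsto (fun n : ℕ => s ^ 2 / (1 + s * ((n : ℝ) + 1)⁻¹)) atTop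
      (𝓝 (s ^ 2 / (1 + s * 0))) :=
    Tendsto.div tendsto_const_nhds
      (tendsto_const_nhds.add (tendsto_const_nhds.mul (tendsto_inv_atTop_zero.comp h1))) (by simp)
  simp only [mul_zero, add_zero, div_one] at h2
  refine h2.congr fun n => ?_
  have hn : (n : ℝ) + 1 ≠ 0 := by positivity
  rw [quarticApprox]
  have : (n : ℝ) + 1 + s = (n + 1) * (1 + s * ((n : ℝ) + 1)⁻¹) := by field_simp
  rw [this, mul_div_mul_left _ _ hn]

/-- Second and fourth moments of solutions are bounded uniformly in the viscosity. -/
theorem exists_uniform_moment (hT : 0 < T)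
    (hμ₀ : ∃ K : Set (E d), IsCompact K ∧ μ₀.toMeasure Kᶜ = 0) {a : ℝ} (ha : 0 ≤ a) :
    ∃ K : ℝ≥0, ∀ (ε : ℝ) (v : ℝ → E d → E d) (μ : ℝ → P2 d), |ε| ≤ 1 →
      IsLinearSolution T μ₀ ε v μ →
      (∀ t ∈ Icc 0 T, ∀ x, ‖v t x‖ ≤ a * (1 + ‖x‖ + (μ t).M1)) →
      ∀ t ∈ Icc 0 T, (μ t).M2 ≤ K ∧ ∫⁻ x, ‖x‖ₑ ^ 4 ∂(μ t).toMeasure ≤ K := by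
  obtain ⟨S, hS, hS0⟩ := hμ₀
  obtain ⟨R, hR⟩ := hS.isBounded.exists_norm_le
  set K₁ : ℝ := (1 + μ₀.M2) * Real.exp ((8 * a + 2 * d) * T) with hK₁
  have hK₁0 : 0 ≤ K₁ := by have := μ₀.M2_nonneg; positivity
  -- The second moment bound gives `M1 ≤ 1 + M2 ≤ K₁`, so the velocity has linear growth in `x`
  -- alone, with this constant.
  set A : ℝ := a * (2 + K₁) with hA
  have hA0 : 0 ≤ A := by positivity
  set K₂ : ℝ := (1 + R ^ 4) * Real.exp ((12 * A + 12 * d) * T) with hK₂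
  have hK₂0 : 0 ≤ K₂ := by positivity
  -- The only use of the compact support of `μ₀` here: its truncated fourth moments are bounded by
  -- `R ^ 4`.
  have hini : ∀ n : ℕ, ∫ x, quarticApprox (n + 1) (‖x‖ ^ 2) ∂μ₀.toMeasure ≤ R ^ 4 := fun n => by
    have hn : (1 : ℝ) ≤ n + 1 := by simp
    have hae : ∀ᵐ x ∂μ₀.toMeasure, ‖quarticApprox (n + 1) (‖x‖ ^ 2)‖ ≤ R ^ 4 := by
      filter_upwards [compl_mem_ae_iff.2 hS0] with x hx
      simp only [compl_compl] at hx
      have hb := quarticApprox_bounds hn (sq_nonneg ‖x‖)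
      rw [Real.norm_of_nonneg hb.1]
      refine hb.2.2.1.trans ?_
      rw [← pow_mul]
      exact pow_le_pow_left₀ (norm_nonneg _) (hR x hx) 4
    have := norm_integral_le_of_norm_le_const hae
    simp only [probReal_univ, mul_one] at this
    exact (le_abs_self _).trans this
  refine ⟨(K₁ + K₂).toNNReal, fun ε v μ hε h hv t ht => ?_⟩
  have hM2 : ∀ t ∈ Icc 0 T, 1 + (μ t).M2 ≤ K₁ := fun t ht => h.M2_le hT hε ha hv ht
  refine ⟨?_, ?_⟩
  · have := hM2 t ht
    rw [Real.coe_toNNReal _ (by positivity)]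
    linarith
  have hv' : ∀ t ∈ Icc 0 T, ∀ x, ‖v t x‖ ≤ A * (1 + ‖x‖) := fun t ht x => by
    refine (hv t ht x).trans ?_
    have h1 := hM2 t ht
    have h2 := (μ t).M1_le
    rw [hA, mul_assoc]
    refine mul_le_mul_of_nonneg_left ?_ ha
    nlinarith [norm_nonneg x]
  have hbd : ∀ n : ℕ, ∫⁻ x, ENNReal.ofReal (quarticApprox (n + 1) (‖x‖ ^ 2)) ∂(μ t).toMeasure
      ≤ ENNReal.ofReal K₂ := fun n => by
    have hn : (1 : ℝ) ≤ n + 1 := by simp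
    have hb := fun x : E d => quarticApprox_bounds hn (sq_nonneg ‖x‖)
    rw [← ofReal_integral_eq_lintegral_ofReal _ (.of_forall fun x => (hb x).1)]
    · refine ENNReal.ofReal_le_ofReal ?_
      have h1 := h.quarticApprox_le hT hε hA0 hv' hn ht
      have h2 : (1 + ∫ x, quarticApprox (n + 1) (‖x‖ ^ 2) ∂μ₀.toMeasure)
          * Real.exp ((12 * A + 12 * d) * T) ≤ K₂ := by
        rw [hK₂]
        gcongr
        exact hini n
      linarith
    · refine (μ t).integrable_of_growth (C := n + 1)
        (contDiff_quarticApprox hn).continuous.aestronglyMeasurable fun x => ?_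
      rw [Real.norm_of_nonneg (hb x).1]
      nlinarith [(hb x).2.1]
  -- Fatou's lemma removes the truncation.
  calc ∫⁻ x, ‖x‖ₑ ^ 4 ∂(μ t).toMeasure
      = ∫⁻ x, liminf (fun n : ℕ => ENNReal.ofReal (quarticApprox (n + 1) (‖x‖ ^ 2))) atTop
          ∂(μ t).toMeasure := by
        refine lintegral_congr fun x => ?_
        rw [(ENNReal.tendsto_ofReal (tendsto_quarticApprox (‖x‖ ^ 2))).liminf_eq, ← pow_mul,
          ENNReal.ofReal_pow (norm_nonneg _), ofReal_norm]
    _ ≤ liminf (fun n : ℕ => ∫⁻ x, ENNReal.ofReal (quarticApprox (n + 1) (‖x‖ ^ 2))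
          ∂(μ t).toMeasure) atTop := by
        refine lintegral_liminf_le fun n => ?_
        have hn : (1 : ℝ) ≤ n + 1 := by simp
        exact (contDiff_quarticApprox hn).continuous.measurable.ennreal_ofReal
    _ ≤ ENNReal.ofReal K₂ := liminf_le_of_le (by isBoundedDefault) fun b hb => by
        obtain ⟨n, hn⟩ := hb.exists
        exact hn.trans (hbd n)
    _ ≤ _ := by
        exact ENNReal.ofReal_le_ofReal (by linarith)

end UniformMoments

/-! ### Freezing the law in the velocity -/

section Velocity

variable {T : ℝ} {μ₀ : P2 d} {b : ℝ → E d → P2 d → E d}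

theorem AssumptionB.seqContinuous (hb : AssumptionB T b) {t : ℝ} (ht : t ∈ Icc 0 T) :
    SeqContinuous (b t) := by
  obtain ⟨L, hL⟩ := hb.lipschitz
  intro x μ xs μs hx hμ
  rw [tendsto_iff_norm_sub_tendsto_zero]
  refine squeeze_zero (fun _ => norm_nonneg _) (fun n => hL t ht _ _ _ _) ?_
  have := ((tendsto_iff_norm_sub_tendsto_zero.1 hx).add hμ).const_mul L
  simpa using this

/-- The velocity field along a solution of the nonlinear equation, as a Borel field. -/
theorem exists_velocity (hT : 0 < T) (hb : AssumptionB T b) {U : Set (E d)} {R : ℝ}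
    (hU : ∀ α ∈ U, ‖α‖ ≤ R) {ε : ℝ} {u : ℝ → E d → E d} (hu : IsControl T U u) {μ : ℝ → P2 d}
    (h : IsWeakSolution T b μ₀ ε u μ) {P : ℝ → Prop}
    (hP : ∀ᵐ t ∂volume.restrict (Icc 0 T), P t) :
    ∃ v, IsLinearSolution T μ₀ ε v μ ∧
      (∀ᵐ t ∂volume.restrict (Icc 0 T), ∀ x, v t x = b t x (μ t) + u t x) ∧
      ∀ t, (t ∈ Icc 0 T ∧ P t ∧ ∀ x, v t x = b t x (μ t) + u t x) ∨ ∀ x, v t x = 0 := by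
  classical
  obtain ⟨H, hHm, -, hH⟩ := exists_measurable_rep h.1 hb.measurable fun t ht => hb.seqContinuous ht
  obtain ⟨M, hM⟩ := hb.growth
  obtain ⟨C, hC0, hC⟩ := h.1.exists_M2_le
  have hae : ∀ᵐ t ∂volume.restrict (Icc 0 T), t ∈ Icc 0 T ∧ P t ∧ ∀ x, H t x = b t x (μ t) := by
    filter_upwards [hP, hH, ae_restrict_mem measurableSet_Icc] with t h1 h2 h3 using ⟨h3, h1, h2⟩
  obtain ⟨G, hG, hGm, hGP⟩ := hae.exists_measurable_mem
  -- Setting the velocity to zero off a Borel set of good times makes it Borel and gives its bounds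
  -- at every time. The predicate `P` lets an almost everywhere property, such as a Lipschitz bound
  -- on the control, hold at each time where the velocity is kept.
  set v : ℝ → E d → E d := fun t x => if t ∈ G then H t x + u t x else 0 with hv
  have hvG : ∀ t ∈ G, ∀ x, v t x = b t x (μ t) + u t x := fun t ht x => by
    simp only [hv, if_pos ht, (hGP t ht).2.2 x]
  have hvae : ∀ᵐ t ∂volume.restrict (Icc 0 T), ∀ x, v t x = b t x (μ t) + u t x := by
    filter_upwards [hG] with t ht using hvG t ht
  refine ⟨v, ⟨h.1, ?_, ?_, fun φ hφ => ?_⟩, hvae, fun t => ?_⟩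
  · exact Measurable.ite (measurable_fst hGm) (hHm.measurable.add hu.1) measurable_const
  · refine ⟨|M| * (2 + C) + |R|, fun t x => ?_⟩
    by_cases ht : t ∈ G
    · have htI := (hGP t ht).1
      rw [hvG t ht]
      have h1 := hM t htI x (μ t)
      have h2 := (μ t).M1_le
      have h3 := hC t htI
      have h4 := hU _ (hu.2 t htI x)
      have h5 := (μ t).M1_nonneg
      have h6 : M * (1 + ‖x‖ + (μ t).M1) ≤ |M| * ((2 + C) * (1 + ‖x‖)) := by
        refine (mul_le_mul_of_nonneg_right (le_abs_self M) (by positivity)).trans ?_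
        refine mul_le_mul_of_nonneg_left ?_ (abs_nonneg _)
        nlinarith [norm_nonneg x]
      have h7 : R ≤ |R| * (1 + ‖x‖) := by
        nlinarith [le_abs_self R, mul_nonneg (abs_nonneg R) (norm_nonneg x)]
      calc _ ≤ ‖b t x (μ t)‖ + ‖u t x‖ := norm_add_le _ _
        _ ≤ _ := by linarith
    · simp only [hv, if_neg ht, norm_zero]
      positivity
  · rw [← h.2 φ hφ]
    refine intervalIntegral.integral_congr_ae ?_
    rw [uIoc_of_le hT.le]
    have := (ae_restrict_iff' measurableSet_Icc).1 hvae
    filter_upwards [this] with t ht htI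
    simp only [ht (Ioc_subset_Icc_self htI)]
  · by_cases ht : t ∈ G
    · exact Or.inl ⟨(hGP t ht).1, (hGP t ht).2.1, hvG t ht⟩
    · exact Or.inr fun x => by simp only [hv, if_neg ht]

end Velocity

/-! ### Compactness of families of solutions -/

section Compactness

/-- Probability measures with a given bound on the fourth moment. -/
def FourthMomentLE (d : ℕ) (K : ℝ≥0) : Set (ProbabilityMeasure (E d)) :=
  {p | ∫⁻ x, ‖x‖ₑ ^ 4 ∂(p : Measure (E d)) ≤ K}

/-- Chebyshev's inequality gives tightness, hence relative compactness by Prokhorov; the fourth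
moment is lower semicontinuous under narrow convergence, so the set is closed. -/
theorem isCompact_fourthMomentLE (K : ℝ≥0) : IsCompact (FourthMomentLE d K) := by
  have hcl : IsClosed (FourthMomentLE d K) := by
    refine IsSeqClosed.isClosed fun ps p hps hp => ?_
    have h1 : ∀ x : E d, ‖x‖ₑ ^ 4 = ENNReal.ofReal (‖x‖ ^ 4) := fun x => by
      rw [ENNReal.ofReal_pow (norm_nonneg _), ofReal_norm]
    have := lintegral_le_liminf_lintegral_of_forall_isOpen_measure_le_liminf_measure
      (μ := (p : Measure (E d))) (μs := fun n => (ps n : Measure (E d)))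
      (f := fun x : E d => ‖x‖ ^ 4) (by fun_prop) (fun x => by positivity)
      (fun G hG => ProbabilityMeasure.le_liminf_measure_open_of_tendsto hp hG)
    simp only [← h1] at this
    refine this.trans (liminf_le_of_le (by isBoundedDefault) fun b hb => ?_)
    obtain ⟨n, hn⟩ := hb.exists
    exact hn.trans (hps n)
  rw [← hcl.closure_eq]
  refine isCompact_closure_of_isTightMeasureSet ?_
  rw [isTightMeasureSet_iff_exists_isCompact_measure_compl_le]
  intro ε hε
  have hlim : Tendsto (fun n : ℕ => (K : ℝ≥0∞) / ((n + 1 : ℕ) : ℝ≥0∞)) atTop (𝓝 0) :=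
    (tendsto_add_atTop_iff_nat 1).2 (ENNReal.Tendsto.const_div ENNReal.tendsto_nat_nhds_top (Or.inr ENNReal.coe_ne_top) |>.trans (by simp))
  obtain ⟨n, hn⟩ := (hlim.eventually (eventually_le_nhds hε)).exists
  refine ⟨Metric.closedBall 0 (n + 1), isCompact_closedBall _ _, ?_⟩
  rintro _ ⟨p, hp, rfl⟩
  refine le_trans ?_ hn
  have hsub : (Metric.closedBall (0 : E d) (n + 1))ᶜ ⊆ {x | ((n + 1 : ℕ) : ℝ≥0∞) ≤ ‖x‖ₑ ^ 4} := by
    intro x hx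
    simp only [mem_compl_iff, Metric.mem_closedBall, dist_zero_right, not_le] at hx
    have h1 : (1 : ℝ) ≤ ‖x‖ := by linarith [Nat.cast_nonneg (α := ℝ) n]
    have h2 : ((n + 1 : ℕ) : ℝ) ≤ ‖x‖ ^ 4 := by
      push_cast
      exact hx.le.trans (le_self_pow₀ h1 (by norm_num))
    have := ENNReal.ofReal_le_ofReal h2
    rwa [ENNReal.ofReal_natCast, ENNReal.ofReal_pow (norm_nonneg _), ofReal_norm] at this
  refine (measure_mono hsub).trans ((meas_ge_le_lintegral_div (by fun_prop) (by simp) (by simp)).trans ?_)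
  gcongr
  exact hp

/-- An element of `FourthMomentLE` as an element of `P2`. -/
theorem FourthMomentLE.exists_P2 {K : ℝ≥0} {p : ProbabilityMeasure (E d)}
    (hp : p ∈ FourthMomentLE d K) : ∃ μ : P2 d, μ.prob = p := by
  refine ⟨⟨p, inferInstance, ?_⟩, rfl⟩
  refine ⟨by fun_prop, ?_⟩
  rw [hasFiniteIntegral_iff_enorm]
  calc ∫⁻ x, ‖‖x‖ ^ 2‖ₑ ∂(p : Measure (E d)) ≤ ∫⁻ x, (1 + ‖x‖ₑ ^ 4) ∂(p : Measure (E d)) := by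
        refine lintegral_mono fun x => ?_
        have h1 : ‖‖x‖ ^ 2‖ₑ = ENNReal.ofReal (‖x‖ ^ 2) := by
          rw [← ofReal_norm, Real.norm_of_nonneg (by positivity)]
        have h2 : 1 + ‖x‖ₑ ^ 4 = ENNReal.ofReal (1 + ‖x‖ ^ 4) := by
          rw [ENNReal.ofReal_add zero_le_one (by positivity), ENNReal.ofReal_one,
            ENNReal.ofReal_pow (norm_nonneg _), ofReal_norm]
        rw [h1, h2]
        exact ENNReal.ofReal_le_ofReal (by nlinarith [sq_nonneg (‖x‖ ^ 2 - 1)])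
    _ < ⊤ := by
        rw [lintegral_add_left measurable_const]
        have : ∫⁻ x, ‖x‖ₑ ^ 4 ∂(p : Measure (E d)) < ⊤ := lt_of_le_of_lt hp ENNReal.coe_lt_top
        simpa using this

theorem contDiff_cos_inner (ξ : E d) (c : ℝ) : ContDiff ℝ ∞ (fun x : E d => Real.cos (⟪x, ξ⟫_ℝ + c)) :=
  Real.contDiff_cos.comp ((contDiff_id.inner ℝ contDiff_const).add contDiff_const)

theorem hasFDerivAt_cos_inner (ξ : E d) (c : ℝ) (x : E d) :
    HasFDerivAt (fun x : E d => Real.cos (⟪x, ξ⟫_ℝ + c))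
      ((-Real.sin (⟪x, ξ⟫_ℝ + c)) • innerSL ℝ ξ) x := by
  have h1 : HasFDerivAt (fun x : E d => ⟪x, ξ⟫_ℝ + c) (innerSL ℝ ξ) x := by
    have := (innerSL ℝ ξ).hasFDerivAt (x := x) |>.add_const c
    refine this.congr_of_eventuallyEq (.of_forall fun y => ?_)
    simp [real_inner_comm]
  exact h1.cos

theorem norm_fderiv_cos_inner_le (ξ : E d) (c : ℝ) (x : E d) :
    ‖fderiv ℝ (fun x : E d => Real.cos (⟪x, ξ⟫_ℝ + c)) x‖ ≤ ‖ξ‖ := by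
  rw [(hasFDerivAt_cos_inner ξ c x).fderiv, norm_smul, innerSL_apply_norm, norm_neg]
  exact mul_le_of_le_one_left (norm_nonneg _) (Real.abs_sin_le_one _)

theorem norm_iteratedFDeriv_two_cos_inner_le (ξ : E d) (c : ℝ) (x : E d) :
    ‖iteratedFDeriv ℝ 2 (fun x : E d => Real.cos (⟪x, ξ⟫_ℝ + c)) x‖ ≤ ‖ξ‖ ^ 2 := by
  have h1 : fderiv ℝ (fun x : E d => Real.cos (⟪x, ξ⟫_ℝ + c))
      = fun x => (-Real.sin (⟪x, ξ⟫_ℝ + c)) • innerSL ℝ ξ :=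
    funext fun x => (hasFDerivAt_cos_inner ξ c x).fderiv
  have h0 : HasFDerivAt (fun x : E d => ⟪x, ξ⟫_ℝ + c) (innerSL ℝ ξ) x := by
    have := (innerSL ℝ ξ).hasFDerivAt (x := x) |>.add_const c
    refine this.congr_of_eventuallyEq (.of_forall fun y => ?_)
    simp [real_inner_comm]
  have h2 : HasFDerivAt (fun x : E d => (-Real.sin (⟪x, ξ⟫_ℝ + c)) • innerSL ℝ ξ) _ x :=
    (h0.sin.neg).smul_const (innerSL ℝ ξ)
  rw [← norm_iteratedFDeriv_fderiv, norm_iteratedFDeriv_one, h1, h2.fderiv]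
  rw [ContinuousLinearMap.norm_smulRight_apply, norm_neg, norm_smul, innerSL_apply_norm, sq, mul_assoc]
  exact mul_le_of_le_one_left (by positivity) (Real.abs_cos_le_one _)

/-- The shift `-π/2` turns cosines into sines, so real test functions with explicit first and second
derivative bounds determine the characteristic function. -/
theorem charFun_eq_integral_cos (m : Measure (E d)) [IsProbabilityMeasure m] (ξ : E d) :
    charFun m ξ = ((∫ x, Real.cos (⟪x, ξ⟫_ℝ + 0) ∂m : ℝ) : ℂ)
      + ((∫ x, Real.cos (⟪x, ξ⟫_ℝ + (-(Real.pi / 2))) ∂m : ℝ) : ℂ) * Complex.I := by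
  rw [charFun_apply, ← integral_complex_ofReal, ← integral_complex_ofReal, ← integral_mul_const, ← integral_add]
  · refine integral_congr_ae (.of_forall fun x => ?_)
    simp only [add_zero, ← sub_eq_add_neg, Real.cos_sub_pi_div_two]
    rw [Complex.exp_mul_I]
    simp
  · refine Integrable.of_bound (by fun_prop) 1 (.of_forall fun x => ?_)
    rw [Complex.norm_real]
    exact Real.abs_cos_le_one _
  · refine Integrable.of_bound (by fun_prop) 1 (.of_forall fun x => ?_)
    rw [norm_mul, Complex.norm_real, Complex.norm_I, mul_one]
    exact Real.abs_cos_le_one _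

variable {T : ℝ} {μ₀ : P2 d}

theorem IsLinearSolution.abs_integral_sub_le (hT : 0 < T) {ε : ℝ} {v : ℝ → E d → E d}
    {μ : ℝ → P2 d} (h : IsLinearSolution T μ₀ ε v μ) {A K B : ℝ} (hA : ∀ t x, ‖v t x‖ ≤ A * (1 + ‖x‖))
    (hK : ∀ t ∈ Icc 0 T, (μ t).M2 ≤ K) (hB : 0 ≤ B) {φ : E d → ℝ} (hφ : ContDiff ℝ ∞ φ)
    (h0 : ∀ x, |φ x| ≤ B * (1 + ‖x‖ ^ 2)) (h1 : ∀ x, ‖fderiv ℝ φ x‖ ≤ B * (1 + ‖x‖))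
    (h2 : ∀ x, |ε| * ‖iteratedFDeriv ℝ 2 φ x‖ ≤ B) {s t : ℝ} (hs : s ∈ Icc 0 T) (ht : t ∈ Icc 0 T) :
    |∫ x, φ x ∂(μ t).toMeasure - ∫ x, φ x ∂(μ s).toMeasure|
      ≤ (2 * B * A + d * B) * (1 + K) * |t - s| := by
  have hA0 : 0 ≤ A := by simpa using (norm_nonneg _).trans (hA 0 0)
  have hi := h.intervalIntegrable_generator hT hφ hB h1 h2
  have hsub : ∀ r ∈ Icc 0 T, IntervalIntegrable
      (fun t => ∫ x, generator ε v φ t x ∂(μ t).toMeasure) volume 0 r := fun r hr =>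
    hi.mono_set (by rw [uIcc_of_le hT.le, uIcc_of_le hr.1]; exact Icc_subset_Icc_right hr.2)
  rw [h.integral_eq hT hφ h0 h1 h2 ht, h.integral_eq hT hφ h0 h1 h2 hs, add_sub_add_left_eq_sub,
    intervalIntegral.integral_interval_sub_left (hsub t ht) (hsub s hs), ← Real.norm_eq_abs]
  refine intervalIntegral.norm_integral_le_of_norm_le_const fun r hr => ?_
  have hr' : r ∈ Icc 0 T := by
    have := uIoc_subset_uIcc hr
    exact (uIcc_subset_Icc hs ht) this
  refine ((μ r).norm_integral_le_of_growth (norm_generator_le hA hB h1 h2 r)).trans ?_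
  have := hK r hr'
  gcongr

/-- The characteristic functions along a solution are Lipschitz in time, with constants that do not
depend on the viscosity. -/
theorem IsLinearSolution.norm_charFun_sub_le (hT : 0 < T) {ε : ℝ} (hε : |ε| ≤ 1)
    {v : ℝ → E d → E d} {μ : ℝ → P2 d} (h : IsLinearSolution T μ₀ ε v μ) {A K : ℝ}
    (hA : ∀ t x, ‖v t x‖ ≤ A * (1 + ‖x‖)) (hK : ∀ t ∈ Icc 0 T, (μ t).M2 ≤ K) (ξ : E d) {s t : ℝ}
    (hs : s ∈ Icc 0 T) (ht : t ∈ Icc 0 T) :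
    ‖charFun (μ t).toMeasure ξ - charFun (μ s).toMeasure ξ‖
      ≤ 2 * ((2 * (1 + ‖ξ‖ + ‖ξ‖ ^ 2) * A + d * (1 + ‖ξ‖ + ‖ξ‖ ^ 2)) * (1 + K)) * |t - s| := by
  have hcos : ∀ c : ℝ, |∫ x, Real.cos (⟪x, ξ⟫_ℝ + c) ∂(μ t).toMeasure
      - ∫ x, Real.cos (⟪x, ξ⟫_ℝ + c) ∂(μ s).toMeasure|
      ≤ (2 * (1 + ‖ξ‖ + ‖ξ‖ ^ 2) * A + d * (1 + ‖ξ‖ + ‖ξ‖ ^ 2)) * (1 + K) * |t - s| := fun c => by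
    have hn := norm_nonneg ξ
    refine h.abs_integral_sub_le hT hA hK (by positivity) (contDiff_cos_inner ξ c) (fun x => ?_)
      (fun x => ?_) (fun x => ?_) hs ht
    · refine (Real.abs_cos_le_one _).trans ?_
      nlinarith [sq_nonneg ‖x‖, sq_nonneg ‖ξ‖, mul_nonneg hn (sq_nonneg ‖x‖),
        mul_nonneg (sq_nonneg ‖ξ‖) (sq_nonneg ‖x‖)]
    · refine (norm_fderiv_cos_inner_le ξ c x).trans ?_
      nlinarith [norm_nonneg x, sq_nonneg ‖ξ‖, mul_nonneg hn (norm_nonneg x),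
        mul_nonneg (sq_nonneg ‖ξ‖) (norm_nonneg x)]
    · have h1 := norm_iteratedFDeriv_two_cos_inner_le ξ c x
      have h2 := mul_le_mul hε h1 (norm_nonneg _) zero_le_one
      linarith
  rw [charFun_eq_integral_cos, charFun_eq_integral_cos]
  set a := ∫ x, Real.cos (⟪x, ξ⟫_ℝ + 0) ∂(μ t).toMeasure
  set a' := ∫ x, Real.cos (⟪x, ξ⟫_ℝ + 0) ∂(μ s).toMeasure
  set c := ∫ x, Real.cos (⟪x, ξ⟫_ℝ + (-(Real.pi / 2))) ∂(μ t).toMeasure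
  set c' := ∫ x, Real.cos (⟪x, ξ⟫_ℝ + (-(Real.pi / 2))) ∂(μ s).toMeasure
  have e : (a : ℂ) + c * Complex.I - (a' + c' * Complex.I)
      = ((a - a' : ℝ) : ℂ) + ((c - c' : ℝ) : ℂ) * Complex.I := by push_cast; ring
  rw [e]
  refine (norm_add_le _ _).trans ?_
  rw [norm_mul, Complex.norm_I, mul_one, Complex.norm_real, Complex.norm_real]
  have h1 := hcos 0
  have h2 := hcos (-(Real.pi / 2))
  simp only [Real.norm_eq_abs]
  linarith

/-- Compactness of families of solutions. -/
theorem exists_subseq_tendsto_W2 (hT : 0 < T) {ε : ℕ → ℝ} (hε : ∀ k, |ε k| ≤ 1)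
    {v : ℕ → ℝ → E d → E d} {μ : ℕ → ℝ → P2 d} (h : ∀ k, IsLinearSolution T μ₀ (ε k) (v k) (μ k))
    {A : ℝ} {K : ℝ≥0} (hA : ∀ k t x, ‖v k t x‖ ≤ A * (1 + ‖x‖))
    (hK2 : ∀ k, ∀ t ∈ Icc 0 T, (μ k t).M2 ≤ K)
    (hK : ∀ k, ∀ t ∈ Icc 0 T, ∫⁻ x, ‖x‖ₑ ^ 4 ∂(μ k t).toMeasure ≤ K) :
    ∃ (φ : ℕ → ℕ) (ν : ℝ → P2 d), StrictMono φ ∧ IsW2Continuous T ν ∧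
      ∀ t ∈ Icc 0 T, Tendsto (fun k => W2 (μ (φ k) t) (ν t)) atTop (𝓝 0) := by
  classical
  have hne : Nonempty (Icc 0 T) := ⟨⟨0, le_rfl, hT.le⟩⟩
  set s : ℕ → ℝ := fun n => (TopologicalSpace.denseSeq (Icc 0 T) n : ℝ) with hs
  have hsI : ∀ n, s n ∈ Icc 0 T := fun n => (TopologicalSpace.denseSeq (Icc 0 T) n).2
  have hdense : ∀ t ∈ Icc 0 T, ∀ δ > 0, ∃ n, |t - s n| < δ := fun t ht δ hδ => by
    obtain ⟨n, hn⟩ := (TopologicalSpace.denseRange_denseSeq (Icc 0 T)).exists_dist_lt ⟨t, ht⟩ hδ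
    exact ⟨n, hn⟩
  have hcpt := isCompact_univ_pi fun _ : ℕ => isCompact_fourthMomentLE (d := d) K
  -- One extraction for a dense sequence of times, by compactness of a countable product.
  obtain ⟨P, -, φ, hφ, hP⟩ := hcpt.tendsto_subseq (x := fun k n => (μ k (s n)).prob)
    fun k n _ => hK k _ (hsI n)
  rw [tendsto_pi_nhds] at hP
  set Cξ : E d → ℝ := fun ξ =>
    2 * ((2 * (1 + ‖ξ‖ + ‖ξ‖ ^ 2) * A + d * (1 + ‖ξ‖ + ‖ξ‖ ^ 2)) * (1 + K)) with hCξ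
  have hA0 : 0 ≤ A := by simpa using (norm_nonneg _).trans (hA 0 0 0)
  have hC0 : ∀ ξ, 0 ≤ Cξ ξ := fun ξ => by positivity
  have hlip : ∀ k ξ, ∀ r ∈ Icc 0 T, ∀ t ∈ Icc 0 T,
      ‖charFun (μ k t).toMeasure ξ - charFun (μ k r).toMeasure ξ‖ ≤ Cξ ξ * |t - r| :=
    fun k ξ r hr t ht => (h k).norm_charFun_sub_le hT (hε k) (hA k) (hK2 k) ξ hr ht
  have hlim : ∀ t ∈ Icc 0 T, ∃ m : P2 d, m.prob ∈ FourthMomentLE d K ∧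
      Tendsto (fun k => (μ (φ k) t).prob) atTop (𝓝 m.prob) := fun t ht => by
    obtain ⟨p, hp, χ, hχ, hpχ⟩ := (isCompact_fourthMomentLE (d := d) K).tendsto_subseq
      (x := fun k => (μ (φ k) t).prob) fun k => hK _ t ht
    obtain ⟨m, rfl⟩ := FourthMomentLE.exists_P2 hp
    refine ⟨m, hp, ?_⟩
    rw [ProbabilityMeasure.tendsto_iff_tendsto_charFun] at hpχ ⊢
    intro ξ
    -- At any other time a further subsequence converges. Comparison with a nearby time of the dense
    -- sequence shows that the characteristic functions are Cauchy along `φ` itself, so no further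
    -- extraction is needed.
    refine tendsto_nhds_of_cauchySeq_of_subseq ?_ hχ.tendsto_atTop (hpχ ξ)
    rw [Metric.cauchySeq_iff']
    intro η hη
    obtain ⟨n, hn⟩ := hdense t ht (η / (4 * (Cξ ξ + 1))) (by have := hC0 ξ; positivity)
    have hcn := ProbabilityMeasure.tendsto_iff_tendsto_charFun.1 (hP n) ξ
    obtain ⟨N, hN⟩ := Metric.cauchySeq_iff'.1 hcn.cauchySeq (η / 4) (by positivity)
    refine ⟨N, fun k hk => ?_⟩
    have h1 := hN k hk
    have h2 := hlip (φ k) ξ _ (hsI n) _ ht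
    have h3 := hlip (φ N) ξ _ (hsI n) _ ht
    have h4 : Cξ ξ * |t - s n| ≤ η / 4 := by
      have h5 : Cξ ξ * |t - s n| ≤ (Cξ ξ + 1) * (η / (4 * (Cξ ξ + 1))) :=
        mul_le_mul (by linarith) hn.le (abs_nonneg _) (by have := hC0 ξ; positivity)
      have h6 : (Cξ ξ + 1) * (η / (4 * (Cξ ξ + 1))) = η / 4 := by
        have := hC0 ξ
        field_simp
      linarith
    rw [← dist_eq_norm] at h2 h3
    have h7 := dist_triangle4 (charFun (μ (φ k) t).toMeasure ξ) (charFun (μ (φ k) (s n)).toMeasure ξ)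
      (charFun (μ (φ N) (s n)).toMeasure ξ) (charFun (μ (φ N) t).toMeasure ξ)
    rw [dist_comm (charFun (μ (φ N) (s n)).toMeasure ξ)] at h7
    simp only [Function.comp_apply, P2.coe_prob] at h1 ⊢
    linarith
  haveI : Nonempty (P2 d) := ⟨P2.diracZero d⟩
  choose! m hm hmlim using hlim
  refine ⟨φ, fun t => m (projIcc 0 T hT.le t), hφ, ?_, fun t ht => ?_⟩
  · intro t ht
    -- The limit inherits the Lipschitz bound on characteristic functions, hence narrow continuity
    -- in time; the inherited fourth moment bound turns this into continuity for `W2`.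
    refine tendsto_W2_of_tendsto_prob (K := K) ?_ (fun r => hm _ (projIcc 0 T hT.le r).2)
      (hm _ (projIcc 0 T hT.le t).2)
    refine tendsto_of_seq_tendsto fun r hr => ?_
    have hr' : Tendsto (fun n => (projIcc 0 T hT.le (r n) : ℝ)) atTop (𝓝 (projIcc 0 T hT.le t)) :=
      (continuous_subtype_val.comp continuous_projIcc).continuousAt.tendsto.comp
        (hr.mono_right nhdsWithin_le_nhds)
    refine ProbabilityMeasure.tendsto_iff_tendsto_charFun.2 fun ξ => ?_
    rw [tendsto_iff_norm_sub_tendsto_zero]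
    refine squeeze_zero (fun _ => norm_nonneg _) (g := fun n =>
      Cξ ξ * |(projIcc 0 T hT.le (r n) : ℝ) - projIcc 0 T hT.le t|) (fun n => ?_) ?_
    · have h1 := ProbabilityMeasure.tendsto_iff_tendsto_charFun.1
        (hmlim _ (projIcc 0 T hT.le (r n)).2) ξ
      have h2 := ProbabilityMeasure.tendsto_iff_tendsto_charFun.1 (hmlim _ (projIcc 0 T hT.le t).2) ξ
      exact le_of_tendsto (h1.sub h2).norm (.of_forall fun k =>
        hlip _ ξ _ (projIcc 0 T hT.le t).2 _ (projIcc 0 T hT.le (r n)).2)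
    · have := ((tendsto_iff_norm_sub_tendsto_zero.1 hr').const_mul (Cξ ξ))
      simpa using this
  · simp only [projIcc_of_mem hT.le ht]
    exact tendsto_W2_of_tendsto_prob (hmlim t ht) (fun k => hK _ t ht) (hm t ht)

end Compactness

end VanishingViscosity

namespace VanishingViscosity

variable {d : ℕ}

/-! ### Borel versions of space derivatives -/

section SpaceDerivative

/-- A Borel version of a directional derivative of a field that is Lipschitz in space. -/
theorem exists_measurable_fderiv {T : ℝ} {u : ℝ → E d → E d} (hu : Measurable (Function.uncurry u))
    {C : ℝ≥0} (hL : ∀ᵐ t ∂volume.restrict (Icc 0 T), LipschitzWith C (u t)) (v : E d) :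
    ∃ D : ℝ → E d → E d, Measurable (Function.uncurry D) ∧ (∀ t x, ‖D t x‖ ≤ C * ‖v‖) ∧
      ∀ᵐ t ∂volume.restrict (Icc 0 T), ∀ᵐ x, D t x = fderiv ℝ (u t) x v := by
  classical
  set g : ℕ → ℝ × E d → E d := fun n z => (n : ℝ) • (u z.1 (z.2 + (n : ℝ)⁻¹ • v) - u z.1 z.2) with hg
  have hgm : ∀ n, Measurable (g n) := fun n => by
    have h1 : Measurable fun z : ℝ × E d => u z.1 (z.2 + (n : ℝ)⁻¹ • v) :=
      hu.comp (measurable_fst.prodMk (measurable_snd.add_const _))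
    exact (h1.sub hu).const_smul (n : ℝ)
  -- Limit of difference quotients with step `1/n`. Where they diverge the value is arbitrary, so it
  -- is discarded below whenever it exceeds the bound `C * ‖v‖` that genuine derivatives satisfy.
  set G : ℝ × E d → E d := fun z => limUnder atTop (fun n => g n z) with hG
  have hGm : Measurable G :=
    (StronglyMeasurable.limUnder fun n => (hgm n).stronglyMeasurable).measurable
  refine ⟨fun t x => if ‖G (t, x)‖ ≤ C * ‖v‖ then G (t, x) else 0, ?_, fun t x => ?_, ?_⟩
  · exact Measurable.ite (measurableSet_le hGm.norm measurable_const) hGm measurable_const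
  · beta_reduce
    split_ifs with h
    · exact h
    · simp only [norm_zero]; positivity
  · filter_upwards [hL] with t ht
    filter_upwards [ht.ae_differentiableAt (μ := volume)] with x hx
    have h1 : Tendsto (fun n => g n (t, x)) atTop (𝓝 (fderiv ℝ (u t) x v)) :=
      (hx.hasFDerivAt.lim_real v).comp tendsto_natCast_atTop_atTop
    have h2 : G (t, x) = fderiv ℝ (u t) x v := h1.limUnder_eq
    rw [h2, if_pos]
    exact ((fderiv ℝ (u t) x).le_opNorm v).trans
      (mul_le_mul_of_nonneg_right (norm_fderiv_le_of_lipschitz ℝ ht) (norm_nonneg _))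

end SpaceDerivative

/-! ### Uniform boundedness against test fields -/

section UniformBoundedness

/-- The pairing of a test field with a field on `(0,T) × B_r`. -/
noncomputable def pairing (T r : ℝ) (F D : ℝ → E d → E d) : ℝ :=
  ∫ t in (0 : ℝ)..T, ∫ x in Metric.ball 0 r, ⟪F t x, D t x⟫_ℝ

/-- Lebesgue measure on `(0,T) × B_r`. -/
noncomputable def cylinder (d : ℕ) (T r : ℝ) : Measure (ℝ × E d) :=
  (volume.restrict (Icc 0 T)).prod (volume.restrict (Metric.ball 0 r))

instance (T r : ℝ) : IsFiniteMeasure (cylinder d T r) := by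
  haveI : IsFiniteMeasure (volume.restrict (Metric.ball (0 : E d) r)) :=
    ⟨by simpa using measure_ball_lt_top⟩
  unfold cylinder
  infer_instance

theorem pairing_eq {T r : ℝ} (hT : 0 ≤ T) {F D : ℝ → E d → E d}
    (h : Integrable (fun z : ℝ × E d => ⟪F z.1 z.2, D z.1 z.2⟫_ℝ) (cylinder d T r)) :
    pairing T r F D = ∫ z, ⟪F z.1 z.2, D z.1 z.2⟫_ℝ ∂cylinder d T r := by
  rw [pairing, intervalIntegral.integral_of_le hT, cylinder, integral_prod _ h,
    ← restrict_Icc_eq_Ioc]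

/-- The unit ball of `L^∞((0,T); L^q(B_r))`. -/
def UnitField (T r q : ℝ) (F : ℝ → E d → E d) : Prop :=
  Measurable (Function.uncurry F) ∧ ∀ t ∈ Icc 0 T, ∫⁻ x in Metric.ball 0 r, ‖F t x‖ₑ ^ q ≤ 1

variable {T r q : ℝ}

theorem UnitField.lintegral_le {F : ℝ → E d → E d} (hF : UnitField T r q F) (hq : 1 ≤ q) :
    ∫⁻ z, ‖F z.1 z.2‖ₑ ∂cylinder d T r
      ≤ ENNReal.ofReal T * (volume (Metric.ball (0 : E d) r) + 1) := by
  have hm : Measurable fun z : ℝ × E d => ‖F z.1 z.2‖ₑ := hF.1.enorm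
  rw [cylinder, lintegral_prod _ hm.aemeasurable]
  calc ∫⁻ t in Icc 0 T, ∫⁻ x in Metric.ball 0 r, ‖F t x‖ₑ
      ≤ ∫⁻ t in Icc 0 T, (volume (Metric.ball (0 : E d) r) + 1) := by
        refine setLIntegral_mono measurable_const fun t ht => ?_
        calc ∫⁻ x in Metric.ball 0 r, ‖F t x‖ₑ ≤ ∫⁻ x in Metric.ball 0 r, (1 + ‖F t x‖ₑ ^ q) := by
              refine lintegral_mono fun x => ?_
              rcases le_total ‖F t x‖ₑ 1 with h | h
              · exact h.trans le_self_add
              · refine le_trans ?_ le_add_self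
                calc ‖F t x‖ₑ = ‖F t x‖ₑ ^ (1 : ℝ) := (ENNReal.rpow_one _).symm
                  _ ≤ _ := ENNReal.rpow_le_rpow_of_exponent_le h hq
          _ = volume (Metric.ball (0 : E d) r) + ∫⁻ x in Metric.ball 0 r, ‖F t x‖ₑ ^ q := by
              rw [lintegral_add_left measurable_const]; simp
          _ ≤ _ := by gcongr; exact hF.2 t ht
    _ = _ := by simp [mul_comm]

/-- Hölder's inequality with weights on finite sums, then the supremum over finite sums. It replaces
the triangle inequality in `L^q` for series of fields. -/
theorem tsum_mul_rpow_le (hq : 1 ≤ q) (w f : ℕ → ℝ≥0∞) :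
    (∑' n, w n * f n) ^ q ≤ (∑' n, w n) ^ (q - 1) * ∑' n, w n * f n ^ q := by
  have hq0 : 0 < q := by linarith
  have h1 : ∑' n, w n * f n ≤ (∑' n, w n) ^ (1 - q⁻¹) * (∑' n, w n * f n ^ q) ^ q⁻¹ := by
    rw [ENNReal.tsum_eq_iSup_sum]
    refine iSup_le fun s => (ENNReal.inner_le_weight_mul_Lp_of_nonneg s hq w f).trans ?_
    have hq1 : 0 ≤ 1 - q⁻¹ := sub_nonneg.2 (inv_le_one_of_one_le₀ hq)
    have hq2 : 0 ≤ q⁻¹ := by positivity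
    gcongr
    · exact ENNReal.sum_le_tsum s
    · exact ENNReal.sum_le_tsum s
  refine (ENNReal.rpow_le_rpow h1 hq0.le).trans (le_of_eq ?_)
  rw [ENNReal.mul_rpow_of_nonneg _ _ hq0.le, ← ENNReal.rpow_mul, ← ENNReal.rpow_mul,
    inv_mul_cancel₀ hq0.ne', ENNReal.rpow_one, sub_mul, inv_mul_cancel₀ hq0.ne', one_mul]

/-- Absolutely convergent combinations of unit fields are test fields. -/
theorem isDualField_tsum (hT : 0 ≤ T) (hq : 1 ≤ q) {Φ : ℕ → ℝ → E d → E d}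
    (hΦ : ∀ n, UnitField T r q (Φ n)) {c : ℕ → ℝ} (hc : Summable fun n => |c n|) :
    IsDualField T r q (fun t x => ∑' n, c n • Φ n t x) := by
  have hq0 : 0 < q := by linarith
  refine ⟨Measurable.tsum fun n => (hΦ n).1.const_smul (c n), ?_⟩
  set S : ℝ≥0∞ := ∑' n, ‖c n‖ₑ with hS
  have hSt : S < ⊤ := by
    have h1 : ∀ n, ‖c n‖ₑ = ((‖c n‖₊ : ℝ≥0) : ℝ≥0∞) := fun n => rfl
    simp only [hS, h1]
    rw [lt_top_iff_ne_top, ENNReal.tsum_coe_ne_top_iff_summable, ← NNReal.summable_coe]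
    simpa using hc
  have hb : ∀ t ∈ Icc 0 T, ∫⁻ x in Metric.ball 0 r, ‖∑' n, c n • Φ n t x‖ₑ ^ q
      ≤ S ^ (q - 1) * S := fun t ht => by
    calc ∫⁻ x in Metric.ball 0 r, ‖∑' n, c n • Φ n t x‖ₑ ^ q
        ≤ ∫⁻ x in Metric.ball 0 r, S ^ (q - 1) * ∑' n, ‖c n‖ₑ * ‖Φ n t x‖ₑ ^ q := by
          refine lintegral_mono fun x => le_trans ?_ (tsum_mul_rpow_le hq _ _)
          refine ENNReal.rpow_le_rpow ?_ hq0.le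
          refine (enorm_tsum_le_tsum_enorm).trans (le_of_eq ?_)
          simp only [enorm_smul]
      _ = S ^ (q - 1) * ∑' n, ‖c n‖ₑ * ∫⁻ x in Metric.ball 0 r, ‖Φ n t x‖ₑ ^ q := by
          have hm : ∀ n, Measurable fun x : E d => ‖Φ n t x‖ₑ ^ q := fun n =>
            (((hΦ n).1.comp (measurable_const.prodMk measurable_id)).enorm).pow_const q
          rw [lintegral_const_mul _ (Measurable.tsum fun n => (hm n).const_mul _),
            lintegral_tsum fun n => ((hm n).const_mul _).aemeasurable]
          congr 2
          ext n
          rw [lintegral_const_mul _ (hm n)]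
      _ ≤ S ^ (q - 1) * S := by
          gcongr
          exact ENNReal.tsum_le_tsum fun n => mul_le_of_le_one_right' ((hΦ n).2 t ht)
  have hfin : (S ^ (q - 1) * S) ^ (2 / q) < ⊤ :=
    ENNReal.rpow_lt_top_of_nonneg (by positivity)
      (ENNReal.mul_ne_top (ENNReal.rpow_ne_top_of_nonneg (by linarith) hSt.ne) hSt.ne)
  calc _ ≤ ∫⁻ t in Icc 0 T, (S ^ (q - 1) * S) ^ (2 / q) :=
        setLIntegral_mono measurable_const fun t ht =>
          ENNReal.rpow_le_rpow (hb t ht) (by positivity)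
    _ < ⊤ := by
        simp only [lintegral_const, MeasurableSet.univ, Measure.restrict_apply, univ_inter,
          Real.volume_Icc]
        exact ENNReal.mul_lt_top hfin ENNReal.ofReal_lt_top

theorem UnitField.integrable_inner {F D : ℝ → E d → E d} (hF : UnitField T r q F) (hq : 1 ≤ q)
    (hD : Measurable (Function.uncurry D)) {C : ℝ} (hC : ∀ t x, ‖D t x‖ ≤ C) :
    Integrable (fun z : ℝ × E d => ⟪F z.1 z.2, D z.1 z.2⟫_ℝ) (cylinder d T r) ∧
    ∫ z, ‖⟪F z.1 z.2, D z.1 z.2⟫_ℝ‖ ∂cylinder d T r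
      ≤ C * (ENNReal.ofReal T * (volume (Metric.ball (0 : E d) r) + 1)).toReal := by
  have hC0 : 0 ≤ C := (norm_nonneg _).trans (hC 0 0)
  have hfin : ENNReal.ofReal T * (volume (Metric.ball (0 : E d) r) + 1) < ⊤ :=
    ENNReal.mul_lt_top ENNReal.ofReal_lt_top (ENNReal.add_lt_top.2 ⟨measure_ball_lt_top, by simp⟩)
  have hFi : Integrable (fun z : ℝ × E d => F z.1 z.2) (cylinder d T r) :=
    ⟨hF.1.aestronglyMeasurable, by
      rw [hasFiniteIntegral_iff_enorm]; exact (hF.lintegral_le hq).trans_lt hfin⟩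
  have hle : ∀ z : ℝ × E d, ‖⟪F z.1 z.2, D z.1 z.2⟫_ℝ‖ ≤ C * ‖F z.1 z.2‖ := fun z => by
    refine (norm_inner_le_norm _ _).trans ?_
    rw [mul_comm]
    exact mul_le_mul_of_nonneg_right (hC _ _) (norm_nonneg _)
  have h_int : Integrable (fun z : ℝ × E d => ⟪F z.1 z.2, D z.1 z.2⟫_ℝ) (cylinder d T r) :=
    (hFi.norm.const_mul C).mono' (Measurable.inner hF.1 hD).aestronglyMeasurable (.of_forall hle)
  refine ⟨h_int, ?_⟩
  calc _ ≤ ∫ z, C * ‖F z.1 z.2‖ ∂cylinder d T r := integral_mono h_int.norm (hFi.norm.const_mul C) hle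
    _ = C * ∫ z, ‖F z.1 z.2‖ ∂cylinder d T r := integral_const_mul _ _
    _ ≤ _ := by
        refine mul_le_mul_of_nonneg_left ?_ hC0
        rw [integral_norm_eq_lintegral_enorm hFi.1]
        exact ENNReal.toReal_mono hfin.ne (hF.lintegral_le hq)

set_option maxHeartbeats 1000000 in
-- A unit field is integrable on the cylinder and `D` is bounded, so absolute summability of the
-- coefficients justifies exchanging series and integral.
theorem tsum_mul_pairing (hT : 0 ≤ T) (hq : 1 ≤ q) {Φ : ℕ → ℝ → E d → E d}
    (hΦ : ∀ n, UnitField T r q (Φ n)) {c : ℕ → ℝ} (hc : Summable fun n => |c n|)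
    {D : ℝ → E d → E d} (hDm : Measurable (Function.uncurry D)) {C : ℝ} (hC : ∀ t x, ‖D t x‖ ≤ C) :
    ∑' n, c n * pairing T r (Φ n) D = pairing T r (fun t x => ∑' n, c n • Φ n t x) D := by
  set V : ℝ := (ENNReal.ofReal T * (volume (Metric.ball (0 : E d) r) + 1)).toReal with hVdef
  have hi : ∀ n, Integrable (fun z : ℝ × E d => c n * ⟪Φ n z.1 z.2, D z.1 z.2⟫_ℝ)
      (cylinder d T r) := fun n =>
    ((hΦ n).integrable_inner hq hDm hC).1.const_mul _
  have hs : Summable fun n => ∫ z, ‖c n * ⟪Φ n z.1 z.2, D z.1 z.2⟫_ℝ‖ ∂cylinder d T r := by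
    refine Summable.of_norm_bounded (hc.mul_right (C * V)) fun n => ?_
    rw [Real.norm_of_nonneg (integral_nonneg fun _ => norm_nonneg _)]
    simp only [norm_mul]
    rw [integral_const_mul]
    exact mul_le_mul_of_nonneg_left ((hΦ n).integrable_inner hq hDm hC).2 (norm_nonneg _)
  have hL := hasSum_integral_of_summable_integral_norm hi hs
  have hcm : ∀ n, Measurable fun z : ℝ × E d => c n • Φ n z.1 z.2 := fun n =>
    (hΦ n).1.const_smul (c n)
  have hfin : ∫⁻ z, ∑' n, ‖c n • Φ n z.1 z.2‖ₑ ∂cylinder d T r < ⊤ := by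
    rw [lintegral_tsum fun n => (hcm n).enorm.aemeasurable]
    have hVt : ENNReal.ofReal T * (volume (Metric.ball (0 : E d) r) + 1) < ⊤ :=
      ENNReal.mul_lt_top ENNReal.ofReal_lt_top
        (ENNReal.add_lt_top.2 ⟨measure_ball_lt_top, by simp⟩)
    calc _ ≤ ∑' n, ‖c n‖ₑ * (ENNReal.ofReal T * (volume (Metric.ball (0 : E d) r) + 1)) := by
          refine ENNReal.tsum_le_tsum fun n => ?_
          simp only [enorm_smul]
          rw [lintegral_const_mul _ (show Measurable fun z : ℝ × E d => ‖Φ n z.1 z.2‖ₑ from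
            (hΦ n).1.enorm)]
          gcongr
          exact (hΦ n).lintegral_le hq
      _ < ⊤ := by
          rw [ENNReal.tsum_mul_right]
          refine ENNReal.mul_lt_top ?_ hVt
          have h1 : ∀ n, ‖c n‖ₑ = ((‖c n‖₊ : ℝ≥0) : ℝ≥0∞) := fun n => rfl
          simp only [h1]
          rw [lt_top_iff_ne_top, ENNReal.tsum_coe_ne_top_iff_summable, ← NNReal.summable_coe]
          simpa using hc
  have hpt : ∀ᵐ z ∂cylinder d T r, ∑' n, c n * ⟪Φ n z.1 z.2, D z.1 z.2⟫_ℝ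
      = ⟪∑' n, c n • Φ n z.1 z.2, D z.1 z.2⟫_ℝ := by
    filter_upwards [ae_lt_top (Measurable.tsum fun n => (hcm n).enorm) hfin.ne] with z hz
    have hsz : Summable fun n => c n • Φ n z.1 z.2 := by
      have h1 : ∀ n, ‖c n • Φ n z.1 z.2‖ₑ = ((‖c n • Φ n z.1 z.2‖₊ : ℝ≥0) : ℝ≥0∞) := fun n => rfl
      simp only [h1] at hz
      rw [lt_top_iff_ne_top, ENNReal.tsum_coe_ne_top_iff_summable, ← NNReal.summable_coe] at hz
      exact hz.of_norm
    have h2 := ((innerSL ℝ (D z.1 z.2)).hasSum hsz.hasSum).tsum_eq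
    rw [real_inner_comm]
    simp only [innerSL_apply_apply, inner_smul_right] at h2
    rw [← h2]
    exact tsum_congr fun n => by rw [real_inner_comm]
  have h_int : Integrable (fun z : ℝ × E d => ⟪∑' n, c n • Φ n z.1 z.2, D z.1 z.2⟫_ℝ)
      (cylinder d T r) := by
    have hS : Measurable fun z : ℝ × E d => ∑' n, c n • Φ n z.1 z.2 := Measurable.tsum hcm
    have hSi : Integrable (fun z : ℝ × E d => ∑' n, c n • Φ n z.1 z.2) (cylinder d T r) :=
      ⟨hS.aestronglyMeasurable, by
        rw [hasFiniteIntegral_iff_enorm]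
        exact (lintegral_mono fun z => enorm_tsum_le_tsum_enorm).trans_lt hfin⟩
    refine (hSi.norm.mul_const C).mono' (hS.inner hDm).aestronglyMeasurable
      (.of_forall fun z => ?_)
    exact (norm_inner_le_norm _ _).trans (mul_le_mul_of_nonneg_left (hC _ _) (norm_nonneg _))
  rw [pairing_eq hT h_int, ← integral_congr_ae hpt, ← hL.tsum_eq]
  refine tsum_congr fun n => ?_
  rw [integral_const_mul, pairing_eq hT ((hΦ n).integrable_inner hq hDm hC).1]

/-- A sequence of bounded fields that is bounded against every test field is bounded on the unit
ball of `L^∞((0,T); L^q(B_r))`. -/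
theorem exists_pairing_bound (hT : 0 ≤ T) (hq : 1 ≤ q) {D : ℕ → ℝ → E d → E d}
    (hDm : ∀ k, Measurable (Function.uncurry (D k))) (hDb : ∀ k, ∃ C, ∀ t x, ‖D k t x‖ ≤ C)
    (hbd : ∀ F, IsDualField T r q F → ∃ C, ∀ k, |pairing T r F (D k)| ≤ C) :
    ∃ C, 0 ≤ C ∧ ∀ k F, UnitField T r q F → |pairing T r F (D k)| ≤ C := by
  by_contra! hcon
  -- If the bound fails, some unit field `Φ n` pairs with some `D (k n)` beyond `n`. All the `D j`
  -- become functionals on `ℓ¹` through combinations of the `Φ n`, so that Banach–Steinhaus applies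
  -- on `ℓ¹` without norming a space of fields.
  choose k Φ hΦ hlt using fun n : ℕ => hcon n (Nat.cast_nonneg n)
  choose C hC using hDb
  have hV : ∀ j n, |pairing T r (Φ n) (D j)|
      ≤ C j * (ENNReal.ofReal T * (volume (Metric.ball (0 : E d) r) + 1)).toReal := fun j n => by
    obtain ⟨h1, h2⟩ := (hΦ n).integrable_inner hq (hDm j) (hC j)
    rw [pairing_eq hT h1]
    exact (norm_integral_le_integral_norm _).trans h2
  set V : ℕ → ℝ := fun j =>
    C j * (ENNReal.ofReal T * (volume (Metric.ball (0 : E d) r) + 1)).toReal with hVdef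
  have hsum : ∀ c : lp (fun _ : ℕ => ℝ) 1, Summable fun n => |c n| := fun c => by
    have := (memℓp_gen_iff (p := 1) (by simp)).1 (lp.memℓp c)
    simpa using this
  have hnorm : ∀ c : lp (fun _ : ℕ => ℝ) 1, ‖c‖ = ∑' n, |c n| := fun c => by
    rw [lp.norm_eq_tsum_rpow (by simp)]
    simp
  have hsum' : ∀ (j : ℕ) (c : lp (fun _ : ℕ => ℝ) 1),
      Summable fun n => c n * pairing T r (Φ n) (D j) := fun j c => by
    refine Summable.of_norm_bounded ((hsum c).mul_right (V j)) fun n => ?_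
    rw [norm_mul]
    exact mul_le_mul_of_nonneg_left (hV j n) (norm_nonneg _)
  set Λ : ℕ → lp (fun _ : ℕ => ℝ) 1 →L[ℝ] ℝ := fun j => LinearMap.mkContinuous
    { toFun := fun c => ∑' n, c n * pairing T r (Φ n) (D j)
      map_add' := fun a b => by
        rw [← (hsum' j a).tsum_add (hsum' j b)]
        exact tsum_congr fun n => by simp [add_mul]
      map_smul' := fun a b => by
        rw [RingHom.id_apply, smul_eq_mul, ← tsum_mul_left]
        exact tsum_congr fun n => by simp [mul_assoc] } (V j) (fun c => by
        rw [hnorm, ← tsum_mul_left]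
        refine tsum_of_norm_bounded ((hsum c).mul_left (V j)).hasSum fun n => ?_
        rw [norm_mul, mul_comm]
        exact mul_le_mul_of_nonneg_right (hV j n) (norm_nonneg _)) with hΛ
  have hΛS : ∀ j c, Λ j c = pairing T r (fun t x => ∑' n, c n • Φ n t x) (D j) := fun j c =>
    tsum_mul_pairing hT hq hΦ (hsum c) (hDm j) (hC j)
  obtain ⟨B, hB⟩ := banach_steinhaus (g := Λ) fun c => by
    obtain ⟨B, hB⟩ := hbd _ (isDualField_tsum hT hq hΦ (hsum c))
    exact ⟨B, fun j => by rw [hΛS]; exact hB j⟩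
  obtain ⟨n, hn⟩ := exists_nat_gt B
  -- The `n`-th basis vector has norm 1 and recovers the large pairing, which contradicts the
  -- uniform bound.
  have h1 : Λ (k n) (lp.single 1 n 1) = pairing T r (Φ n) (D (k n)) := by
    change ∑' m, _ = _
    rw [tsum_eq_single n]
    · simp
    · intro m hm
      simp [lp.single_apply_ne, hm]
  have h2 := (Λ (k n)).le_opNorm (lp.single 1 n 1)
  rw [h1, lp.norm_single (by simp)] at h2
  have h3 := hlt n
  have h4 := hB (k n)
  rw [Real.norm_eq_abs] at h2
  simp only [norm_one, mul_one] at h2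
  linarith

end UniformBoundedness

end VanishingViscosity

namespace VanishingViscosity

variable {d : ℕ}

/-! ### Truncated and regularized Riesz kernels -/

section Kernels

/-- A smooth cutoff in the square of the radius. -/
noncomputable def sqCutoff (δ s : ℝ) : ℝ := Real.smoothTransition (2 - s / δ ^ 2)

/-- The components of a regularized and truncated multiple of the field `y / |y|^d`. -/
noncomputable def rieszKernel (δ η : ℝ) (i : Fin d) (y : E d) : ℝ :=
  y i * (sqCutoff δ (‖y‖ ^ 2) * (‖y‖ ^ 2 + η ^ 2) ^ (-(d : ℝ) / 2))

/-- The part of the divergence of `rieszKernel` that concentrates at the origin. -/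
noncomputable def coreKernel (δ η : ℝ) (y : E d) : ℝ :=
  d * (sqCutoff δ (‖y‖ ^ 2) * (η ^ 2 * (‖y‖ ^ 2 + η ^ 2) ^ (-(d : ℝ) / 2 - 1)))

/-- The part of the divergence of `rieszKernel` that lives where the cutoff varies. -/
noncomputable def annulusKernel (δ η : ℝ) (y : E d) : ℝ :=
  -(2 * ‖y‖ ^ 2 / δ ^ 2) * (deriv Real.smoothTransition (2 - ‖y‖ ^ 2 / δ ^ 2)
    * (max (‖y‖ ^ 2) (δ ^ 2) + η ^ 2) ^ (-(d : ℝ) / 2))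

theorem contDiff_smoothTransition : ContDiff ℝ ∞ Real.smoothTransition :=
  Real.smoothTransition.contDiff

theorem deriv_smoothTransition_of_one_lt {x : ℝ} (hx : 1 < x) :
    deriv Real.smoothTransition x = 0 := by
  have h : Real.smoothTransition =ᶠ[𝓝 x] fun _ => 1 := by
    filter_upwards [lt_mem_nhds hx] with y hy using Real.smoothTransition.one_of_one_le hy.le
  rw [h.deriv_eq, deriv_const]

theorem deriv_smoothTransition_of_neg {x : ℝ} (hx : x < 0) :
    deriv Real.smoothTransition x = 0 := by
  have h : Real.smoothTransition =ᶠ[𝓝 x] fun _ => 0 := by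
    filter_upwards [gt_mem_nhds hx] with y hy using Real.smoothTransition.zero_of_nonpos hy.le
  rw [h.deriv_eq, deriv_const]

theorem sqCutoff_nonneg (δ s : ℝ) : 0 ≤ sqCutoff δ s := Real.smoothTransition.nonneg _

theorem sqCutoff_le_one (δ s : ℝ) : sqCutoff δ s ≤ 1 := Real.smoothTransition.le_one _

variable {δ η : ℝ}

theorem two_le_div {y : E d} (hδ : 0 < δ) (hy : 2 * δ ≤ ‖y‖) : 4 ≤ ‖y‖ ^ 2 / δ ^ 2 := by
  rw [le_div_iff₀ (by positivity)]
  nlinarith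

theorem sqCutoff_eq_zero (hδ : 0 < δ) {y : E d} (hy : 2 * δ ≤ ‖y‖) : sqCutoff δ (‖y‖ ^ 2) = 0 :=
  Real.smoothTransition.zero_of_nonpos (by linarith [two_le_div hδ hy])

theorem sqCutoff_eq_one (hδ : 0 < δ) {y : E d} (hy : ‖y‖ ≤ δ) : sqCutoff δ (‖y‖ ^ 2) = 1 := by
  refine Real.smoothTransition.one_of_one_le ?_
  have : ‖y‖ ^ 2 / δ ^ 2 ≤ 1 := by
    rw [div_le_one (by positivity)]
    exact pow_le_pow_left₀ (norm_nonneg _) hy 2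
  linarith

theorem contDiff_sqCutoff : ContDiff ℝ 1 (fun y : E d => sqCutoff δ (‖y‖ ^ 2)) := by
  have h := (contDiff_smoothTransition.of_le (m := 1) (by norm_num))
  exact h.comp (contDiff_const.sub ((contDiff_norm_sq ℝ).div_const _))

theorem contDiff_rieszKernel (hη : 0 < η) (i : Fin d) :
    ContDiff ℝ 1 (rieszKernel (d := d) δ η i) := by
  have h1 : ContDiff ℝ 1 (fun y : E d => y i) := by fun_prop
  have h2 : ContDiff ℝ 1 (fun y : E d => (‖y‖ ^ 2 + η ^ 2) ^ (-(d : ℝ) / 2)) :=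
    ((contDiff_norm_sq ℝ).add contDiff_const).rpow_const_of_ne fun y => by positivity
  exact h1.mul (contDiff_sqCutoff.mul h2)

theorem rieszKernel_eq_zero (hδ : 0 < δ) (i : Fin d) {y : E d} (hy : 2 * δ ≤ ‖y‖) :
    rieszKernel δ η i y = 0 := by simp [rieszKernel, sqCutoff_eq_zero hδ hy]

theorem hasCompactSupport_rieszKernel (hδ : 0 < δ) (i : Fin d) :
    HasCompactSupport (rieszKernel (d := d) δ η i) :=
  HasCompactSupport.intro (isCompact_closedBall 0 (2 * δ)) fun y hy =>
    rieszKernel_eq_zero hδ i (by simpa using (not_le.1 (by simpa using hy)).le)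

theorem rpow_le_norm_rpow {y : E d} (hy : y ≠ 0) (η : ℝ) :
    (‖y‖ ^ 2 + η ^ 2) ^ (-(d : ℝ) / 2) ≤ ‖y‖ ^ (-(d : ℝ)) := by
  have h0 : 0 < ‖y‖ := norm_pos_iff.2 hy
  calc (‖y‖ ^ 2 + η ^ 2) ^ (-(d : ℝ) / 2) ≤ (‖y‖ ^ 2) ^ (-(d : ℝ) / 2) :=
        Real.rpow_le_rpow_of_nonpos (by positivity) (by nlinarith [sq_nonneg η])
          (by have := Nat.cast_nonneg (α := ℝ) d; linarith)
    _ = ‖y‖ ^ (-(d : ℝ)) := by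
        rw [← Real.rpow_natCast, ← Real.rpow_mul h0.le]
        congr 1; push_cast; ring

theorem norm_rpow_one_sub {y : E d} (hy : y ≠ 0) :
    ‖y‖ * ‖y‖ ^ (-(d : ℝ)) = ‖y‖ ^ (1 - (d : ℝ)) := by
  have h0 : 0 < ‖y‖ := norm_pos_iff.2 hy
  rw [sub_eq_add_neg, Real.rpow_add h0, Real.rpow_one]

theorem abs_coord_le (y : E d) (i : Fin d) : |y i| ≤ ‖y‖ := by
  simpa using PiLp.norm_apply_le y i

theorem abs_rieszKernel_le (δ η : ℝ) (i : Fin d) (y : E d) :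
    |rieszKernel δ η i y| ≤ ‖y‖ ^ (1 - (d : ℝ)) := by
  by_cases hy : y = 0
  · simp only [hy, rieszKernel]
    simp only [PiLp.zero_apply, zero_mul, abs_zero, norm_zero]
    exact Real.rpow_nonneg le_rfl _
  rw [rieszKernel, abs_mul, ← norm_rpow_one_sub hy]
  refine mul_le_mul (abs_coord_le y i) ?_ (abs_nonneg _) (norm_nonneg _)
  rw [abs_of_nonneg (mul_nonneg (sqCutoff_nonneg _ _) (by positivity))]
  exact (mul_le_of_le_one_left (by positivity) (sqCutoff_le_one _ _)).trans (rpow_le_norm_rpow hy η)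

/-- The divergence of the kernel. -/
theorem sum_fderiv_rieszKernel (hδ : 0 < δ) (hη : 0 < η) (y : E d) :
    ∑ i, fderiv ℝ (rieszKernel (d := d) δ η i) y (EuclideanSpace.single i 1)
      = coreKernel δ η y + annulusKernel δ η y := by
  set s : ℝ := ‖y‖ ^ 2 with hs
  have hsp : 0 < s + η ^ 2 := by positivity
  -- The kernel is `y i * g (‖y‖²)`, with divergence `d g + 2 s g'(s)` at `s = ‖y‖²`. The terms that
  -- do not differentiate the cutoff add up to a multiple of `η²`, which is the core kernel.
  set g' : ℝ := -(1 / δ ^ 2) * deriv Real.smoothTransition (2 - s / δ ^ 2)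
      * (s + η ^ 2) ^ (-(d : ℝ) / 2)
    + sqCutoff δ s * (-(d : ℝ) / 2 * (s + η ^ 2) ^ (-(d : ℝ) / 2 - 1)) with hg'
  have hg : HasDerivAt (fun s => sqCutoff δ s * (s + η ^ 2) ^ (-(d : ℝ) / 2)) g' s := by
    have h1 : HasDerivAt (sqCutoff δ)
        (deriv Real.smoothTransition (2 - s / δ ^ 2) * (-(1 / δ ^ 2))) s := by
      have h2 : HasDerivAt (fun s => 2 - s / δ ^ 2) (-(1 / δ ^ 2)) s :=
        ((hasDerivAt_id s).div_const (δ ^ 2)).const_sub 2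
      have h3 := ((contDiff_smoothTransition.differentiable (by simp)) (2 - s / δ ^ 2)).hasDerivAt
      exact h3.comp s h2
    have h4 := ((hasDerivAt_id s).add_const (η ^ 2)).rpow_const (p := -(d : ℝ) / 2)
      (Or.inl hsp.ne')
    refine (h1.mul h4).congr_deriv ?_
    simp only [id, hg']
    ring
  have hn : HasFDerivAt (fun y : E d => ‖y‖ ^ 2) (2 • innerSL ℝ y) y := by
    simpa using (hasStrictFDerivAt_norm_sq y).hasFDerivAt
  have hi : ∀ i, fderiv ℝ (rieszKernel (d := d) δ η i) y (EuclideanSpace.single i 1)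
      = sqCutoff δ s * (s + η ^ 2) ^ (-(d : ℝ) / 2) + 2 * g' * (y i) ^ 2 := fun i => by
    have h1 : HasFDerivAt (fun y : E d => y i) (EuclideanSpace.proj i : E d →L[ℝ] ℝ) y :=
      (EuclideanSpace.proj i : E d →L[ℝ] ℝ).hasFDerivAt
    have h3 : HasFDerivAt (fun y : E d => sqCutoff δ (‖y‖ ^ 2) * (‖y‖ ^ 2 + η ^ 2) ^ (-(d : ℝ) / 2))
        (g' • (2 • innerSL ℝ y)) y :=
      HasDerivAt.comp_hasFDerivAt
        (h₂ := fun s => sqCutoff δ s * (s + η ^ 2) ^ (-(d : ℝ) / 2)) y hg hn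
    have h2 : HasFDerivAt (rieszKernel (d := d) δ η i) _ y := h1.mul h3
    rw [h2.fderiv]
    simp only [add_apply, smul_apply, innerSL_apply_apply, Function.comp_apply, smul_eq_mul]
    rw [EuclideanSpace.inner_single_right]
    simp
    ring
  have hsum : ∑ i, (y i) ^ 2 = s := by
    rw [hs, EuclideanSpace.norm_sq_eq]
    simp
  -- The maximum in `annulusKernel` changes nothing where the cutoff varies, and keeps the kernel
  -- continuous at the origin even for `η = 0`.
  have hmax : deriv Real.smoothTransition (2 - s / δ ^ 2) * (max s (δ ^ 2) + η ^ 2) ^ (-(d : ℝ) / 2)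
      = deriv Real.smoothTransition (2 - s / δ ^ 2) * (s + η ^ 2) ^ (-(d : ℝ) / 2) := by
    rcases le_or_gt (δ ^ 2) s with h | h
    · rw [max_eq_left h]
    · have : s / δ ^ 2 < 1 := by rwa [div_lt_one (by positivity)]
      rw [deriv_smoothTransition_of_one_lt (by linarith), zero_mul, zero_mul]
  have hpow : (s + η ^ 2) ^ (-(d : ℝ) / 2) = (s + η ^ 2) * (s + η ^ 2) ^ (-(d : ℝ) / 2 - 1) := by
    rw [Real.rpow_sub_one hsp.ne']
    field_simp
  rw [Finset.sum_congr rfl fun i _ => hi i, Finset.sum_add_distrib, ← Finset.mul_sum (f := fun i => (y i) ^ 2), hsum]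
  rw [coreKernel, annulusKernel, ← hs, hmax]
  simp only [Finset.sum_const, Finset.card_univ, Fintype.card_fin, nsmul_eq_mul, hg']
  rw [hpow]
  ring

theorem coreKernel_nonneg (δ η : ℝ) (y : E d) : 0 ≤ coreKernel δ η y :=
  mul_nonneg (Nat.cast_nonneg _) (mul_nonneg (sqCutoff_nonneg _ _) (by positivity))

theorem coreKernel_eq_zero (hδ : 0 < δ) {y : E d} (hy : 2 * δ ≤ ‖y‖) : coreKernel δ η y = 0 := by
  simp [coreKernel, sqCutoff_eq_zero hδ hy]

theorem annulusKernel_eq_zero (hδ : 0 < δ) {y : E d} (hy : 2 * δ ≤ ‖y‖) :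
    annulusKernel δ η y = 0 := by
  rw [annulusKernel, deriv_smoothTransition_of_neg (by linarith [two_le_div hδ hy])]
  simp

theorem continuous_coreKernel (hη : 0 < η) : Continuous (coreKernel (d := d) δ η) := by
  have h2 : Continuous (fun y : E d => (‖y‖ ^ 2 + η ^ 2) ^ (-(d : ℝ) / 2 - 1)) :=
    Continuous.rpow_const (by fun_prop) fun y => Or.inl (by positivity)
  exact continuous_const.mul (contDiff_sqCutoff.continuous.mul (continuous_const.mul h2))

theorem continuous_deriv_smoothTransition : Continuous (deriv Real.smoothTransition) :=
  contDiff_smoothTransition.continuous_deriv (by simp)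

theorem continuous_annulusKernel (hδ : 0 < δ) (η : ℝ) :
    Continuous (annulusKernel (d := d) δ η) := by
  have h2 : Continuous (fun y : E d => (max (‖y‖ ^ 2) (δ ^ 2) + η ^ 2) ^ (-(d : ℝ) / 2)) :=
    Continuous.rpow_const (by fun_prop) fun y => Or.inl (by
      have : 0 < max (‖y‖ ^ 2) (δ ^ 2) := lt_max_of_lt_right (by positivity)
      positivity)
  exact Continuous.mul (by fun_prop)
    ((continuous_deriv_smoothTransition.comp (by fun_prop)).mul h2)

theorem abs_annulusKernel_le (hδ : 0 < δ) (η : ℝ) (y : E d) :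
    |annulusKernel δ η y| ≤ |annulusKernel δ 0 y| := by
  have h0 : 0 < max (‖y‖ ^ 2) (δ ^ 2) := lt_max_of_lt_right (by positivity)
  rw [annulusKernel, annulusKernel, abs_mul, abs_mul, abs_mul, abs_mul]
  refine mul_le_mul_of_nonneg_left (mul_le_mul_of_nonneg_left ?_ (abs_nonneg _)) (abs_nonneg _)
  rw [abs_of_nonneg (by positivity), abs_of_nonneg (by positivity)]
  exact Real.rpow_le_rpow_of_nonpos (by positivity) (by nlinarith [sq_nonneg η])
    (by have := Nat.cast_nonneg (α := ℝ) d; linarith)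

theorem hasCompactSupport_annulusKernel (hδ : 0 < δ) (η : ℝ) :
    HasCompactSupport (annulusKernel (d := d) δ η) :=
  HasCompactSupport.intro (isCompact_closedBall 0 (2 * δ)) fun y hy =>
    annulusKernel_eq_zero hδ (by simpa using (not_le.1 (by simpa using hy)).le)

theorem hasCompactSupport_coreKernel (hδ : 0 < δ) (η : ℝ) :
    HasCompactSupport (coreKernel (d := d) δ η) :=
  HasCompactSupport.intro (isCompact_closedBall 0 (2 * δ)) fun y hy =>
    coreKernel_eq_zero hδ (by simpa using (not_le.1 (by simpa using hy)).le)

/-- A null sequence of regularization parameters below `δ`. -/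
noncomputable def etaSeq (δ : ℝ) (n : ℕ) : ℝ := δ / (n + 1)

theorem etaSeq_pos (hδ : 0 < δ) (n : ℕ) : 0 < etaSeq δ n := by unfold etaSeq; positivity

theorem etaSeq_le (hδ : 0 < δ) (n : ℕ) : etaSeq δ n ≤ δ :=
  div_le_self hδ.le (by simp)

theorem tendsto_etaSeq (δ : ℝ) : Tendsto (etaSeq δ) atTop (𝓝 0) :=
  tendsto_const_nhds.div_atTop (tendsto_atTop_add_const_right _ _ tendsto_natCast_atTop_atTop)

theorem tendsto_integral_annulusKernel_sub (hδ : 0 < δ) :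
    Tendsto (fun n => ∫ y : E d, |annulusKernel δ (etaSeq δ n) y - annulusKernel δ 0 y|) atTop
      (𝓝 0) := by
  have h0i : Integrable (annulusKernel (d := d) δ 0) :=
    (continuous_annulusKernel hδ 0).integrable_of_hasCompactSupport
      (hasCompactSupport_annulusKernel hδ 0)
  have := tendsto_integral_of_dominated_convergence (μ := (volume : Measure (E d)))
    (F := fun n y => |annulusKernel δ (etaSeq δ n) y - annulusKernel δ 0 y|) (f := fun _ => 0)
    (fun y => 2 * |annulusKernel δ 0 y|)
    (fun n => (((continuous_annulusKernel hδ _).sub (continuous_annulusKernel hδ _)).abs).aestronglyMeasurable)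
    (h0i.abs.const_mul 2)
    (fun n => .of_forall fun y => ?_) (.of_forall fun y => ?_)
  · simpa using this
  · rw [Real.norm_eq_abs, abs_abs]
    have h1 := abs_annulusKernel_le hδ (etaSeq δ n) y
    have h2 := abs_sub (annulusKernel δ (etaSeq δ n) y) (annulusKernel δ 0 y)
    linarith
  · have h0 : 0 < max (‖y‖ ^ 2) (δ ^ 2) := lt_max_of_lt_right (by positivity)
    have h1 : ContinuousAt (fun η => annulusKernel δ η y) 0 := by
      have h2 : ContinuousAt (fun η : ℝ => (max (‖y‖ ^ 2) (δ ^ 2) + η ^ 2) ^ (-(d : ℝ) / 2)) 0 :=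
        ContinuousAt.rpow_const (by fun_prop) (Or.inl (by simpa using h0.ne'))
      exact continuousAt_const.mul (continuousAt_const.mul h2)
    have h3 : Tendsto (fun n => annulusKernel δ (etaSeq δ n) y) atTop (𝓝 (annulusKernel δ 0 y)) :=
      h1.tendsto.comp (tendsto_etaSeq δ)
    have := (h3.sub_const (annulusKernel δ 0 y)).abs
    simpa using this

/-- Powers of the norm are integrable near the origin up to the critical exponent. -/
theorem integrableOn_norm_rpow (hd : 0 < d) {a : ℝ} (ha : 0 < a + d) (r : ℝ) :
    IntegrableOn (fun y : E d => ‖y‖ ^ a) (Metric.ball 0 r) := by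
  have : Nontrivial (E d) := by
    haveI : Nonempty (Fin d) := ⟨⟨0, hd⟩⟩
    infer_instance
  rw [integrableOn_fun_norm_addHaar volume (f := fun t => t ^ a)]
  rcases le_or_gt r 0 with hr | hr
  · rw [Ioo_eq_empty (by linarith)]; exact integrableOn_empty
  have h1 : IntegrableOn (fun t : ℝ => t ^ (a + d - 1)) (Ioo 0 r) := by
    rw [← integrableOn_Ioc_iff_integrableOn_Ioo, ← intervalIntegrable_iff_integrableOn_Ioc_of_le hr.le]
    exact intervalIntegral.intervalIntegrable_rpow' (by linarith)
  refine h1.congr_fun (fun t ht => ?_) measurableSet_Ioo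
  simp only [smul_eq_mul, finrank_euclideanSpace, Fintype.card_fin]
  rw [← Real.rpow_natCast, ← Real.rpow_add ht.1, Nat.cast_sub hd]
  congr 1
  push_cast
  ring

/-- The core kernel concentrates at the origin as `η` tends to 0. After multiplication by `‖y‖` it
is dominated by a multiple of the locally integrable `‖y‖^(1-d)` and tends to zero away from the
origin. -/
theorem tendsto_integral_coreKernel_mul_norm (hd : 0 < d) (hδ : 0 < δ) :
    Tendsto (fun n => ∫ y : E d, coreKernel δ (etaSeq δ n) y * ‖y‖) atTop (𝓝 0) := by
  have : Nontrivial (E d) := by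
    haveI : Nonempty (Fin d) := ⟨⟨0, hd⟩⟩
    infer_instance
  have h_int : Integrable ((Metric.ball (0 : E d) (2 * δ)).indicator
      fun y => d * ‖y‖ ^ (1 - (d : ℝ))) :=
    (integrable_indicator_iff measurableSet_ball).2
      ((integrableOn_norm_rpow hd (by linarith) _).const_mul _)
  have hne : ∀ᵐ y : E d, y ≠ 0 := by
    simp [ae_iff]
  have := tendsto_integral_of_dominated_convergence (μ := (volume : Measure (E d)))
    (F := fun n y => coreKernel δ (etaSeq δ n) y * ‖y‖) (f := fun _ => 0) _
    (fun n => ((continuous_coreKernel (etaSeq_pos hδ n)).mul continuous_norm).aestronglyMeasurable)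
    h_int (fun n => ?_) ?_
  · simpa using this
  · filter_upwards [hne] with y hy
    by_cases hyb : y ∈ Metric.ball (0 : E d) (2 * δ)
    · rw [indicator_of_mem hyb, Real.norm_of_nonneg
        (mul_nonneg (coreKernel_nonneg _ _ _) (norm_nonneg _)), coreKernel, mul_assoc]
      refine mul_le_mul_of_nonneg_left ?_ (Nat.cast_nonneg _)
      have hsp : 0 < ‖y‖ ^ 2 + etaSeq δ n ^ 2 := by have := etaSeq_pos hδ n; positivity
      rw [← norm_rpow_one_sub hy, mul_comm ‖y‖]
      refine mul_le_mul_of_nonneg_right ?_ (norm_nonneg _)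
      refine le_trans ?_ (rpow_le_norm_rpow hy (etaSeq δ n))
      refine (mul_le_of_le_one_left (by positivity) (sqCutoff_le_one _ _)).trans ?_
      rw [Real.rpow_sub_one hsp.ne', mul_div_assoc']
      rw [div_le_iff₀ hsp, mul_comm]
      exact mul_le_mul_of_nonneg_left (by nlinarith [sq_nonneg ‖y‖]) (by positivity)
    · rw [indicator_of_notMem hyb, coreKernel_eq_zero hδ (by simpa using hyb)]
      simp
  · filter_upwards [hne] with y hy
    have h0 : 0 < ‖y‖ := norm_pos_iff.2 hy
    have h1 : ContinuousAt (fun η : ℝ => η ^ 2 * (‖y‖ ^ 2 + η ^ 2) ^ (-(d : ℝ) / 2 - 1)) 0 := by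
      have h2 : ContinuousAt (fun η : ℝ => (‖y‖ ^ 2 + η ^ 2) ^ (-(d : ℝ) / 2 - 1)) 0 :=
        ContinuousAt.rpow_const (by fun_prop) (Or.inl (by positivity))
      exact ContinuousAt.mul (by fun_prop) h2
    have h3 := (h1.tendsto.comp (tendsto_etaSeq δ)).const_mul (sqCutoff δ (‖y‖ ^ 2))
      |>.const_mul (d : ℝ) |>.mul_const ‖y‖
    simpa [coreKernel, Function.comp_def] using h3

/-- The concentrating part of the divergence keeps a fixed amount of mass. -/
theorem exists_le_integral_coreKernel (hd : 0 < d) :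
    ∃ c > 0, ∀ δ η : ℝ, 0 < η → η ≤ δ → c ≤ ∫ y : E d, coreKernel δ η y := by
  set V : ℝ := volume.real (Metric.ball (0 : E d) 1) with hV
  have hV0 : 0 < V := ENNReal.toReal_pos (Metric.measure_ball_pos _ _ one_pos).ne'
    measure_ball_lt_top.ne
  refine ⟨d * 2 ^ (-(d : ℝ) / 2 - 1) * V, by positivity, fun δ η hη hηδ => ?_⟩
  have hδ : 0 < δ := hη.trans_le hηδ
  have hi : Integrable (coreKernel (d := d) δ η) :=
    (continuous_coreKernel hη).integrable_of_hasCompactSupport (hasCompactSupport_coreKernel hδ η)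
  -- On the ball of radius `η` the kernel is at least a constant times `η⁻ᵈ`, and the volume of the
  -- ball is a constant times `ηᵈ`.
  have hpt : ∀ y ∈ Metric.ball (0 : E d) η,
      d * 2 ^ (-(d : ℝ) / 2 - 1) * (η ^ d)⁻¹ ≤ coreKernel δ η y := fun y hy => by
    have hy' : ‖y‖ ≤ η := by simpa using (Metric.mem_ball.1 hy).le
    rw [coreKernel, sqCutoff_eq_one hδ (hy'.trans hηδ), one_mul, mul_assoc]
    refine mul_le_mul_of_nonneg_left ?_ (Nat.cast_nonneg _)
    have h1 : (2 * η ^ 2) ^ (-(d : ℝ) / 2 - 1) ≤ (‖y‖ ^ 2 + η ^ 2) ^ (-(d : ℝ) / 2 - 1) :=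
      Real.rpow_le_rpow_of_nonpos (by positivity) (by nlinarith [norm_nonneg y])
        (by have := Nat.cast_nonneg (α := ℝ) d; linarith)
    refine le_trans (le_of_eq ?_) (mul_le_mul_of_nonneg_left h1 (sq_nonneg η))
    rw [Real.mul_rpow (by norm_num) (by positivity), ← Real.rpow_natCast η 2, ← Real.rpow_mul hη.le,
      mul_left_comm, ← Real.rpow_add hη, ← Real.rpow_natCast, ← Real.rpow_neg hη.le]
    congr 2
    push_cast
    ring
  calc d * 2 ^ (-(d : ℝ) / 2 - 1) * V
      = ∫ y in Metric.ball (0 : E d) η, d * 2 ^ (-(d : ℝ) / 2 - 1) * (η ^ d)⁻¹ := by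
        rw [setIntegral_const, Measure.real, Measure.addHaar_ball_of_pos _ _ hη, ENNReal.toReal_mul,
          ENNReal.toReal_ofReal (by positivity)]
        simp only [finrank_euclideanSpace, Fintype.card_fin, smul_eq_mul]
        rw [hV, Measure.real]
        field_simp
    _ ≤ ∫ y in Metric.ball (0 : E d) η, coreKernel δ η y :=
        setIntegral_mono_on (integrableOn_const measure_ball_lt_top.ne) hi.integrableOn
          measurableSet_ball hpt
    _ ≤ ∫ y : E d, coreKernel δ η y :=
        setIntegral_le_integral hi (.of_forall fun y => coreKernel_nonneg _ _ _)

/-- The kernels are small in `L^q` when truncated near the origin. -/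
theorem exists_lintegral_rieszKernel_le (hd : 0 < d) {q : ℝ} (hq : 0 < q)
    (hqd : 0 < (1 - (d : ℝ)) * q + d) {τ : ℝ≥0∞} (hτ : τ ≠ 0) :
    ∃ δ > 0, δ ≤ 1 ∧ ∀ (η : ℝ) (i : Fin d), ∫⁻ y, ‖rieszKernel δ η i y‖ₑ ^ q ≤ τ := by
  have h_int := integrableOn_norm_rpow hd hqd 2
  have hfin : ∫⁻ y in Metric.ball (0 : E d) 2, ENNReal.ofReal (‖y‖ ^ ((1 - (d : ℝ)) * q)) ≠ ⊤ := by
    have := h_int.2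
    rw [hasFiniteIntegral_iff_ofReal (.of_forall fun y => by positivity)] at this
    exact this.ne
  -- The hypothesis on `q` says that `‖y‖^((1-d) q)` is integrable near the origin. By absolute
  -- continuity of the integral, a small truncation radius works for all regularizations at once.
  obtain ⟨ρ, hρ, hsmall⟩ := exists_pos_setLIntegral_lt_of_measure_lt hfin hτ
  have hvol : Tendsto (fun δ : ℝ => volume (Metric.ball (0 : E d) (2 * δ))) (𝓝[>] 0) (𝓝 0) := by
    have h1 : Tendsto (fun δ : ℝ => ENNReal.ofReal ((2 * δ) ^ d) * volume (Metric.ball (0 : E d) 1))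
        (𝓝[>] 0) (𝓝 (ENNReal.ofReal ((2 * 0) ^ d) * volume (Metric.ball (0 : E d) 1))) := by
      refine ENNReal.Tendsto.mul_const (ENNReal.tendsto_ofReal ?_) (Or.inr measure_ball_lt_top.ne)
      exact (Continuous.tendsto (by fun_prop) 0).mono_left nhdsWithin_le_nhds
    simp only [mul_zero, ne_eq, hd.ne', not_false_eq_true, zero_pow, ENNReal.ofReal_zero,
      zero_mul] at h1
    refine h1.congr' ?_
    filter_upwards [self_mem_nhdsWithin] with δ hδ
    have hδ' : (0 : ℝ) < 2 * δ := mul_pos two_pos hδ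
    rw [Measure.addHaar_ball_of_pos volume (0 : E d) hδ']
    simp
  have hev : ∀ᶠ δ : ℝ in 𝓝[>] 0, δ ≤ 1 := by
    filter_upwards [Ioo_mem_nhdsGT (zero_lt_one' ℝ)] with δ hδ using hδ.2.le
  obtain ⟨δ, ⟨h1, h2⟩, h3⟩ := ((hvol.eventually (gt_mem_nhds hρ)).and hev).and
    self_mem_nhdsWithin |>.exists
  have hδ : (0 : ℝ) < δ := h3
  refine ⟨δ, hδ, h2, fun η i => ?_⟩
  have hsub : Metric.ball (0 : E d) (2 * δ) ⊆ Metric.ball 0 2 := Metric.ball_subset_ball (by linarith)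
  calc ∫⁻ y, ‖rieszKernel δ η i y‖ₑ ^ q
      ≤ ∫⁻ y, (Metric.ball (0 : E d) (2 * δ)).indicator
          (fun y => ENNReal.ofReal (‖y‖ ^ ((1 - (d : ℝ)) * q))) y := by
        refine lintegral_mono fun y => ?_
        by_cases hy : y ∈ Metric.ball (0 : E d) (2 * δ)
        · rw [indicator_of_mem hy, Real.rpow_mul (norm_nonneg _),
            ← ENNReal.ofReal_rpow_of_nonneg (by positivity) hq.le, Real.enorm_eq_ofReal_abs]
          exact ENNReal.rpow_le_rpow (ENNReal.ofReal_le_ofReal (abs_rieszKernel_le δ η i y)) hq.le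
        · rw [rieszKernel_eq_zero hδ i (by simpa using hy), indicator_of_notMem hy]
          simp [hq]
    _ = ∫⁻ y in Metric.ball (0 : E d) (2 * δ), ENNReal.ofReal (‖y‖ ^ ((1 - (d : ℝ)) * q)) :=
        lintegral_indicator measurableSet_ball _
    _ = ∫⁻ y in Metric.ball (0 : E d) (2 * δ), ENNReal.ofReal (‖y‖ ^ ((1 - (d : ℝ)) * q))
          ∂(volume.restrict (Metric.ball 0 2)) := by
        rw [Measure.restrict_restrict measurableSet_ball, inter_eq_left.2 hsub]
    _ ≤ τ := (hsmall _ ((Measure.restrict_apply_le _ _).trans_lt h1)).le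

end Kernels

end VanishingViscosity

namespace VanishingViscosity

variable {d : ℕ}

/-! ### Recovering a Lipschitz field from its gradient -/

section Representation

variable {δ η : ℝ}

theorem lipschitzWith_inner {w : E d → E d} {C : ℝ≥0} (hw : LipschitzWith C w) (θ : E d) :
    LipschitzWith (‖θ‖₊ * C) (fun y => ⟪θ, w y⟫_ℝ) := by
  have h := (innerSL ℝ θ).lipschitz.comp hw
  rw [show ‖innerSL ℝ θ‖₊ = ‖θ‖₊ from NNReal.eq (innerSL_apply_norm ℝ θ)] at h
  exact h

/-- Integration by parts for a Lipschitz function against a compactly supported `C¹` function, the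
pointwise derivative being supplied by Rademacher's theorem. The reflection `x - y` absorbs the
sign. -/
theorem integral_fderiv_mul_inner {w : E d → E d} {C : ℝ≥0} (hw : LipschitzWith C w) {G : E d → ℝ}
    (hG : ContDiff ℝ 1 G) (hGc : HasCompactSupport G) (θ x v : E d) :
    ∫ y, fderiv ℝ G (x - y) v * ⟪θ, w y⟫_ℝ = ∫ y, G (x - y) * ⟪θ, fderiv ℝ w y v⟫_ℝ := by
  have hgd : ContDiff ℝ 1 (fun y => G (x - y)) := hG.comp (contDiff_const.sub contDiff_id)
  have hgc : HasCompactSupport (fun y => G (x - y)) :=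
    hGc.comp_homeomorph (Homeomorph.subLeft x)
  obtain ⟨D, hD⟩ := hgd.lipschitzWith_of_hasCompactSupport hgc (by norm_num)
  have h := (lipschitzWith_inner hw θ).integral_lineDeriv_mul_eq (μ := volume) hD hgc v
  have h1 : ∀ y, lineDeriv ℝ (fun y => G (x - y)) y (-v) = fderiv ℝ G (x - y) v := fun y => by
    have h2 : HasFDerivAt G (fderiv ℝ G (x - y)) (x - y) :=
      (hG.differentiable (by norm_num) _).hasFDerivAt
    have h3 := h2.comp y ((hasFDerivAt_id y).const_sub x)
    have h4 := h3.hasLineDerivAt (-v)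
    rw [HasLineDerivAt.lineDeriv (f := fun y => G (x - y)) h4]
    simp
  simp only [h1] at h
  rw [← h]
  refine integral_congr_ae ?_
  filter_upwards [hw.ae_differentiableAt (μ := volume)] with y hy
  have h5 : HasFDerivAt (fun y => ⟪θ, w y⟫_ℝ) ((innerSL ℝ θ).comp (fderiv ℝ w y)) y :=
    (innerSL ℝ θ).hasFDerivAt.comp y hy.hasFDerivAt
  rw [(h5.hasLineDerivAt v).lineDeriv, mul_comm]
  simp

/-- A Lipschitz field is recovered from its averages over an annulus and its derivatives. -/
theorem abs_representation_le (hδ : 0 < δ) (hη : 0 < η) {w : E d → E d} {C : ℝ≥0}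
    (hw : LipschitzWith C w) {R : ℝ} (hR : ∀ x, ‖w x‖ ≤ R) {D : Fin d → E d → E d}
    (hD : ∀ i, ∀ᵐ y, D i y = fderiv ℝ w y (EuclideanSpace.single i 1)) (θ x : E d) :
    |(∫ y : E d, coreKernel δ η y) * ⟪θ, w x⟫_ℝ
      - (∑ i, (∫ y, rieszKernel δ η i (x - y) * ⟪θ, D i y⟫_ℝ)
        - ∫ y, annulusKernel δ 0 (x - y) * ⟪θ, w y⟫_ℝ)|
      ≤ ‖θ‖ * (C * (∫ y : E d, coreKernel δ η y * ‖y‖)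
        + R * ∫ y : E d, |annulusKernel δ η y - annulusKernel δ 0 y|) := by
  have hwc : Continuous fun y => ⟪θ, w y⟫_ℝ := (lipschitzWith_inner hw θ).continuous
  have hcore := continuous_coreKernel (d := d) (δ := δ) hη
  have hcs := hasCompactSupport_coreKernel (d := d) hδ η
  have hann := continuous_annulusKernel (d := d) hδ
  have has := hasCompactSupport_annulusKernel (d := d) hδ
  have hci : ∀ {g f : E d → ℝ}, Continuous g → HasCompactSupport g → Continuous f →
      Integrable (fun y => g (x - y) * f y) := fun {g f} hg hgc hf =>
    ((hg.comp (continuous_const.sub continuous_id)).mul hf).integrable_of_hasCompactSupport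
      ((hgc.comp_homeomorph (Homeomorph.subLeft x)).mul_right)
  -- Summing the integrations by parts moves the divergence onto the kernels and produces the core
  -- and annulus parts.
  have e1 : ∑ i, (∫ y, rieszKernel δ η i (x - y) * ⟪θ, D i y⟫_ℝ)
      = (∫ y, coreKernel δ η (x - y) * ⟪θ, w y⟫_ℝ) + ∫ y, annulusKernel δ η (x - y) * ⟪θ, w y⟫_ℝ := by
    rw [← integral_add (hci hcore hcs hwc) (hci (hann η) (has η) hwc)]
    have e2 : ∀ i, ∫ y, rieszKernel δ η i (x - y) * ⟪θ, D i y⟫_ℝ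
        = ∫ y, fderiv ℝ (rieszKernel δ η i) (x - y) (EuclideanSpace.single i 1) * ⟪θ, w y⟫_ℝ :=
      fun i => by
        rw [integral_fderiv_mul_inner hw (contDiff_rieszKernel hη i)
          (hasCompactSupport_rieszKernel hδ i)]
        refine integral_congr_ae ?_
        filter_upwards [hD i] with y hy
        rw [hy]
    rw [Finset.sum_congr rfl fun i _ => e2 i, ← integral_finsetSum]
    · refine integral_congr_ae (.of_forall fun y => ?_)
      beta_reduce
      rw [← add_mul, ← sum_fderiv_rieszKernel hδ hη, Finset.sum_mul]
    · intro i _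
      refine hci (g := fun z => fderiv ℝ (rieszKernel δ η i) z (EuclideanSpace.single i 1)) ?_ ?_ hwc
      · exact ((contDiff_rieszKernel hη i).continuous_fderiv (by norm_num)).clm_apply
          continuous_const
      · exact (hasCompactSupport_rieszKernel hδ i).fderiv_apply (𝕜 := ℝ) _
  have e3 : ∫ y : E d, coreKernel δ η y = ∫ y, coreKernel δ η (x - y) :=
    (integral_sub_left_eq_self _ _ x).symm
  have i1 : Integrable fun y => coreKernel δ η (x - y) * ⟪θ, w x⟫_ℝ := hci hcore hcs continuous_const
  have i2 := hci hcore hcs hwc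
  have i3 := hci (hann η) (has η) hwc
  have i4 := hci (hann 0) (has 0) hwc
  have i5 : Integrable fun y => (annulusKernel δ η (x - y) * ⟪θ, w y⟫_ℝ
      - annulusKernel δ 0 (x - y) * ⟪θ, w y⟫_ℝ) := i3.sub i4
  have i6 : Integrable fun y => (coreKernel δ η (x - y) * ⟪θ, w x⟫_ℝ
      - coreKernel δ η (x - y) * ⟪θ, w y⟫_ℝ) := i1.sub i2
  have e4 : (∫ y : E d, coreKernel δ η y) * ⟪θ, w x⟫_ℝ
      - (∑ i, (∫ y, rieszKernel δ η i (x - y) * ⟪θ, D i y⟫_ℝ)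
        - ∫ y, annulusKernel δ 0 (x - y) * ⟪θ, w y⟫_ℝ)
      = ∫ y, ((coreKernel δ η (x - y) * ⟪θ, w x⟫_ℝ - coreKernel δ η (x - y) * ⟪θ, w y⟫_ℝ)
          - (annulusKernel δ η (x - y) * ⟪θ, w y⟫_ℝ - annulusKernel δ 0 (x - y) * ⟪θ, w y⟫_ℝ)) := by
    rw [integral_sub i6 i5, integral_sub i1 i2, integral_sub i3 i4, e1, e3, integral_mul_const]
    ring
  have j1 : Integrable fun y : E d => coreKernel δ η y * ‖y‖ :=
    (hcore.mul continuous_norm).integrable_of_hasCompactSupport hcs.mul_right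
  have j2 : Integrable fun y : E d => |annulusKernel δ η y - annulusKernel δ 0 y| :=
    (((hann η).integrable_of_hasCompactSupport (has η)).sub
      ((hann 0).integrable_of_hasCompactSupport (has 0))).abs
  have j1' := (j1.comp_sub_left x).const_mul (C : ℝ)
  have j2' := (j2.comp_sub_left x).const_mul R
  rw [e4, ← Real.norm_eq_abs]
  -- Two errors: `w y` is replaced by `w x` under the core kernel, at the price of the Lipschitz
  -- constant, and the annulus kernel at `η` by the one at `0`, at the price of the bound on `w`.
  calc _ ≤ ∫ y, ‖θ‖ * (C * (coreKernel δ η (x - y) * ‖x - y‖)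
        + R * |annulusKernel δ η (x - y) - annulusKernel δ 0 (x - y)|) := by
        refine norm_integral_le_of_norm_le ((j1'.add j2').const_mul ‖θ‖) (.of_forall fun y => ?_)
        refine (norm_sub_le _ _).trans ?_
        rw [← mul_sub, ← sub_mul, ← inner_sub_right, norm_mul, norm_mul, mul_add]
        refine add_le_add ?_ ?_
        · rw [Real.norm_of_nonneg (coreKernel_nonneg _ _ _)]
          have h1 : ‖⟪θ, w x - w y⟫_ℝ‖ ≤ ‖θ‖ * (C * ‖x - y‖) :=
            (norm_inner_le_norm _ _).trans
              (mul_le_mul_of_nonneg_left (hw.norm_sub_le x y) (norm_nonneg _))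
          have := mul_le_mul_of_nonneg_left h1 (coreKernel_nonneg δ η (x - y))
          nlinarith
        · have h1 : ‖⟪θ, w y⟫_ℝ‖ ≤ ‖θ‖ * R := (norm_inner_le_norm _ _).trans
            (mul_le_mul_of_nonneg_left (hR y) (norm_nonneg _))
          have := mul_le_mul_of_nonneg_left h1
            (abs_nonneg (annulusKernel δ η (x - y) - annulusKernel δ 0 (x - y)))
          rw [Real.norm_eq_abs (annulusKernel δ η (x - y) - annulusKernel δ 0 (x - y))]
          nlinarith
    _ = _ := by
        rw [integral_const_mul, integral_add j1' j2', integral_const_mul, integral_const_mul,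
          integral_sub_left_eq_self (fun y : E d => coreKernel δ η y * ‖y‖) volume x,
          integral_sub_left_eq_self
            (fun y : E d => |annulusKernel δ η y - annulusKernel δ 0 y|) volume x]

end Representation

/-! ### Averages of kernels against the law -/

section Smear

open ProbabilityTheory

/-- Average of a field against a kernel and the law at time `t`. -/
noncomputable def smear (κ : Kernel ℝ (E d)) (G : E d → ℝ) (Θ : ℝ → E d → E d) (t : ℝ) (y : E d) :
    E d := ∫ x, G (x - y) • Θ t x ∂κ t

variable {κ : Kernel ℝ (E d)} [IsMarkovKernel κ] {G : E d → ℝ} {Θ : ℝ → E d → E d} {B : ℝ}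

theorem measurable_smear (hG : Continuous G) (hΘ : Measurable (Function.uncurry Θ)) :
    Measurable (Function.uncurry (smear κ G Θ)) := by
  have h1 : StronglyMeasurable fun z : (ℝ × E d) × E d => G (z.2 - z.1.2) • Θ z.1.1 z.2 := by
    have h2 : Measurable fun z : (ℝ × E d) × E d => Θ z.1.1 z.2 :=
      hΘ.comp ((measurable_fst.comp measurable_fst).prodMk measurable_snd)
    have h3 : Measurable fun z : (ℝ × E d) × E d => G (z.2 - z.1.2) :=
      hG.measurable.comp (measurable_snd.sub (measurable_snd.comp measurable_fst))
    exact (h3.smul h2).stronglyMeasurable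
  exact (h1.integral_kernel_prod_right' (κ := κ.comap Prod.fst measurable_fst)).measurable

theorem norm_smear_le {C : ℝ} (hC : ∀ y, |G y| ≤ C) (hB : ∀ t x, ‖Θ t x‖ ≤ B) (t : ℝ) (y : E d) :
    ‖smear κ G Θ t y‖ ≤ C * B := by
  refine (norm_integral_le_of_norm_le_const (C := C * B) (.of_forall fun x => ?_)).trans (by simp)
  rw [norm_smul]
  exact mul_le_mul (hC _) (hB _ _) (norm_nonneg _) ((abs_nonneg _).trans (hC 0))

theorem rpow_lintegral_le {m : Measure (E d)} [IsProbabilityMeasure m] {f : E d → ℝ≥0∞}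
    (hf : AEMeasurable f m) {q : ℝ} (hq : 1 ≤ q) : (∫⁻ x, f x ∂m) ^ q ≤ ∫⁻ x, f x ^ q ∂m := by
  have h := eLpNorm'_le_eLpNorm'_of_exponent_le (f := f) (μ := m) zero_lt_one hq hf.aestronglyMeasurable
  simp only [eLpNorm', enorm_eq_self, ENNReal.rpow_one, div_one] at h
  have hq0 : 0 < q := by linarith
  refine (ENNReal.rpow_le_rpow h hq0.le).trans (le_of_eq ?_)
  rw [← ENNReal.rpow_mul, one_div_mul_cancel hq0.ne', ENNReal.rpow_one]

/-- Jensen's inequality for the probability `κ t`, Tonelli and translation invariance. The bound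
depends only on the `L^q` norm of `G`, so the law needs no density. -/
theorem lintegral_smear_le (hG : Continuous G) (hΘ : Measurable (Function.uncurry Θ))
    (hB : ∀ t x, ‖Θ t x‖ ≤ B) {q : ℝ} (hq : 1 ≤ q) (t : ℝ) :
    ∫⁻ y, ‖smear κ G Θ t y‖ₑ ^ q ≤ ENNReal.ofReal B ^ q * ∫⁻ y, ‖G y‖ₑ ^ q := by
  have hq0 : 0 ≤ q := by linarith
  have hm : Measurable fun z : E d × E d => ‖G (z.2 - z.1)‖ₑ ^ q :=
    ((hG.measurable.comp (measurable_snd.sub measurable_fst)).enorm).pow_const q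
  calc ∫⁻ y, ‖smear κ G Θ t y‖ₑ ^ q
      ≤ ∫⁻ y, ∫⁻ x, ENNReal.ofReal B ^ q * ‖G (x - y)‖ₑ ^ q ∂κ t := by
        refine lintegral_mono fun y => ?_
        refine (ENNReal.rpow_le_rpow (enorm_integral_le_lintegral_enorm _) hq0).trans ?_
        refine (rpow_lintegral_le ?_ hq).trans (lintegral_mono fun x => ?_)
        · have h2 : Measurable (Θ t) := hΘ.comp (measurable_const.prodMk measurable_id)
          exact ((hG.measurable.comp (measurable_id.sub_const y)).smul h2).enorm.aemeasurable
        · rw [enorm_smul, ENNReal.mul_rpow_of_nonneg _ _ hq0, mul_comm]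
          refine mul_le_mul_left ?_ _
          refine ENNReal.rpow_le_rpow ?_ hq0
          rw [← ofReal_norm]
          exact ENNReal.ofReal_le_ofReal (hB _ _)
    _ = ∫⁻ x, (∫⁻ y, ENNReal.ofReal B ^ q * ‖G (x - y)‖ₑ ^ q) ∂κ t :=
        lintegral_lintegral_swap (hm.const_mul _).aemeasurable
    _ = ∫⁻ _, (ENNReal.ofReal B ^ q * ∫⁻ y, ‖G y‖ₑ ^ q) ∂κ t := by
        refine lintegral_congr fun x => ?_
        have hx : Measurable fun y => ‖G (x - y)‖ₑ ^ q :=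
          hm.comp (measurable_id.prodMk measurable_const)
        rw [lintegral_const_mul _ hx]
        congr 1
        exact lintegral_sub_left_eq_self (fun y => ‖G y‖ₑ ^ q) x
    _ = _ := by simp

/-- Fubini's theorem for averages against a kernel. -/
theorem integral_integral_kernel {m : Measure (E d)} [IsProbabilityMeasure m] (hG : Continuous G)
    {C : ℝ} (hC : ∀ y, |G y| ≤ C) (hG2 : ∀ y, 2 ≤ ‖y‖ → G y = 0) {θ Z : E d → E d}
    (hθ : Measurable θ) (hB : ∀ x, ‖θ x‖ ≤ B) {ρ : ℝ} (hρ : ∀ x, ρ ≤ ‖x‖ → θ x = 0)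
    (hZ : Measurable Z) {R : ℝ} (hR : ∀ x, ‖Z x‖ ≤ R) :
    Integrable (fun x => ∫ y, G (x - y) * ⟪θ x, Z y⟫_ℝ) m ∧
    ∫ x, (∫ y, G (x - y) * ⟪θ x, Z y⟫_ℝ) ∂m
      = ∫ y in Metric.ball 0 (ρ + 2), ⟪∫ x, G (x - y) • θ x ∂m, Z y⟫_ℝ := by
  -- The integrand lives on `‖x‖ < ρ` and `‖x - y‖ < 2`, hence on `‖y‖ < ρ + 2`.
  have hin : ∀ x, ∫ y, G (x - y) * ⟪θ x, Z y⟫_ℝ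
      = ∫ y in Metric.ball 0 (ρ + 2), G (x - y) * ⟪θ x, Z y⟫_ℝ := fun x => by
    refine (setIntegral_eq_integral_of_forall_compl_eq_zero fun y hy => ?_).symm
    rcases le_or_gt ρ ‖x‖ with h | h
    · rw [hρ x h]; simp
    · rw [hG2 (x - y), zero_mul]
      have h1 : ρ + 2 ≤ ‖y‖ := by simpa using hy
      have h2 := norm_sub_norm_le y x
      rw [norm_sub_rev] at h2
      linarith
  haveI : IsFiniteMeasure (volume.restrict (Metric.ball (0 : E d) (ρ + 2))) :=
    ⟨by simpa using measure_ball_lt_top⟩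
  have hm : Measurable fun z : E d × E d => G (z.1 - z.2) * ⟪θ z.1, Z z.2⟫_ℝ :=
    (hG.measurable.comp (measurable_fst.sub measurable_snd)).mul
      ((hθ.comp measurable_fst).inner (hZ.comp measurable_snd))
  have hC0 : 0 ≤ C := (abs_nonneg _).trans (hC 0)
  have hB0 : 0 ≤ B := (norm_nonneg _).trans (hB 0)
  have h_int : Integrable (fun z : E d × E d => G (z.1 - z.2) * ⟪θ z.1, Z z.2⟫_ℝ)
      (m.prod (volume.restrict (Metric.ball (0 : E d) (ρ + 2)))) := by
    refine Integrable.of_bound hm.aestronglyMeasurable (C * (B * R)) (.of_forall fun z => ?_)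
    rw [norm_mul]
    exact mul_le_mul (hC _) ((norm_inner_le_norm _ _).trans
      (mul_le_mul (hB _) (hR _) (norm_nonneg _) hB0)) (norm_nonneg _) hC0
  simp only [hin]
  refine ⟨h_int.integral_prod_left, ?_⟩
  rw [integral_integral_swap h_int]
  refine integral_congr_ae (.of_forall fun y => ?_)
  beta_reduce
  have hi : Integrable (fun x => G (x - y) • θ x) m := by
    refine Integrable.of_bound ((hG.measurable.comp (measurable_id.sub_const y)).smul
      hθ).aestronglyMeasurable (C * B) (.of_forall fun x => ?_)
    rw [norm_smul]
    exact mul_le_mul (hC _) (hB _) (norm_nonneg _) hC0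
  rw [real_inner_comm, ← integral_inner hi]
  refine integral_congr_ae (.of_forall fun x => ?_)
  beta_reduce
  rw [inner_smul_right, real_inner_comm]

end Smear

end VanishingViscosity

namespace VanishingViscosity

variable {d : ℕ}

/-! ### Pairing weakly convergent fields with smeared ones -/

section Compensated

open ProbabilityTheory

/-- Bounded Borel fields that are Lipschitz in space. -/
structure IsLipField (T R : ℝ) (w : ℝ → E d → E d) : Prop where
  meas : Measurable (Function.uncurry w)
  bound : ∀ t ∈ Icc 0 T, ∀ x, ‖w t x‖ ≤ R
  lip : ∃ C : ℝ≥0, ∀ᵐ t ∂volume.restrict (Icc 0 T), LipschitzWith C (w t)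

variable {T r : ℝ}

theorem ae_cylinder_of_ae {P : ℝ → Prop} (h : ∀ᵐ t ∂volume.restrict (Icc 0 T), P t) :
    ∀ᵐ z ∂cylinder d T r, P z.1 := Measure.quasiMeasurePreserving_fst.ae h

theorem integrable_cylinder {f : ℝ × E d → ℝ} (hf : Measurable f) {C : ℝ}
    (hC : ∀ t ∈ Icc 0 T, ∀ x, ‖f (t, x)‖ ≤ C) : Integrable f (cylinder d T r) := by
  refine Integrable.of_bound hf.aestronglyMeasurable C ?_
  filter_upwards [ae_cylinder_of_ae (ae_restrict_mem measurableSet_Icc)] with z hz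
    using hC z.1 hz z.2

theorem norm_inner_le_of_bounds {a b : E d} {A B : ℝ} (ha : ‖a‖ ≤ A) (hb : ‖b‖ ≤ B) :
    ‖⟪a, b⟫_ℝ‖ ≤ A * B :=
  (norm_inner_le_norm _ _).trans (mul_le_mul ha hb (norm_nonneg _) ((norm_nonneg _).trans ha))

theorem intervalIntegrable_pairing (hT : 0 ≤ T) {F D : ℝ → E d → E d}
    (hF : Measurable (Function.uncurry F)) (hD : Measurable (Function.uncurry D)) {A B : ℝ}
    (hA : ∀ t x, ‖F t x‖ ≤ A) (hB : ∀ t ∈ Icc 0 T, ∀ x, ‖D t x‖ ≤ B) :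
    IntervalIntegrable (fun t => ∫ x in Metric.ball 0 r, ⟪F t x, D t x⟫_ℝ) volume 0 T := by
  have h : Integrable (fun z : ℝ × E d => ⟪F z.1 z.2, D z.1 z.2⟫_ℝ) (cylinder d T r) :=
    integrable_cylinder (Measurable.inner hF hD) fun t ht x =>
      norm_inner_le_of_bounds (hA t x) (hB t ht x)
  haveI : IsFiniteMeasure (volume.restrict (Metric.ball (0 : E d) r)) :=
    ⟨by simpa using measure_ball_lt_top⟩
  rw [intervalIntegrable_iff_integrableOn_Icc_of_le hT]
  exact h.integral_prod_left

theorem intervalIntegrable_integral_inner (hT : 0 ≤ T) {μ : ℝ → P2 d} (hμ : IsW2Continuous T μ)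
    {F D : ℝ → E d → E d}
    (hF : Measurable (Function.uncurry F)) (hD : Measurable (Function.uncurry D)) {A B : ℝ}
    (hA : ∀ t x, ‖F t x‖ ≤ A) (hB : ∀ t ∈ Icc 0 T, ∀ x, ‖D t x‖ ≤ B) :
    IntervalIntegrable (fun t => ∫ x, ⟪F t x, D t x⟫_ℝ ∂(μ t).toMeasure) volume 0 T := by
  rw [intervalIntegrable_iff_integrableOn_Icc_of_le hT]
  have hm := aestronglyMeasurable_integral_curve hT hμ
    (H := fun t x => ⟪F t x, D t x⟫_ℝ) (h := fun t x => ⟪F t x, D t x⟫_ℝ)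
    (Measurable.inner hF hD).stronglyMeasurable (.of_forall fun t x => rfl)
  refine Integrable.of_bound hm (A * B) ?_
  filter_upwards [ae_restrict_mem measurableSet_Icc] with t ht
  refine (norm_integral_le_of_norm_le_const (C := A * B) (.of_forall fun x =>
    norm_inner_le_of_bounds (hA t x) (hB t ht x))).trans (by simp)

variable {κ : Kernel ℝ (E d)} [IsMarkovKernel κ] {Θ : ℝ → E d → E d} {B ρ : ℝ}

/-- The representation of a Lipschitz field, integrated along a curve of measures. -/
theorem abs_integral_representation_le (hT : 0 < T) {R : ℝ} {w : ℝ → E d → E d}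
    (hw : IsLipField T R w) {C : ℝ≥0}
    (hL : ∀ᵐ t ∂volume.restrict (Icc 0 T), LipschitzWith C (w t)) {D : Fin d → ℝ → E d → E d}
    (hDm : ∀ i, Measurable (Function.uncurry (D i))) (hDb : ∀ i t x, ‖D i t x‖ ≤ C)
    (hD : ∀ i, ∀ᵐ t ∂volume.restrict (Icc 0 T), ∀ᵐ y,
      D i t y = fderiv ℝ (w t) y (EuclideanSpace.single i 1))
    {μ : ℝ → P2 d} (hμ : IsW2Continuous T μ) (hκ : ∀ t ∈ Icc 0 T, κ t = (μ t).toMeasure)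
    (hΘ : Measurable (Function.uncurry Θ)) (hB : ∀ t x, ‖Θ t x‖ ≤ B)
    (hρ : ∀ t x, ρ ≤ ‖x‖ → Θ t x = 0) {δ η : ℝ} (hδ : 0 < δ) (hδ1 : δ ≤ 1) (hη : 0 < η) :
    |(∫ y : E d, coreKernel δ η y) * (∫ t in (0 : ℝ)..T, ∫ x, ⟪Θ t x, w t x⟫_ℝ ∂(μ t).toMeasure)
      - (∑ i, pairing T (ρ + 2) (smear κ (rieszKernel δ η i) Θ) (D i)
        - pairing T (ρ + 2) (smear κ (annulusKernel δ 0) Θ) w)|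
      ≤ B * (C * (∫ y : E d, coreKernel δ η y * ‖y‖)
        + R * ∫ y : E d, |annulusKernel δ η y - annulusKernel δ 0 y|) * T := by
  set m : ℝ := ∫ y : E d, coreKernel δ η y
  set e : ℝ := C * (∫ y : E d, coreKernel δ η y * ‖y‖)
        + R * ∫ y : E d, |annulusKernel δ η y - annulusKernel δ 0 y| with he
  have hrc : ∀ i, Continuous (rieszKernel (d := d) δ η i) := fun i =>
    (contDiff_rieszKernel hη i).continuous
  have hac : Continuous (annulusKernel (d := d) δ 0) := continuous_annulusKernel hδ 0
  choose Kr hKr using fun i =>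
    (hrc i).bounded_above_of_compact_support (hasCompactSupport_rieszKernel hδ i)
  obtain ⟨Ka, hKa⟩ := hac.bounded_above_of_compact_support (hasCompactSupport_annulusKernel hδ 0)
  have ha := intervalIntegrable_integral_inner hT.le hμ hΘ hw.meas hB hw.bound
  have hb : ∀ i, IntervalIntegrable (fun t => ∫ x in Metric.ball 0 (ρ + 2),
      ⟪smear κ (rieszKernel δ η i) Θ t x, D i t x⟫_ℝ) volume 0 T := fun i =>
    intervalIntegrable_pairing hT.le (measurable_smear (hrc i) hΘ) (hDm i)
      (norm_smear_le (hKr i) hB) fun t _ => hDb i t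
  have hc : IntervalIntegrable (fun t => ∫ x in Metric.ball 0 (ρ + 2),
      ⟪smear κ (annulusKernel δ 0) Θ t x, w t x⟫_ℝ) volume 0 T :=
    intervalIntegrable_pairing hT.le (measurable_smear hac hΘ) hw.meas (norm_smear_le hKa hB) hw.bound
  have hB0 : 0 ≤ B := (norm_nonneg _).trans (hB 0 0)
  have hsum : IntervalIntegrable (fun t => ∑ i, ∫ x in Metric.ball 0 (ρ + 2),
      ⟪smear κ (rieszKernel δ η i) Θ t x, D i t x⟫_ℝ) volume 0 T := by
    have := IntervalIntegrable.sum Finset.univ fun i _ => hb i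
    refine this.congr (fun t _ => by simp)
  have heq : m * (∫ t in (0 : ℝ)..T, ∫ x, ⟪Θ t x, w t x⟫_ℝ ∂(μ t).toMeasure)
      - (∑ i, pairing T (ρ + 2) (smear κ (rieszKernel δ η i) Θ) (D i)
        - pairing T (ρ + 2) (smear κ (annulusKernel δ 0) Θ) w)
      = ∫ t in (0 : ℝ)..T, (m * (∫ x, ⟪Θ t x, w t x⟫_ℝ ∂(μ t).toMeasure)
        - ((∑ i, ∫ x in Metric.ball 0 (ρ + 2), ⟪smear κ (rieszKernel δ η i) Θ t x, D i t x⟫_ℝ)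
          - ∫ x in Metric.ball 0 (ρ + 2), ⟪smear κ (annulusKernel δ 0) Θ t x, w t x⟫_ℝ)) := by
    rw [intervalIntegral.integral_sub (ha.const_mul m) (hsum.sub hc),
      intervalIntegral.integral_sub hsum hc, intervalIntegral.integral_const_mul,
      intervalIntegral.integral_finsetSum fun i _ => hb i]
    rfl
  rw [heq, ← Real.norm_eq_abs]
  refine (intervalIntegral.norm_integral_le_of_norm_le_const_ae (C := B * e) ?_).trans
    (by rw [sub_zero, abs_of_pos hT])
  rw [uIoc_of_le hT.le]
  have hgood := (ae_restrict_iff' measurableSet_Icc).1 (hL.and (ae_all_iff.2 hD))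
  filter_upwards [hgood] with t ht htI
  have htI' : t ∈ Icc 0 T := Ioc_subset_Icc_self htI
  obtain ⟨hLt, hDt⟩ := ht htI'
  have hwt : Measurable (w t) := hw.meas.comp (measurable_const.prodMk measurable_id)
  have hΘt : Measurable (Θ t) := hΘ.comp (measurable_const.prodMk measurable_id)
  have h2 : ∀ y : E d, 2 ≤ ‖y‖ → 2 * δ ≤ ‖y‖ := fun y hy => by linarith
  have hr := fun i => integral_integral_kernel (m := (μ t).toMeasure) (Z := D i t) (hrc i) (hKr i)
    (fun y hy => rieszKernel_eq_zero hδ i (h2 y hy)) hΘt (hB t) (hρ t)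
    ((hDm i).comp (measurable_const.prodMk measurable_id)) (hDb i t)
  have han := integral_integral_kernel (m := (μ t).toMeasure) hac hKa
    (fun y hy => annulusKernel_eq_zero hδ (h2 y hy)) hΘt (hB t) (hρ t) hwt (hw.bound t htI')
  have hsm : ∀ (G : E d → ℝ) y, smear κ G Θ t y = ∫ x, G (x - y) • Θ t x ∂(μ t).toMeasure :=
    fun G y => by rw [smear, hκ t htI']
  have hi0 : Integrable (fun x => ⟪Θ t x, w t x⟫_ℝ) (μ t).toMeasure :=
    Integrable.of_bound (hΘt.inner hwt).aestronglyMeasurable (B * R) (.of_forall fun x =>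
      norm_inner_le_of_bounds (hB t x) (hw.bound t htI' x))
  have hi1 : Integrable (fun x => ∑ i, ∫ y, rieszKernel δ η i (x - y) * ⟪Θ t x, D i t y⟫_ℝ)
      (μ t).toMeasure := integrable_finsetSum _ fun i _ => (hr i).1
  have hi2 : Integrable (fun x => (∑ i, ∫ y, rieszKernel δ η i (x - y) * ⟪Θ t x, D i t y⟫_ℝ)
      - ∫ y, annulusKernel δ 0 (x - y) * ⟪Θ t x, w t y⟫_ℝ) (μ t).toMeasure := hi1.sub han.1
  have hfin : m * (∫ x, ⟪Θ t x, w t x⟫_ℝ ∂(μ t).toMeasure)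
        - ((∑ i, ∫ x in Metric.ball 0 (ρ + 2), ⟪smear κ (rieszKernel δ η i) Θ t x, D i t x⟫_ℝ)
          - ∫ x in Metric.ball 0 (ρ + 2), ⟪smear κ (annulusKernel δ 0) Θ t x, w t x⟫_ℝ)
      = ∫ x, (m * ⟪Θ t x, w t x⟫_ℝ - ((∑ i, ∫ y, rieszKernel δ η i (x - y) * ⟪Θ t x, D i t y⟫_ℝ)
          - ∫ y, annulusKernel δ 0 (x - y) * ⟪Θ t x, w t y⟫_ℝ)) ∂(μ t).toMeasure := by
    rw [integral_sub (hi0.const_mul m) hi2, integral_sub hi1 han.1, integral_const_mul,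
      integral_finsetSum _ fun i _ => (hr i).1, han.2, Finset.sum_congr rfl fun i _ => (hr i).2]
    simp only [hsm]
  rw [hfin]
  refine (norm_integral_le_of_norm_le_const (C := B * e) (.of_forall fun x => ?_)).trans (by simp)
  have h3 := abs_representation_le hδ hη hLt (hw.bound t htI') (D := fun i => D i t) hDt (Θ t x) x
  refine h3.trans (mul_le_mul_of_nonneg_right (hB t x) ?_)
  have hR0 : 0 ≤ R := (norm_nonneg _).trans (hw.bound t htI' 0)
  have h4 : 0 ≤ ∫ y : E d, coreKernel δ η y * ‖y‖ :=
    integral_nonneg fun y => mul_nonneg (coreKernel_nonneg _ _ _) (norm_nonneg _)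
  have h5 : 0 ≤ ∫ y : E d, |annulusKernel δ η y - annulusKernel δ 0 y| :=
    integral_nonneg fun y => abs_nonneg _
  positivity

/-- Smeared fields converge, so that weakly convergent fields may be tested against them. -/
theorem tendsto_pairing_smear (hT : 0 < T) {q R : ℝ} (hq : 1 ≤ q) {us : ℕ → ℝ → E d → E d}
    {u : ℝ → E d → E d} (husm : ∀ k, Measurable (Function.uncurry (us k)))
    (hum : Measurable (Function.uncurry u)) (husb : ∀ k, ∀ t ∈ Icc 0 T, ∀ x, ‖us k t x‖ ≤ R)
    (hub : ∀ t ∈ Icc 0 T, ∀ x, ‖u t x‖ ≤ R)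
    (hweak : ∀ F, IsDualField T r q F →
      Tendsto (fun k => pairing T r F (us k)) atTop (𝓝 (pairing T r F u)))
    {κs : ℕ → Kernel ℝ (E d)} [∀ k, IsMarkovKernel (κs k)] {G : E d → ℝ} (hG : Continuous G)
    {C : ℝ} (hC : ∀ y, |G y| ≤ C) (hΘ : Measurable (Function.uncurry Θ)) (hB : ∀ t x, ‖Θ t x‖ ≤ B)
    (hlim : ∀ᵐ t ∂volume.restrict (Icc 0 T), ∀ y,
      Tendsto (fun k => smear (κs k) G Θ t y) atTop (𝓝 (smear κ G Θ t y))) :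
    Tendsto (fun k => pairing T r (smear (κs k) G Θ) (us k) - pairing T r (smear (κs k) G Θ) u)
      atTop (𝓝 0) := by
  have hq0 : 0 < q := by linarith
  have hC0 : 0 ≤ C := (abs_nonneg _).trans (hC 0)
  have hB0 : 0 ≤ B := (norm_nonneg _).trans (hB 0 0)
  have hR0 : 0 ≤ R := (norm_nonneg _).trans (hub 0 ⟨le_rfl, hT.le⟩ 0)
  have hFm := measurable_smear (κ := κ) hG hΘ
  have hFsm := fun k => measurable_smear (κ := κs k) hG hΘ
  have hFb := norm_smear_le (κ := κ) hC hB
  have hFsb := fun k => norm_smear_le (κ := κs k) hC hB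
  have hdual : IsDualField T r q (smear κ G Θ) := by
    refine ⟨hFm, ?_⟩
    have hpt : ∀ t, ∫⁻ x in Metric.ball 0 r, ‖smear κ G Θ t x‖ₑ ^ q
        ≤ ENNReal.ofReal (C * B) ^ q * volume (Metric.ball (0 : E d) r) := fun t => by
      calc _ ≤ ∫⁻ x in Metric.ball (0 : E d) r, ENNReal.ofReal (C * B) ^ q := by
            refine lintegral_mono fun x => ENNReal.rpow_le_rpow ?_ hq0.le
            rw [← ofReal_norm]
            exact ENNReal.ofReal_le_ofReal (hFb t x)
        _ = _ := by simp
    have hfin : (ENNReal.ofReal (C * B) ^ q * volume (Metric.ball (0 : E d) r)) ^ (2 / q) < ⊤ :=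
      ENNReal.rpow_lt_top_of_nonneg (by positivity) (ENNReal.mul_ne_top
        (ENNReal.rpow_ne_top_of_nonneg hq0.le ENNReal.ofReal_ne_top) measure_ball_lt_top.ne)
    calc _ ≤ ∫⁻ _ in Icc 0 T,
          (ENNReal.ofReal (C * B) ^ q * volume (Metric.ball (0 : E d) r)) ^ (2 / q) :=
          lintegral_mono fun t => ENNReal.rpow_le_rpow (hpt t) (by positivity)
      _ < ⊤ := by
          simp only [lintegral_const, MeasurableSet.univ, Measure.restrict_apply, univ_inter,
            Real.volume_Icc]
          exact ENNReal.mul_lt_top hfin ENNReal.ofReal_lt_top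
  have hdiff : ∀ k (w : ℝ → E d → E d), Measurable (Function.uncurry w) →
      (∀ t ∈ Icc 0 T, ∀ x, ‖w t x‖ ≤ R) →
      |pairing T r (smear (κs k) G Θ) w - pairing T r (smear κ G Θ) w|
        ≤ R * ∫ z, ‖smear (κs k) G Θ z.1 z.2 - smear κ G Θ z.1 z.2‖ ∂cylinder d T r :=
    fun k w hwm hwb => by
      have hi1 : Integrable (fun z : ℝ × E d => ⟪smear (κs k) G Θ z.1 z.2, w z.1 z.2⟫_ℝ)
          (cylinder d T r) := integrable_cylinder (Measurable.inner (hFsm k) hwm) fun t ht x =>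
            norm_inner_le_of_bounds (hFsb k t x) (hwb t ht x)
      have hi2 : Integrable (fun z : ℝ × E d => ⟪smear κ G Θ z.1 z.2, w z.1 z.2⟫_ℝ)
          (cylinder d T r) := integrable_cylinder (Measurable.inner hFm hwm) fun t ht x =>
            norm_inner_le_of_bounds (hFb t x) (hwb t ht x)
      have hi3 : Integrable (fun z : ℝ × E d => ‖smear (κs k) G Θ z.1 z.2 - smear κ G Θ z.1 z.2‖)
          (cylinder d T r) := by
        refine integrable_cylinder ((hFsm k).sub hFm).norm (C := C * B + C * B) fun t _ x => ?_
        rw [norm_norm]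
        exact (norm_sub_le _ _).trans (add_le_add (hFsb k t x) (hFb t x))
      rw [pairing_eq hT.le hi1, pairing_eq hT.le hi2, ← integral_sub hi1 hi2, ← integral_const_mul,
        ← Real.norm_eq_abs]
      refine norm_integral_le_of_norm_le (hi3.const_mul R) ?_
      filter_upwards [ae_cylinder_of_ae (ae_restrict_mem measurableSet_Icc)] with z hz
      rw [← inner_sub_left, mul_comm]
      exact norm_inner_le_of_bounds le_rfl (hwb z.1 hz z.2)
  -- The smeared fields are uniformly bounded and converge pointwise, hence in `L¹` of the cylinder;
  -- the bounded fields `us k` tolerate this replacement uniformly in `k`.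
  have herr : Tendsto (fun k => ∫ z, ‖smear (κs k) G Θ z.1 z.2 - smear κ G Θ z.1 z.2‖
      ∂cylinder d T r) atTop (𝓝 0) := by
    have := tendsto_integral_of_dominated_convergence (μ := cylinder d T r)
      (F := fun k z => ‖smear (κs k) G Θ z.1 z.2 - smear κ G Θ z.1 z.2‖) (f := fun _ => 0)
      (fun _ => C * B + C * B) (fun k => ((hFsm k).sub hFm).norm.aestronglyMeasurable)
      (integrable_const _) (fun k => .of_forall fun z => ?_) ?_
    · simpa using this
    · rw [norm_norm]
      exact (norm_sub_le _ _).trans (add_le_add (hFsb k _ _) (hFb _ _))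
    · filter_upwards [ae_cylinder_of_ae hlim] with z hz
      exact tendsto_iff_norm_sub_tendsto_zero.1 (hz z.2)
  have hmain := (hweak _ hdual).sub_const (pairing T r (smear κ G Θ) u)
  rw [sub_self] at hmain
  have hbound := (herr.const_mul (R + R))
  rw [mul_zero] at hbound
  have hsplit : Tendsto (fun k => (pairing T r (smear (κs k) G Θ) (us k)
      - pairing T r (smear (κs k) G Θ) u)
      - (pairing T r (smear κ G Θ) (us k) - pairing T r (smear κ G Θ) u)) atTop (𝓝 0) := by
    refine squeeze_zero_norm (fun k => ?_) hbound
    have h1 := hdiff k (us k) (husm k) (husb k)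
    have h2 := hdiff k u hum hub
    rw [Real.norm_eq_abs]
    have h3 := abs_sub (pairing T r (smear (κs k) G Θ) (us k) - pairing T r (smear κ G Θ) (us k))
      (pairing T r (smear (κs k) G Θ) u - pairing T r (smear κ G Θ) u)
    calc _ = |pairing T r (smear (κs k) G Θ) (us k) - pairing T r (smear κ G Θ) (us k)
      - (pairing T r (smear (κs k) G Θ) u - pairing T r (smear κ G Θ) u)| := by congr 1; ring
      _ ≤ _ := by linarith
  have := hsplit.add hmain
  rw [add_zero] at this
  exact this.congr fun k => by ring

end Compensated

end VanishingViscosity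

namespace VanishingViscosity

variable {d : ℕ}

/-! ### Vector-valued test functions for narrow convergence -/

section NarrowConvergence

variable {ι : Type*} {l : Filter ι} {ps : ι → ProbabilityMeasure (E d)} {p : ProbabilityMeasure (E d)}

theorem tendsto_integral_of_bounded_continuous (h : Tendsto ps l (𝓝 p)) {f : E d → ℝ}
    (hf : Continuous f) {C : ℝ} (hC : ∀ x, ‖f x‖ ≤ C) :
    Tendsto (fun i => ∫ x, f x ∂(ps i : Measure (E d))) l (𝓝 (∫ x, f x ∂(p : Measure (E d)))) :=
  ProbabilityMeasure.tendsto_iff_forall_integral_tendsto.1 h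
    (BoundedContinuousFunction.ofNormedAddCommGroup f hf C hC)

theorem tendsto_integral_vector_of_bounded_continuous (h : Tendsto ps l (𝓝 p)) {f : E d → E d}
    (hf : Continuous f) {C : ℝ} (hC : ∀ x, ‖f x‖ ≤ C) :
    Tendsto (fun i => ∫ x, f x ∂(ps i : Measure (E d))) l (𝓝 (∫ x, f x ∂(p : Measure (E d)))) := by
  have h_int : ∀ m : ProbabilityMeasure (E d), Integrable f (m : Measure (E d)) := fun m =>
    Integrable.of_bound hf.aestronglyMeasurable C (.of_forall hC)
  rw [(EuclideanSpace.equiv (Fin d) ℝ).toHomeomorph.isInducing.tendsto_nhds_iff, tendsto_pi_nhds]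
  intro i
  have h1 : ∀ m : ProbabilityMeasure (E d),
      (∫ x, f x ∂(m : Measure (E d))) i = ∫ x, f x i ∂(m : Measure (E d)) := fun m =>
    ((EuclideanSpace.proj i : E d →L[ℝ] ℝ).integral_comp_comm (h_int m)).symm
  have h2 := tendsto_integral_of_bounded_continuous h (f := fun x => f x i) (by fun_prop)
    (C := C) fun x => (abs_coord_le (f x) i).trans (hC x)
  simp only [← h1] at h2
  exact h2

end NarrowConvergence

/-! ### Replacing a weakly convergent control by its limit -/

section Compensated

open ProbabilityTheory

variable {T r : ℝ}

theorem pairing_smul (c : ℝ) (F D : ℝ → E d → E d) :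
    pairing T r (fun t x => c • F t x) D = c * pairing T r F D := by
  simp only [pairing, inner_smul_left, integral_const_mul, intervalIntegral.integral_const_mul]
  simp

theorem pairing_congr_ae (hT : 0 ≤ T) {F D D' : ℝ → E d → E d}
    (h : ∀ᵐ t ∂volume.restrict (Icc 0 T), ∀ᵐ x, D t x = D' t x) :
    pairing T r F D = pairing T r F D' := by
  refine intervalIntegral.integral_congr_ae ?_
  rw [uIoc_of_le hT]
  filter_upwards [(ae_restrict_iff' measurableSet_Icc).1 h] with t ht htI
  refine integral_congr_ae ?_
  filter_upwards [ae_restrict_of_ae (ht (Ioc_subset_Icc_self htI))] with x hx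
  rw [hx]

/-- Weak convergence of a sequence of controls, together with their space derivatives. -/
def WeakSeq (T q : ℝ) (us : ℕ → ℝ → E d → E d) (u : ℝ → E d → E d) : Prop :=
  ∀ r > 0, ∀ F, IsDualField T r q F →
    Tendsto (fun k => pairing T r F (us k)) atTop (𝓝 (pairing T r F u)) ∧
    ∀ v : E d, Tendsto (fun k => pairing T r F (fun t x => fderiv ℝ (us k t) x v)) atTop
      (𝓝 (pairing T r F (fun t x => fderiv ℝ (u t) x v)))

theorem WeakSeq.const (T q : ℝ) (u : ℝ → E d → E d) : WeakSeq T q (fun _ => u) u :=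
  fun _ _ _ _ => ⟨tendsto_const_nhds, fun _ => tendsto_const_nhds⟩

/-- The derivatives of a weakly convergent sequence of Lipschitz controls are uniformly bounded on
the unit ball of test fields. -/
theorem WeakSeq.exists_derivative_bound (hT : 0 < T) {q R : ℝ} (hq : 1 ≤ q)
    {us : ℕ → ℝ → E d → E d} {u : ℝ → E d → E d} (hw : WeakSeq T q us u)
    (hus : ∀ k, IsLipField T R (us k)) (hr : 0 < r) :
    ∃ (C : ℕ → ℝ≥0) (D : ℕ → Fin d → ℝ → E d → E d) (K : ℝ),
      (∀ k, ∀ᵐ t ∂volume.restrict (Icc 0 T), LipschitzWith (C k) (us k t)) ∧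
      (∀ k i, Measurable (Function.uncurry (D k i))) ∧ (∀ k i t x, ‖D k i t x‖ ≤ C k) ∧
      (∀ k i, ∀ᵐ t ∂volume.restrict (Icc 0 T), ∀ᵐ y,
        D k i t y = fderiv ℝ (us k t) y (EuclideanSpace.single i 1)) ∧
      0 ≤ K ∧ ∀ k i F, UnitField T r q F → |pairing T r F (D k i)| ≤ K := by
  choose C hC using fun k => (hus k).lip
  choose D hDm hDb hD using fun (k : ℕ) (i : Fin d) =>
    exists_measurable_fderiv (hus k).meas (hC k) (EuclideanSpace.single i (1 : ℝ))
  have hDb' : ∀ k i t x, ‖D k i t x‖ ≤ C k := fun k i t x => by simpa using hDb k i t x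
  have hK : ∀ i, ∃ K, 0 ≤ K ∧ ∀ k F, UnitField T r q F → |pairing T r F (D k i)| ≤ K := fun i => by
    refine exists_pairing_bound hT.le hq (fun k => hDm k i) (fun k => ⟨_, hDb k i⟩) fun F hF => ?_
    have h1 := (hw r hr F hF).2 (EuclideanSpace.single i 1)
    obtain ⟨K, hK⟩ := (Metric.isBounded_range_of_tendsto _ h1).exists_norm_le
    refine ⟨K, fun k => ?_⟩
    rw [pairing_congr_ae hT.le (hD k i)]
    exact hK _ ⟨k, rfl⟩
  choose K hK0 hK using hK
  refine ⟨C, D, ∑ i, K i, hC, hDm, hDb', hD, Finset.sum_nonneg fun i _ => hK0 i, fun k i F hF => ?_⟩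
  exact (hK i k F hF).trans (Finset.single_le_sum (fun i _ => hK0 i) (Finset.mem_univ i))

/-- This converts smallness of the kernel in `L^q` into smallness of pairings: rescaled by `1/τ`,
the smeared field is still a unit field, so a bound `K` on unit fields becomes `K * τ`. -/
theorem unitField_smear {κ : Kernel ℝ (E d)} [IsMarkovKernel κ] {G : E d → ℝ} (hG : Continuous G)
    {Θ : ℝ → E d → E d} (hΘ : Measurable (Function.uncurry Θ)) {B : ℝ} (hB0 : 0 < B)
    (hB : ∀ t x, ‖Θ t x‖ ≤ B) {q : ℝ} (hq : 1 ≤ q) {τ : ℝ} (hτ : 0 < τ)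
    (hGq : ∫⁻ y, ‖G y‖ₑ ^ q ≤ ENNReal.ofReal (τ / B) ^ q) :
    UnitField T r q (fun t x => τ⁻¹ • smear κ G Θ t x) := by
  have hq0 : 0 ≤ q := by linarith
  refine ⟨(measurable_smear hG hΘ).const_smul τ⁻¹, fun t _ => ?_⟩
  have hm : Measurable fun y => ‖smear κ G Θ t y‖ₑ ^ q :=
    (((measurable_smear hG hΘ).comp (measurable_const.prodMk measurable_id)).enorm).pow_const q
  calc ∫⁻ x in Metric.ball 0 r, ‖τ⁻¹ • smear κ G Θ t x‖ₑ ^ q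
      ≤ ∫⁻ x, ‖τ⁻¹ • smear κ G Θ t x‖ₑ ^ q := setLIntegral_le_lintegral _ _
    _ = ‖τ⁻¹‖ₑ ^ q * ∫⁻ x, ‖smear κ G Θ t x‖ₑ ^ q := by
        rw [← lintegral_const_mul _ hm]
        refine lintegral_congr fun x => ?_
        rw [enorm_smul, ENNReal.mul_rpow_of_nonneg _ _ hq0]
    _ ≤ ‖τ⁻¹‖ₑ ^ q * (ENNReal.ofReal B ^ q * ENNReal.ofReal (τ / B) ^ q) := by
        gcongr
        exact (lintegral_smear_le hG hΘ hB hq t).trans (by gcongr)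
    _ = 1 := by
        rw [← ENNReal.mul_rpow_of_nonneg _ _ hq0, ← ENNReal.mul_rpow_of_nonneg _ _ hq0,
          Real.enorm_eq_ofReal (by positivity), ← ENNReal.ofReal_mul (by positivity),
          ← ENNReal.ofReal_mul (by positivity)]
        have : τ⁻¹ * (B * (τ / B)) = 1 := by field_simp
        rw [this]
        simp

/-- Write both controls through the representation formula, integrated against `Θ` and the law. The
gradient terms are uniformly small once the truncation radius `δ` is, by the Banach–Steinhaus bound;
for that fixed `δ` the annulus terms converge. The mass of the core kernel, bounded below by `c`, is
divided out. -/
theorem tendsto_integral_inner_sub_of_support (hd : 0 < d) (hT : 0 < T) {q R : ℝ} (hq : 1 ≤ q)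
    (hqd : 0 < (1 - (d : ℝ)) * q + d) {us : ℕ → ℝ → E d → E d} {u : ℝ → E d → E d}
    (hw : WeakSeq T q us u) (hus : ∀ k, IsLipField T R (us k)) (hu : IsLipField T R u)
    {μs : ℕ → ℝ → P2 d} {μ : ℝ → P2 d} (hμs : ∀ k, IsW2Continuous T (μs k))
    (hμ : IsW2Continuous T μ)
    (hlim : ∀ t ∈ Icc 0 T, Tendsto (fun k => W2 (μs k t) (μ t)) atTop (𝓝 0))
    {Θ : ℝ → E d → E d} (hΘ : Measurable (Function.uncurry Θ)) {B : ℝ} (hB : ∀ t x, ‖Θ t x‖ ≤ B)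
    (hΘc : ∀ᵐ t ∂volume.restrict (Icc 0 T), Continuous (Θ t)) {ρ : ℝ} (hρ0 : 0 < ρ)
    (hρ : ∀ t x, ρ ≤ ‖x‖ → Θ t x = 0) :
    Tendsto (fun k => (∫ t in (0 : ℝ)..T, ∫ x, ⟪Θ t x, us k t x⟫_ℝ ∂(μs k t).toMeasure)
      - ∫ t in (0 : ℝ)..T, ∫ x, ⟪Θ t x, u t x⟫_ℝ ∂(μs k t).toMeasure) atTop (𝓝 0) := by
  wlog hB0 : 0 < B generalizing B
  · exact this (B := max B 1) (fun t x => (hB t x).trans (le_max_left _ _))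
      (lt_max_of_lt_right one_pos)
  have hr : 0 < ρ + 2 := by linarith
  choose κs hκsM hκs using fun k => exists_kernel hT.le (hμs k)
  obtain ⟨κ, hκM, hκ⟩ := exists_kernel hT.le hμ
  obtain ⟨C, D, K, hC, hDm, hDb, hD, hK0, hK⟩ := hw.exists_derivative_bound hT hq hus hr
  obtain ⟨C', D', K', hC', hDm', hDb', hD', hK0', hK'⟩ :=
    (WeakSeq.const T q u).exists_derivative_bound hT hq (fun _ => hu) hr
  obtain ⟨c, hc0, hc⟩ := exists_le_integral_coreKernel hd
  rw [Metric.tendsto_atTop]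
  intro ε hε
  -- Chosen so that the gradient terms of both controls together cost at most `c * ε / 4`; the
  -- annulus terms get another `c * ε / 4`.
  set τ : ℝ := c * ε / (4 * (d * (K + K') + 1)) with hτdef
  have hτ : 0 < τ := by positivity
  obtain ⟨δ, hδ, hδ1, hsmall⟩ := exists_lintegral_rieszKernel_le hd (zero_lt_one.trans_le hq) hqd
    (τ := ENNReal.ofReal (τ / B) ^ q)
    (by
      have : 0 < ENNReal.ofReal (τ / B) := ENNReal.ofReal_pos.2 (by positivity)
      exact (ENNReal.rpow_pos this ENNReal.ofReal_ne_top).ne')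
  have hac : Continuous (annulusKernel (d := d) δ 0) := continuous_annulusKernel hδ 0
  obtain ⟨Ka, hKa⟩ := hac.bounded_above_of_compact_support (hasCompactSupport_annulusKernel hδ 0)
  have hB1 : Tendsto (fun k => pairing T (ρ + 2) (smear (κs k) (annulusKernel δ 0) Θ) (us k)
      - pairing T (ρ + 2) (smear (κs k) (annulusKernel δ 0) Θ) u) atTop (𝓝 0) := by
    refine tendsto_pairing_smear (κ := κ) hT hq (fun k => (hus k).meas) hu.meas
      (fun k => (hus k).bound) hu.bound (fun F hF => (hw _ hr F hF).1) hac hKa hΘ hB ?_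
    filter_upwards [hΘc, ae_restrict_mem measurableSet_Icc] with t ht htI y
    have h1 := tendsto_prob_of_tendsto_W2 (hlim t htI)
    have hf : Continuous fun x => annulusKernel δ 0 (x - y) • Θ t x :=
      (hac.comp (continuous_id.sub continuous_const)).smul ht
    have hfb : ∀ x, ‖annulusKernel δ 0 (x - y) • Θ t x‖ ≤ Ka * B := fun x => by
      rw [norm_smul]
      exact mul_le_mul (hKa _) (hB _ _) (norm_nonneg _) ((norm_nonneg _).trans (hKa 0))
    simp only [smear, hκs _ t htI, hκ t htI]
    exact tendsto_integral_vector_of_bounded_continuous h1 hf hfb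
  obtain ⟨N, hN⟩ := Metric.tendsto_atTop.1 hB1 (c * ε / 4) (by positivity)
  refine ⟨N, fun k hk => ?_⟩
  have hNk := hN k hk
  rw [Real.dist_0_eq_abs] at hNk
  rw [Real.dist_0_eq_abs]
  set I := ∫ t in (0 : ℝ)..T, ∫ x, ⟪Θ t x, us k t x⟫_ℝ ∂(μs k t).toMeasure
  set I' := ∫ t in (0 : ℝ)..T, ∫ x, ⟪Θ t x, u t x⟫_ℝ ∂(μs k t).toMeasure
  set e : ℝ≥0 → ℕ → ℝ := fun C n => B * (C * (∫ y : E d, coreKernel δ (etaSeq δ n) y * ‖y‖)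
        + R * ∫ y : E d, |annulusKernel δ (etaSeq δ n) y - annulusKernel δ 0 y|) * T with he
  have helim : ∀ C, Tendsto (e C) atTop (𝓝 0) := fun C => by
    have h1 := ((tendsto_integral_coreKernel_mul_norm hd hδ).const_mul (C : ℝ)).add
      ((tendsto_integral_annulusKernel_sub (d := d) hδ).const_mul R)
      |>.const_mul B |>.mul_const T
    simpa using h1
  -- The remainders `e` involve the Lipschitz constant of `us k`, which is not controlled in `k`.
  -- They are removed by letting the regularization `n` tend to infinity with `k` fixed, all other
  -- bounds being independent of `n`.
  have hbound : ∀ n, c * |I - I'| ≤ e (C k) n + e (C' k) n + (d * (K + K') * τ + c * ε / 4) :=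
    fun n => by
      have hη := etaSeq_pos hδ n
      have h1 := abs_integral_representation_le hT (hus k) (hC k) (hDm k) (hDb k) (hD k) (hμs k)
        (hκs k) hΘ hB hρ hδ hδ1 hη
      have h2 := abs_integral_representation_le hT hu (hC' k) (hDm' k) (hDb' k) (hD' k) (hμs k)
        (hκs k) hΘ hB hρ hδ hδ1 hη
      have hun : ∀ i, UnitField T (ρ + 2) q
          (fun t x => τ⁻¹ • smear (κs k) (rieszKernel δ (etaSeq δ n) i) Θ t x) := fun i =>
        unitField_smear (contDiff_rieszKernel hη i).continuous hΘ hB0 hB hq hτ (hsmall _ i)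
      have hres : ∀ (i : Fin d) (Z : ℝ → E d → E d) (K : ℝ),
          |pairing T (ρ + 2) (fun t x => τ⁻¹ • smear (κs k) (rieszKernel δ (etaSeq δ n) i) Θ t x) Z|
            ≤ K → |pairing T (ρ + 2) (smear (κs k) (rieszKernel δ (etaSeq δ n) i) Θ) Z| ≤ K * τ :=
        fun i Z K h => by
          rw [pairing_smul, abs_mul, abs_of_pos (by positivity), inv_mul_le_iff₀ hτ] at h
          linarith
      have h3 : |∑ i, pairing T (ρ + 2) (smear (κs k) (rieszKernel δ (etaSeq δ n) i) Θ) (D k i)|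
          ≤ d * (K * τ) := by
        refine (Finset.abs_sum_le_sum_abs _ _).trans ?_
        refine (Finset.sum_le_sum fun i _ => hres i _ K (hK k i _ (hun i))).trans (by simp)
      have h4 : |∑ i, pairing T (ρ + 2) (smear (κs k) (rieszKernel δ (etaSeq δ n) i) Θ) (D' k i)|
          ≤ d * (K' * τ) := by
        refine (Finset.abs_sum_le_sum_abs _ _).trans ?_
        refine (Finset.sum_le_sum fun i _ => hres i _ K' (hK' k i _ (hun i))).trans (by simp)
      have hcm := hc δ (etaSeq δ n) hη (etaSeq_le hδ n)
      have h5 : c * |I - I'| ≤ |(∫ y : E d, coreKernel δ (etaSeq δ n) y) * I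
          - (∫ y : E d, coreKernel δ (etaSeq δ n) y) * I'| := by
        rw [← mul_sub, abs_mul, abs_of_nonneg (hc0.le.trans hcm)]
        exact mul_le_mul_of_nonneg_right hcm (abs_nonneg _)
      refine h5.trans ?_
      rw [abs_le] at h1 h2 h3 h4 ⊢
      have h6 := abs_le.1 hNk.le
      simp only [he]
      constructor <;> linarith [h1.1, h1.2, h2.1, h2.2, h3.1, h3.2, h4.1, h4.2, h6.1, h6.2]
  have hlimb : c * |I - I'| ≤ 0 + 0 + (d * (K + K') * τ + c * ε / 4) :=
    ge_of_tendsto' (((helim (C k)).add (helim (C' k))).add_const _) hbound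
  have hτ2 : d * (K + K') * τ ≤ c * ε / 4 := by
    have : 0 ≤ d * (K + K') := by positivity
    rw [hτdef, mul_div_assoc', div_le_iff₀ (by positivity)]
    nlinarith [mul_pos hc0 hε]
  have : c * |I - I'| < c * ε := by nlinarith [mul_pos hc0 hε]
  exact lt_of_mul_lt_mul_left this hc0.le

/-- Along convergent curves of measures, a weakly convergent sequence of Lipschitz controls may be
replaced by its limit. -/
theorem tendsto_integral_inner_sub (hT : 0 < T) {R : ℝ} {us : ℕ → ℝ → E d → E d}
    {u : ℝ → E d → E d} (hw : WeakSeq T ((d + 2 : ℝ) / (d + 1)) us u)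
    (hus : ∀ k, IsLipField T R (us k)) (hu : IsLipField T R u)
    {μs : ℕ → ℝ → P2 d} {μ : ℝ → P2 d} (hμs : ∀ k, IsW2Continuous T (μs k))
    (hμ : IsW2Continuous T μ)
    (hlim : ∀ t ∈ Icc 0 T, Tendsto (fun k => W2 (μs k t) (μ t)) atTop (𝓝 0))
    {K : ℝ} (hK : ∀ k, ∀ t ∈ Icc 0 T, (μs k t).M2 ≤ K)
    {Θ : ℝ → E d → E d} (hΘ : Measurable (Function.uncurry Θ)) {B : ℝ} (hB : ∀ t x, ‖Θ t x‖ ≤ B)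
    (hΘc : ∀ᵐ t ∂volume.restrict (Icc 0 T), Continuous (Θ t)) :
    Tendsto (fun k => (∫ t in (0 : ℝ)..T, ∫ x, ⟪Θ t x, us k t x⟫_ℝ ∂(μs k t).toMeasure)
      - ∫ t in (0 : ℝ)..T, ∫ x, ⟪Θ t x, u t x⟫_ℝ ∂(μs k t).toMeasure) atTop (𝓝 0) := by
  -- In dimension zero all fields coincide; the kernel estimates need positive dimension.
  rcases Nat.eq_zero_or_pos d with rfl | hd
  · have : ∀ k, us k = u := fun k => by
      funext t x
      exact Subsingleton.elim _ _
    simp [this]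
  have hq : (1 : ℝ) ≤ (d + 2 : ℝ) / (d + 1) := by
    rw [le_div_iff₀ (by positivity)]; linarith
  -- This is the subcritical condition that puts `‖y‖^(1-d)` in `L^q` near the origin; it reflects
  -- that the conjugate exponent `d + 2` exceeds `d`.
  have hqd : 0 < (1 - (d : ℝ)) * ((d + 2 : ℝ) / (d + 1)) + d := by
    have : (1 - (d : ℝ)) * ((d + 2 : ℝ) / (d + 1)) + d = 2 / (d + 1) := by field_simp; ring
    rw [this]; positivity
  obtain ⟨A, ζ, -, hζ⟩ := exists_spaceCutoff d
  have hB0 : 0 ≤ B := (norm_nonneg _).trans (hB 0 0)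
  have hR0 : 0 ≤ R := (norm_nonneg _).trans (hu.bound 0 ⟨le_rfl, hT.le⟩ 0)
  have hK0 : 0 ≤ K := (P2.M2_nonneg _).trans (hK 0 0 ⟨le_rfl, hT.le⟩)
  have hΘn : ∀ n, Measurable (Function.uncurry fun t x => ζ n x • Θ t x) := fun n =>
    ((hζ n).1.continuous.measurable.comp measurable_snd).smul hΘ
  have hΘnB : ∀ n t x, ‖ζ n x • Θ t x‖ ≤ B := fun n t x => by
    rw [norm_smul, Real.norm_of_nonneg ((hζ n).2.2.1 x).1]
    exact (mul_le_of_le_one_left (norm_nonneg _) ((hζ n).2.2.1 x).2).trans (hB t x)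
  -- Cutting `Θ` off at radius `n + 1` costs a tail controlled by the uniform second moments,
  -- equally for every bounded Lipschitz field `w`.
  have htail : ∀ n k (w : ℝ → E d → E d), IsLipField T R w →
      |(∫ t in (0 : ℝ)..T, ∫ x, ⟪Θ t x, w t x⟫_ℝ ∂(μs k t).toMeasure)
        - ∫ t in (0 : ℝ)..T, ∫ x, ⟪ζ n x • Θ t x, w t x⟫_ℝ ∂(μs k t).toMeasure|
        ≤ B * R * K / (n + 1) * T := fun n k w hw => by
    rw [← intervalIntegral.integral_sub
      (intervalIntegrable_integral_inner hT.le (hμs k) hΘ hw.meas hB hw.bound)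
      (intervalIntegrable_integral_inner hT.le (hμs k) (hΘn n) hw.meas (hΘnB n) hw.bound),
      ← Real.norm_eq_abs]
    refine (intervalIntegral.norm_integral_le_of_norm_le_const (C := B * R * K / (n + 1))
      fun t ht => ?_).trans (by rw [sub_zero, abs_of_pos hT])
    rw [uIoc_of_le hT.le] at ht
    have htI : t ∈ Icc 0 T := Ioc_subset_Icc_self ht
    have hwt : Measurable (w t) := hw.meas.comp (measurable_const.prodMk measurable_id)
    have hΘt : Measurable (Θ t) := hΘ.comp (measurable_const.prodMk measurable_id)
    have hΘnt : Measurable fun x => ζ n x • Θ t x := (hζ n).1.continuous.measurable.smul hΘt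
    rw [← integral_sub
      (Integrable.of_bound (hΘt.inner hwt).aestronglyMeasurable (B * R) (.of_forall fun x =>
        norm_inner_le_of_bounds (hB t x) (hw.bound t htI x)))
      (Integrable.of_bound (hΘnt.inner hwt).aestronglyMeasurable (B * R) (.of_forall fun x =>
        norm_inner_le_of_bounds (hΘnB n t x) (hw.bound t htI x)))]
    calc _ ≤ ∫ x, B * R / (n + 1) * ‖x‖ ^ 2 ∂(μs k t).toMeasure := by
          refine norm_integral_le_of_norm_le ((μs k t).integrable_sq.const_mul _)
            (.of_forall fun x => ?_)
          rw [← inner_sub_left]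
          rcases le_or_gt ‖x‖ (n + 1) with hx | hx
          · rw [(hζ n).2.2.2.1 x hx, one_smul, sub_self, inner_zero_left, norm_zero]
            positivity
          · have h1 : ‖Θ t x - ζ n x • Θ t x‖ ≤ B := by
              have : Θ t x - ζ n x • Θ t x = (1 - ζ n x) • Θ t x := by rw [sub_smul, one_smul]
              have h01 := (hζ n).2.2.1 x
              rw [this, norm_smul, Real.norm_of_nonneg (by linarith)]
              exact (mul_le_of_le_one_left (norm_nonneg _) (by linarith)).trans (hB t x)
            refine (norm_inner_le_of_bounds h1 (hw.bound t htI x)).trans ?_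
            rw [div_mul_eq_mul_div, le_div_iff₀ (by positivity)]
            have h2 : (n : ℝ) + 1 ≤ ‖x‖ ^ 2 := by nlinarith [Nat.cast_nonneg (α := ℝ) n]
            exact mul_le_mul_of_nonneg_left h2 (by positivity)
      _ = B * R / (n + 1) * (μs k t).M2 := integral_const_mul _ _
      _ ≤ B * R / (n + 1) * K := mul_le_mul_of_nonneg_left (hK k t htI) (by positivity)
      _ = _ := by ring
  rw [Metric.tendsto_atTop]
  intro ε hε
  have hsm : Tendsto (fun n : ℕ => B * R * K / ((n : ℝ) + 1) * T) atTop (𝓝 0) := by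
    have := (tendsto_const_nhds (x := B * R * K)).div_atTop
      (tendsto_atTop_add_const_right atTop (1 : ℝ) tendsto_natCast_atTop_atTop) |>.mul_const T
    simpa using this
  obtain ⟨n, hn⟩ := (hsm.eventually (gt_mem_nhds (show (0 : ℝ) < ε / 4 by positivity))).exists
  obtain ⟨ρ, hρ⟩ := (hζ n).2.1.isCompact.isBounded.exists_norm_le
  have hcut := tendsto_integral_inner_sub_of_support hd hT hq hqd hw hus hu hμs hμ hlim (hΘn n)
    (hΘnB n) (hΘc.mono fun t ht => (hζ n).1.continuous.smul ht) (ρ := |ρ| + 1) (by positivity)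
    (fun t x hx => by
      have : ζ n x = 0 := by
        by_contra h0
        have := hρ x (subset_tsupport _ h0)
        linarith [le_abs_self ρ]
      simp [this])
  obtain ⟨N, hN⟩ := Metric.tendsto_atTop.1 hcut (ε / 4) (by positivity)
  refine ⟨N, fun k hk => ?_⟩
  have h1 := hN k hk
  have h2 := htail n k (us k) (hus k)
  have h3 := htail n k u hu
  rw [Real.dist_0_eq_abs] at h1 ⊢
  rw [abs_lt] at h1 ⊢
  rw [abs_le] at h2 h3
  constructor <;> linarith [h1.1, h1.2, h2.1, h2.2, h3.1, h3.2]

end Compensated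

end VanishingViscosity

namespace VanishingViscosity

variable {d : ℕ}

/-! ### Convergence of costs along curves of measures -/

section Costs

variable {T : ℝ}

/-- Integrands that are measurable in time and locally Lipschitz in space and measure. -/
structure IsCost (T M : ℝ) (h : ℝ → E d → P2 d → ℝ) : Prop where
  nonneg : 0 ≤ M
  measurable : ∀ x μ, AEStronglyMeasurable (fun t => h t x μ) (volume.restrict (Icc 0 T))
  integrable : IntegrableOn (fun t => h t 0 (P2.diracZero d)) (Icc 0 T)
  locLip : ∀ t ∈ Icc 0 T, ∀ x y μ ν, |h t x μ - h t y ν|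
      ≤ M * (1 + ‖x‖ + ‖y‖ + μ.M2 + ν.M2) * (‖x - y‖ + W2 μ ν)

/-- The estimate of `IsCost`, at a fixed time. -/
def CostLip (M : ℝ) (h : E d → P2 d → ℝ) : Prop :=
  ∀ x y μ ν, |h x μ - h y ν|
      ≤ M * (1 + ‖x‖ + ‖y‖ + μ.M2 + ν.M2) * (‖x - y‖ + W2 μ ν)

theorem M2_diracZero : (P2.diracZero d).M2 = 0 := by
  simp [P2.M2, P2.diracZero]

variable {M : ℝ} {h : E d → P2 d → ℝ}

/-- Compare with the value at the origin and the Dirac mass there, whose distance to `μ` is at most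
the square root of `M2`. -/
theorem CostLip.growth (hM : 0 ≤ M) (hh : CostLip M h) (x : E d) (μ : P2 d) :
    |h x μ| ≤ (|h 0 (P2.diracZero d)| + 2 * M * (1 + μ.M2) ^ 2) * (1 + ‖x‖ ^ 2) := by
  have h1 := hh x 0 μ (P2.diracZero d)
  have h2 := W2_diracZero_le μ
  have h3 : Real.sqrt μ.M2 ≤ 1 + μ.M2 := by
    rw [Real.sqrt_le_left (by have := μ.M2_nonneg; linarith)]
    nlinarith [μ.M2_nonneg]
  rw [norm_zero, M2_diracZero, sub_zero, add_zero, add_zero] at h1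
  have h4 := abs_sub_abs_le_abs_sub (h x μ) (h 0 (P2.diracZero d))
  set m := 1 + μ.M2 with hm
  have hm1 : 1 ≤ m := by have := μ.M2_nonneg; linarith
  have h5 : M * (1 + ‖x‖ + μ.M2) * (‖x‖ + W2 μ (P2.diracZero d)) ≤ M * ((‖x‖ + m) * (‖x‖ + m)) := by
    rw [mul_assoc]
    refine mul_le_mul_of_nonneg_left ?_ hM
    refine mul_le_mul (by linarith) (by linarith) ?_ (by positivity)
    have := W2_nonneg μ (P2.diracZero d)
    positivity
  have h6 : (‖x‖ + m) * (‖x‖ + m) ≤ 2 * m ^ 2 * (1 + ‖x‖ ^ 2) := by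
    have h7 : ‖x‖ ^ 2 ≤ m ^ 2 * ‖x‖ ^ 2 := le_mul_of_one_le_left (sq_nonneg _) (by nlinarith)
    nlinarith [sq_nonneg (‖x‖ - m)]
  have h7 := mul_le_mul_of_nonneg_left h6 hM
  have h8 : |h 0 (P2.diracZero d)| ≤ |h 0 (P2.diracZero d)| * (1 + ‖x‖ ^ 2) :=
    le_mul_of_one_le_right (abs_nonneg _) (by nlinarith [sq_nonneg ‖x‖])
  linarith

theorem CostLip.abs_sub_le (hM : 0 ≤ M) (hh : CostLip M h) (x : E d) (μ ν : P2 d) :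
    |h x μ - h x ν| ≤ M * W2 μ ν * (2 + μ.M2 + ν.M2) * (1 + ‖x‖ ^ 2) := by
  have h1 := hh x x μ ν
  rw [sub_self, norm_zero, zero_add] at h1
  refine h1.trans ?_
  have ha := μ.M2_nonneg
  have hb := ν.M2_nonneg
  have h2 : 1 + ‖x‖ + ‖x‖ + μ.M2 + ν.M2 ≤ (2 + μ.M2 + ν.M2) * (1 + ‖x‖ ^ 2) := by
    nlinarith [sq_nonneg (‖x‖ - 1), mul_nonneg ha (sq_nonneg ‖x‖), mul_nonneg hb (sq_nonneg ‖x‖)]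
  have := mul_le_mul_of_nonneg_left h2 (mul_nonneg hM (W2_nonneg μ ν))
  linarith

theorem CostLip.locLip (hM : 0 ≤ M) (hh : CostLip M h) (ν : P2 d) :
    LocLip (M * (1 + 2 * ν.M2)) (fun x => h x ν) := fun x y => by
  have h1 := hh x y ν ν
  rw [W2_self, add_zero] at h1
  refine h1.trans ?_
  refine mul_le_mul_of_nonneg_right ?_ (norm_nonneg _)
  rw [mul_assoc]
  refine mul_le_mul_of_nonneg_left ?_ hM
  nlinarith [ν.M2_nonneg, norm_nonneg x, norm_nonneg y, mul_nonneg ν.M2_nonneg (norm_nonneg x),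
    mul_nonneg ν.M2_nonneg (norm_nonneg y)]

theorem CostLip.integrable (hM : 0 ≤ M) (hh : CostLip M h) (μ ν : P2 d) :
    Integrable (fun x => h x ν) μ.toMeasure :=
  (hh.locLip hM ν).integrable μ

/-- The measure occurs twice. First the argument of `h` is replaced, at a cost proportional to `W2`;
then the integration measure, for a fixed locally Lipschitz function. -/
theorem CostLip.tendsto_integral (hM : 0 ≤ M) (hh : CostLip M h) {ι : Type*} {l : Filter ι}
    {μs : ι → P2 d} {ν : P2 d} (hμ : Tendsto (fun i => W2 (μs i) ν) l (𝓝 0)) :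
    Tendsto (fun i => ∫ x, h x (μs i) ∂(μs i).toMeasure) l (𝓝 (∫ x, h x ν ∂ν.toMeasure)) := by
  have h1 := (hh.locLip hM ν).tendsto_integral hμ
  have h2 : Tendsto (fun i => M * W2 (μs i) ν * (2 + (μs i).M2 + ν.M2) * (1 + (μs i).M2)) l (𝓝 0) := by
    have hM2 := tendsto_M2 hμ
    have := ((hμ.const_mul M).mul ((tendsto_const_nhds (x := (2 : ℝ))).add hM2 |>.add_const ν.M2)).mul
      (tendsto_const_nhds (x := (1 : ℝ)) |>.add hM2)
    simpa using this
  have h3 : Tendsto (fun i => (∫ x, h x (μs i) ∂(μs i).toMeasure)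
      - ∫ x, h x ν ∂(μs i).toMeasure) l (𝓝 0) := by
    refine squeeze_zero_norm (fun i => ?_) h2
    rw [← integral_sub (hh.integrable hM _ _) (hh.integrable hM _ _)]
    exact (μs i).norm_integral_le_of_growth fun x => hh.abs_sub_le hM x _ _
  have := h3.add h1
  rw [zero_add] at this
  exact this.congr fun i => by ring

theorem CostLip.seqContinuous (hM : 0 ≤ M) (hh : CostLip M h) : SeqContinuous h := by
  intro x μ xs μs hx hμ
  rw [tendsto_iff_norm_sub_tendsto_zero]
  refine squeeze_zero (fun _ => norm_nonneg _) (fun n => hh _ _ _ _) ?_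
  have h1 := (((tendsto_const_nhds (x := (1 : ℝ))).add hx.norm).add_const ‖x‖).add (tendsto_M2 hμ)
    |>.add_const μ.M2 |>.const_mul M
  have h2 := h1.mul ((tendsto_iff_norm_sub_tendsto_zero.1 hx).add hμ)
  simpa using h2

variable {H : ℝ → E d → P2 d → ℝ}

theorem IsCost.norm_integral_le (hH : IsCost T M H) {t : ℝ} (ht : t ∈ Icc 0 T) {μ : P2 d} {K : ℝ}
    (hK : μ.M2 ≤ K) : ‖∫ x, H t x μ ∂μ.toMeasure‖
      ≤ (|H t 0 (P2.diracZero d)| + 2 * M * (1 + K) ^ 2) * (1 + K) := by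
  have h1 := μ.norm_integral_le_of_growth (φ := fun x => H t x μ)
    (fun x => CostLip.growth hH.nonneg (hH.locLip t ht) x μ)
  have h0 := μ.M2_nonneg
  have hM := hH.nonneg
  refine h1.trans ?_
  gcongr

theorem IsCost.intervalIntegrable (hT : 0 < T) (hH : IsCost T M H) {μ : ℝ → P2 d}
    (hμ : IsW2Continuous T μ) :
    IntervalIntegrable (fun t => ∫ x, H t x (μ t) ∂(μ t).toMeasure) volume 0 T := by
  obtain ⟨G, hGm, -, hG⟩ := exists_measurable_rep hμ hH.measurable
    fun t ht => CostLip.seqContinuous hH.nonneg (hH.locLip t ht)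
  obtain ⟨K, hK0, hK⟩ := hμ.exists_M2_le
  rw [intervalIntegrable_iff_integrableOn_Icc_of_le hT.le]
  refine Integrable.mono'
    (g := fun t => (|H t 0 (P2.diracZero d)| + 2 * M * (1 + K) ^ 2) * (1 + K)) ?_
    (aestronglyMeasurable_integral_curve hT.le hμ hGm hG) ?_
  · exact (hH.integrable.abs.add (integrable_const _)).mul_const _
  · filter_upwards [ae_restrict_mem measurableSet_Icc] with t ht
      using hH.norm_integral_le ht (hK t ht)

/-- Integrals of locally Lipschitz integrands converge along convergent curves of measures. -/
theorem IsCost.tendsto_integral (hT : 0 < T) (hH : IsCost T M H) {μs : ℕ → ℝ → P2 d} {ν : ℝ → P2 d}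
    (hμs : ∀ k, IsW2Continuous T (μs k)) {K : ℝ} (hK : ∀ k, ∀ t ∈ Icc 0 T, (μs k t).M2 ≤ K)
    (hlim : ∀ t ∈ Icc 0 T, Tendsto (fun k => W2 (μs k t) (ν t)) atTop (𝓝 0)) :
    Tendsto (fun k => ∫ t in (0 : ℝ)..T, ∫ x, H t x (μs k t) ∂(μs k t).toMeasure) atTop
      (𝓝 (∫ t in (0 : ℝ)..T, ∫ x, H t x (ν t) ∂(ν t).toMeasure)) := by
  refine intervalIntegral.tendsto_integral_filter_of_dominated_convergence
    (fun t => (|H t 0 (P2.diracZero d)| + 2 * M * (1 + K) ^ 2) * (1 + K)) ?_ ?_ ?_ ?_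
  · exact .of_forall fun k => (hH.intervalIntegrable hT (hμs k)).def'.aestronglyMeasurable
  · refine .of_forall fun k => .of_forall fun t ht => ?_
    rw [uIoc_of_le hT.le] at ht
    exact hH.norm_integral_le (Ioc_subset_Icc_self ht) (hK k t (Ioc_subset_Icc_self ht))
  · rw [intervalIntegrable_iff_integrableOn_Icc_of_le hT.le]
    exact (hH.integrable.abs.add (integrable_const _)).mul_const _
  · refine .of_forall fun t ht => ?_
    rw [uIoc_of_le hT.le] at ht
    exact CostLip.tendsto_integral hH.nonneg (hH.locLip t (Ioc_subset_Icc_self ht))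
      (hlim t (Ioc_subset_Icc_self ht))

theorem intervalIntegrable_integral_bounded (hT : 0 < T) {χ : ℝ → E d → ℝ}
    (hχ : Measurable (Function.uncurry χ)) {C : ℝ} (hC : ∀ t ∈ Icc 0 T, ∀ x, ‖χ t x‖ ≤ C)
    {μ : ℝ → P2 d} (hμ : IsW2Continuous T μ) :
    IntervalIntegrable (fun t => ∫ x, χ t x ∂(μ t).toMeasure) volume 0 T := by
  rw [intervalIntegrable_iff_integrableOn_Icc_of_le hT.le]
  refine Integrable.of_bound (aestronglyMeasurable_integral_curve hT.le hμ (H := χ)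
    hχ.stronglyMeasurable (.of_forall fun t x => rfl)) C ?_
  filter_upwards [ae_restrict_mem measurableSet_Icc] with t ht
  exact (norm_integral_le_of_norm_le_const (.of_forall (hC t ht))).trans (by simp)

/-- Integrals of bounded Carathéodory functions converge along convergent curves of measures. -/
theorem tendsto_integral_bounded (hT : 0 < T) {χ : ℝ → E d → ℝ}
    (hχ : Measurable (Function.uncurry χ)) {C : ℝ} (hC : ∀ t ∈ Icc 0 T, ∀ x, ‖χ t x‖ ≤ C)
    (hc : ∀ᵐ t ∂volume.restrict (Icc 0 T), Continuous (χ t)) {μs : ℕ → ℝ → P2 d} {ν : ℝ → P2 d}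
    (hμs : ∀ k, IsW2Continuous T (μs k))
    (hlim : ∀ t ∈ Icc 0 T, Tendsto (fun k => W2 (μs k t) (ν t)) atTop (𝓝 0)) :
    Tendsto (fun k => ∫ t in (0 : ℝ)..T, ∫ x, χ t x ∂(μs k t).toMeasure) atTop
      (𝓝 (∫ t in (0 : ℝ)..T, ∫ x, χ t x ∂(ν t).toMeasure)) := by
  refine intervalIntegral.tendsto_integral_filter_of_dominated_convergence (fun _ => C) ?_ ?_
    intervalIntegrable_const ?_
  · exact .of_forall fun k =>
      (intervalIntegrable_integral_bounded hT hχ hC (hμs k)).def'.aestronglyMeasurable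
  · refine .of_forall fun k => .of_forall fun t ht => ?_
    rw [uIoc_of_le hT.le] at ht
    exact (norm_integral_le_of_norm_le_const (.of_forall (hC t (Ioc_subset_Icc_self ht)))).trans
      (by simp)
  · rw [uIoc_of_le hT.le]
    filter_upwards [(ae_restrict_iff' measurableSet_Icc).1 hc] with t ht htI
    have htI' : t ∈ Icc 0 T := Ioc_subset_Icc_self htI
    exact tendsto_integral_of_bounded_continuous (tendsto_prob_of_tendsto_W2 (hlim t htI'))
      (ht htI') (hC t htI')

end Costs

end VanishingViscosity

namespace VanishingViscosity

variable {d : ℕ}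

/-! ### Test functions in time and space -/

section TestFunctions

variable {T : ℝ} {φ : ℝ → E d → ℝ}

theorem one_add_one_le_contDiff_top : (1 + 1 : ℕ∞ω) ≤ (∞ : ℕ∞ω) := by
  rw [one_add_one_eq_two]
  exact two_le_contDiff_top

/-- A function of time and space as a function on the product. -/
def joint (φ : ℝ → E d → ℝ) (z : ℝ × E d) : ℝ := φ z.1 z.2

theorem IsTestFunction.exists_bounds (hφ : IsTestFunction T φ) :
    ∃ (G : ℝ) (L : ℝ≥0) (S : ℝ), 0 ≤ G ∧ (∀ z, ‖fderiv ℝ (joint φ) z‖ ≤ G) ∧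
      LipschitzWith L (fderiv ℝ (joint φ)) ∧ ∀ z, ‖iteratedFDeriv ℝ 2 (joint φ) z‖ ≤ S := by
  have hs : ContDiff ℝ ∞ (joint φ) := hφ.1
  have hc : HasCompactSupport (joint φ) := hφ.2.1
  obtain ⟨G, hG⟩ := (hs.continuous_fderiv (by simp)).bounded_above_of_compact_support
    (hc.fderiv (𝕜 := ℝ))
  have hd1 : ContDiff ℝ 1 (fderiv ℝ (joint φ)) := hs.fderiv_right one_add_one_le_contDiff_top
  obtain ⟨L, hL⟩ := hd1.lipschitzWith_of_hasCompactSupport (hc.fderiv (𝕜 := ℝ)) (by norm_num)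
  obtain ⟨S, hS⟩ := (hs.continuous_iteratedFDeriv (m := 2)
    two_le_contDiff_top).bounded_above_of_compact_support (hc.iteratedFDeriv 2)
  exact ⟨G, L, S, (norm_nonneg _).trans (hG 0), hG, hL, hS⟩

theorem IsTestFunction.deriv_eq (hφ : IsTestFunction T φ) (t : ℝ) (x : E d) :
    deriv (fun s => φ s x) t = fderiv ℝ (joint φ) (t, x) (1, 0) := by
  have hs : ContDiff ℝ ∞ (joint φ) := hφ.1
  have h1 : HasFDerivAt (joint φ) (fderiv ℝ (joint φ) (t, x)) (t, x) :=
    (hs.differentiable (by simp) _).hasFDerivAt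
  have h2 : HasDerivAt (fun s : ℝ => (s, x)) (1, 0) t :=
    (hasDerivAt_id t).prodMk (hasDerivAt_const t x)
  exact (h1.comp_hasDerivAt t h2).deriv

theorem IsTestFunction.fderiv_eq (hφ : IsTestFunction T φ) (t : ℝ) (x : E d) :
    fderiv ℝ (φ t) x = (fderiv ℝ (joint φ) (t, x)).comp (ContinuousLinearMap.inr ℝ ℝ (E d)) := by
  have hs : ContDiff ℝ ∞ (joint φ) := hφ.1
  have h1 : HasFDerivAt (joint φ) (fderiv ℝ (joint φ) (t, x)) (t, x) :=
    (hs.differentiable (by simp) _).hasFDerivAt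
  have h2 : HasFDerivAt (fun y : E d => (t, y)) (ContinuousLinearMap.inr ℝ ℝ (E d)) x :=
    hasFDerivAt_prodMk_right t x
  exact (h1.comp x h2).fderiv

theorem IsTestFunction.gradient_eq (hφ : IsTestFunction T φ) (t : ℝ) (x : E d) :
    gradient (φ t) x = (InnerProductSpace.toDual ℝ (E d)).symm
      ((fderiv ℝ (joint φ) (t, x)).comp (ContinuousLinearMap.inr ℝ ℝ (E d))) := by
  rw [gradient, hφ.fderiv_eq]

theorem IsTestFunction.continuous_gradient (hφ : IsTestFunction T φ) :
    Continuous (fun z : ℝ × E d => gradient (φ z.1) z.2) := by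
  have hs : ContDiff ℝ ∞ (joint φ) := hφ.1
  have h1 := hs.continuous_fderiv (by simp)
  simp only [hφ.gradient_eq]
  exact (InnerProductSpace.toDual ℝ (E d)).symm.continuous.comp (h1.clm_comp continuous_const)

theorem IsTestFunction.norm_gradient_le (hφ : IsTestFunction T φ) {G : ℝ}
    (hG : ∀ z, ‖fderiv ℝ (joint φ) z‖ ≤ G) (t : ℝ) (x : E d) : ‖gradient (φ t) x‖ ≤ G := by
  have hG0 : 0 ≤ G := (norm_nonneg _).trans (hG 0)
  rw [hφ.gradient_eq, LinearIsometryEquiv.norm_map]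
  refine (ContinuousLinearMap.opNorm_comp_le _ _).trans ?_
  calc _ ≤ G * 1 := by
        gcongr
        · exact hG _
        · exact ContinuousLinearMap.norm_inr_le_one ℝ ℝ (E d)
    _ = G := mul_one G

theorem IsTestFunction.iteratedFDeriv_apply (hφ : IsTestFunction T φ) (t : ℝ) (x : E d)
    (m : Fin 2 → E d) :
    iteratedFDeriv ℝ 2 (φ t) x m = iteratedFDeriv ℝ 2 (joint φ) (t, x) (fun i => (0, m i)) := by
  have hs : ContDiff ℝ ∞ (joint φ) := hφ.1
  have h1 : φ t = (fun z => joint φ ((t, 0) + z)) ∘ (ContinuousLinearMap.inr ℝ ℝ (E d)) := by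
    funext y
    simp [joint]
  have h2 : ContDiff ℝ ∞ (fun z => joint φ ((t, 0) + z)) := hs.comp (contDiff_const.add contDiff_id)
  rw [h1, ContinuousLinearMap.iteratedFDeriv_comp_right (ContinuousLinearMap.inr ℝ ℝ (E d)) h2 x
    (i := 2) two_le_contDiff_top, iteratedFDeriv_comp_add_left]
  simp [ContinuousMultilinearMap.compContinuousLinearMap_apply, Function.comp_def]

theorem IsTestFunction.contDiff (hφ : IsTestFunction T φ) (t : ℝ) : ContDiff ℝ ∞ (φ t) :=
  hφ.1.comp (contDiff_prodMk_right t)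

theorem IsTestFunction.continuous_laplacian (hφ : IsTestFunction T φ) :
    Continuous (fun z : ℝ × E d => Laplacian.laplacian (φ z.1) z.2) := by
  have hs : ContDiff ℝ ∞ (joint φ) := hφ.1
  have h2 : Continuous (iteratedFDeriv ℝ 2 (joint φ)) :=
    hs.continuous_iteratedFDeriv two_le_contDiff_top
  simp only [laplacian_eq_sum, hφ.iteratedFDeriv_apply]
  fun_prop

theorem IsTestFunction.abs_laplacian_le (hφ : IsTestFunction T φ) {S : ℝ}
    (hS : ∀ z, ‖iteratedFDeriv ℝ 2 (joint φ) z‖ ≤ S) (t : ℝ) (x : E d) :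
    |Laplacian.laplacian (φ t) x| ≤ d * S := by
  rw [laplacian_eq_sum]
  refine (Finset.abs_sum_le_sum_abs _ _).trans ?_
  calc _ ≤ ∑ _i : Fin d, S := by
        refine Finset.sum_le_sum fun i _ => ?_
        rw [hφ.iteratedFDeriv_apply]
        refine ((iteratedFDeriv ℝ 2 (joint φ) (t, x)).le_opNorm _).trans ?_
        refine (mul_le_of_le_one_right (norm_nonneg _) ?_).trans (hS _)
        refine Finset.prod_le_one (fun _ _ => norm_nonneg _) fun j _ => ?_
        rw [Prod.norm_mk, norm_zero]
        fin_cases j <;> simp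
    _ = d * S := by simp

/-- The terms `∂_t φ + b · ∇φ` are the space-time differential of `φ` applied to `(1, b)`. They
satisfy the assumptions on a running cost, so the convergence theorem for costs also handles the
nonlocal drift. -/
theorem IsTestFunction.isCost (hφ : IsTestFunction T φ) {b : ℝ → E d → P2 d → E d}
    (hb : AssumptionB T b) :
    ∃ M, IsCost T M (fun t x μ => fderiv ℝ (joint φ) (t, x) (1, b t x μ)) := by
  have hs : ContDiff ℝ ∞ (joint φ) := hφ.1
  have hfc := hs.continuous_fderiv (by simp)
  obtain ⟨G, L, S, hG0, hG, hL, -⟩ := hφ.exists_bounds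
  obtain ⟨M, hM⟩ := hb.growth
  obtain ⟨N, hN⟩ := hb.lipschitz
  have hmeas : ∀ x μ, AEStronglyMeasurable (fun t => fderiv ℝ (joint φ) (t, x) (1, b t x μ))
      (volume.restrict (Icc 0 T)) := fun x μ => by
    have h1 : Continuous fun p : ℝ × E d => fderiv ℝ (joint φ) (p.1, x) (1, p.2) :=
      (hfc.comp (by fun_prop : Continuous fun p : ℝ × E d => (p.1, x))).clm_apply (by fun_prop)
    exact h1.comp_aestronglyMeasurable (aestronglyMeasurable_id.prodMk (hb.measurable x μ))
  have hM' : ∀ t ∈ Icc 0 T, ∀ x μ, ‖((1 : ℝ), b t x μ)‖ ≤ 1 + |M| * (2 + ‖x‖ + μ.M2) :=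
    fun t ht x μ => by
      have h1 := hM t ht x μ
      have h2 := μ.M1_le
      have h3 := μ.M1_nonneg
      have h4 : M * (1 + ‖x‖ + μ.M1) ≤ |M| * (2 + ‖x‖ + μ.M2) :=
        mul_le_mul (le_abs_self M) (by linarith) (by positivity) (abs_nonneg _)
      rw [Prod.norm_mk, norm_one]
      have h5 : 0 ≤ |M| * (2 + ‖x‖ + μ.M2) := by have := μ.M2_nonneg; positivity
      exact max_le (by linarith) (by linarith)
  refine ⟨L * (1 + 2 * |M|) + G * |N|, by positivity, hmeas, ?_, fun t ht x x' μ μ' => ?_⟩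
  · refine Integrable.of_bound (hmeas _ _) (G * (1 + |M| * 2)) ?_
    filter_upwards [ae_restrict_mem measurableSet_Icc] with t ht
    refine ((fderiv ℝ (joint φ) (t, 0)).le_opNorm _).trans ?_
    have := hM' t ht 0 (P2.diracZero d)
    rw [M2_diracZero, norm_zero, add_zero, add_zero] at this
    exact mul_le_mul (hG _) this (norm_nonneg _) hG0
  · set z := fderiv ℝ (joint φ) (t, x)
    set z' := fderiv ℝ (joint φ) (t, x')
    have e : z (1, b t x μ) - z' (1, b t x' μ')
        = z (0, b t x μ - b t x' μ') + (z - z') (1, b t x' μ') := by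
      have : ((0 : ℝ), b t x μ - b t x' μ') = (1, b t x μ) - (1, b t x' μ') := by simp
      rw [this, map_sub, sub_apply]
      ring
    have hW := W2_nonneg μ μ'
    have h1 : ‖z (0, b t x μ - b t x' μ')‖ ≤ G * (|N| * (‖x - x'‖ + W2 μ μ')) := by
      refine (z.le_opNorm _).trans (mul_le_mul (hG _) ?_ (norm_nonneg _) hG0)
      rw [Prod.norm_mk, norm_zero, max_eq_right (norm_nonneg _)]
      exact (hN t ht x x' μ μ').trans (mul_le_mul_of_nonneg_right (le_abs_self N) (by positivity))
    have h2 : ‖(z - z') (1, b t x' μ')‖ ≤ L * ‖x - x'‖ * (1 + |M| * (2 + ‖x'‖ + μ'.M2)) := by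
      refine ((z - z').le_opNorm _).trans ?_
      refine mul_le_mul ?_ (hM' t ht x' μ') (norm_nonneg _) (by positivity)
      have := hL.norm_sub_le (t, x) (t, x')
      rwa [Prod.mk_sub_mk, sub_self, Prod.norm_mk, norm_zero, max_eq_right (norm_nonneg _)] at this
    rw [e]
    refine (norm_add_le _ _).trans ((add_le_add h1 h2).trans ?_)
    have ha := μ.M2_nonneg
    have hb := μ'.M2_nonneg
    set P := 1 + ‖x‖ + ‖x'‖ + μ.M2 + μ'.M2 with hP
    have hP1 : 1 ≤ P := by have := norm_nonneg x; have := norm_nonneg x'; linarith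
    set w := ‖x - x'‖ + W2 μ μ' with hw
    have hw0 : 0 ≤ w := by positivity
    have h3 : G * (|N| * w) ≤ G * |N| * P * w := by
      have : 0 ≤ G * |N| * w := by positivity
      nlinarith
    have h4 : L * ‖x - x'‖ * (1 + |M| * (2 + ‖x'‖ + μ'.M2)) ≤ L * w * ((1 + 2 * |M|) * P) := by
      refine mul_le_mul ?_ ?_ (by positivity) (by positivity)
      · exact mul_le_mul_of_nonneg_left (by linarith) L.coe_nonneg
      · have h5 : 2 + ‖x'‖ + μ'.M2 ≤ 2 * P := by have := norm_nonneg x; have := norm_nonneg x'; linarith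
        have := mul_le_mul_of_nonneg_left h5 (abs_nonneg M)
        nlinarith
    nlinarith

end TestFunctions

/-! ### Passing to the limit in the equation -/

section LimitEquation

variable {T : ℝ} {μ₀ : P2 d} {b : ℝ → E d → P2 d → E d}

/-- The three pieces have different limits: the drift is a cost, the control term needs the
replacement of weak limits, and the viscous term is `ε` times a bounded quantity. -/
theorem integral_test_eq (hT : 0 < T) {φ : ℝ → E d → ℝ} (hφ : IsTestFunction T φ)
    (hb : AssumptionB T b) {w : ℝ → E d → E d} (hw : Measurable (Function.uncurry w)) {R : ℝ}
    (hR : ∀ t ∈ Icc 0 T, ∀ x, ‖w t x‖ ≤ R) {μ : ℝ → P2 d} (hμ : IsW2Continuous T μ) (ε : ℝ) :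
    ∫ t in (0 : ℝ)..T, ∫ x, (deriv (fun s => φ s x) t + ⟪b t x (μ t) + w t x, gradient (φ t) x⟫_ℝ
        + ε * Laplacian.laplacian (φ t) x) ∂(μ t).toMeasure
      = (∫ t in (0 : ℝ)..T, ∫ x, fderiv ℝ (joint φ) (t, x) (1, b t x (μ t)) ∂(μ t).toMeasure)
        + (∫ t in (0 : ℝ)..T, ∫ x, ⟪gradient (φ t) x, w t x⟫_ℝ ∂(μ t).toMeasure)
        + ε * ∫ t in (0 : ℝ)..T, ∫ x, Laplacian.laplacian (φ t) x ∂(μ t).toMeasure := by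
  obtain ⟨G, L, S, hG0, hG, hL, hS⟩ := hφ.exists_bounds
  obtain ⟨M, hM⟩ := hφ.isCost hb
  have i1 := hM.intervalIntegrable hT hμ
  have i2 := intervalIntegrable_integral_inner hT.le hμ (F := fun t x => gradient (φ t) x)
    hφ.continuous_gradient.measurable hw
    (hφ.norm_gradient_le hG) hR
  have i3 : IntervalIntegrable (fun t => ∫ x, Laplacian.laplacian (φ t) x ∂(μ t).toMeasure)
      volume 0 T := intervalIntegrable_integral_bounded hT
        (χ := fun t x => Laplacian.laplacian (φ t) x) hφ.continuous_laplacian.measurable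
        (fun t _ => hφ.abs_laplacian_le hS t) hμ
  rw [← intervalIntegral.integral_const_mul, ← intervalIntegral.integral_add i1 i2,
    ← intervalIntegral.integral_add (i1.add i2) (i3.const_mul ε)]
  refine intervalIntegral.integral_congr fun t ht => ?_
  rw [uIcc_of_le hT.le] at ht
  have j1 : Integrable (fun x => fderiv ℝ (joint φ) (t, x) (1, b t x (μ t))) (μ t).toMeasure :=
    CostLip.integrable (h := fun x μ => fderiv ℝ (joint φ) (t, x) (1, b t x μ)) hM.nonneg
      (hM.locLip t ht) _ _
  have hwt : Measurable (w t) := hw.comp (measurable_const.prodMk measurable_id)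
  have hgt : Measurable fun x => gradient (φ t) x :=
    hφ.continuous_gradient.measurable.comp (measurable_const.prodMk measurable_id)
  have j2 : Integrable (fun x => ⟪gradient (φ t) x, w t x⟫_ℝ) (μ t).toMeasure :=
    Integrable.of_bound (hgt.inner hwt).aestronglyMeasurable (G * R) (.of_forall fun x =>
      norm_inner_le_of_bounds (hφ.norm_gradient_le hG t x) (hR t ht x))
  have j3 : Integrable (fun x => Laplacian.laplacian (φ t) x) (μ t).toMeasure :=
    Integrable.of_bound (hφ.continuous_laplacian.comp
      (Continuous.prodMk_right t)).aestronglyMeasurable (d * S)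
      (.of_forall fun x => hφ.abs_laplacian_le hS t x)
  have j4 : Integrable (fun x => fderiv ℝ (joint φ) (t, x) (1, b t x (μ t))
      + ⟪gradient (φ t) x, w t x⟫_ℝ) (μ t).toMeasure := j1.add j2
  beta_reduce
  rw [← integral_add j1 j2, ← integral_const_mul, ← integral_add j4 (j3.const_mul ε)]
  refine integral_congr_ae (.of_forall fun x => ?_)
  beta_reduce
  have e : fderiv ℝ (joint φ) (t, x) (1, b t x (μ t))
      = deriv (fun s => φ s x) t + ⟪b t x (μ t), gradient (φ t) x⟫_ℝ := by
    rw [inner_gradient_eq, hφ.fderiv_eq, hφ.deriv_eq, ContinuousLinearMap.comp_apply,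
      ContinuousLinearMap.inr_apply, ← map_add]
    simp
  rw [e, inner_add_left, real_inner_comm (w t x)]
  ring

/-- Limits of solutions with vanishing viscosity and weakly convergent controls are solutions of the
continuity equation with the limit control. -/
theorem isWeakSolution_of_tendsto (hT : 0 < T) (hb : AssumptionB T b) {εs : ℕ → ℝ}
    (hε : Tendsto εs atTop (𝓝 0)) {R : ℝ} {us : ℕ → ℝ → E d → E d} {u : ℝ → E d → E d}
    (hw : WeakSeq T ((d + 2 : ℝ) / (d + 1)) us u)
    (hus : ∀ k, IsLipField T R (us k)) (hu : IsLipField T R u)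
    {μs : ℕ → ℝ → P2 d} {ν : ℝ → P2 d} (hsol : ∀ k, IsWeakSolution T b μ₀ (εs k) (us k) (μs k))
    (hν : IsW2Continuous T ν)
    (hlim : ∀ t ∈ Icc 0 T, Tendsto (fun k => W2 (μs k t) (ν t)) atTop (𝓝 0))
    {K : ℝ} (hK : ∀ k, ∀ t ∈ Icc 0 T, (μs k t).M2 ≤ K) : IsWeakSolution T b μ₀ 0 u ν := by
  refine ⟨hν, fun φ hφ => ?_⟩
  obtain ⟨G, L, S, hG0, hG, hL, hS⟩ := hφ.exists_bounds
  obtain ⟨M, hM⟩ := hφ.isCost hb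
  have hμs := fun k => (hsol k).1
  have hgm := hφ.continuous_gradient.measurable
  have h1 := hM.tendsto_integral hT hμs hK hlim
  have h2 := tendsto_integral_inner_sub hT hw hus hu hμs hν hlim hK
    (Θ := fun t x => gradient (φ t) x) hgm (hφ.norm_gradient_le hG)
    (.of_forall fun t => hφ.continuous_gradient.comp (Continuous.prodMk_right t))
  have h3 : Tendsto (fun k => ∫ t in (0 : ℝ)..T, ∫ x, ⟪gradient (φ t) x, u t x⟫_ℝ ∂(μs k t).toMeasure)
      atTop (𝓝 (∫ t in (0 : ℝ)..T, ∫ x, ⟪gradient (φ t) x, u t x⟫_ℝ ∂(ν t).toMeasure)) := by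
    refine tendsto_integral_bounded hT (χ := fun t x => ⟪gradient (φ t) x, u t x⟫_ℝ)
      (Measurable.inner hgm hu.meas) (C := G * R) (fun t ht x =>
      norm_inner_le_of_bounds (hφ.norm_gradient_le hG t x) (hu.bound t ht x)) ?_ hμs hlim
    obtain ⟨C, hC⟩ := hu.lip
    filter_upwards [hC] with t ht
    exact (hφ.continuous_gradient.comp (Continuous.prodMk_right t)).inner ht.continuous
  have h4 : Tendsto (fun k => ∫ t in (0 : ℝ)..T, ∫ x, Laplacian.laplacian (φ t) x ∂(μs k t).toMeasure)
      atTop (𝓝 (∫ t in (0 : ℝ)..T, ∫ x, Laplacian.laplacian (φ t) x ∂(ν t).toMeasure)) := by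
    have hc : ∀ t, Continuous fun x => Laplacian.laplacian (φ t) x := fun t =>
      continuous_laplacian (hφ.contDiff t)
    refine tendsto_integral_bounded hT (χ := fun t x => Laplacian.laplacian (φ t) x)
      hφ.continuous_laplacian.measurable (C := d * S) ?_ (.of_forall hc) hμs hlim
    intro t _ x
    exact hφ.abs_laplacian_le hS t x
  have h5 := (h1.add (h2.add h3)).add (hε.mul h4)
  rw [integral_test_eq hT hφ hb hu.meas hu.bound hν 0]
  rw [zero_add] at h5
  refine tendsto_nhds_unique h5 (tendsto_const_nhds.congr fun k => ?_)
  rw [← (hsol k).2 φ hφ, integral_test_eq hT hφ hb (hus k).meas (hus k).bound (hμs k) (εs k)]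
  ring

end LimitEquation

end VanishingViscosity

namespace VanishingViscosity

variable {d : ℕ}

/-! ### Mollification of Lipschitz fields -/

section Mollify

open scoped Convolution

/-- Convolution with a normalized bump function. -/
noncomputable def mollify (ρ : ContDiffBump (0 : E d)) (V : E d → E d) : E d → E d :=
  ρ.normed volume ⋆[ContinuousLinearMap.lsmul ℝ ℝ, volume] V

theorem mollify_apply (ρ : ContDiffBump (0 : E d)) (V : E d → E d) (x : E d) :
    mollify ρ V x = ∫ z, ρ.normed volume z • V (x - z) := rfl

theorem integrable_mollify (ρ : ContDiffBump (0 : E d)) {V : E d → E d} (hV : Continuous V)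
    (x : E d) : Integrable (fun z => ρ.normed volume z • V (x - z)) := by
  refine Continuous.integrable_of_hasCompactSupport ?_ ρ.hasCompactSupport_normed.smul_right
  exact ρ.continuous_normed.smul (hV.comp (continuous_const.sub continuous_id))

theorem contDiff_mollify (ρ : ContDiffBump (0 : E d)) {V : E d → E d} (hV : Continuous V) :
    ContDiff ℝ ∞ (mollify ρ V) :=
  ρ.hasCompactSupport_normed.contDiff_convolution_left _ ρ.contDiff_normed hV.locallyIntegrable

theorem norm_mollify_sub_const_le (ρ : ContDiffBump (0 : E d)) {V : E d → E d} (hV : Continuous V)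
    {x c : E d} {M : ℝ} (hM : ∀ z ∈ Metric.ball (0 : E d) ρ.rOut, ‖V (x - z) - c‖ ≤ M) :
    ‖mollify ρ V x - c‖ ≤ M := by
  have hc : c = ∫ z, ρ.normed volume z • c := by
    rw [integral_smul_const, ρ.integral_normed, one_smul]
  have hi : Integrable (fun z => ρ.normed volume z • c) := ρ.integrable_normed.smul_const c
  rw [hc, mollify_apply, ← integral_sub (integrable_mollify ρ hV x) hi]
  refine (norm_integral_le_of_norm_le (g := fun z => ρ.normed volume z * M)
    (ρ.integrable_normed.mul_const M) (.of_forall fun z => ?_)).trans ?_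
  · rw [← smul_sub, norm_smul, Real.norm_of_nonneg (ρ.nonneg_normed z)]
    by_cases hz : z ∈ Metric.ball (0 : E d) ρ.rOut
    · exact mul_le_mul_of_nonneg_left (hM z hz) (ρ.nonneg_normed z)
    · have : ρ.normed volume z = 0 := by
        have h1 := ρ.support_normed_eq (μ := volume)
        rw [← h1] at hz
        exact Function.notMem_support.1 hz
      simp [this]
  · rw [integral_mul_const, ρ.integral_normed, one_mul]

theorem norm_mollify_sub_le (ρ : ContDiffBump (0 : E d)) {V : E d → E d} {C : ℝ≥0}
    (hV : LipschitzWith C V) (x : E d) : ‖mollify ρ V x - V x‖ ≤ C * ρ.rOut := by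
  refine norm_mollify_sub_const_le ρ hV.continuous fun z hz => ?_
  refine (hV.norm_sub_le _ _).trans (mul_le_mul_of_nonneg_left ?_ C.coe_nonneg)
  simpa using (mem_ball_zero_iff.1 hz).le

theorem mollify_sub (ρ : ContDiffBump (0 : E d)) {V V' : E d → E d} (hV : Continuous V)
    (hV' : Continuous V') (x : E d) :
    mollify ρ V x - mollify ρ V' x = mollify ρ (fun y => V y - V' y) x := by
  simp only [mollify_apply]
  rw [← integral_sub (integrable_mollify ρ hV x) (integrable_mollify ρ hV' x)]
  simp only [smul_sub]

theorem norm_mollify_le (ρ : ContDiffBump (0 : E d)) {V : E d → E d} (hV : Continuous V) {M : ℝ}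
    (hM : ∀ x, ‖V x‖ ≤ M) (x : E d) : ‖mollify ρ V x‖ ≤ M := by
  have := norm_mollify_sub_const_le ρ hV (x := x) (c := 0) (M := M) fun z _ => by simpa using hM _
  simpa using this

theorem mollify_add_right (ρ : ContDiffBump (0 : E d)) (V : E d → E d) (c x : E d) :
    mollify ρ V (x + c) = mollify ρ (fun y => V (y + c)) x := by
  simp only [mollify_apply]
  congr 1
  funext z
  rw [add_sub_right_comm]

/-- Mollification is linear, commutes with translations and does not increase the supremum norm;
applied to a field minus its translate, this preserves the Lipschitz constant. -/
theorem lipschitzWith_mollify (ρ : ContDiffBump (0 : E d)) {V : E d → E d} {C : ℝ≥0}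
    (hV : LipschitzWith C V) : LipschitzWith C (mollify ρ V) := by
  refine LipschitzWith.of_dist_le_mul fun x y => ?_
  rw [dist_eq_norm, dist_eq_norm]
  have hc : Continuous fun z => V (z + (x - y)) := hV.continuous.comp (continuous_add_const _)
  have e : mollify ρ V x = mollify ρ (fun z => V (z + (x - y))) y := by
    rw [← mollify_add_right, add_sub_cancel]
  rw [e, mollify_sub ρ hc hV.continuous]
  refine norm_mollify_le ρ (hc.sub hV.continuous) (fun z => ?_) y
  simpa using hV.norm_sub_le (z + (x - y)) z

/-- The `L¹` norm of the derivative of a bump function. -/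
noncomputable def bumpConst (ρ : ContDiffBump (0 : E d)) : ℝ :=
  ∫ z, ‖fderiv ℝ (ρ.normed volume) z‖

theorem bumpConst_nonneg (ρ : ContDiffBump (0 : E d)) : 0 ≤ bumpConst ρ :=
  integral_nonneg fun _ => norm_nonneg _

theorem norm_fderiv_mollify_le (ρ : ContDiffBump (0 : E d)) {V : E d → E d} (hV : Continuous V)
    {M : ℝ} (hM : ∀ x, ‖V x‖ ≤ M) (x : E d) : ‖fderiv ℝ (mollify ρ V) x‖ ≤ bumpConst ρ * M := by
  have hM0 : 0 ≤ M := (norm_nonneg _).trans (hM 0)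
  have hs : ContDiff ℝ 1 (ρ.normed volume) := ρ.contDiff_normed
  have hc : HasCompactSupport (ρ.normed volume) := ρ.hasCompactSupport_normed
  have h := hc.hasFDerivAt_convolution_left (ContinuousLinearMap.lsmul ℝ ℝ (E := E d)) hs
    (hV.locallyIntegrable (μ := volume)) x
  rw [mollify, h.fderiv, bumpConst, ← integral_mul_const]
  have hi : Integrable (fun z => ‖fderiv ℝ (ρ.normed volume) z‖) :=
    ((hs.continuous_fderiv (by norm_num)).integrable_of_hasCompactSupport
      (hc.fderiv (𝕜 := ℝ))).norm
  refine norm_integral_le_of_norm_le (hi.mul_const M) (.of_forall fun z => ?_)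
  refine (ContinuousLinearMap.le_opNorm₂ (ContinuousLinearMap.precompL (E d)
    (ContinuousLinearMap.lsmul ℝ ℝ (E := E d))) _ _).trans ?_
  have h1 : ‖ContinuousLinearMap.precompL (E d) (ContinuousLinearMap.lsmul ℝ ℝ (E := E d))‖ ≤ 1 :=
    (ContinuousLinearMap.norm_precompL_le _ _).trans ContinuousLinearMap.opNorm_lsmul_le
  calc _ ≤ 1 * ‖fderiv ℝ (ρ.normed volume) z‖ * M := by
        gcongr
        exact hM _
    _ = _ := by rw [one_mul]

/-- The same translation argument, with the derivative placed on the bump. The constant `bumpConst`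
depends on the radius, so later limits must fix the mollifier before refining the time step. -/
theorem norm_fderiv_mollify_sub_le (ρ : ContDiffBump (0 : E d)) {V : E d → E d} {C : ℝ≥0}
    (hV : LipschitzWith C V) (x y : E d) :
    ‖fderiv ℝ (mollify ρ V) x - fderiv ℝ (mollify ρ V) y‖ ≤ bumpConst ρ * (C * ‖x - y‖) := by
  have hc : Continuous fun z => V (z + (x - y)) := hV.continuous.comp (continuous_add_const _)
  have hd : Differentiable ℝ (mollify ρ V) :=
    (contDiff_mollify ρ hV.continuous).differentiable (by simp)
  have hd' : Differentiable ℝ (mollify ρ fun z => V (z + (x - y))) :=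
    (contDiff_mollify ρ hc).differentiable (by simp)
  have e : fderiv ℝ (mollify ρ V) x = fderiv ℝ (mollify ρ fun z => V (z + (x - y))) y := by
    have e1 : (mollify ρ fun z => V (z + (x - y))) = fun z => mollify ρ V (z + (x - y)) :=
      funext fun z => (mollify_add_right ρ V _ z).symm
    rw [e1, fderiv_comp_add_right, add_sub_cancel]
  have e2 : (fun z => mollify ρ (fun z => V (z + (x - y))) z - mollify ρ V z)
      = mollify ρ fun z => V (z + (x - y)) - V z :=
    funext fun z => mollify_sub ρ hc hV.continuous z
  rw [e, ← fderiv_fun_sub (hd' y) (hd y), e2]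
  refine norm_fderiv_mollify_le ρ (hc.sub hV.continuous) (fun z => ?_) y
  simpa using hV.norm_sub_le (z + (x - y)) z

end Mollify

/-! ### Observables and their transport by one step -/

section Observables

/-- Smooth bounded functions with gradient bounded by `A` and `Q`-Lipschitz. -/
structure IsObservable (A Q : ℝ) (φ : E d → ℝ) : Prop where
  contDiff : ContDiff ℝ ∞ φ
  bounded : ∃ B, ∀ x, |φ x| ≤ B
  norm_fderiv_le : ∀ x, ‖fderiv ℝ φ x‖ ≤ A
  norm_fderiv_sub_le : ∀ x y, ‖fderiv ℝ φ x - fderiv ℝ φ y‖ ≤ Q * ‖x - y‖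
  nonneg : 0 ≤ A
  le : A ≤ Q

theorem isObservable_cos (ξ : E d) (c : ℝ) :
    IsObservable ‖ξ‖ (‖ξ‖ + ‖ξ‖ ^ 2) (fun x : E d => Real.cos (⟪x, ξ⟫_ℝ + c)) where
  contDiff := contDiff_cos_inner ξ c
  bounded := ⟨1, fun x => Real.abs_cos_le_one _⟩
  norm_fderiv_le := norm_fderiv_cos_inner_le ξ c
  norm_fderiv_sub_le x y := by
    have hd : Differentiable ℝ (fderiv ℝ (fun x : E d => Real.cos (⟪x, ξ⟫_ℝ + c))) :=
      ((contDiff_cos_inner ξ c).fderiv_right (m := 1) one_add_one_le_contDiff_top).differentiable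
        (by norm_num)
    have h := Convex.norm_image_sub_le_of_norm_fderiv_le (𝕜 := ℝ) (s := univ)
      (f := fderiv ℝ (fun x : E d => Real.cos (⟪x, ξ⟫_ℝ + c))) (C := ‖ξ‖ ^ 2)
      (fun z _ => hd z) (fun z _ => ?_) convex_univ (mem_univ y) (mem_univ x)
    · refine h.trans ?_
      have := norm_nonneg ξ
      gcongr
      linarith
    · have := norm_iteratedFDeriv_two_cos_inner_le ξ c z
      rwa [← norm_iteratedFDeriv_fderiv, norm_iteratedFDeriv_one] at this
  nonneg := norm_nonneg ξ
  le := le_add_of_nonneg_right (sq_nonneg _)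

namespace IsObservable

variable {A Q : ℝ} {φ : E d → ℝ}

theorem taylor (h : IsObservable A Q φ) (x w : E d) :
    |φ (x + w) - φ x - fderiv ℝ φ x w| ≤ Q * ‖w‖ ^ 2 := by
  have hd : Differentiable ℝ φ := h.contDiff.differentiable (by simp)
  have hQ := h.nonneg.trans h.le
  have := Convex.norm_image_sub_le_of_norm_fderiv_le' (𝕜 := ℝ) (f := φ) (φ := fderiv ℝ φ x)
    (s := Metric.closedBall x ‖w‖) (C := Q * ‖w‖) (fun z _ => hd z) (fun z hz => ?_)
    (convex_closedBall x ‖w‖) (Metric.mem_closedBall_self (norm_nonneg w)) (y := x + w) (by simp)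
  · rw [add_sub_cancel_left, mul_assoc, ← sq] at this
    exact this
  · refine (h.norm_fderiv_sub_le z x).trans (mul_le_mul_of_nonneg_left ?_ hQ)
    rwa [← dist_eq_norm]

/-- Chain rule for `φ ∘ (id + W)`. The curvature term of `W` is multiplied by the gradient bound
`A`, which `A ≤ Q` lets one absorb into `Q`; this is why that inequality belongs to the structure.
-/
theorem comp_add (h : IsObservable A Q φ) {W : E d → E d} (hW : ContDiff ℝ ∞ W) {c : ℝ≥0}
    (hc : LipschitzWith c W) {κ : ℝ} (hκ : 0 ≤ κ)
    (hκW : ∀ x y, ‖fderiv ℝ W x - fderiv ℝ W y‖ ≤ κ * ‖x - y‖) :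
    IsObservable ((1 + c) * A) (((1 + c) ^ 2 + κ) * Q) (fun x => φ (x + W x)) := by
  have hd : Differentiable ℝ φ := h.contDiff.differentiable (by simp)
  have hdW : Differentiable ℝ W := hW.differentiable (by simp)
  have hc0 : (0 : ℝ) ≤ c := c.coe_nonneg
  have hA := h.nonneg
  have hQ := h.nonneg.trans h.le
  set D : E d → E d →L[ℝ] E d := fun x => ContinuousLinearMap.id ℝ (E d) + fderiv ℝ W x with hD
  have hDn : ∀ x, ‖D x‖ ≤ 1 + c := fun x =>
    (norm_add_le _ _).trans (add_le_add ContinuousLinearMap.norm_id_le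
      (norm_fderiv_le_of_lipschitz ℝ hc))
  have e : ∀ x, fderiv ℝ (fun x => φ (x + W x)) x = (fderiv ℝ φ (x + W x)).comp (D x) := fun x =>
    ((hd _).hasFDerivAt.comp x ((hasFDerivAt_id x).add (hdW x).hasFDerivAt)).fderiv
  obtain ⟨B, hB⟩ := h.bounded
  refine ⟨h.contDiff.comp (contDiff_id.add hW), ⟨B, fun x => hB _⟩, fun x => ?_, fun x y => ?_,
    by positivity, ?_⟩
  · rw [e, mul_comm]
    exact (ContinuousLinearMap.opNorm_comp_le _ _).trans
      (mul_le_mul (h.norm_fderiv_le _) (hDn x) (norm_nonneg _) hA)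
  · rw [e, e]
    have e1 : (fderiv ℝ φ (x + W x)).comp (D x) - (fderiv ℝ φ (y + W y)).comp (D y)
        = (fderiv ℝ φ (x + W x) - fderiv ℝ φ (y + W y)).comp (D x)
          + (fderiv ℝ φ (y + W y)).comp (fderiv ℝ W x - fderiv ℝ W y) := by
      ext z
      simp only [hD, sub_apply, add_apply, ContinuousLinearMap.comp_apply, map_add, map_sub,
        ContinuousLinearMap.id_apply]
      ring
    have hE : ‖x + W x - (y + W y)‖ ≤ (1 + c) * ‖x - y‖ := by
      rw [add_sub_add_comm, add_mul, one_mul]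
      exact (norm_add_le _ _).trans (add_le_add le_rfl (hc.norm_sub_le x y))
    have h1 : ‖(fderiv ℝ φ (x + W x) - fderiv ℝ φ (y + W y)).comp (D x)‖
        ≤ Q * ((1 + c) * ‖x - y‖) * (1 + c) :=
      (ContinuousLinearMap.opNorm_comp_le _ _).trans (mul_le_mul
        ((h.norm_fderiv_sub_le _ _).trans (mul_le_mul_of_nonneg_left hE hQ)) (hDn x)
        (norm_nonneg _) (by positivity))
    have h2 : ‖(fderiv ℝ φ (y + W y)).comp (fderiv ℝ W x - fderiv ℝ W y)‖
        ≤ Q * (κ * ‖x - y‖) :=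
      (ContinuousLinearMap.opNorm_comp_le _ _).trans (mul_le_mul
        ((h.norm_fderiv_le _).trans h.le) (hκW x y) (norm_nonneg _) hQ)
    rw [e1]
    refine (norm_add_le _ _).trans ((add_le_add h1 h2).trans (le_of_eq ?_))
    ring
  · have h1 : 1 + (c : ℝ) ≤ (1 + c) ^ 2 + κ := by nlinarith
    exact mul_le_mul h1 h.le hA (by positivity)

theorem locLip (h : IsObservable A Q φ) {v : E d → E d} {Λ : ℝ≥0} (hv : LipschitzWith Λ v) {a : ℝ}
    (ha : ∀ x, ‖v x‖ ≤ a * (1 + ‖x‖)) :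
    LocLip (A * Λ + Q * a) (fun x => fderiv ℝ φ x (v x)) := by
  intro x y
  have hQ := h.nonneg.trans h.le
  have hA := h.nonneg
  have ha0 : 0 ≤ a := by simpa using (norm_nonneg _).trans (ha 0)
  have e : fderiv ℝ φ x (v x) - fderiv ℝ φ y (v y)
      = fderiv ℝ φ x (v x - v y) + (fderiv ℝ φ x - fderiv ℝ φ y) (v y) := by
    rw [map_sub, sub_apply]
    ring
  have h1 : ‖fderiv ℝ φ x (v x - v y)‖ ≤ A * (Λ * ‖x - y‖) :=
    (ContinuousLinearMap.le_opNorm _ _).trans (mul_le_mul (h.norm_fderiv_le x) (hv.norm_sub_le x y)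
      (norm_nonneg _) hA)
  have h2 : ‖(fderiv ℝ φ x - fderiv ℝ φ y) (v y)‖ ≤ Q * ‖x - y‖ * (a * (1 + ‖y‖)) :=
    (ContinuousLinearMap.le_opNorm _ _).trans (mul_le_mul (h.norm_fderiv_sub_le x y) (ha y)
      (norm_nonneg _) (by positivity))
  rw [e]
  refine (norm_add_le _ _).trans ((add_le_add h1 h2).trans ?_)
  have h3 : A * Λ * ‖x - y‖ * 1 ≤ A * Λ * ‖x - y‖ * (1 + ‖x‖ + ‖y‖) :=
    mul_le_mul_of_nonneg_left (by linarith [norm_nonneg x, norm_nonneg y]) (by positivity)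
  have h4 : Q * a * ‖x - y‖ * (1 + ‖y‖) ≤ Q * a * ‖x - y‖ * (1 + ‖x‖ + ‖y‖) :=
    mul_le_mul_of_nonneg_left (by linarith [norm_nonneg x]) (by positivity)
  linarith

end IsObservable

variable {T : ℝ}

/-- Integrals of locally Lipschitz functions along a `W2`-continuous curve have a common modulus of
continuity. -/
theorem IsW2Continuous.exists_modulus {μ : ℝ → P2 d} (hμ : IsW2Continuous T μ) {η : ℝ}
    (hη : 0 < η) : ∃ δ > 0, ∀ r ∈ Icc 0 T, ∀ t ∈ Icc 0 T, |r - t| < δ → ∀ (C : ℝ) (g : E d → ℝ),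
      0 ≤ C → LocLip C g →
      |∫ x, g x ∂(μ r).toMeasure - ∫ x, g x ∂(μ t).toMeasure| ≤ C * η := by
  obtain ⟨K, hK0, hK⟩ := hμ.exists_M2_le
  set S := √(3 * (1 + K + K)) with hS
  have hS0 : 0 < S := Real.sqrt_pos.2 (by positivity)
  have hev : ∀ s ∈ Icc 0 T, ∃ U ∈ 𝓝 s, ∀ r ∈ U ∩ Icc 0 T, W2 (μ r) (μ s) ≤ η / (2 * S) :=
    fun s hs => by
      have := (hμ s hs).eventually (eventually_le_nhds (b := η / (2 * S)) (by positivity))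
      obtain ⟨U, hU, hUs⟩ := mem_nhdsWithin_iff_exists_mem_nhds_inter.1 this
      exact ⟨U, hU, hUs⟩
  choose! U hU hUs using hev
  -- A Lebesgue number for a cover of `[0,T]` by neighbourhoods on which the curve stays `W2`-close
  -- to a centre. The modulus then serves all locally Lipschitz functions, scaling with their
  -- constant.
  obtain ⟨δ, hδ, hleb⟩ := lebesgue_number_lemma_of_metric (s := Icc 0 T)
    (c := fun s : Icc (0 : ℝ) T => interior (U s)) isCompact_Icc (fun _ => isOpen_interior)
    (fun s hs => mem_iUnion.2 ⟨⟨s, hs⟩, mem_interior_iff_mem_nhds.2 (hU s hs)⟩)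
  refine ⟨δ, hδ, fun r hr t ht hrt C g hC hg => ?_⟩
  obtain ⟨⟨s, hs⟩, hsub⟩ := hleb t ht
  have key : ∀ q ∈ Icc 0 T, q ∈ Metric.ball t δ →
      |∫ x, g x ∂(μ q).toMeasure - ∫ x, g x ∂(μ s).toMeasure| ≤ C * (η / 2) := fun q hq hqt => by
    refine (hg.abs_integral_sub_le hC _ _).trans ?_
    have h1 : W2 (μ q) (μ s) ≤ η / (2 * S) := hUs s hs q ⟨interior_subset (hsub hqt), hq⟩
    have h2 : √(3 * (1 + (μ q).M2 + (μ s).M2)) ≤ S := by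
      refine Real.sqrt_le_sqrt ?_
      have := hK q hq
      have := hK s hs
      linarith
    calc _ ≤ C * S * (η / (2 * S)) := by
          have := W2_nonneg (μ q) (μ s)
          gcongr
      _ = C * (η / 2) := by field_simp
  have h1 := key r hr (by rwa [Metric.mem_ball, Real.dist_eq])
  have h2 := key t ht (Metric.mem_ball_self hδ)
  rw [abs_le] at *
  constructor <;> linarith

end Observables

end VanishingViscosity

namespace VanishingViscosity

variable {d : ℕ}

/-! ### A mollified Euler scheme for the continuity equation -/

section Euler

/-- Measurable velocity fields of linear growth, Lipschitz in space uniformly in time. -/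
structure IsLipVelocity (a : ℝ) (Λ : ℝ≥0) (v : ℝ → E d → E d) : Prop where
  meas : Measurable (Function.uncurry v)
  growth : ∀ t x, ‖v t x‖ ≤ a * (1 + ‖x‖)
  lip : ∀ t, LipschitzWith Λ (v t)

/-- The velocity integrated over a time interval. -/
noncomputable def impulse (v : ℝ → E d → E d) (s t : ℝ) (x : E d) : E d := ∫ r in s..t, v r x

namespace IsLipVelocity

variable {a : ℝ} {Λ : ℝ≥0} {v : ℝ → E d → E d}

theorem nonneg (hv : IsLipVelocity a Λ v) : 0 ≤ a := by
  simpa using (norm_nonneg _).trans (hv.growth 0 0)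

theorem intervalIntegrable (hv : IsLipVelocity a Λ v) (s t : ℝ) (x : E d) :
    IntervalIntegrable (fun r => v r x) volume s t := by
  rw [intervalIntegrable_iff]
  have hm : Measurable fun r => v r x := hv.meas.comp (measurable_id.prodMk measurable_const)
  haveI : IsFiniteMeasure (volume.restrict (uIoc s t)) := ⟨by simp [uIoc]⟩
  exact Integrable.of_bound hm.aestronglyMeasurable (a * (1 + ‖x‖))
    (.of_forall fun r => hv.growth r x)

theorem lipschitzWith_impulse (hv : IsLipVelocity a Λ v) {s t : ℝ} (hst : s ≤ t) :
    LipschitzWith ((t - s).toNNReal * Λ) (impulse v s t) := by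
  refine LipschitzWith.of_dist_le_mul fun x y => ?_
  rw [dist_eq_norm, impulse, impulse, ← intervalIntegral.integral_sub (hv.intervalIntegrable s t x)
    (hv.intervalIntegrable s t y)]
  refine (intervalIntegral.norm_integral_le_of_norm_le_const (C := Λ * ‖x - y‖) fun r _ =>
    (hv.lip r).norm_sub_le x y).trans (le_of_eq ?_)
  rw [abs_of_nonneg (sub_nonneg.2 hst), dist_eq_norm, NNReal.coe_mul,
    Real.coe_toNNReal _ (sub_nonneg.2 hst)]
  ring

theorem norm_impulse_le (hv : IsLipVelocity a Λ v) {s t : ℝ} (hst : s ≤ t) (x : E d) :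
    ‖impulse v s t x‖ ≤ (t - s) * (a * (1 + ‖x‖)) := by
  refine (intervalIntegral.norm_integral_le_of_norm_le_const fun r _ => hv.growth r x).trans
    (le_of_eq ?_)
  rw [abs_of_nonneg (sub_nonneg.2 hst)]
  ring

theorem norm_mollify_impulse_sub_le (hv : IsLipVelocity a Λ v) (ρ : ContDiffBump (0 : E d))
    {s t : ℝ} (hst : s ≤ t) (x : E d) :
    ‖mollify ρ (impulse v s t) x - impulse v s t x‖ ≤ (t - s) * (Λ * ρ.rOut) := by
  refine (norm_mollify_sub_le ρ (hv.lipschitzWith_impulse hst) x).trans (le_of_eq ?_)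
  rw [NNReal.coe_mul, Real.coe_toNNReal _ (sub_nonneg.2 hst), mul_assoc]

theorem norm_mollify_impulse_le (hv : IsLipVelocity a Λ v) {ρ : ContDiffBump (0 : E d)}
    (hρ : ρ.rOut ≤ 1) {s t : ℝ} (hst : s ≤ t) (x : E d) :
    ‖mollify ρ (impulse v s t) x‖ ≤ (t - s) * ((a + Λ) * (1 + ‖x‖)) := by
  have h1 := hv.norm_mollify_impulse_sub_le ρ hst x
  have h2 := hv.norm_impulse_le hst x
  have h3 : (Λ : ℝ) * ρ.rOut ≤ Λ * (1 + ‖x‖) :=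
    mul_le_mul_of_nonneg_left (by linarith [norm_nonneg x]) Λ.coe_nonneg
  have h4 := norm_sub_norm_le (mollify ρ (impulse v s t) x) (impulse v s t x)
  have h5 := mul_le_mul_of_nonneg_left h3 (sub_nonneg.2 hst)
  linarith

end IsLipVelocity

variable {T : ℝ} {μ₀ : P2 d} {a : ℝ} {Λ : ℝ≥0} {v : ℝ → E d → E d} {μ : ℝ → P2 d}

theorem integral_fderiv_impulse {A Q : ℝ} {φ : E d → ℝ} (hφ : IsObservable A Q φ)
    (hv : IsLipVelocity a Λ v) {s t : ℝ} (hst : s ≤ t) (m : P2 d) :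
    IntervalIntegrable (fun r => ∫ x, fderiv ℝ φ x (v r x) ∂m.toMeasure) volume s t ∧
    ∫ x, fderiv ℝ φ x (impulse v s t x) ∂m.toMeasure
      = ∫ r in s..t, ∫ x, fderiv ℝ φ x (v r x) ∂m.toMeasure := by
  have ha := hv.nonneg
  have hA := hφ.nonneg
  have hc : Continuous (fderiv ℝ φ) := hφ.contDiff.continuous_fderiv (by simp)
  have hm : Measurable fun z : ℝ × E d => fderiv ℝ φ z.2 (v z.1 z.2) :=
    (by fun_prop : Continuous fun p : (E d →L[ℝ] ℝ) × E d => p.1 p.2).measurable.comp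
      ((hc.measurable.comp measurable_snd).prodMk hv.meas)
  have hb : ∀ r x, ‖fderiv ℝ φ x (v r x)‖ ≤ A * a * (1 + ‖x‖) := fun r x => by
    rw [mul_assoc]
    exact (ContinuousLinearMap.le_opNorm _ _).trans
      (mul_le_mul (hφ.norm_fderiv_le x) (hv.growth r x) (norm_nonneg _) hA)
  have h_int : Integrable (Function.uncurry fun r x => fderiv ℝ φ x (v r x))
      ((volume.restrict (Ioc s t)).prod m.toMeasure) := by
    have hi : Integrable (fun x : E d => A * a * (1 + ‖x‖)) m.toMeasure :=
      (((integrable_const (1 : ℝ)).add m.integrable_norm).const_mul (A * a))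
    have hi2 : Integrable (fun z : ℝ × E d => A * a * (1 + ‖z.2‖))
        ((volume.restrict (Ioc s t)).prod m.toMeasure) := hi.comp_snd _
    exact hi2.mono' hm.aestronglyMeasurable (.of_forall fun z => hb z.1 z.2)
  refine ⟨?_, ?_⟩
  · rw [intervalIntegrable_iff_integrableOn_Ioc_of_le hst]
    exact h_int.integral_prod_left
  · rw [intervalIntegral.integral_of_le hst, integral_integral_swap h_int]
    refine integral_congr_ae (.of_forall fun x => ?_)
    beta_reduce
    rw [impulse, ← ContinuousLinearMap.intervalIntegral_comp_comm _ (hv.intervalIntegrable s t x),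
      intervalIntegral.integral_of_le hst]

/-- One step of the mollified Euler scheme. -/
theorem abs_integral_euler_step_le (hT : 0 < T) (h : IsLinearSolution T μ₀ 0 v μ)
    (hv : IsLipVelocity a Λ v) {K : ℝ} (hK : ∀ t ∈ Icc 0 T, (μ t).M2 ≤ K)
    {ρ : ContDiffBump (0 : E d)} (hρ : ρ.rOut ≤ 1) {A Q : ℝ} {φ : E d → ℝ}
    (hφ : IsObservable A Q φ) {s t : ℝ} (hs : 0 ≤ s) (hst : s ≤ t) (ht : t ≤ T) {η : ℝ}
    (hη : ∀ r ∈ Icc s t, ∀ (C : ℝ) (g : E d → ℝ), 0 ≤ C → LocLip C g →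
      |∫ x, g x ∂(μ r).toMeasure - ∫ x, g x ∂(μ s).toMeasure| ≤ C * η) :
    |∫ x, φ (x + mollify ρ (impulse v s t) x) ∂(μ s).toMeasure - ∫ x, φ x ∂(μ t).toMeasure|
      ≤ (t - s) * (A * (Λ * ρ.rOut)
        + Q * (((Λ + a) + 2 * (a + Λ) ^ 2 * (1 + K)) * (η + (t - s)))) := by
  have ha := hv.nonneg
  have hA := hφ.nonneg
  have hAQ := hφ.le
  have hQ := hA.trans hAQ
  have hsI : s ∈ Icc 0 T := ⟨hs, hst.trans ht⟩
  have htI : t ∈ Icc 0 T := ⟨hs.trans hst, ht⟩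
  have hK0 : 0 ≤ K := (μ s).M2_nonneg.trans (hK s hsI)
  have hh : 0 ≤ t - s := sub_nonneg.2 hst
  have hΛ : (0 : ℝ) ≤ Λ := Λ.coe_nonneg
  have hη0 : 0 ≤ η := by
    have := hη s ⟨le_rfl, hst⟩ 1 (fun _ => 0) zero_le_one (fun x y => by
      rw [sub_self, norm_zero]
      positivity)
    simpa using this
  set V := impulse v s t with hV
  set W := mollify ρ V with hW
  have hVl := hv.lipschitzWith_impulse hst
  have hVc : Continuous V := hVl.continuous
  have hWc : Continuous W := (contDiff_mollify ρ hVc).continuous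
  have hfc : Continuous (fderiv ℝ φ) := hφ.contDiff.continuous_fderiv (by simp)
  have hφc : Continuous φ := hφ.contDiff.continuous
  obtain ⟨B, hB⟩ := hφ.bounded
  have hB0 : 0 ≤ B := (abs_nonneg _).trans (hB 0)
  have hWn : ∀ x, ‖W x‖ ≤ (t - s) * ((a + Λ) * (1 + ‖x‖)) := hv.norm_mollify_impulse_le hρ hst
  have hWV : ∀ x, ‖W x - V x‖ ≤ (t - s) * (Λ * ρ.rOut) := hv.norm_mollify_impulse_sub_le ρ hst
  have i1 : Integrable (fun x => φ (x + W x)) (μ s).toMeasure :=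
    Integrable.of_bound (hφc.comp (continuous_id.add hWc)).aestronglyMeasurable B
      (.of_forall fun x => hB _)
  have i2 : Integrable φ (μ s).toMeasure :=
    Integrable.of_bound hφc.aestronglyMeasurable B (.of_forall hB)
  have i4 : Integrable (fun x => fderiv ℝ φ x (V x)) (μ s).toMeasure := by
    have hi : Integrable (fun x : E d => A * ((t - s) * (a * (1 + ‖x‖)))) (μ s).toMeasure :=
      ((((integrable_const (1 : ℝ)).add (μ s).integrable_norm).const_mul a).const_mul
        (t - s)).const_mul A
    refine hi.mono' (hfc.clm_apply hVc).aestronglyMeasurable (.of_forall fun x => ?_)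
    exact (ContinuousLinearMap.le_opNorm _ _).trans
      (mul_le_mul (hφ.norm_fderiv_le x) (hv.norm_impulse_le hst x) (norm_nonneg _) hA)
  -- Taylor expansion of `φ` along the step, plus the error of mollifying the impulse. Squared
  -- displacements have finite mean by the second moment bound.
  have hfirst : |(∫ x, φ (x + W x) ∂(μ s).toMeasure) - (∫ x, φ x ∂(μ s).toMeasure)
      - ∫ x, fderiv ℝ φ x (V x) ∂(μ s).toMeasure|
      ≤ (t - s) * (A * (Λ * ρ.rOut)) + Q * (2 * (t - s) ^ 2 * (a + Λ) ^ 2 * (1 + K)) := by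
    have i5 : Integrable (fun x => φ (x + W x) - φ x) (μ s).toMeasure := i1.sub i2
    rw [← integral_sub i1 i2, ← integral_sub i5 i4, ← Real.norm_eq_abs]
    have hi0 : Integrable (fun x : E d => Q * (2 * (t - s) ^ 2 * (a + Λ) ^ 2) * (1 + ‖x‖ ^ 2))
        (μ s).toMeasure := ((integrable_const _).add (μ s).integrable_sq).const_mul _
    have hi : Integrable (fun x : E d => (t - s) * (A * (Λ * ρ.rOut))
        + Q * (2 * (t - s) ^ 2 * (a + Λ) ^ 2) * (1 + ‖x‖ ^ 2)) (μ s).toMeasure :=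
      (integrable_const _).add hi0
    refine (norm_integral_le_of_norm_le hi (.of_forall fun x => ?_)).trans ?_
    · have e : φ (x + W x) - φ x - fderiv ℝ φ x (V x)
          = (φ (x + W x) - φ x - fderiv ℝ φ x (W x)) + fderiv ℝ φ x (W x - V x) := by
        rw [map_sub]
        ring
      have h1 := hφ.taylor x (W x)
      have h2 : ‖fderiv ℝ φ x (W x - V x)‖ ≤ A * ((t - s) * (Λ * ρ.rOut)) :=
        (ContinuousLinearMap.le_opNorm _ _).trans
          (mul_le_mul (hφ.norm_fderiv_le x) (hWV x) (norm_nonneg _) hA)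
      have h3 : ‖W x‖ ^ 2 ≤ 2 * (t - s) ^ 2 * (a + Λ) ^ 2 * (1 + ‖x‖ ^ 2) := by
        refine (pow_le_pow_left₀ (norm_nonneg _) (hWn x) 2).trans ?_
        have : (1 + ‖x‖) ^ 2 ≤ 2 * (1 + ‖x‖ ^ 2) := by nlinarith [sq_nonneg (1 - ‖x‖)]
        calc _ = (t - s) ^ 2 * (a + Λ) ^ 2 * (1 + ‖x‖) ^ 2 := by ring
          _ ≤ (t - s) ^ 2 * (a + Λ) ^ 2 * (2 * (1 + ‖x‖ ^ 2)) := by gcongr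
          _ = _ := by ring
      rw [e]
      refine (norm_add_le _ _).trans ?_
      rw [Real.norm_eq_abs]
      have h4 := mul_le_mul_of_nonneg_left h3 hQ
      linarith
    · rw [integral_add (integrable_const _) hi0,
        integral_const_mul (Q * (2 * (t - s) ^ 2 * (a + Λ) ^ 2)),
        integral_add (integrable_const _) (μ s).integrable_sq]
      have hM : ∫ x, ‖x‖ ^ 2 ∂(μ s).toMeasure ≤ K := hK s hsI
      simp only [integral_const, probReal_univ, one_smul]
      have : Q * (2 * (t - s) ^ 2 * (a + Λ) ^ 2) * (1 + ∫ x, ‖x‖ ^ 2 ∂(μ s).toMeasure)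
          ≤ Q * (2 * (t - s) ^ 2 * (a + Λ) ^ 2) * (1 + K) := by gcongr
      linarith
  -- The equation on `[s,t]` integrates the same observable against `μ r` instead of `μ s`; the
  -- modulus of continuity of the curve bounds the difference.
  have hsecond : |(∫ x, fderiv ℝ φ x (V x) ∂(μ s).toMeasure)
      - ((∫ x, φ x ∂(μ t).toMeasure) - ∫ x, φ x ∂(μ s).toMeasure)|
      ≤ (t - s) * ((A * Λ + Q * a) * η) := by
    have h0 : ∀ x, |φ x| ≤ (A + B) * (1 + ‖x‖ ^ 2) := fun x => by
      have := hB x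
      nlinarith [sq_nonneg ‖x‖, mul_nonneg hA (sq_nonneg ‖x‖), mul_nonneg hB0 (sq_nonneg ‖x‖)]
    have h1 : ∀ x, ‖fderiv ℝ φ x‖ ≤ (A + B) * (1 + ‖x‖) := fun x => by
      have := hφ.norm_fderiv_le x
      nlinarith [norm_nonneg x, mul_nonneg hA (norm_nonneg x), mul_nonneg hB0 (norm_nonneg x)]
    have h2 : ∀ x, |(0 : ℝ)| * ‖iteratedFDeriv ℝ 2 φ x‖ ≤ A + B := fun x => by
      rw [abs_zero, zero_mul]
      positivity
    have hi := h.intervalIntegrable_generator hT hφ.contDiff (by positivity) h1 h2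
    have hsub : ∀ p q, p ∈ Icc 0 T → q ∈ Icc 0 T → IntervalIntegrable
        (fun t => ∫ x, generator 0 v φ t x ∂(μ t).toMeasure) volume p q := fun p q hp hq =>
      hi.mono_set (by rw [uIcc_of_le hT.le]; exact uIcc_subset_Icc hp hq)
    have h0I : (0 : ℝ) ∈ Icc 0 T := ⟨le_rfl, hT.le⟩
    obtain ⟨hj, hF⟩ := integral_fderiv_impulse hφ hv hst (μ s)
    rw [h.integral_eq hT hφ.contDiff h0 h1 h2 htI, h.integral_eq hT hφ.contDiff h0 h1 h2 hsI,
      add_sub_add_left_eq_sub,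
      intervalIntegral.integral_interval_sub_left (hsub 0 t h0I htI) (hsub 0 s h0I hsI), hF,
      ← intervalIntegral.integral_sub hj (hsub s t hsI htI), ← Real.norm_eq_abs]
    refine (intervalIntegral.norm_integral_le_of_norm_le_const (C := (A * Λ + Q * a) * η)
      fun r hr => ?_).trans (le_of_eq ?_)
    · rw [uIoc_of_le hst] at hr
      rw [Real.norm_eq_abs, abs_sub_comm]
      simp only [generator, zero_mul, add_zero]
      exact hη r ⟨hr.1.le, hr.2⟩ _ _ (by positivity) (hφ.locLip (hv.lip r) (hv.growth r))
    · rw [abs_of_nonneg hh, mul_comm]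
  have h3 : A * Λ ≤ Q * Λ := mul_le_mul_of_nonneg_right hAQ hΛ
  have h4 : (t - s) * ((A * Λ + Q * a) * η) ≤ (t - s) * ((Q * (Λ + a)) * η) := by
    gcongr
    linarith
  have h5 : 0 ≤ (t - s) * (Q * (Λ + a) * (t - s)) := by positivity
  have h6 : 0 ≤ (t - s) * (Q * (2 * (a + Λ) ^ 2 * (1 + K)) * η) := by positivity
  rw [abs_le] at *
  constructor <;> linarith

/-- The mollified Euler scheme with step `h`. -/
noncomputable def eulerMap (ρ : ContDiffBump (0 : E d)) (v : ℝ → E d → E d) (h : ℝ) : ℕ → E d → E d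
  | 0 => id
  | j + 1 => fun x => eulerMap ρ v h j x
      + mollify ρ (impulse v (j * h) ((j + 1) * h)) (eulerMap ρ v h j x)

theorem continuous_eulerMap (ρ : ContDiffBump (0 : E d)) (hv : IsLipVelocity a Λ v) {h : ℝ}
    (hh : 0 ≤ h) (j : ℕ) : Continuous (eulerMap ρ v h j) := by
  induction j with
  | zero => exact continuous_id
  | succ j ih =>
    have hst : (j : ℝ) * h ≤ (j + 1) * h := by nlinarith
    exact ih.add ((contDiff_mollify ρ
      (hv.lipschitzWith_impulse hst).continuous).continuous.comp ih)

theorem norm_eulerMap_le {ρ : ContDiffBump (0 : E d)} (hρ : ρ.rOut ≤ 1) (hv : IsLipVelocity a Λ v)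
    {h : ℝ} (hh : 0 ≤ h) (j : ℕ) (x : E d) :
    1 + ‖eulerMap ρ v h j x‖ ≤ (1 + h * (a + Λ)) ^ j * (1 + ‖x‖) := by
  have ha := hv.nonneg
  induction j with
  | zero => simp [eulerMap]
  | succ j ih =>
    have hst : (j : ℝ) * h ≤ (j + 1) * h := by nlinarith
    have h1 := hv.norm_mollify_impulse_le hρ hst (eulerMap ρ v h j x)
    have h2 : 0 ≤ 1 + h * (a + Λ) := by positivity
    have h3 := mul_le_mul_of_nonneg_left ih h2
    have h4 := norm_add_le (eulerMap ρ v h j x)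
      (mollify ρ (impulse v (j * h) ((j + 1) * h)) (eulerMap ρ v h j x))
    rw [eulerMap, pow_succ]
    have h5 : ((j : ℝ) + 1) * h - j * h = h := by ring
    rw [h5] at h1
    linarith

/-- Induction on the number of steps for all observables at once: the last step is pulled back onto
`φ`, whose constants change by `comp_add`. The factor with `bumpConst` multiplies only `η + h`,
which can be made small after the mollifier is fixed; the other term is proportional to the
mollification radius. -/
theorem abs_integral_eulerMap_sub_le (hT : 0 < T) (hsol : IsLinearSolution T μ₀ 0 v μ)
    (hv : IsLipVelocity a Λ v) {K : ℝ} (hK : ∀ t ∈ Icc 0 T, (μ t).M2 ≤ K)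
    {ρ : ContDiffBump (0 : E d)} (hρ : ρ.rOut ≤ 1) {η h : ℝ} (hh : 0 ≤ h) (hh1 : h ≤ 1)
    (hη : ∀ r ∈ Icc 0 T, ∀ s ∈ Icc 0 T, |r - s| ≤ h → ∀ (C : ℝ) (g : E d → ℝ), 0 ≤ C → LocLip C g →
      |∫ x, g x ∂(μ r).toMeasure - ∫ x, g x ∂(μ s).toMeasure| ≤ C * η) (j : ℕ) (hj : j * h ≤ T)
    {A Q : ℝ} {φ : E d → ℝ} (hφ : IsObservable A Q φ) :
    |∫ x, φ (eulerMap ρ v h j x) ∂μ₀.toMeasure - ∫ x, φ x ∂(μ (j * h)).toMeasure|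
      ≤ j * h * ((1 + h * Λ) ^ j * (A * (Λ * ρ.rOut))
        + (1 + h * (2 * Λ + Λ ^ 2 + bumpConst ρ * Λ)) ^ j
          * (Q * (((Λ + a) + 2 * (a + Λ) ^ 2 * (1 + K)) * (η + h)))) := by
  have ha := hv.nonneg
  have h0I : (0 : ℝ) ∈ Icc 0 T := ⟨le_rfl, hT.le⟩
  have hK0 : 0 ≤ K := (μ 0).M2_nonneg.trans (hK 0 h0I)
  have hκ := bumpConst_nonneg ρ
  have hΛ : (0 : ℝ) ≤ Λ := Λ.coe_nonneg
  have hη0 : 0 ≤ η := by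
    have := hη 0 h0I 0 h0I (by simpa using hh) 1 (fun _ => 0) zero_le_one (fun x y => by
      rw [sub_self, norm_zero]
      positivity)
    simpa using this
  induction j generalizing A Q φ with
  | zero =>
    obtain ⟨B, hB⟩ := hφ.bounded
    have hB0 : 0 ≤ B := (abs_nonneg _).trans (hB 0)
    have hA := hφ.nonneg
    have e := hsol.integral_eq hT hφ.contDiff (B := A + B) (fun x => by
      have := hB x
      nlinarith [sq_nonneg ‖x‖, mul_nonneg hA (sq_nonneg ‖x‖), mul_nonneg hB0 (sq_nonneg ‖x‖)])
      (fun x => by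
        have := hφ.norm_fderiv_le x
        nlinarith [norm_nonneg x, mul_nonneg hA (norm_nonneg x), mul_nonneg hB0 (norm_nonneg x)])
      (fun x => by
        rw [abs_zero, zero_mul]
        positivity) h0I
    rw [intervalIntegral.integral_same, add_zero] at e
    simp [eulerMap, e]
  | succ j ih =>
    push_cast at hj ⊢
    have hst : (j : ℝ) * h ≤ (j + 1) * h := by nlinarith
    have hjh : (0 : ℝ) ≤ j * h := by positivity
    have hd : ((j : ℝ) + 1) * h - j * h = h := by ring
    have hVl := hv.lipschitzWith_impulse hst
    rw [hd] at hVl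
    have hc : ((h.toNNReal * Λ : ℝ≥0) : ℝ) = h * Λ := by rw [NNReal.coe_mul, Real.coe_toNNReal _ hh]
    have hobs := hφ.comp_add (contDiff_mollify ρ hVl.continuous) (lipschitzWith_mollify ρ hVl)
      (κ := bumpConst ρ * (h * Λ)) (by positivity) (fun x y => by
        rw [mul_assoc, ← hc]
        exact norm_fderiv_mollify_sub_le ρ hVl x y)
    rw [hc] at hobs
    have h1 := ih (hst.trans hj) hobs
    have h2 := abs_integral_euler_step_le hT hsol hv hK hρ hφ hjh hst hj (η := η)
      (fun r hr => hη r ⟨hjh.trans hr.1, hr.2.trans hj⟩ _ ⟨hjh, hst.trans hj⟩ (by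
        rw [abs_of_nonneg (sub_nonneg.2 hr.1)]
        linarith [hr.2]))
    rw [hd] at h2
    set C := ((Λ : ℝ) + a) + 2 * (a + Λ) ^ 2 * (1 + K) with hC
    set κ := 2 * (Λ : ℝ) + Λ ^ 2 + bumpConst ρ * Λ with hκd
    have hC0 : 0 ≤ C := by positivity
    have hκ0 : 0 ≤ κ := by positivity
    have hA := hφ.nonneg
    have hQ := hA.trans hφ.le
    have hr := ρ.rOut_pos.le
    have hQ' : ((1 + h * (Λ : ℝ)) ^ 2 + bumpConst ρ * (h * Λ)) * Q ≤ (1 + h * κ) * Q := by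
      refine mul_le_mul_of_nonneg_right ?_ hQ
      have : h * h * (Λ : ℝ) ^ 2 ≤ h * 1 * Λ ^ 2 := by gcongr
      rw [hκd]
      nlinarith
    have h3 : (1 + h * κ) ^ j * (((1 + h * (Λ : ℝ)) ^ 2 + bumpConst ρ * (h * Λ)) * Q * (C * (η + h)))
        ≤ (1 + h * κ) ^ (j + 1) * (Q * (C * (η + h))) := by
      rw [pow_succ (1 + h * κ) j, mul_assoc ((1 + h * κ) ^ j), ← mul_assoc (1 + h * κ) Q]
      gcongr
    have h4 : (1 + h * (Λ : ℝ)) ^ j * ((1 + h * Λ) * A * (Λ * ρ.rOut))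
        = (1 + h * (Λ : ℝ)) ^ (j + 1) * (A * (Λ * ρ.rOut)) := by ring
    have hq1 : 1 ≤ 1 + h * (Λ : ℝ) := le_add_of_nonneg_right (by positivity)
    have hq2 : 1 ≤ 1 + h * κ := le_add_of_nonneg_right (by positivity)
    have h5 : A * (Λ * ρ.rOut) ≤ (1 + h * (Λ : ℝ)) ^ (j + 1) * (A * (Λ * ρ.rOut)) :=
      le_mul_of_one_le_left (by positivity) (one_le_pow₀ hq1)
    have h6 : Q * (C * (η + h)) ≤ (1 + h * κ) ^ (j + 1) * (Q * (C * (η + h))) :=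
      le_mul_of_one_le_left (by positivity) (one_le_pow₀ hq2)
    have h7 := mul_le_mul_of_nonneg_left h3 hjh
    have h8 := mul_le_mul_of_nonneg_left (add_le_add h5 h6) hh
    rw [h4] at h1
    simp only [eulerMap]
    refine (abs_sub_le _ _ _).trans ((add_le_add h1 h2).trans ?_)
    linarith

end Euler

end VanishingViscosity

namespace VanishingViscosity

variable {d : ℕ}

/-! ### Convergence of the scheme and comparison of two schemes -/

section EulerLimit

variable {T : ℝ} {μ₀ : P2 d} {a : ℝ} {Λ : ℝ≥0} {v : ℝ → E d → E d} {μ : ℝ → P2 d}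

theorem one_add_pow_le_exp {y : ℝ} (hy : 0 ≤ y) (n : ℕ) : (1 + y) ^ n ≤ Real.exp (n * y) := by
  rw [Real.exp_nat_mul]
  exact pow_le_pow_left₀ (by positivity) (by linarith [Real.add_one_le_exp y]) n

/-- Fix the mollifier first. Once the time step is small enough to offset the exponential of
`bumpConst`, only an error proportional to the mollification radius remains. -/
theorem eventually_abs_integral_eulerMap_sub_le (hT : 0 < T) (hsol : IsLinearSolution T μ₀ 0 v μ)
    (hv : IsLipVelocity a Λ v) {K : ℝ} (hK : ∀ t ∈ Icc 0 T, (μ t).M2 ≤ K)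
    {ρ : ContDiffBump (0 : E d)} (hρ : ρ.rOut ≤ 1) {t : ℝ} (ht : t ∈ Icc 0 T) :
    ∀ᶠ N : ℕ in atTop, ∀ (A Q : ℝ) (φ : E d → ℝ), IsObservable A Q φ →
      |∫ x, φ (eulerMap ρ v (t / N) N x) ∂μ₀.toMeasure - ∫ x, φ x ∂(μ t).toMeasure|
        ≤ T * (Real.exp (T * Λ) * (A * Λ) + Q * ((Λ + a) + 2 * (a + Λ) ^ 2 * (1 + K)))
          * ρ.rOut := by
  have hK0 : 0 ≤ K := (μ 0).M2_nonneg.trans (hK 0 ⟨le_rfl, hT.le⟩)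
  have ha := hv.nonneg
  have hδ := ρ.rOut_pos
  have hΛ : (0 : ℝ) ≤ Λ := Λ.coe_nonneg
  set κ := 2 * (Λ : ℝ) + Λ ^ 2 + bumpConst ρ * Λ with hκd
  have hκ0 : 0 ≤ κ := by have := bumpConst_nonneg ρ; positivity
  set X := Real.exp (T * κ) with hX
  have hX0 : 0 < X := Real.exp_pos _
  -- The growth factor of the second derivatives is at most `X`, so requiring `η + t / N ≤ rOut / X`
  -- cancels it.
  set η := ρ.rOut / (2 * X) with hη
  have hη0 : 0 < η := by positivity
  obtain ⟨δ, hδ0, hmod⟩ := hsol.cont.exists_modulus hη0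
  have hlim : Tendsto (fun N : ℕ => t / (N : ℝ)) atTop (𝓝 0) := tendsto_const_div_atTop_nhds_zero_nat t
  filter_upwards [hlim.eventually (eventually_lt_nhds hδ0), hlim.eventually (eventually_le_nhds hη0),
    hlim.eventually (eventually_le_nhds one_pos), eventually_gt_atTop 0] with N h1 h2 h3 h4 A Q φ hφ
  have hN : (0 : ℝ) < N := Nat.cast_pos.2 h4
  have e : (N : ℝ) * (t / N) = t := by field_simp
  have hh : 0 ≤ t / N := div_nonneg ht.1 hN.le
  have key := abs_integral_eulerMap_sub_le hT hsol hv hK hρ hh h3 (η := η)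
    (fun r hr s hs hrs => hmod r hr s hs (hrs.trans_lt h1)) N (by rw [e]; exact ht.2) hφ
  rw [e] at key
  refine key.trans ?_
  have hA := hφ.nonneg
  have hQ := hA.trans hφ.le
  have hC0 : 0 ≤ ((Λ : ℝ) + a) + 2 * (a + Λ) ^ 2 * (1 + K) := by positivity
  set C := ((Λ : ℝ) + a) + 2 * (a + Λ) ^ 2 * (1 + K) with hC
  have p1 : (1 + t / N * (Λ : ℝ)) ^ N ≤ Real.exp (T * Λ) := by
    refine (one_add_pow_le_exp (by positivity) N).trans (Real.exp_le_exp.2 ?_)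
    rw [← mul_assoc, e]
    exact mul_le_mul_of_nonneg_right ht.2 hΛ
  have p2 : (1 + t / N * κ) ^ N ≤ X := by
    refine (one_add_pow_le_exp (by positivity) N).trans (Real.exp_le_exp.2 ?_)
    rw [← mul_assoc, e]
    exact mul_le_mul_of_nonneg_right ht.2 hκ0
  have p3 : η + t / N ≤ ρ.rOut / X := by
    have : ρ.rOut / X = η + η := by rw [hη]; field_simp; ring
    linarith
  calc _ ≤ T * (Real.exp (T * Λ) * (A * (Λ * ρ.rOut)) + X * (Q * (C * (ρ.rOut / X)))) := by
        have := ht.1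
        gcongr
        exact ht.2
    _ = _ := by field_simp

/-- Comparison of the Euler schemes for two velocity fields. -/
theorem norm_eulerMap_sub_le {v' : ℝ → E d → E d} (ρ : ContDiffBump (0 : E d))
    (hv : IsLipVelocity a Λ v) (hv' : IsLipVelocity a Λ v') {D : ℝ → ℝ} (hT : 0 ≤ T)
    (hD : IntervalIntegrable D volume 0 T)
    (hvD : ∀ᵐ r ∂volume.restrict (Icc 0 T), ∀ x, ‖v r x - v' r x‖ ≤ D r) {h : ℝ} (hh : 0 ≤ h) (j : ℕ)
    (hj : j * h ≤ T) (x : E d) :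
    ‖eulerMap ρ v h j x - eulerMap ρ v' h j x‖ ≤ (1 + h * Λ) ^ j * ∫ r in (0 : ℝ)..(j * h), D r := by
  have hI : ∀ p q, p ∈ Icc 0 T → q ∈ Icc 0 T → IntervalIntegrable D volume p q := fun p q hp hq =>
    hD.mono_set (by rw [uIcc_of_le hT]; exact uIcc_subset_Icc hp hq)
  have hvD' := (ae_restrict_iff' measurableSet_Icc).1 hvD
  induction j with
  | zero => simp [eulerMap]
  | succ j ih =>
    push_cast at hj ⊢
    have hst : (j : ℝ) * h ≤ (j + 1) * h := by nlinarith
    have hd : ((j : ℝ) + 1) * h - j * h = h := by ring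
    have hjh : (0 : ℝ) ≤ j * h := by positivity
    have h0I : (0 : ℝ) ∈ Icc 0 T := ⟨le_rfl, hT⟩
    have hjI : (j : ℝ) * h ∈ Icc 0 T := ⟨hjh, hst.trans hj⟩
    have hjI' : ((j : ℝ) + 1) * h ∈ Icc 0 T := ⟨hjh.trans hst, hj⟩
    have ih := ih hjI.2
    set s := (j : ℝ) * h
    set t := ((j : ℝ) + 1) * h
    have hVl := hv.lipschitzWith_impulse hst
    have hVl' := hv'.lipschitzWith_impulse hst
    have hΛ : (0 : ℝ) ≤ Λ := Λ.coe_nonneg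
    have hVV : ∀ y, ‖impulse v s t y - impulse v' s t y‖ ≤ ∫ r in s..t, D r := fun y => by
      rw [impulse, impulse, ← intervalIntegral.integral_sub (hv.intervalIntegrable s t y)
        (hv'.intervalIntegrable s t y)]
      refine intervalIntegral.norm_integral_le_of_norm_le hst ?_ (hI s t hjI hjI')
      filter_upwards [hvD'] with r hr hrI
      exact hr ⟨hjI.1.trans hrI.1.le, hrI.2.trans hj⟩ y
    set y := eulerMap ρ v h j x
    set y' := eulerMap ρ v' h j x
    have h1 : ‖mollify ρ (impulse v s t) y - mollify ρ (impulse v s t) y'‖ ≤ h * Λ * ‖y - y'‖ := by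
      have := (lipschitzWith_mollify ρ hVl).norm_sub_le y y'
      rwa [NNReal.coe_mul, Real.coe_toNNReal _ (sub_nonneg.2 hst), hd] at this
    have h2 : ‖mollify ρ (impulse v s t) y' - mollify ρ (impulse v' s t) y'‖ ≤ ∫ r in s..t, D r := by
      rw [mollify_sub ρ hVl.continuous hVl'.continuous]
      exact norm_mollify_le ρ (hVl.continuous.sub hVl'.continuous) hVV y'
    have h3 : eulerMap ρ v h (j + 1) x - eulerMap ρ v' h (j + 1) x
        = (y - y') + (mollify ρ (impulse v s t) y - mollify ρ (impulse v s t) y')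
          + (mollify ρ (impulse v s t) y' - mollify ρ (impulse v' s t) y') := by
      simp only [eulerMap]
      abel
    rw [h3, ← intervalIntegral.integral_add_adjacent_intervals (hI 0 s h0I hjI) (hI s t hjI hjI')]
    have h4 : 0 ≤ ∫ r in s..t, D r := (norm_nonneg _).trans (hVV 0)
    have hq : 1 ≤ 1 + h * (Λ : ℝ) := le_add_of_nonneg_right (by positivity)
    have h5 : ∫ r in s..t, D r ≤ (1 + h * (Λ : ℝ)) ^ (j + 1) * ∫ r in s..t, D r :=
      le_mul_of_one_le_left h4 (one_le_pow₀ hq)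
    have h6 := mul_le_mul_of_nonneg_left ih (by positivity : 0 ≤ 1 + h * (Λ : ℝ))
    refine (norm_add₃_le).trans ?_
    rw [mul_add, pow_succ'] at *
    linarith

/-- If `μ` and `ν` are limits of images of a compactly supported measure under maps at uniform
distance at most `ϱ`, then `W2 μ ν ≤ ϱ`. -/
theorem W2_le_of_tendsto_map (hμ₀ : ∃ K : Set (E d), IsCompact K ∧ μ₀.toMeasure Kᶜ = 0)
    {Y Z : ℕ → E d → E d} (hY : ∀ n, Continuous (Y n)) (hZ : ∀ n, Continuous (Z n)) {c : ℝ}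
    (hYc : ∀ n x, ‖Y n x‖ ≤ c * (1 + ‖x‖)) (hZc : ∀ n x, ‖Z n x‖ ≤ c * (1 + ‖x‖)) {ϱ : ℝ}
    (hϱ : ∀ n x, ‖Y n x - Z n x‖ ≤ ϱ) {m m' : P2 d}
    (hm : ∀ ξ c, Tendsto (fun n => ∫ x, Real.cos (⟪Y n x, ξ⟫_ℝ + c) ∂μ₀.toMeasure) atTop
      (𝓝 (∫ x, Real.cos (⟪x, ξ⟫_ℝ + c) ∂m.toMeasure)))
    (hm' : ∀ ξ c, Tendsto (fun n => ∫ x, Real.cos (⟪Z n x, ξ⟫_ℝ + c) ∂μ₀.toMeasure) atTop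
      (𝓝 (∫ x, Real.cos (⟪x, ξ⟫_ℝ + c) ∂m'.toMeasure))) : W2 m m' ≤ ϱ := by
  have hϱ0 : 0 ≤ ϱ := (norm_nonneg _).trans (hϱ 0 0)
  have hc0 : 0 ≤ c := by simpa using (norm_nonneg _).trans (hYc 0 0)
  obtain ⟨S, hS, hS0⟩ := hμ₀
  obtain ⟨R, hR⟩ := hS.isBounded.subset_closedBall (0 : E d)
  set F : ℕ → E d → E d × E d := fun n x => (Y n x, Z n x) with hF
  have hFc : ∀ n, Continuous (F n) := fun n => (hY n).prodMk (hZ n)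
  haveI hp : ∀ n, IsProbabilityMeasure (μ₀.toMeasure.map (F n)) := fun n =>
    Measure.isProbabilityMeasure_map (hFc n).measurable.aemeasurable
  -- The joint images of `μ₀` under `(Y n, Z n)` sit in a fixed ball, so they have a narrow limit
  -- point. Its marginals are identified by characteristic functions, and the closed constraint
  -- `‖z.1 - z.2‖ ≤ ϱ` survives the limit.
  set γ : ℕ → ProbabilityMeasure (E d × E d) := fun n => ⟨μ₀.toMeasure.map (F n), hp n⟩ with hγ
  have hcpt : IsCompact (closure (range γ)) := by
    refine isCompact_closure_of_isTightMeasureSet ?_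
    rw [isTightMeasureSet_iff_exists_isCompact_measure_compl_le]
    intro ε _
    refine ⟨Metric.closedBall 0 (c * (1 + R)), isCompact_closedBall _ _, ?_⟩
    rintro _ ⟨_, ⟨n, rfl⟩, rfl⟩
    have h0 : (μ₀.toMeasure.map (F n)) (Metric.closedBall 0 (c * (1 + R)))ᶜ = 0 := by
      rw [Measure.map_apply (hFc n).measurable Metric.isClosed_closedBall.measurableSet.compl]
      refine measure_mono_null (fun x hx => ?_) hS0
      refine fun hxS => hx ?_
      have hxR : ‖x‖ ≤ R := by simpa using hR hxS
      rw [mem_closedBall_zero_iff, Prod.norm_mk]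
      exact max_le ((hYc n x).trans (by gcongr)) ((hZc n x).trans (by gcongr))
    simpa [hγ] using h0.le.trans (zero_le)
  obtain ⟨g, -, χ, hχ, hg⟩ := hcpt.tendsto_subseq (x := γ) fun n => subset_closure (mem_range_self n)
  have hmarg : ∀ (π : E d × E d → E d) (hπ : Continuous π) (q : P2 d),
      (∀ ξ c, Tendsto (fun n => ∫ x, Real.cos (⟪π (F n x), ξ⟫_ℝ + c) ∂μ₀.toMeasure) atTop
        (𝓝 (∫ x, Real.cos (⟪x, ξ⟫_ℝ + c) ∂q.toMeasure))) →
      (g : Measure (E d × E d)).map π = q.toMeasure := fun π hπ q hq => by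
    haveI : IsProbabilityMeasure ((g : Measure (E d × E d)).map π) :=
      Measure.isProbabilityMeasure_map hπ.measurable.aemeasurable
    refine Measure.ext_of_charFun (funext fun ξ => ?_)
    have hcos : ∀ c : ℝ, ∫ z, Real.cos (⟪π z, ξ⟫_ℝ + c) ∂(g : Measure (E d × E d))
        = ∫ x, Real.cos (⟪x, ξ⟫_ℝ + c) ∂q.toMeasure := fun c => by
      have hcc : Continuous fun z => Real.cos (⟪π z, ξ⟫_ℝ + c) := by fun_prop
      have h1 := ProbabilityMeasure.tendsto_iff_forall_integral_tendsto.1 hg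
        (BoundedContinuousFunction.ofNormedAddCommGroup _ hcc 1 fun z => Real.abs_cos_le_one _)
      refine tendsto_nhds_unique h1 (((hq ξ c).comp hχ.tendsto_atTop).congr fun n => ?_)
      exact (integral_map (μ := μ₀.toMeasure) (hFc (χ n)).measurable.aemeasurable
        hcc.aestronglyMeasurable).symm
    have h_int : ∀ c : ℝ, Continuous fun x : E d => Real.cos (⟪x, ξ⟫_ℝ + c) := fun c => by fun_prop
    rw [charFun_eq_integral_cos q.toMeasure, ← hcos, ← hcos, ← integral_map hπ.measurable.aemeasurable
      (f := fun x => Real.cos (⟪x, ξ⟫_ℝ + 0)) (h_int _).aestronglyMeasurable,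
      ← integral_map hπ.measurable.aemeasurable
      (f := fun x => Real.cos (⟪x, ξ⟫_ℝ + -(Real.pi / 2))) (h_int _).aestronglyMeasurable]
    exact charFun_eq_integral_cos _ ξ
  have hplan : (g : Measure (E d × E d)) ∈ Plans m m' :=
    ⟨hmarg Prod.fst continuous_fst m hm, hmarg Prod.snd continuous_snd m' hm'⟩
  have hclosed : IsClosed {z : E d × E d | ‖z.1 - z.2‖ ≤ ϱ} :=
    isClosed_le (by fun_prop) continuous_const
  have hsupp : ∀ᵐ z ∂(g : Measure (E d × E d)), ‖z.1 - z.2‖ ≤ ϱ := by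
    have h1 := ProbabilityMeasure.le_liminf_measure_open_of_tendsto hg hclosed.isOpen_compl
    have h2 : ∀ n, (γ n : Measure (E d × E d)) {z : E d × E d | ‖z.1 - z.2‖ ≤ ϱ}ᶜ = 0 := fun n => by
      simp only [hγ, ProbabilityMeasure.coe_mk]
      rw [Measure.map_apply (hFc n).measurable hclosed.measurableSet.compl]
      refine measure_mono_null (fun x hx => hx ?_) (measure_empty (μ := μ₀.toMeasure))
      exact hϱ n x
    simp only [Function.comp_apply, h2, liminf_const] at h1
    exact nonpos_iff_eq_zero.1 h1
  have hsq : W2 m m' ^ 2 ≤ ϱ ^ 2 := by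
    refine (W2_sq_le_of_mem_plans hplan).trans ?_
    haveI := isProbabilityMeasure_of_mem_plans hplan
    calc ∫ z, ‖z.1 - z.2‖ ^ 2 ∂(g : Measure (E d × E d)) ≤ ∫ _z, ϱ ^ 2 ∂(g : Measure (E d × E d)) := by
          refine integral_mono_ae (integrable_sub_sq_of_mem_plans hplan) (integrable_const _) ?_
          filter_upwards [hsupp] with z hz
          exact pow_le_pow_left₀ (norm_nonneg _) hz 2
      _ = ϱ ^ 2 := by simp
  exact le_of_sq_le_sq hsq hϱ0

end EulerLimit

end VanishingViscosity

namespace VanishingViscosity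

variable {d : ℕ}

/-! ### Stability and uniqueness for the inviscid equation -/

section Uniqueness

variable {T : ℝ} {μ₀ : P2 d} {b : ℝ → E d → P2 d → E d}

theorem eq_of_W2_le_zero {μ ν : P2 d} (h : W2 μ ν ≤ 0) : μ = ν := by
  have h0 : W2 μ ν = 0 := le_antisymm h (W2_nonneg _ _)
  refine P2.ext_measure (Measure.ext_of_charFun (funext fun ξ => ?_))
  have hcos : ∀ c : ℝ, ∫ x, Real.cos (⟪x, ξ⟫_ℝ + c) ∂μ.toMeasure
      = ∫ x, Real.cos (⟪x, ξ⟫_ℝ + c) ∂ν.toMeasure := fun c => by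
    have hl : LocLip ‖ξ‖ (fun x : E d => Real.cos (⟪x, ξ⟫_ℝ + c)) := fun x y => by
      have hd : Differentiable ℝ (fun x : E d => Real.cos (⟪x, ξ⟫_ℝ + c)) :=
        (contDiff_cos_inner ξ c).differentiable (by simp)
      refine (Convex.norm_image_sub_le_of_norm_fderiv_le (𝕜 := ℝ) (s := univ) (fun z _ => hd z)
        (fun z _ => norm_fderiv_cos_inner_le ξ c z) convex_univ (mem_univ y) (mem_univ x)).trans ?_
      have : 1 ≤ 1 + ‖x‖ + ‖y‖ := by linarith [norm_nonneg x, norm_nonneg y]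
      exact mul_le_mul_of_nonneg_right (le_mul_of_one_le_right (norm_nonneg _) this) (norm_nonneg _)
    have := hl.abs_integral_sub_le (norm_nonneg ξ) μ ν
    rw [h0, mul_zero] at this
    exact sub_eq_zero.1 (abs_nonpos_iff.1 this)
  rw [charFun_eq_integral_cos, charFun_eq_integral_cos, hcos, hcos]

theorem W2_sq_le (μ ν : P2 d) : W2 μ ν ^ 2 ≤ 2 * (μ.M2 + ν.M2) := by
  have hp := prod_mem_plans μ ν
  refine (W2_sq_le_of_mem_plans hp).trans ?_
  have h1 := integrable_fst_of_mem_plans hp μ.integrable_sq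
  have h2 := integrable_snd_of_mem_plans hp ν.integrable_sq
  calc _ ≤ ∫ z : E d × E d, 2 * (‖z.1‖ ^ 2 + ‖z.2‖ ^ 2) ∂(μ.toMeasure.prod ν.toMeasure) := by
        refine integral_mono (integrable_sub_sq_of_mem_plans hp) ((h1.add h2).const_mul 2) fun z => ?_
        have h3 := norm_sub_le z.1 z.2
        have h4 := norm_nonneg (z.1 - z.2)
        have : ‖z.1 - z.2‖ ^ 2 ≤ (‖z.1‖ + ‖z.2‖) ^ 2 := pow_le_pow_left₀ h4 h3 2
        beta_reduce
        nlinarith [sq_nonneg (‖z.1‖ - ‖z.2‖)]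
    _ = _ := by
        rw [integral_const_mul, integral_add h1 h2, integral_fst_of_mem_plans hp μ.integrable_sq,
          integral_snd_of_mem_plans hp ν.integrable_sq, P2.M2, P2.M2]

/-- Stability of the continuity equation with respect to the velocity field. -/
theorem W2_le_integral (hT : 0 < T)
    (hμ₀ : ∃ K : Set (E d), IsCompact K ∧ μ₀.toMeasure Kᶜ = 0) {a : ℝ} {Λ : ℝ≥0}
    {v v' : ℝ → E d → E d} {μ ν : ℝ → P2 d} (hμ : IsLinearSolution T μ₀ 0 v μ)
    (hν : IsLinearSolution T μ₀ 0 v' ν) (hv : IsLipVelocity a Λ v) (hv' : IsLipVelocity a Λ v')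
    {D : ℝ → ℝ} (hD : IntervalIntegrable D volume 0 T)
    (hvD : ∀ᵐ r ∂volume.restrict (Icc 0 T), ∀ x, ‖v r x - v' r x‖ ≤ D r) {t : ℝ}
    (ht : t ∈ Icc 0 T) :
    W2 (μ t) (ν t) ≤ Real.exp (T * Λ) * ∫ r in (0 : ℝ)..t, D r := by
  obtain ⟨K, -, hK⟩ := hμ.cont.exists_M2_le
  obtain ⟨K', -, hK'⟩ := hν.cont.exists_M2_le
  have ha := hv.nonneg
  have hΛ : (0 : ℝ) ≤ Λ := Λ.coe_nonneg
  have hpos : ∀ n : ℕ, (0 : ℝ) < 1 / ((n : ℝ) + 1) := fun n => Nat.one_div_pos_of_nat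
  set ρ : ℕ → ContDiffBump (0 : E d) := fun n =>
    ⟨1 / ((n : ℝ) + 1) / 2, 1 / ((n : ℝ) + 1), half_pos (hpos n), half_lt_self (hpos n)⟩ with hρd
  have hρr : ∀ n, (ρ n).rOut = 1 / ((n : ℝ) + 1) := fun n => rfl
  have hρ : ∀ n, (ρ n).rOut ≤ 1 := fun n => by
    rw [hρr, div_le_one (by positivity)]
    linarith [Nat.cast_nonneg (α := ℝ) n]
  -- For each mollification radius `1 / (n + 1)` the same number of time steps is chosen for both
  -- velocities, so that the two schemes can be compared point by point.
  have hex : ∀ n, ∃ N : ℕ, 0 < N ∧ _ ∧ _ := fun n =>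
    ((eventually_gt_atTop 0).and
      ((eventually_abs_integral_eulerMap_sub_le hT hμ hv hK (hρ n) ht).and
      (eventually_abs_integral_eulerMap_sub_le hT hν hv' hK' (hρ n) ht))).exists
  choose N hN0 hN hN' using hex
  have e : ∀ n, (N n : ℝ) * (t / N n) = t := fun n => by
    have : (0 : ℝ) < N n := Nat.cast_pos.2 (hN0 n)
    field_simp
  have hh : ∀ n, 0 ≤ t / (N n : ℝ) := fun n => div_nonneg ht.1 (Nat.cast_nonneg _)
  have hpow : ∀ (n : ℕ) {y : ℝ}, 0 ≤ y → (1 + t / N n * y) ^ N n ≤ Real.exp (T * y) :=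
    fun n y hy => by
      refine (one_add_pow_le_exp (mul_nonneg (hh n) hy) _).trans (Real.exp_le_exp.2 ?_)
      rw [← mul_assoc, e]
      exact mul_le_mul_of_nonneg_right ht.2 hy
  have hgrow : ∀ {w : ℝ → E d → E d}, IsLipVelocity a Λ w → ∀ n x,
      ‖eulerMap (ρ n) w (t / N n) (N n) x‖ ≤ Real.exp (T * (a + Λ)) * (1 + ‖x‖) := fun hw n x => by
    have h1 := norm_eulerMap_le (hρ n) hw (hh n) (N n) x
    have h2 := mul_le_mul_of_nonneg_right (hpow n (add_nonneg ha hΛ))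
      (by positivity : 0 ≤ 1 + ‖x‖)
    linarith
  have hlim : ∀ c : ℝ, Tendsto (fun n => c * (ρ n).rOut) atTop (𝓝 0) := fun c => by
    simp only [hρr]
    simpa using (tendsto_one_div_add_atTop_nhds_zero_nat (𝕜 := ℝ)).const_mul c
  refine W2_le_of_tendsto_map hμ₀ (fun n => continuous_eulerMap (ρ n) hv (hh n) (N n))
    (fun n => continuous_eulerMap (ρ n) hv' (hh n) (N n)) (hgrow hv) (hgrow hv') (fun n x => ?_)
    (fun ξ c => ?_) (fun ξ c => ?_)
  · have h1 := norm_eulerMap_sub_le (ρ n) hv hv' hT.le hD hvD (hh n) (N n)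
      (by rw [e]; exact ht.2) x
    rw [e] at h1
    refine h1.trans (mul_le_mul_of_nonneg_right (hpow n hΛ) ?_)
    -- A single step of length `t` shows that the integral of `D` is nonnegative.
    have h2 := norm_eulerMap_sub_le (ρ n) hv hv' hT.le hD hvD ht.1 1 (by simpa using ht.2) x
    have h3 := (norm_nonneg _).trans h2
    rw [Nat.cast_one, one_mul, pow_one] at h3
    exact nonneg_of_mul_nonneg_right h3 (by have := ht.1; positivity)
  · exact tendsto_iff_norm_sub_tendsto_zero.2 (squeeze_zero (fun _ => norm_nonneg _)
      (fun n => hN n _ _ _ (isObservable_cos ξ c)) (hlim _))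
  · exact tendsto_iff_norm_sub_tendsto_zero.2 (squeeze_zero (fun _ => norm_nonneg _)
      (fun n => hN' n _ _ _ (isObservable_cos ξ c)) (hlim _))

/-- Taking the Lipschitz bound of the control as the property of good times makes the frozen
velocity Lipschitz at every time, as the Euler scheme requires. -/
theorem exists_lip_velocity (hT : 0 < T) (hb : AssumptionB T b) {U : Set (E d)}
    (hU : IsCompact U) {u : ℝ → E d → E d} (hu : IsLipControl T U u) {μ : ℝ → P2 d}
    (h : IsWeakSolution T b μ₀ 0 u μ) {L : ℝ} (hL : ∀ t ∈ Icc 0 T, ∀ x y μ ν,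
      ‖b t x μ - b t y ν‖ ≤ L * (‖x - y‖ + W2 μ ν)) {C : ℝ≥0}
    (hC : ∀ᵐ t ∂volume.restrict (Icc 0 T), LipschitzWith C (u t)) :
    ∃ a v, IsLinearSolution T μ₀ 0 v μ ∧ IsLipVelocity a (L.toNNReal + C) v ∧
      ∀ᵐ t ∂volume.restrict (Icc 0 T), ∀ x, v t x = b t x (μ t) + u t x := by
  obtain ⟨R, hR⟩ := hU.isBounded.exists_norm_le
  obtain ⟨v, hv, hvae, hgood⟩ := exists_velocity hT hb hR hu.1 h hC
  obtain ⟨a, ha⟩ := hv.growth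
  refine ⟨a, v, hv, ⟨hv.meas, ha, fun t => ?_⟩, hvae⟩
  rcases hgood t with ⟨ht, hut, hvt⟩ | h0
  · refine LipschitzWith.of_dist_le_mul fun x y => ?_
    rw [dist_eq_norm, dist_eq_norm, hvt, hvt, add_sub_add_comm, NNReal.coe_add, add_mul]
    refine (norm_add_le _ _).trans (add_le_add ?_ (hut.norm_sub_le x y))
    refine (hL t ht x y (μ t) (μ t)).trans ?_
    rw [W2_self, add_zero]
    exact mul_le_mul_of_nonneg_right (Real.le_coe_toNNReal L) (norm_nonneg _)
  · refine LipschitzWith.of_dist_le_mul fun x y => ?_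
    rw [h0, h0, dist_self]
    positivity

theorem IsLipVelocity.mono {a a' : ℝ} {Λ : ℝ≥0} {v : ℝ → E d → E d} (hv : IsLipVelocity a Λ v)
    (h : a ≤ a') : IsLipVelocity a' Λ v :=
  ⟨hv.meas, fun t x => (hv.growth t x).trans (mul_le_mul_of_nonneg_right h (by positivity)), hv.lip⟩

/-- Uniqueness of solutions of the nonlocal continuity equation with a Lipschitz control. -/
theorem IsWeakSolution.unique (hT : 0 < T) (hb : AssumptionB T b) {U : Set (E d)}
    (hU : IsCompact U) {u : ℝ → E d → E d} (hu : IsLipControl T U u)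
    (hμ₀ : ∃ K : Set (E d), IsCompact K ∧ μ₀.toMeasure Kᶜ = 0) {μ ν : ℝ → P2 d}
    (hμ : IsWeakSolution T b μ₀ 0 u μ) (hν : IsWeakSolution T b μ₀ 0 u ν) {t : ℝ}
    (ht : t ∈ Icc 0 T) : μ t = ν t := by
  obtain ⟨L, hL⟩ := hb.lipschitz
  obtain ⟨C, hC⟩ := hu.2
  obtain ⟨a, v, hvs, hv, hvae⟩ := exists_lip_velocity hT hb hU hu hμ hL hC
  obtain ⟨a', v', hvs', hv', hvae'⟩ := exists_lip_velocity hT hb hU hu hν hL hC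
  replace hv := hv.mono (le_max_left a a')
  replace hv' := hv'.mono (le_max_right a a')
  set x : ℕ → E d := TopologicalSpace.denseSeq (E d) with hx
  -- The supremum distance of the two velocities, over a dense sequence so that it is measurable. It
  -- is at most `|L| * W2 (μ r) (ν r)`, because the control cancels; measurability of this `W2` is
  -- never needed.
  set D : ℝ → ℝ≥0∞ := fun r => ⨆ n, ‖v r (x n) - v' r (x n)‖ₑ with hDdef
  have hDm : Measurable D := by
    refine Measurable.iSup fun n => ?_
    have h1 : Measurable fun r => v r (x n) := hv.meas.comp (measurable_id.prodMk measurable_const)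
    have h2 : Measurable fun r => v' r (x n) := hv'.meas.comp (measurable_id.prodMk measurable_const)
    exact (h1.sub h2).enorm
  have hDW : ∀ᵐ r ∂volume.restrict (Icc 0 T), D r ≤ ENNReal.ofReal (|L| * W2 (μ r) (ν r)) := by
    filter_upwards [hvae, hvae', ae_restrict_mem measurableSet_Icc] with r hr hr' hrI
    refine iSup_le fun n => ?_
    rw [hr, hr', add_sub_add_right_eq_sub, ← ofReal_norm]
    refine ENNReal.ofReal_le_ofReal ((hL r hrI _ _ _ _).trans ?_)
    rw [sub_self, norm_zero, zero_add]
    exact mul_le_mul_of_nonneg_right (le_abs_self L) (W2_nonneg _ _)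
  have hDR : ∀ᵐ r ∂volume.restrict (Icc 0 T), (D r).toReal ≤ |L| * W2 (μ r) (ν r) := by
    filter_upwards [hDW] with r hr
    exact ENNReal.toReal_le_of_le_ofReal (mul_nonneg (abs_nonneg _) (W2_nonneg _ _)) hr
  obtain ⟨K, hK0, hK⟩ := hμ.1.exists_M2_le
  obtain ⟨K', hK0', hK'⟩ := hν.1.exists_M2_le
  have hDi : IntervalIntegrable (fun r => (D r).toReal) volume 0 T := by
    rw [intervalIntegrable_iff_integrableOn_Icc_of_le hT.le]
    refine Integrable.of_bound hDm.ennreal_toReal.aestronglyMeasurable (|L| * √(2 * (K + K'))) ?_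
    filter_upwards [hDR, ae_restrict_mem measurableSet_Icc] with r hr hrI
    rw [Real.norm_of_nonneg ENNReal.toReal_nonneg]
    refine hr.trans (mul_le_mul_of_nonneg_left (Real.le_sqrt_of_sq_le ?_) (abs_nonneg _))
    refine (W2_sq_le _ _).trans ?_
    have := hK r hrI
    have := hK' r hrI
    linarith
  have hvD : ∀ᵐ r ∂volume.restrict (Icc 0 T), ∀ y, ‖v r y - v' r y‖ ≤ (D r).toReal := by
    filter_upwards [hDW] with r hr y
    have hfin : D r ≠ ⊤ := (hr.trans_lt ENNReal.ofReal_lt_top).ne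
    have hcl : IsClosed {y | ‖v r y - v' r y‖ ≤ (D r).toReal} :=
      isClosed_le ((hv.lip r).continuous.sub (hv'.lip r).continuous).norm continuous_const
    have hsub : range x ⊆ {y | ‖v r y - v' r y‖ ≤ (D r).toReal} := by
      rintro _ ⟨n, rfl⟩
      have h1 : ‖v r (x n) - v' r (x n)‖ₑ ≤ D r := le_iSup (fun n => ‖v r (x n) - v' r (x n)‖ₑ) n
      have h2 := ENNReal.toReal_mono hfin h1
      rwa [toReal_enorm] at h2
    exact hcl.closure_subset_iff.2 hsub ((TopologicalSpace.denseRange_denseSeq (E d)) y)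
  set Λ := L.toNNReal + C
  have hW : ∀ s ∈ Icc 0 T, W2 (μ s) (ν s)
      ≤ Real.exp (T * Λ) * ∫ r in (0 : ℝ)..s, (D r).toReal := fun s hs =>
    W2_le_integral hT hμ₀ hvs hvs' hv hv' hDi hvD hs
  set F : ℝ → ℝ := fun s => ∫ r in (0 : ℝ)..s, (D r).toReal with hF
  have hFc : ContinuousOn F (Icc 0 T) := by
    have := intervalIntegral.continuousOn_primitive_interval
      ((intervalIntegrable_iff_integrableOn_Icc_of_le hT.le).1 hDi |>.mono_set
        (by rw [uIcc_of_le hT.le]))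
    rwa [uIcc_of_le hT.le] at this
  have hFi : IntervalIntegrable F volume 0 T := by
    refine ContinuousOn.intervalIntegrable ?_
    rwa [uIcc_of_le hT.le]
  obtain ⟨B, hB⟩ := (isCompact_Icc.image_of_continuousOn hFc).bddAbove
  -- Grönwall is applied to the primitive of `D` with zero initial value: stability bounds `W2` by
  -- the primitive, and `D` is bounded by `W2`.
  have hgr := gronwall_integral (y := F) (T := T) (a := 0) (C := |L| * Real.exp (T * Λ)) (K := B)
    le_rfl (by positivity) hFi (fun s hs => hB (mem_image_of_mem F hs)) (fun s hs => by
      have hsub : uIcc 0 s ⊆ uIcc 0 T := by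
        rw [uIcc_of_le hT.le, uIcc_of_le hs.1]
        exact Icc_subset_Icc_right hs.2
      rw [zero_add, ← intervalIntegral.integral_const_mul]
      refine intervalIntegral.integral_mono_ae_restrict hs.1 (hDi.mono_set hsub)
        ((hFi.mono_set hsub).const_mul _) ?_
      filter_upwards [ae_restrict_of_ae_restrict_of_subset (Icc_subset_Icc_right hs.2) hDR,
        ae_restrict_mem measurableSet_Icc] with r hr hrI
      rw [mul_assoc]
      exact hr.trans (mul_le_mul_of_nonneg_left (hW r ⟨hrI.1, hrI.2.trans hs.2⟩) (abs_nonneg _)))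
  refine eq_of_W2_le_zero ((hW t ht).trans ?_)
  have := hgr t ht
  rw [zero_mul] at this
  exact mul_nonpos_of_nonneg_of_nonpos (Real.exp_pos _).le this

end Uniqueness

end VanishingViscosity

namespace VanishingViscosity

variable {d : ℕ}

/-! ### The cost functional for a fixed control -/

section ControlCost

variable {T : ℝ} {U : Set (E d)} {F : Type*} [NormedAddCommGroup F]

/-- The control cost and its gradient are controlled only on `U`. Extension by zero makes them Borel
and bounded, and changes nothing along controls with values in `U`. -/
theorem measurable_indicator_of_continuousOn [MeasurableSpace F] [BorelSpace F] (hU : IsCompact U)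
    {h : E d → F} (hh : ContinuousOn h U) : Measurable (U.indicator h) := by
  classical
  rw [← piecewise_eq_indicator]
  exact hh.measurable_piecewise continuousOn_const hU.measurableSet

theorem exists_norm_indicator_le (hU : IsCompact U) {h : E d → F} (hh : ContinuousOn h U) :
    ∃ B, ∀ α, ‖U.indicator h α‖ ≤ B := by
  obtain ⟨B, hB⟩ := (hU.image_of_continuousOn hh).isBounded.exists_norm_le
  refine ⟨max B 0, fun α => ?_⟩
  by_cases hα : α ∈ U
  · rw [indicator_of_mem hα]
    exact (hB _ (mem_image_of_mem h hα)).trans (le_max_left _ _)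
  · rw [indicator_of_notMem hα, norm_zero]
    exact le_max_right _ _

theorem continuous_indicator_comp {h : E d → F} (hh : ContinuousOn h U) {w : E d → E d}
    (hw : Continuous w) (hwU : ∀ x, w x ∈ U) : Continuous fun x => U.indicator h (w x) := by
  have : (fun x => U.indicator h (w x)) = fun x => h (w x) :=
    funext fun x => indicator_of_mem (hwU x) h
  rw [this]
  exact hh.comp_continuous hw hwU

variable {f : ℝ → E d → P2 d → ℝ} {g : E d → P2 d → ℝ} {ψ : E d → ℝ}

theorem AssumptionFG.exists_isCost (h : AssumptionFG T f g) : ∃ M, IsCost T M f ∧ CostLip M g := by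
  obtain ⟨M, hf, hg⟩ := h.locLipschitz
  have hle : ∀ (x x' : E d) (μ μ' : P2 d),
      M * (1 + ‖x‖ + ‖x'‖ + μ.M2 + μ'.M2) * (‖x - x'‖ + W2 μ μ')
        ≤ |M| * (1 + ‖x‖ + ‖x'‖ + μ.M2 + μ'.M2) * (‖x - x'‖ + W2 μ μ') := fun x x' μ μ' => by
    have := μ.M2_nonneg
    have := μ'.M2_nonneg
    have := W2_nonneg μ μ'
    gcongr
    exact le_abs_self M
  exact ⟨|M|, ⟨abs_nonneg M, h.measurable, h.integrable, fun t ht x x' μ μ' =>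
    (hf t ht x x' μ μ').trans (hle _ _ _ _)⟩, fun x x' μ μ' => (hg x x' μ μ').trans (hle _ _ _ _)⟩

theorem J_eq (hT : 0 < T) (hU : IsCompact U) (hfg : AssumptionFG T f g) (hψ : ContinuousOn ψ U)
    {w : ℝ → E d → E d} (hw : IsControl T U w) {μ : ℝ → P2 d} (hμ : IsW2Continuous T μ) :
    J T f g ψ μ w = (∫ t in (0 : ℝ)..T, ∫ x, f t x (μ t) ∂(μ t).toMeasure)
      + (∫ t in (0 : ℝ)..T, ∫ x, U.indicator ψ (w t x) ∂(μ t).toMeasure)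
      + ∫ x, g x (μ T) ∂(μ T).toMeasure := by
  obtain ⟨M, hf, -⟩ := hfg.exists_isCost
  obtain ⟨B, hB⟩ := exists_norm_indicator_le hU hψ
  have hm : Measurable (Function.uncurry fun t x => U.indicator ψ (w t x)) :=
    (measurable_indicator_of_continuousOn hU hψ).comp hw.1
  have i1 := hf.intervalIntegrable hT hμ
  have i2 := intervalIntegrable_integral_bounded hT hm (fun t _ x => hB (w t x)) hμ
  rw [J, ← intervalIntegral.integral_add i1 i2]
  congr 1
  refine intervalIntegral.integral_congr fun t ht => ?_
  rw [uIcc_of_le hT.le] at ht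
  have j1 : Integrable (fun x => f t x (μ t)) (μ t).toMeasure :=
    CostLip.integrable (h := f t) hf.nonneg (hf.locLip t ht) _ _
  have hmt : Measurable fun x => U.indicator ψ (w t x) :=
    hm.comp (measurable_const.prodMk measurable_id)
  have j2 : Integrable (fun x => U.indicator ψ (w t x)) (μ t).toMeasure :=
    Integrable.of_bound hmt.aestronglyMeasurable B (.of_forall fun x => hB _)
  beta_reduce
  rw [← integral_add j1 j2]
  refine integral_congr_ae (.of_forall fun x => ?_)
  beta_reduce
  rw [indicator_of_mem (hw.2 t ht x)]

theorem tendsto_J (hT : 0 < T) (hU : IsCompact U) (hfg : AssumptionFG T f g) (hψ : ContinuousOn ψ U)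
    {w : ℝ → E d → E d} (hw : IsControl T U w)
    (hwc : ∀ᵐ t ∂volume.restrict (Icc 0 T), Continuous (w t)) {μs : ℕ → ℝ → P2 d} {ν : ℝ → P2 d}
    (hμs : ∀ k, IsW2Continuous T (μs k)) (hν : IsW2Continuous T ν) {K : ℝ}
    (hK : ∀ k, ∀ t ∈ Icc 0 T, (μs k t).M2 ≤ K)
    (hlim : ∀ t ∈ Icc 0 T, Tendsto (fun k => W2 (μs k t) (ν t)) atTop (𝓝 0)) :
    Tendsto (fun k => J T f g ψ (μs k) w) atTop (𝓝 (J T f g ψ ν w)) := by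
  obtain ⟨M, hf, hg⟩ := hfg.exists_isCost
  obtain ⟨B, hB⟩ := exists_norm_indicator_le hU hψ
  have hm : Measurable (Function.uncurry fun t x => U.indicator ψ (w t x)) :=
    (measurable_indicator_of_continuousOn hU hψ).comp hw.1
  have hc : ∀ᵐ t ∂volume.restrict (Icc 0 T), Continuous fun x => U.indicator ψ (w t x) := by
    filter_upwards [hwc, ae_restrict_mem measurableSet_Icc] with t ht htI
    exact continuous_indicator_comp hψ ht (hw.2 t htI)
  rw [J_eq hT hU hfg hψ hw hν]
  simp only [J_eq hT hU hfg hψ hw (hμs _)]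
  exact ((hf.tendsto_integral hT hμs hK hlim).add
    (tendsto_integral_bounded hT hm (fun t _ x => hB (w t x)) hc hμs hlim)).add
    (hg.tendsto_integral hf.nonneg (hlim T ⟨hT.le, le_rfl⟩))

end ControlCost

/-! ### Limits of viscous trajectories and lower semicontinuity -/

section Limit

variable {T : ℝ} {U : Set (E d)} {μ₀ : P2 d} {b : ℝ → E d → P2 d → E d}

theorem IsLipControl.isLipField {u : ℝ → E d → E d} (hu : IsLipControl T U u) {R : ℝ}
    (hR : ∀ α ∈ U, ‖α‖ ≤ R) : IsLipField T R u :=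
  ⟨hu.1.1, fun t ht x => hR _ (hu.1.2 t ht x), hu.2⟩

/-- Compactness and identification of the limit: along a subsequence, viscous solutions with weakly
convergent Lipschitz controls converge to the solution of the inviscid equation. -/
theorem exists_subseq_tendsto_solution (hT : 0 < T) (hU : IsCompact U) (hb : AssumptionB T b)
    (hμ₀ : ∃ K : Set (E d), IsCompact K ∧ μ₀.toMeasure Kᶜ = 0) {εs : ℕ → ℝ}
    (hε : Tendsto εs atTop (𝓝 0)) (hε1 : ∀ k, |εs k| ≤ 1) {us : ℕ → ℝ → E d → E d}
    {u : ℝ → E d → E d} (hw : WeakSeq T ((d + 2 : ℝ) / (d + 1)) us u)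
    (hus : ∀ k, IsLipControl T U (us k)) (hu : IsLipControl T U u) {μs : ℕ → ℝ → P2 d}
    {ν : ℝ → P2 d} (hsol : ∀ k, IsWeakSolution T b μ₀ (εs k) (us k) (μs k))
    (hν : IsWeakSolution T b μ₀ 0 u ν) :
    ∃ (φ : ℕ → ℕ) (K : ℝ), StrictMono φ ∧ (∀ k, ∀ t ∈ Icc 0 T, (μs k t).M2 ≤ K) ∧
      ∀ t ∈ Icc 0 T, Tendsto (fun k => W2 (μs (φ k) t) (ν t)) atTop (𝓝 0) := by
  obtain ⟨R, hR⟩ := hU.isBounded.exists_norm_le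
  obtain ⟨M, hM⟩ := hb.growth
  choose v hv hvae hgood using fun k => exists_velocity hT hb hR (hus k).1 (hsol k)
    (P := fun _ => True) (.of_forall fun _ => trivial)
  set a := |M| + |R| with ha
  have ha0 : 0 ≤ a := by positivity
  obtain ⟨K, hK⟩ := exists_uniform_moment hT hμ₀ ha0
  have hgrow : ∀ k, ∀ t, ∀ x, v k t x = 0 ∨ t ∈ Icc 0 T ∧ ‖v k t x‖ ≤ a * (1 + ‖x‖ + (μs k t).M1) :=
    fun k t x => by
      rcases hgood k t with ⟨ht, -, hvt⟩ | h0
      · refine Or.inr ⟨ht, ?_⟩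
        have h1 := hM t ht x (μs k t)
        have h2 := hR _ ((hus k).1.2 t ht x)
        have h3 : 0 ≤ ‖x‖ + (μs k t).M1 := add_nonneg (norm_nonneg x) (μs k t).M1_nonneg
        have h4 : M * (1 + ‖x‖ + (μs k t).M1) ≤ |M| * (1 + ‖x‖ + (μs k t).M1) :=
          mul_le_mul_of_nonneg_right (le_abs_self M) (by linarith)
        have h5 : R ≤ |R| * (1 + ‖x‖ + (μs k t).M1) := by
          nlinarith [le_abs_self R, mul_nonneg (abs_nonneg R) h3]
        rw [hvt, ha, add_mul]
        exact (norm_add_le _ _).trans (by linarith)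
      · exact Or.inl (h0 x)
  have hmom : ∀ k, ∀ t ∈ Icc 0 T,
      (μs k t).M2 ≤ K ∧ ∫⁻ x, ‖x‖ₑ ^ 4 ∂(μs k t).toMeasure ≤ K := fun k =>
    hK (εs k) (v k) (μs k) (hε1 k) (hv k) fun t _ x => by
      rcases hgrow k t x with h0 | ⟨-, h⟩
      · rw [h0, norm_zero]
        have := (μs k t).M1_nonneg
        positivity
      · exact h
  have hA : ∀ k t x, ‖v k t x‖ ≤ a * (2 + K) * (1 + ‖x‖) := fun k t x => by
    have hK0 := K.coe_nonneg
    rcases hgrow k t x with h0 | ⟨ht, h⟩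
    · rw [h0, norm_zero]
      positivity
    · refine h.trans ?_
      rw [mul_assoc]
      refine mul_le_mul_of_nonneg_left ?_ ha0
      have h1 := (μs k t).M1_le
      have h2 := (hmom k t ht).1
      nlinarith [norm_nonneg x, mul_nonneg hK0 (norm_nonneg x)]
  obtain ⟨φ, ν', hφ, hν', hlim⟩ := exists_subseq_tendsto_W2 hT hε1 hv hA
    (fun k t ht => (hmom k t ht).1) (fun k t ht => (hmom k t ht).2)
  refine ⟨φ, K, hφ, fun k t ht => (hmom k t ht).1, fun t ht => ?_⟩
  have hsol' : IsWeakSolution T b μ₀ 0 u ν' :=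
    isWeakSolution_of_tendsto hT hb (hε.comp hφ.tendsto_atTop) (us := fun k => us (φ k))
      (fun r hr F hF => ⟨(hw r hr F hF).1.comp hφ.tendsto_atTop,
        fun v => ((hw r hr F hF).2 v).comp hφ.tendsto_atTop⟩)
      (fun k => (hus (φ k)).isLipField hR) (hu.isLipField hR) (fun k => hsol (φ k)) hν' hlim
      (fun k t ht => (hmom (φ k) t ht).1)
  -- Uniqueness identifies the limit found by compactness with the given solution.
  rw [hν.unique hT hb hU hu hμ₀ hsol' ht]
  exact hlim t ht

/-- A countably generated filter is tested by sequences, and a sequence converges if each of its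
subsequences has a further one that does. Dropping finitely many terms turns `P` from an eventual
property into one of every term. -/
theorem tendsto_of_forall_seq_exists_subseq {l : Filter ℝ} [l.IsCountablyGenerated] {G : ℝ → ℝ}
    {c : ℝ} {P : ℝ → Prop} (hP : ∀ᶠ ε in l, P ε)
    (h : ∀ y : ℕ → ℝ, Tendsto y atTop l → (∀ n, P (y n)) →
      ∃ φ : ℕ → ℕ, Tendsto (fun n => G (y (φ n))) atTop (𝓝 c)) : Tendsto G l (𝓝 c) := by
  refine tendsto_of_seq_tendsto fun x hx => tendsto_of_subseq_tendsto fun ns hns => ?_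
  have hy : Tendsto (fun n => x (ns n)) atTop l := hx.comp hns
  obtain ⟨N, hN⟩ := eventually_atTop.1 (hy.eventually hP)
  obtain ⟨φ, hφ⟩ := h (fun n => x (ns (n + N))) (hy.comp (tendsto_add_atTop_nat N))
    fun n => hN _ (Nat.le_add_left N n)
  exact ⟨fun n => φ n + N, hφ⟩

/-- A single exponent `p = d + 2` is used; being larger than `d`, its conjugate is subcritical for
the Riesz kernel. -/
theorem WeaklyConverges.weakSeq {l : Filter ℝ} {uε : ℝ → ℝ → E d → E d} {u : ℝ → E d → E d}
    (h : WeaklyConverges T (d + 2 : ℝ) l uε u) {y : ℕ → ℝ} (hy : Tendsto y atTop l) :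
    WeakSeq T ((d + 2 : ℝ) / (d + 1)) (fun k => uε (y k)) u := by
  have hpq : (d + 2 : ℝ).HolderConjugate ((d + 2 : ℝ) / (d + 1)) := by
    have hd : (0 : ℝ) ≤ d := Nat.cast_nonneg d
    refine (Real.holderConjugate_iff).2 ⟨by linarith, ?_⟩
    field_simp
    ring
  exact fun r hr F hF => ⟨(h r hr _ hpq F hF).1.comp hy, fun v => ((h r hr _ hpq F hF).2 v).comp hy⟩

variable {f : ℝ → E d → P2 d → ℝ} {g : E d → P2 d → ℝ} {ψ : E d → ℝ}

theorem AssumptionPsi.continuousOn {lam : ℝ} (h : AssumptionPsi U ψ lam) : ContinuousOn ψ U := by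
  obtain ⟨ψ', -, h2, -⟩ := h
  exact fun α hα => (h2 α hα).continuousWithinAt

/-- Convexity of the control cost gives an affine lower bound for the cost. -/
theorem J_add_le (hT : 0 < T) (hU : IsCompact U) (hfg : AssumptionFG T f g) (hψ : ContinuousOn ψ U)
    {ψ' : E d → E d} (hψ' : ContinuousOn ψ' U)
    (hconv : ∀ α ∈ U, ∀ α' ∈ U, ψ α + ⟪ψ' α, α' - α⟫_ℝ ≤ ψ α') {u w : ℝ → E d → E d}
    (hu : IsControl T U u) (hw : IsControl T U w) {μ : ℝ → P2 d} (hμ : IsW2Continuous T μ) :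
    J T f g ψ μ u
      + ((∫ t in (0 : ℝ)..T, ∫ x, ⟪U.indicator ψ' (u t x), w t x⟫_ℝ ∂(μ t).toMeasure)
        - ∫ t in (0 : ℝ)..T, ∫ x, ⟪U.indicator ψ' (u t x), u t x⟫_ℝ ∂(μ t).toMeasure)
      ≤ J T f g ψ μ w := by
  obtain ⟨R, hR⟩ := hU.isBounded.exists_norm_le
  obtain ⟨B, hB⟩ := exists_norm_indicator_le hU hψ
  obtain ⟨B', hB'⟩ := exists_norm_indicator_le hU hψ'
  have hΘ : Measurable (Function.uncurry fun t x => U.indicator ψ' (u t x)) :=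
    (measurable_indicator_of_continuousOn hU hψ').comp hu.1
  have hm : ∀ {w : ℝ → E d → E d}, IsControl T U w →
      Measurable (Function.uncurry fun t x => U.indicator ψ (w t x)) := fun hw =>
    (measurable_indicator_of_continuousOn hU hψ).comp hw.1
  have hi : ∀ {w : ℝ → E d → E d}, IsControl T U w → IntervalIntegrable
      (fun t => ∫ x, U.indicator ψ (w t x) ∂(μ t).toMeasure) volume 0 T := fun {w} hw =>
    intervalIntegrable_integral_bounded hT (hm hw) (fun t _ x => hB (w t x)) hμ
  have hj : ∀ {w : ℝ → E d → E d}, IsControl T U w → IntervalIntegrable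
      (fun t => ∫ x, ⟪U.indicator ψ' (u t x), w t x⟫_ℝ ∂(μ t).toMeasure) volume 0 T := fun {w} hw =>
    intervalIntegrable_integral_inner hT.le hμ (F := fun t x => U.indicator ψ' (u t x)) (D := w) hΘ
      hw.1 (fun t x => hB' _) (fun t ht x => hR _ (hw.2 t ht x))
  rw [J_eq hT hU hfg hψ hu hμ, J_eq hT hU hfg hψ hw hμ]
  have key : (∫ t in (0 : ℝ)..T, ∫ x, U.indicator ψ (u t x) ∂(μ t).toMeasure)
      + ((∫ t in (0 : ℝ)..T, ∫ x, ⟪U.indicator ψ' (u t x), w t x⟫_ℝ ∂(μ t).toMeasure)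
        - ∫ t in (0 : ℝ)..T, ∫ x, ⟪U.indicator ψ' (u t x), u t x⟫_ℝ ∂(μ t).toMeasure)
      ≤ ∫ t in (0 : ℝ)..T, ∫ x, U.indicator ψ (w t x) ∂(μ t).toMeasure := by
    rw [← intervalIntegral.integral_sub (hj hw) (hj hu),
      ← intervalIntegral.integral_add (hi hu) ((hj hw).sub (hj hu))]
    refine intervalIntegral.integral_mono_on hT.le ((hi hu).add ((hj hw).sub (hj hu))) (hi hw)
      fun t ht => ?_
    have hslice : ∀ {G : Type} [MeasurableSpace G] {χ : ℝ → E d → G},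
        Measurable (Function.uncurry χ) → Measurable (χ t) := fun hχ =>
      hχ.comp (measurable_const.prodMk measurable_id)
    have k1 : ∀ {w : ℝ → E d → E d}, IsControl T U w →
        Integrable (fun x => U.indicator ψ (w t x)) (μ t).toMeasure := fun {w} hw =>
      Integrable.of_bound (hslice (hm hw)).aestronglyMeasurable B (.of_forall fun x => hB _)
    have k2 : ∀ {w : ℝ → E d → E d}, IsControl T U w →
        Integrable (fun x => ⟪U.indicator ψ' (u t x), w t x⟫_ℝ) (μ t).toMeasure := fun {w} hw =>
      Integrable.of_bound ((hslice hΘ).inner (hslice hw.1)).aestronglyMeasurable (B' * R)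
        (.of_forall fun x => norm_inner_le_of_bounds (hB' _) (hR _ (hw.2 t ht x)))
    have k3 : Integrable (fun x => ⟪U.indicator ψ' (u t x), w t x⟫_ℝ
        - ⟪U.indicator ψ' (u t x), u t x⟫_ℝ) (μ t).toMeasure := (k2 hw).sub (k2 hu)
    rw [← integral_sub (k2 hw) (k2 hu), ← integral_add (k1 hu) k3]
    refine integral_mono ((k1 hu).add k3) (k1 hw) fun x => ?_
    have hux := hu.2 t ht x
    have hwx := hw.2 t ht x
    have := hconv _ hux _ hwx
    simp only [indicator_of_mem hux, indicator_of_mem hwx]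
    rwa [inner_sub_right] at this
  linarith

end Limit

end VanishingViscosity

/-- The limit `ε → 0⁺` is taken along any countably generated filter `l ≤ 𝓝[>] 0`: both the whole
family (`l = 𝓝[>] 0`) and any vanishing sequence of viscosities are covered. -/
theorem mainTheorem6 {d : ℕ} (T : ℝ) (hT : 0 < T)
    (U : Set (E d)) (hUc : IsCompact U) (hUconv : Convex ℝ U)
    (b : ℝ → E d → P2 d → E d) (hb : AssumptionB T b)
    (f : ℝ → E d → P2 d → ℝ) (g : E d → P2 d → ℝ) (hfg : AssumptionFG T f g)
    (ψ : E d → ℝ) (lam : ℝ) (hlam : 0 < lam) (hψ : AssumptionPsi U ψ lam)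
    (μ₀ : P2 d) (hμ₀ : ∃ K : Set (E d), IsCompact K ∧ μ₀.toMeasure Kᶜ = 0)
    (l : Filter ℝ) (hl : l ≤ 𝓝[>] 0) (hlc : l.IsCountablyGenerated)
    -- optimal pairs `(μ^ε, u^ε)` of the viscous problems, with `u^ε ∈ L^∞((0,T); Lip(ℝ^d, U))`
    (με : ℝ → ℝ → P2 d) (uε : ℝ → ℝ → E d → E d)
    (hopt : ∀ᶠ ε in l, IsOptimalPair T U b f g ψ μ₀ ε (με ε) (uε ε))
    (huε : ∀ᶠ ε in l, IsLipControl T U (uε ε))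
    -- a weak limit `u` of the optimal controls, and its trajectory `μ`
    (u : ℝ → E d → E d) (hu : IsLipControl T U u)
    (hconv : ∀ p : ℝ, 1 < p → WeaklyConverges T p l uε u)
    (μ : ℝ → P2 d) (hμ : IsWeakSolution T b μ₀ 0 u μ) :
    -- fixed control, along the optimal trajectories
    (∀ w : ℝ → E d → E d, IsControl T U w →
      (∀ᵐ t ∂volume.restrict (Icc 0 T), Continuous (w t)) →
      Tendsto (fun ε => J T f g ψ (με ε) w) l (𝓝 (J T f g ψ μ w))) ∧
    -- fixed control, along its own trajectories
    (∀ (w : ℝ → E d → E d) (νε : ℝ → ℝ → P2 d) (ν : ℝ → P2 d), IsLipControl T U w →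
      (∀ᶠ ε in l, IsWeakSolution T b μ₀ ε w (νε ε)) → IsWeakSolution T b μ₀ 0 w ν →
      Tendsto (fun ε => J T f g ψ (νε ε) w) l (𝓝 (J T f g ψ ν w))) ∧
    -- lower semicontinuity along the optimal sequence
    ((J T f g ψ μ u : ℝ) : EReal)
      ≤ liminf (fun ε => ((J T f g ψ (με ε) (uε ε) : ℝ) : EReal)) l := by
  have hψc := hψ.continuousOn
  obtain ⟨R, hR⟩ := hUc.isBounded.exists_norm_le
  have hl0 : l ≤ 𝓝 (0 : ℝ) := hl.trans nhdsWithin_le_nhds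
  have hsmall : ∀ᶠ ε in l, |ε| ≤ 1 := by
    have : Tendsto (fun ε : ℝ => |ε|) (𝓝 0) (𝓝 0) := by simpa using continuous_abs.tendsto (0 : ℝ)
    exact hl0 (this.eventually (eventually_le_nhds one_pos))
  have hgood := hsmall.and (hopt.and huε)
  have hlipc : ∀ {w : ℝ → E d → E d}, IsLipControl T U w →
      ∀ᵐ t ∂volume.restrict (Icc 0 T), Continuous (w t) := fun hw => by
    obtain ⟨C, hC⟩ := hw.2
    filter_upwards [hC] with t ht using ht.continuous
  have hweak := hconv (d + 2) (by linarith [Nat.cast_nonneg (α := ℝ) d])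
  have hfixed : ∀ w : ℝ → E d → E d, IsControl T U w →
      (∀ᵐ t ∂volume.restrict (Icc 0 T), Continuous (w t)) →
      Tendsto (fun ε => J T f g ψ (με ε) w) l (𝓝 (J T f g ψ μ w)) := fun w hw hwc => by
    refine tendsto_of_forall_seq_exists_subseq hgood fun y hy hyP => ?_
    obtain ⟨φ, K, -, hK, hlim⟩ := exists_subseq_tendsto_solution hT hUc hb hμ₀ (hy.mono_right hl0)
      (fun k => (hyP k).1) (hweak.weakSeq hy) (fun k => (hyP k).2.2) hu
      (fun k => (hyP k).2.1.2.1) hμ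
    exact ⟨φ, tendsto_J hT hUc hfg hψc hw hwc (fun k => (hyP (φ k)).2.1.2.1.1) hμ.1
      (fun k => hK (φ k)) hlim⟩
  refine ⟨hfixed, fun w νε ν hw hνε hν => ?_, ?_⟩
  · refine tendsto_of_forall_seq_exists_subseq (hsmall.and hνε) fun y hy hyP => ?_
    obtain ⟨φ, K, -, hK, hlim⟩ := exists_subseq_tendsto_solution hT hUc hb hμ₀ (hy.mono_right hl0)
      (fun k => (hyP k).1) (WeakSeq.const T _ w) (fun _ => hw) hw (fun k => (hyP k).2) hν
    exact ⟨φ, tendsto_J hT hUc hfg hψc hw.1 (hlipc hw) (fun k => (hyP (φ k)).2.1) hν.1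
      (fun k => hK (φ k)) hlim⟩
  · obtain ⟨ψ', hψ'c, -, hψ'⟩ := hψ
    obtain ⟨B, hB⟩ := exists_norm_indicator_le hUc hψ'c
    have hΘc : ∀ᵐ t ∂volume.restrict (Icc 0 T), Continuous fun x => U.indicator ψ' (u t x) := by
      filter_upwards [hlipc hu, ae_restrict_mem measurableSet_Icc] with t ht htI
      exact continuous_indicator_comp hψ'c ht (hu.1.2 t htI)
    have hΘm : Measurable (Function.uncurry fun t x => U.indicator ψ' (u t x)) :=
      (measurable_indicator_of_continuousOn hUc hψ'c).comp hu.1.1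
    -- The replacement principle with `Θ = ∇ψ(u)`, which is bounded and, for almost every time,
    -- continuous in space since the limit control `u` is Lipschitz.
    have hcross : Tendsto (fun ε =>
        (∫ t in (0 : ℝ)..T, ∫ x, ⟪U.indicator ψ' (u t x), uε ε t x⟫_ℝ ∂(με ε t).toMeasure)
        - ∫ t in (0 : ℝ)..T, ∫ x, ⟪U.indicator ψ' (u t x), u t x⟫_ℝ ∂(με ε t).toMeasure) l
        (𝓝 0) := by
      refine tendsto_of_forall_seq_exists_subseq hgood fun y hy hyP => ?_
      obtain ⟨φ, K, hφ, hK, hlim⟩ := exists_subseq_tendsto_solution hT hUc hb hμ₀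
        (hy.mono_right hl0) (fun k => (hyP k).1) (hweak.weakSeq hy) (fun k => (hyP k).2.2) hu
        (fun k => (hyP k).2.1.2.1) hμ
      exact ⟨φ, tendsto_integral_inner_sub hT (hweak.weakSeq (hy.comp hφ.tendsto_atTop))
        (fun k => (hyP (φ k)).2.2.isLipField hR) (hu.isLipField hR)
        (fun k => (hyP (φ k)).2.1.2.1.1) hμ.1 hlim (fun k => hK (φ k))
        (Θ := fun t x => U.indicator ψ' (u t x)) hΘm (fun t x => hB _) hΘc⟩
    have hlower := (hfixed u hu.1 (hlipc hu)).add hcross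
    rw [add_zero] at hlower
    -- Along the trivial filter the lower limit is `⊤`. Otherwise the affine lower bound converges
    -- to the cost of `(μ, u)`, and its limit equals its lower limit.
    rcases l.eq_or_neBot with rfl | hne
    · simp
    rw [← ((continuous_coe_real_ereal.tendsto _).comp hlower).liminf_eq]
    refine liminf_le_liminf ?_
    filter_upwards [hgood] with ε hε
    refine EReal.coe_le_coe_iff.2 (J_add_le hT hUc hfg hψc hψ'c (fun α hα α' hα' => ?_) hu.1
      hε.2.2.1 hε.2.1.2.1.1)
    have h1 := hψ' α hα α' hα'
    have h2 : 0 ≤ lam * ‖α' - α‖ ^ 2 := by positivity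
    linarith
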